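/- **Weighted Vertex Cover (WVC).** An instance consists of a finite simple graph $G=(V,E)$, vertex weights $w:V\to\mathbb{R}$ with $w(v)\ge 1$ for all $v$, and a real number $W\ge 1$. The task is to return a vertex cover $U\subseteq V$ with $\sum_{v\in U}w(v)\le W$ if one exists, and NIL otherwise. **$k$-WVC.** Given in addition $k\in\mathbb{N}$, the task is: if $G$ has a vertex cover of weight at most $W$ and size at most $k$, return a vertex cover of weight at most $W$ (of any size); otherwise return either NIL or a vertex cover of weight at most $W$. Let $s$ be the minimum size of a vertex cover of weight at most $W$ if one exists, and $s=\min\{W,|V|\}$ otherwise. The notation $O^*(f)$ hides a constant factor and a factor polynomial in the input size, which is $|V|+1$ for WVC and $|V|+\ell(k)+1$ for $k$-WVC, with $\ell(k)$ the length of $k$ in binary. Algorithms are programs of a random access machine that computes with natural numbers at logarithmic cost, and that can add, subtract and compare the real numbers $1$, $W$, $w(v)$ of the input; every real number that arises is an integer linear combination of these, and time and space are charged for the bit lengths of its coefficients. **Theorem.** There is an algorithm that solves $k$-WVC in $O^*(1.381^k)$ time and polynomial space. There is an algorithm that solves WVC in $O^*(1.381^s)$ time and polynomial space. -/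

import Mathlib

noncomputable section

namespace WVC

/-! ### Weighted Vertex Cover -/

/-- An instance of Weighted Vertex Cover: a finite simple graph on the vertices `0, …, n - 1`,
real vertex weights and a real bound `W`, where `W` and all weights are at least `1`. -/
structure Instance where
  n : ℕ
  G : SimpleGraph (Fin n)
  w : Fin n → ℝ
  W : ℝ
  one_le_w : ∀ v, 1 ≤ w v
  one_le_W : 1 ≤ W

/-- `U` is a vertex cover of weight at most `W`. -/
def Instance.IsSolution (I : Instance) (U : Finset (Fin I.n)) : Prop :=
  I.G.IsVertexCover (U : Set (Fin I.n)) ∧ ∑ v ∈ U, I.w v ≤ I.W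

/-- The answer `ans` (where `none` stands for NIL) is correct for WVC: it is a vertex cover of
weight at most `W` if there is one, and NIL otherwise. -/
def Instance.IsAnswer (I : Instance) : Option (Finset (Fin I.n)) → Prop
  | some U => I.IsSolution U
  | none => ¬ ∃ U, I.IsSolution U

/-- The answer `ans` (where `none` stands for NIL) is correct for `k`-WVC: every returned set is a
vertex cover of weight at most `W` (of any size), and NIL is allowed only if no vertex cover has
both weight at most `W` and size at most `k`. -/
def Instance.IsAnswerK (I : Instance) (k : ℕ) : Option (Finset (Fin I.n)) → Prop
  | some U => I.IsSolution U
  | none => ¬ ∃ U, I.IsSolution U ∧ U.card ≤ k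

open Classical in
/-- The parameter `s`: the minimum size of a vertex cover of weight at most `W` if there is one,
and `min {W, |V|}` otherwise. -/
def Instance.s (I : Instance) : ℝ :=
  if ∃ U, I.IsSolution U then
    ((sInf {m : ℕ | ∃ U, I.IsSolution U ∧ U.card = m} : ℕ) : ℝ)
  else min I.W (I.n : ℝ)

/-! ### The machine model

Programs of a structured random access machine with logarithmic cost. The memory consists of
arrays `0, 1, 2, …` of natural numbers and arrays `0, 1, 2, …` of real numbers. A program names
arrays by constants, so that it uses finitely many of them; a position in an array is computed.
Real numbers can only be added, subtracted and compared.

As only sums and differences of the real numbers of the input arise, a real cell is represented by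
the integer coefficients of its content as a linear combination of the real inputs. Thus the
machine's storage, and not only its number of cells, can be measured. -/

/-- A formal integer combination of the real inputs number `0, 1, 2, …`. -/
abbrev Form := ℕ →₀ ℤ

/-- The real number that a form stands for, if the real inputs are `x 0, x 1, …`. -/
def Form.val (x : ℕ → ℝ) (f : Form) : ℝ := f.sum fun i c => (c : ℝ) * x i

/-- The length of a natural number in binary, plus one. -/
def natBits (a : ℕ) : ℕ := Nat.size a + 1

/-- The length of a form: the number of bits of its indices and its coefficients (with sign). -/
def formBits (f : Form) : ℕ := (f.sum fun i c => natBits i + natBits c.natAbs + 1) + 1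

/-- Memory contents: `nat (a, i)` and `real (a, i)` are the entries at position `i` of the
array `a` of natural numbers and of the array `a` of real numbers. -/
structure State where
  nat : (ℕ × ℕ) →₀ ℕ
  real : (ℕ × ℕ) →₀ Form

/-- The space that is in use: the number of bits of the addresses and contents of all cells that
are not zero. -/
def State.size (σ : State) : ℕ :=
  (σ.nat.sum fun p v => natBits p.1 + natBits p.2 + natBits v) +
  (σ.real.sum fun p f => natBits p.1 + natBits p.2 + formBits f)

/-- Expressions for natural numbers; `cell a e` reads the array `a` at position `e`. -/
inductive NExp where
  | const (c : ℕ)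
  | cell (a : ℕ) (e : NExp)
  | add (e₁ e₂ : NExp)
  | sub (e₁ e₂ : NExp)
  | mul (e₁ e₂ : NExp)

/-- The value of an expression (`sub` is truncated subtraction). -/
def NExp.val (σ : State) : NExp → ℕ
  | const c => c
  | cell a e => σ.nat (a, e.val σ)
  | add e₁ e₂ => e₁.val σ + e₂.val σ
  | sub e₁ e₂ => e₁.val σ - e₂.val σ
  | mul e₁ e₂ => e₁.val σ * e₂.val σ

/-- The cost of evaluating an expression: the sum of the bit lengths of all values occurring. -/
def NExp.cost (σ : State) : NExp → ℕ
  | const c => natBits c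
  | cell a e => e.cost σ + natBits (σ.nat (a, e.val σ))
  | add e₁ e₂ => e₁.cost σ + e₂.cost σ + natBits (e₁.val σ + e₂.val σ)
  | sub e₁ e₂ => e₁.cost σ + e₂.cost σ + natBits (e₁.val σ - e₂.val σ)
  | mul e₁ e₂ => e₁.cost σ + e₂.cost σ + natBits (e₁.val σ * e₂.val σ)

/-- Expressions for real numbers; `cell a e` reads the real array `a` at position `e`. -/
inductive RExp where
  | zero
  | cell (a : ℕ) (e : NExp)
  | add (e₁ e₂ : RExp)
  | sub (e₁ e₂ : RExp)

/-- The value of an expression for a real number, as a form. -/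
def RExp.val (σ : State) : RExp → Form
  | zero => 0
  | cell a e => σ.real (a, e.val σ)
  | add e₁ e₂ => e₁.val σ + e₂.val σ
  | sub e₁ e₂ => e₁.val σ - e₂.val σ

/-- The cost of evaluating an expression for a real number. -/
def RExp.cost (σ : State) : RExp → ℕ
  | zero => 1
  | cell a e => e.cost σ + formBits (σ.real (a, e.val σ))
  | add e₁ e₂ => e₁.cost σ + e₂.cost σ + formBits (e₁.val σ + e₂.val σ)
  | sub e₁ e₂ => e₁.cost σ + e₂.cost σ + formBits (e₁.val σ - e₂.val σ)

/-- Tests: comparisons of natural numbers and of real numbers, and Boolean combinations. -/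
inductive Test where
  | nle (e₁ e₂ : NExp)
  | rle (e₁ e₂ : RExp)
  | and (b₁ b₂ : Test)
  | not (b : Test)

/-- The outcome of a test, where `x` lists the real inputs. -/
def Test.Holds (x : ℕ → ℝ) (σ : State) : Test → Prop
  | nle e₁ e₂ => e₁.val σ ≤ e₂.val σ
  | rle e₁ e₂ => (e₁.val σ).val x ≤ (e₂.val σ).val x
  | and b₁ b₂ => b₁.Holds x σ ∧ b₂.Holds x σ
  | not b => ¬ b.Holds x σ

/-- The cost of a test. -/
def Test.cost (σ : State) : Test → ℕ
  | nle e₁ e₂ => e₁.cost σ + e₂.cost σ + 1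
  | rle e₁ e₂ => e₁.cost σ + e₂.cost σ + 1
  | and b₁ b₂ => b₁.cost σ + b₂.cost σ + 1
  | not b => b.cost σ + 1

/-- Programs; `nset a i e` and `rset a i e` assign `e` to position `i` of the array `a`. -/
inductive Prog where
  | skip
  | nset (a : ℕ) (i : NExp) (e : NExp)
  | rset (a : ℕ) (i : NExp) (e : RExp)
  | seq (p q : Prog)
  | ite (b : Test) (p q : Prog)
  | while (b : Test) (p : Prog)

/-- The memory after an assignment to a cell of natural numbers. -/
def State.setNat (σ : State) (a i v : ℕ) : State := ⟨σ.nat.update (a, i) v, σ.real⟩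

/-- The memory after an assignment to a cell of real numbers. -/
def State.setReal (σ : State) (a i : ℕ) (f : Form) : State := ⟨σ.nat, σ.real.update (a, i) f⟩

/-- `Run x p σ σ' t m`: on real inputs `x` and with initial memory `σ`, the program `p` halts with
memory `σ'`, after `t` units of time, and the largest space in use during the run is `m`. -/
inductive Run (x : ℕ → ℝ) : Prog → State → State → ℕ → ℕ → Prop
  | skip (σ : State) : Run x .skip σ σ 1 σ.size
  | nset (σ : State) (a : ℕ) (i e : NExp) :
      Run x (.nset a i e) σ (σ.setNat a (i.val σ) (e.val σ)) (i.cost σ + e.cost σ + 1)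
        (max σ.size (σ.setNat a (i.val σ) (e.val σ)).size)
  | rset (σ : State) (a : ℕ) (i : NExp) (e : RExp) :
      Run x (.rset a i e) σ (σ.setReal a (i.val σ) (e.val σ)) (i.cost σ + e.cost σ + 1)
        (max σ.size (σ.setReal a (i.val σ) (e.val σ)).size)
  | seq {p q : Prog} {σ₁ σ₂ σ₃ : State} {t₁ t₂ m₁ m₂ : ℕ} :
      Run x p σ₁ σ₂ t₁ m₁ → Run x q σ₂ σ₃ t₂ m₂ →
      Run x (.seq p q) σ₁ σ₃ (t₁ + t₂) (max m₁ m₂)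
  | ite_true {b : Test} {p q : Prog} {σ σ' : State} {t m : ℕ} :
      b.Holds x σ → Run x p σ σ' t m → Run x (.ite b p q) σ σ' (b.cost σ + t) m
  | ite_false {b : Test} {p q : Prog} {σ σ' : State} {t m : ℕ} :
      ¬ b.Holds x σ → Run x q σ σ' t m → Run x (.ite b p q) σ σ' (b.cost σ + t) m
  | while_true {b : Test} {p : Prog} {σ₁ σ₂ σ₃ : State} {t₁ t₂ m₁ m₂ : ℕ} :
      b.Holds x σ₁ → Run x p σ₁ σ₂ t₁ m₁ → Run x (.while b p) σ₂ σ₃ t₂ m₂ →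
      Run x (.while b p) σ₁ σ₃ (b.cost σ₁ + t₁ + t₂) (max m₁ m₂)
  | while_false {b : Test} {p : Prog} {σ : State} :
      ¬ b.Holds x σ → Run x (.while b p) σ σ (b.cost σ) σ.size

/-- A program, a real input and an initial memory determine the run. -/
theorem Run.unique {x : ℕ → ℝ} {p : Prog} {σ σ' σ'' : State} {t t' m m' : ℕ}
    (h : Run x p σ σ' t m) (h' : Run x p σ σ'' t' m') : σ' = σ'' ∧ t = t' ∧ m = m' := by
  induction h generalizing σ'' t' m' with
  | skip | nset | rset => cases h'; exact ⟨rfl, rfl, rfl⟩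
  | seq _ _ ih₁ ih₂ =>
    cases h' with
    | seq a b => obtain ⟨rfl, rfl, rfl⟩ := ih₁ a; obtain ⟨rfl, rfl, rfl⟩ := ih₂ b; simp
  | ite_true hb _ ih =>
    cases h' with
    | ite_true _ a => obtain ⟨rfl, rfl, rfl⟩ := ih a; simp
    | ite_false hb' _ => exact absurd hb hb'
  | ite_false hb _ ih =>
    cases h' with
    | ite_true hb' _ => exact absurd hb' hb
    | ite_false _ a => obtain ⟨rfl, rfl, rfl⟩ := ih a; simp
  | while_true hb _ _ ih₁ ih₂ =>
    cases h' with
    | while_true _ a b => obtain ⟨rfl, rfl, rfl⟩ := ih₁ a; obtain ⟨rfl, rfl, rfl⟩ := ih₂ b; simp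
    | while_false hb' => exact absurd hb hb'
  | while_false hb =>
    cases h' with
    | while_true hb' _ _ => exact absurd hb' hb
    | while_false _ => exact ⟨rfl, rfl, rfl⟩

/-! ### Input and output -/

/-- The real inputs: `1`, then `W`, then the weights of the vertices. -/
def Instance.reals (I : Instance) : ℕ → ℝ
  | 0 => 1
  | 1 => I.W
  | i + 2 => if h : i < I.n then I.w ⟨i, h⟩ else 0

open Classical in
/-- The initial memory for the instance `I` with size parameter `k`. Array `0` of natural numbers
holds `n` and `k`, and array `1` holds the adjacency matrix, row by row. Array `0` of real numbers
holds `1` and `W`, and array `1` holds the weights. All other cells are zero. -/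
def Instance.input (I : Instance) (k : ℕ) : State where
  nat := Finsupp.single (0, 0) I.n + Finsupp.single (0, 1) k +
    ∑ i : Fin I.n, ∑ j : Fin I.n,
      Finsupp.single (1, (i : ℕ) * I.n + (j : ℕ)) (if I.G.Adj i j then 1 else 0)
  real := Finsupp.single (0, 0) (Finsupp.single 0 1 : Form) +
    Finsupp.single (0, 1) (Finsupp.single 1 1 : Form) +
    ∑ i : Fin I.n, Finsupp.single (1, (i : ℕ)) (Finsupp.single ((i : ℕ) + 2) 1 : Form)

/-- The answer that is read off the final memory: NIL if cell `0` of array `2` of natural numbers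
is zero, and otherwise the set whose indicator function is in array `3`. -/
def State.output (σ : State) (n : ℕ) : Option (Finset (Fin n)) :=
  if σ.nat (2, 0) = 0 then none
  else some (Finset.univ.filter fun v : Fin n => σ.nat (3, (v : ℕ)) ≠ 0)

end WVC

end

/-!
# Weighted vertex cover by branching and elimination

The search assigns to each vertex the value `1` (in the cover) or `0`. Its size is controlled by a
potential: a search tree from a configuration `c` has at most `base ^ pot` leaves, where
`base ^ 78 = 1.381` (`Ok.length_leaves_le`).

*First phase.* As long as some vertex has degree at least four, branch on it: it is in the cover, or
all its neighbours are. The number of vertices that may still be chosen drops by `1` or by `4`, and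
`1 / 1.381 + 1 / 1.381 ^ 4 ≤ 1` (`Cfg.IsFix.pot_mode_zero`). When the maximum degree is three, `k'`
further vertices cover at most `3 * k'` edges, so there is no solution if more edges remain
(`Cfg.Good.mass_le`). From here on, the number of edges bounds the search, and the size of the cover
may be forgotten.

*Second phase.* Costs are generalized to a table for each pair of vertices. A vertex with at most two
neighbours `a`, `b` can then be eliminated: its best value is a function of the values of `a` and
`b`, and the resulting cost goes into the table for `a` and `b`. This may create an edge between `a`
and `b`, a soft one, which does not force one of its ends to have the value `1`. In the same way,
two adjacent vertices of degree three that have the same two other neighbours are eliminated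
together (`Cfg.CanElim`, `Cfg.IsElim.cost_eq`, `Cfg.IsElim.cost_le`). When nothing can be eliminated,
the graph is cubic, and adjacent vertices have at most one common neighbour (`Cfg.Inv.cubic`). Then
branch on a vertex, on one with a hard edge if there is any. The potential is
`36 * (vertices of degree three) + mass`, where the mass is twice the number of edges with soft edges
counted double, and `42 * (vertices of degree three)` if no edge is hard. It does not increase in an
elimination (`Cfg.IsElim.pot_le`), and it drops by `150` and `190`, or by `168` twice, in a branching
(`Cfg.IsFix.pot_mode_one`). At the start of the second phase it is at most `13` times the mass, hence
at most `78 * k'` (`Cfg.pot_set_mode`).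

Edges that are not covered cost `W + 1`, so values of cost at most `W` are those of solutions. At a
leaf, the values of the eliminated vertices are recovered from the records of the eliminations, and
the result is verified, so that an answer is correct no matter how it was found. If there is a
solution of size at most `k`, some leaf leads to one (`Ok.exists_leaf`).

*The machine.* Everything but the outermost loops is a program with counting loops only, whose
assignments are guarded by a bound for values and positions. Such programs run in polynomial time and
space (`LP.exec_run`). The search needs no recursion: a leaf is given by a string of binary digits,
each round clears the memory and replays the path to the current leaf, and then moves on to the
next string (`round_spec`, `rounds_run`). Clearing the memory also resets the lengths of the
coefficients, which therefore grow only along a single path.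

For `k`-WVC this is run once, with `min k n` for `k` (`boundedProg_run`). For WVC it is run with
`k = 0, 1, …` as long as no solution has been found, `k ≤ n` and `k ≤ W`; weights are at least `1`,
so a cover of weight at most `W` has size at most `W`, and every round has `k ≤ s`
(`deepening_run`, `wvcProg_run`).
-/


noncomputable section

namespace WVC

/-! ### Loop programs -/

/-- The arrays of natural numbers that an expression reads. -/
def NExp.rd : NExp → List ℕ
  | const _ => []
  | cell a e => a :: e.rd
  | add e₁ e₂ => e₁.rd ++ e₂.rd
  | sub e₁ e₂ => e₁.rd ++ e₂.rd
  | mul e₁ e₂ => e₁.rd ++ e₂.rd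

/-- The arrays of natural numbers that an expression for a real number reads. -/
def RExp.rd : RExp → List ℕ
  | zero => []
  | cell _ e => e.rd
  | add e₁ e₂ => e₁.rd ++ e₂.rd
  | sub e₁ e₂ => e₁.rd ++ e₂.rd

/-- The arrays of natural numbers that a test reads. -/
def Test.rd : Test → List ℕ
  | nle e₁ e₂ => e₁.rd ++ e₂.rd
  | rle e₁ e₂ => e₁.rd ++ e₂.rd
  | and b₁ b₂ => b₁.rd ++ b₂.rd
  | not b => b.rd

/-- Programs whose only loops are counting loops: `loop c e p` runs `p` for the values
`0, …, e - 1` of the counter, which is cell `0` of the array `c`. -/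
inductive LP where
  | skip
  | nset (a : ℕ) (i e : NExp)
  | rset (a : ℕ) (i : NExp) (e : RExp)
  | seq (p q : LP)
  | ite (b : Test) (p q : LP)
  | loop (c : ℕ) (e : NExp) (p : LP)

namespace LP

/-- Cell `0` of array `4` holds the bound that all values and positions have to respect. -/
abbrev bnd : NExp := .cell 4 (.const 0)

/-- A loop program as a program of the machine. Assignments are guarded: one that would exceed the
bound in cell `0` of array `4` is skipped, so that values and positions stay bounded. -/
def compile : LP → Prog
  | skip => .skip
  | nset a i e => .ite (.and (.nle i bnd) (.nle e bnd)) (.nset a i e) .skip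
  | rset a i e => .ite (.nle i bnd) (.rset a i e) .skip
  | seq p q => .seq p.compile q.compile
  | ite b p q => .ite b p.compile q.compile
  | loop c e p => .seq (.nset c (.const 0) (.const 0))
      (.while (.and (.nle (.add (.cell c (.const 0)) (.const 1)) e) (.nle (.cell c (.const 0)) bnd))
        (.seq p.compile (.nset c (.const 0) (.add (.cell c (.const 0)) (.const 1)))))

/-- Adds one to cell `0` of the array `c`. -/
def incr (c : ℕ) (σ : State) : State := σ.setNat c 0 (σ.nat (c, 0) + 1)

open Classical in
/-- The memory after the run of a loop program. -/
def exec (x : ℕ → ℝ) : LP → State → State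
  | skip, σ => σ
  | nset a i e, σ =>
      if i.val σ ≤ σ.nat (4, 0) ∧ e.val σ ≤ σ.nat (4, 0) then σ.setNat a (i.val σ) (e.val σ) else σ
  | rset a i e, σ =>
      if i.val σ ≤ σ.nat (4, 0) then σ.setReal a (i.val σ) (e.val σ) else σ
  | seq p q, σ => exec x q (exec x p σ)
  | ite b p q, σ => if b.Holds x σ then exec x p σ else exec x q σ
  | loop c e p, σ =>
      (fun τ => incr c (exec x p τ))^[min (e.val σ) (σ.nat (4, 0) + 1)] (σ.setNat c 0 0)

/-- The arrays of natural numbers that a loop program may change. -/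
def wr : LP → List ℕ
  | skip => []
  | nset a _ _ => [a]
  | rset _ _ _ => []
  | seq p q => p.wr ++ q.wr
  | ite _ p q => p.wr ++ q.wr
  | loop c _ p => c :: p.wr

/-- The arrays of real numbers that a loop program may change. -/
def wrR : LP → List ℕ
  | skip => []
  | nset _ _ _ => []
  | rset a _ _ => [a]
  | seq p q => p.wrR ++ q.wrR
  | ite _ p q => p.wrR ++ q.wrR
  | loop _ _ p => p.wrR

/-- The arrays of natural numbers that occur in a loop program. -/
def use : LP → List ℕ
  | skip => []
  | nset a i e => a :: (i.rd ++ e.rd)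
  | rset _ i e => i.rd ++ e.rd
  | seq p q => p.use ++ q.use
  | ite b p q => b.rd ++ (p.use ++ q.use)
  | loop c e p => c :: (e.rd ++ p.use)

/-- Well-formedness: loops do not change their counters and bounds, the bound in array `4` and the
input arrays `0` and `1` are never changed, and only certain arrays are changed. -/
def wf : LP → Bool
  | skip => true
  | nset a _ _ => decide (a ≤ 60) && decide (a ≠ 4) && decide (2 ≤ a)
  | rset a _ _ => decide (2 ≤ a) && decide (a ≤ 4)
  | seq p q => p.wf && q.wf
  | ite _ p q => p.wf && q.wf
  | loop c e p => decide (c ≤ 60) && decide (c ≠ 4) && decide (2 ≤ c) && decide (c ∉ p.wr) &&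
      e.rd.all (fun a => decide (a ∉ c :: p.wr)) && p.wf

end LP

/-! ### Reading memory after assignments -/

theorem State.setNat_nat (σ : State) (a i v b j : ℕ) :
    (σ.setNat a i v).nat (b, j) = if b = a ∧ j = i then v else σ.nat (b, j) := by
  classical
  simp [State.setNat, Finsupp.update_apply, Prod.ext_iff]

@[simp] theorem State.setNat_real (σ : State) (a i v : ℕ) : (σ.setNat a i v).real = σ.real := rfl

theorem State.setReal_real (σ : State) (a i : ℕ) (f : Form) (b j : ℕ) :
    (σ.setReal a i f).real (b, j) = if b = a ∧ j = i then f else σ.real (b, j) := by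
  classical
  simp [State.setReal, Finsupp.update_apply, Prod.ext_iff]

@[simp] theorem State.setReal_nat (σ : State) (a i : ℕ) (f : Form) :
    (σ.setReal a i f).nat = σ.nat := rfl

theorem NExp.val_congr {σ τ : State} :
    ∀ e : NExp, (∀ a ∈ e.rd, ∀ i, σ.nat (a, i) = τ.nat (a, i)) → e.val σ = e.val τ
  | const _, _ => rfl
  | cell a e, h => by
      have := e.val_congr (fun a' ha i => h a' (by simp [rd, ha]) i)
      simp only [val, this]
      exact h a (by simp [rd]) _
  | add e₁ e₂, h | sub e₁ e₂, h | mul e₁ e₂, h => by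
      simp only [val, e₁.val_congr (fun a ha => h a (by simp [rd, ha])),
        e₂.val_congr (fun a ha => h a (by simp [rd, ha]))]

theorem RExp.val_congr {σ τ : State} (hr : σ.real = τ.real) :
    ∀ e : RExp, (∀ a ∈ e.rd, ∀ i, σ.nat (a, i) = τ.nat (a, i)) → e.val σ = e.val τ
  | zero, _ => rfl
  | cell a e, h => by
      simp only [val, hr, NExp.val_congr e h]
  | add e₁ e₂, h | sub e₁ e₂, h => by
      simp only [val, e₁.val_congr hr (fun a ha => h a (by simp [rd, ha])),
        e₂.val_congr hr (fun a ha => h a (by simp [rd, ha]))]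

theorem Test.holds_congr {x : ℕ → ℝ} {σ τ : State} (hr : σ.real = τ.real) :
    ∀ b : Test, (∀ a ∈ b.rd, ∀ i, σ.nat (a, i) = τ.nat (a, i)) → (b.Holds x σ ↔ b.Holds x τ)
  | nle e₁ e₂, h => by
      simp only [Holds, e₁.val_congr (fun a ha => h a (by simp [rd, ha])),
        e₂.val_congr (fun a ha => h a (by simp [rd, ha]))]
  | rle e₁ e₂, h => by
      simp only [Holds, e₁.val_congr hr (fun a ha => h a (by simp [rd, ha])),
        e₂.val_congr hr (fun a ha => h a (by simp [rd, ha]))]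
  | and b₁ b₂, h => by
      simp only [Holds, b₁.holds_congr hr (fun a ha => h a (by simp [rd, ha])),
        b₂.holds_congr hr (fun a ha => h a (by simp [rd, ha]))]
  | not b, h => by simp only [Holds, b.holds_congr hr h]

namespace LP

variable {x : ℕ → ℝ}

theorem exec_nat_of_not_mem (p : LP) (σ : State) {a : ℕ} (ha : a ∉ p.wr) (i : ℕ) :
    (p.exec x σ).nat (a, i) = σ.nat (a, i) := by
  induction p generalizing σ with
  | skip => rfl
  | nset b j e =>
    simp only [exec]
    split_ifs
    · simp only [wr, List.mem_singleton] at ha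
      simp [State.setNat_nat, ha]
    · rfl
  | rset b j e =>
    simp only [exec]
    split_ifs <;> rfl
  | seq p q ihp ihq =>
    simp only [wr, List.mem_append, not_or] at ha
    simp only [exec, ihq _ ha.2, ihp _ ha.1]
  | ite b p q ihp ihq =>
    simp only [wr, List.mem_append, not_or] at ha
    simp only [exec]
    split_ifs
    · exact ihp _ ha.1
    · exact ihq _ ha.2
  | loop c e p ih =>
    simp only [wr, List.mem_cons, not_or] at ha
    simp only [exec]
    have key : ∀ r τ, ((fun τ => incr c (exec x p τ))^[r] τ).nat (a, i) = τ.nat (a, i) := by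
      intro r
      induction r with
      | zero => intro τ; rfl
      | succ r ihr =>
        intro τ
        rw [Function.iterate_succ_apply, ihr]
        simp [incr, State.setNat_nat, ha.1, ih _ ha.2]
    rw [key]
    simp [State.setNat_nat, ha.1]

theorem exec_real_of_not_mem (p : LP) (σ : State) {a : ℕ} (ha : a ∉ p.wrR) (i : ℕ) :
    (p.exec x σ).real (a, i) = σ.real (a, i) := by
  induction p generalizing σ with
  | skip => rfl
  | nset b j e =>
    simp only [exec]
    split_ifs <;> rfl
  | rset b j e =>
    simp only [exec]
    split_ifs
    · simp only [wrR, List.mem_singleton] at ha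
      simp [State.setReal_real, ha]
    · rfl
  | seq p q ihp ihq =>
    simp only [wrR, List.mem_append, not_or] at ha
    simp only [exec, ihq _ ha.2, ihp _ ha.1]
  | ite b p q ihp ihq =>
    simp only [wrR, List.mem_append, not_or] at ha
    simp only [exec]
    split_ifs
    · exact ihp _ ha.1
    · exact ihq _ ha.2
  | loop c e p ih =>
    simp only [wrR] at ha
    simp only [exec]
    have key : ∀ r τ, ((fun τ => incr c (exec x p τ))^[r] τ).real (a, i) = τ.real (a, i) := by
      intro r
      induction r with
      | zero => intro τ; rfl
      | succ r ihr =>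
        intro τ
        rw [Function.iterate_succ_apply, ihr]
        simp [incr, ih _ ha]
    rw [key]
    simp

theorem wf_four {p : LP} (h : p.wf) : 4 ∉ p.wr := by
  induction p with
  | skip => simp [wr]
  | nset a i e => simp only [wf, Bool.and_eq_true, decide_eq_true_eq] at h; simp [wr]; omega
  | rset a i e => simp [wr]
  | seq p q ihp ihq | ite b p q ihp ihq =>
    simp only [wf, Bool.and_eq_true] at h
    simp [wr, ihp h.1, ihq h.2]
  | loop c e p ih =>
    simp only [wf, Bool.and_eq_true, decide_eq_true_eq] at h
    simp only [wr, List.mem_cons, not_or]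
    exact ⟨by omega, ih h.2⟩

/-- Induction along a counting loop. Besides the invariant, the step may use that the arrays that
the body does not change are as they were before the loop. -/
theorem exec_loop {c : ℕ} {e : NExp} {p : LP} {σ : State} (hwf : (loop c e p).wf)
    (Inv : ℕ → State → Prop) (hb : e.val σ ≤ σ.nat (4, 0) + 1) (h0 : Inv 0 (σ.setNat c 0 0))
    (hs : ∀ j τ, j < e.val σ → Inv j τ → τ.nat (c, 0) = j →
      (∀ a, a ∉ c :: p.wr → ∀ i, τ.nat (a, i) = σ.nat (a, i)) →
      (∀ a, a ∉ p.wrR → ∀ i, τ.real (a, i) = σ.real (a, i)) →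
      Inv (j + 1) ((p.exec x τ).setNat c 0 (j + 1))) :
    Inv (e.val σ) ((loop c e p).exec x σ) := by
  simp only [exec, min_eq_left hb]
  simp only [wf, Bool.and_eq_true, decide_eq_true_eq] at hwf
  have hc : c ∉ p.wr := hwf.1.1.2
  have key : ∀ j ≤ e.val σ, Inv j ((fun τ => incr c (exec x p τ))^[j] (σ.setNat c 0 0)) ∧
      ((fun τ => incr c (exec x p τ))^[j] (σ.setNat c 0 0)).nat (c, 0) = j ∧
      (∀ a, a ∉ c :: p.wr → ∀ i,
        ((fun τ => incr c (exec x p τ))^[j] (σ.setNat c 0 0)).nat (a, i) = σ.nat (a, i)) ∧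
      (∀ a, a ∉ p.wrR → ∀ i,
        ((fun τ => incr c (exec x p τ))^[j] (σ.setNat c 0 0)).real (a, i) = σ.real (a, i)) := by
    intro j
    induction j with
    | zero =>
      intro _
      refine ⟨h0, by simp [State.setNat_nat], fun a ha i => ?_, fun a ha i => by simp⟩
      simp only [List.mem_cons, not_or] at ha
      simp [State.setNat_nat, ha.1]
    | succ j ih =>
      intro hj
      obtain ⟨h1, h2, h3, h4⟩ := ih (by omega)
      rw [Function.iterate_succ_apply']
      generalize (fun τ => incr c (exec x p τ))^[j] (σ.setNat c 0 0) = τ at h1 h2 h3 h4 ⊢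
      have := hs j τ (by omega) h1 h2 h3 h4
      refine ⟨?_, ?_, fun a ha i => ?_, fun a ha i => ?_⟩
      · simpa [incr, exec_nat_of_not_mem p _ hc, h2] using this
      · simp [incr, State.setNat_nat, exec_nat_of_not_mem p _ hc, h2]
      · have ha' := ha
        simp only [List.mem_cons, not_or] at ha'
        simp [incr, State.setNat_nat, ha'.1, exec_nat_of_not_mem p _ ha'.2, h3 a ha]
      · simp [incr, exec_real_of_not_mem p _ ha, h4 a ha]
  exact (key _ le_rfl).1

/-- The two memories agree except possibly on the arrays of natural numbers in `s`. -/
def Agree (s : List ℕ) (σ τ : State) : Prop :=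
  σ.real = τ.real ∧ ∀ a, a ∉ s → ∀ i, σ.nat (a, i) = τ.nat (a, i)

theorem Agree.symm {s : List ℕ} {σ τ : State} (h : Agree s σ τ) : Agree s τ σ :=
  ⟨h.1.symm, fun a ha i => (h.2 a ha i).symm⟩

theorem Agree.setNat {s : List ℕ} {σ τ : State} (h : Agree s σ τ) (a i v : ℕ) :
    Agree s (σ.setNat a i v) (τ.setNat a i v) :=
  ⟨h.1, fun b hb j => by simp only [State.setNat_nat, h.2 b hb j]⟩

theorem Agree.setNat_left {s : List ℕ} {σ τ : State} (h : Agree s σ τ) {a : ℕ} (ha : a ∈ s)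
    (i v : ℕ) : Agree s (σ.setNat a i v) τ :=
  ⟨h.1, fun b hb j => by
    rw [State.setNat_nat, if_neg (by rintro ⟨rfl, -⟩; exact hb ha), h.2 b hb j]⟩

/-- A loop program does not depend on arrays that do not occur in it. -/
theorem exec_congr {s : List ℕ} (h4 : 4 ∉ s) (p : LP) (hp : ∀ a ∈ p.use, a ∉ s) {σ τ : State}
    (h : Agree s σ τ) : Agree s (p.exec x σ) (p.exec x τ) := by
  induction p generalizing σ τ with
  | skip => exact h
  | nset a i e =>
    simp only [use, List.mem_cons, List.mem_append] at hp
    have h1 : i.val σ = i.val τ := i.val_congr fun a ha => h.2 a (hp a (by simp [ha]))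
    have h2 : e.val σ = e.val τ := e.val_congr fun a ha => h.2 a (hp a (by simp [ha]))
    simp only [exec, h1, h2, h.2 4 h4]
    split_ifs
    · exact h.setNat _ _ _
    · exact h
  | rset a i e =>
    simp only [use, List.mem_append] at hp
    have h1 : i.val σ = i.val τ := i.val_congr fun a ha => h.2 a (hp a (by simp [ha]))
    have h2 : e.val σ = e.val τ := e.val_congr h.1 fun a ha => h.2 a (hp a (by simp [ha]))
    simp only [exec, h1, h2, h.2 4 h4]
    split_ifs
    · refine ⟨?_, h.2⟩
      simp only [State.setReal, h.1]
    · exact h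
  | seq p q ihp ihq =>
    simp only [use, List.mem_append] at hp
    exact ihq (fun a ha => hp a (.inr ha)) (ihp (fun a ha => hp a (.inl ha)) h)
  | ite b p q ihp ihq =>
    simp only [use, List.mem_append] at hp
    have h1 : b.Holds x σ ↔ b.Holds x τ := b.holds_congr h.1 fun a ha => h.2 a (hp a (.inl ha))
    simp only [exec]
    by_cases hb : b.Holds x σ
    · rw [if_pos hb, if_pos (h1.1 hb)]
      exact ihp (fun a ha => hp a (.inr (.inl ha))) h
    · rw [if_neg hb, if_neg (fun h' => hb (h1.2 h'))]
      exact ihq (fun a ha => hp a (.inr (.inr ha))) h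
  | loop c e p ih =>
    simp only [use, List.mem_cons, List.mem_append] at hp
    have h1 : e.val σ = e.val τ := e.val_congr fun a ha => h.2 a (hp a (by simp [ha]))
    simp only [exec, h1, h.2 4 h4]
    have key : ∀ r (σ τ : State), Agree s σ τ → Agree s ((fun τ => incr c (exec x p τ))^[r] σ)
        ((fun τ => incr c (exec x p τ))^[r] τ) := by
      intro r
      induction r with
      | zero => intro σ τ h; exact h
      | succ r ihr =>
        intro σ τ h
        simp only [Function.iterate_succ_apply]
        apply ihr
        have h2 := ih (fun a ha => hp a (by simp [ha])) h
        simp only [incr, h2.2 c (hp c (by simp)) 0]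
        exact h2.setNat _ _ _
    exact key _ _ _ (h.setNat _ _ _)

end LP

open Polynomial

/-! ### Running times of loop programs -/

theorem eval_mono (q : ℕ[X]) {a b : ℕ} (h : a ≤ b) : q.eval a ≤ q.eval b := by
  rw [eval_eq_sum, eval_eq_sum]
  exact Finset.sum_le_sum fun i _ => Nat.mul_le_mul_left _ (Nat.pow_le_pow_left h i)

theorem natBits_le (a : ℕ) : natBits a ≤ a + 1 := by
  have : Nat.size a ≤ a := Nat.size_le.2 Nat.lt_two_pow_self
  unfold natBits; omega

/-- A memory whose natural numbers are at most `b + 1`, whose used positions are at most `b`, and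
whose real cells have coefficients at most `2 ^ X`. -/
structure Bd (b X : ℕ) (σ : State) : Prop where
  val_le : ∀ a i, σ.nat (a, i) ≤ b + 1
  supp : ∀ a i, σ.nat (a, i) ≠ 0 → a ≤ 60 ∧ i ≤ b
  rsupp : ∀ a i, σ.real (a, i) ≠ 0 → a ≤ 5 ∧ i ≤ b
  ind : ∀ a i j, σ.real (a, i) j ≠ 0 → j ≤ b
  coeff : ∀ a i j, (σ.real (a, i) j).natAbs ≤ 2 ^ X

theorem Bd.mono {b X Y : ℕ} {σ : State} (h : Bd b X σ) (hXY : X ≤ Y) : Bd b Y σ :=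
  { h with coeff := fun a i j => (h.coeff a i j).trans (Nat.pow_le_pow_right (by norm_num) hXY) }

/-- A linear combination of at most `b + 1` input numbers whose coefficients have length about `X`
is stored in polynomial space. -/
theorem formBits_le {f : Form} {b X : ℕ} (h1 : ∀ j, f j ≠ 0 → j ≤ b)
    (h2 : ∀ j, (f j).natAbs ≤ 2 ^ X) : formBits f ≤ (b + X + 1) * (b + X + 5) + 1 := by
  unfold formBits
  refine Nat.add_le_add_right ?_ 1
  rw [Finsupp.sum]
  have hs : f.support ⊆ Finset.range (b + 1) := by
    intro j hj
    simpa using Nat.lt_succ_of_le (h1 j (by simpa using hj))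
  have ht : ∀ j ∈ f.support, natBits j + natBits (f j).natAbs + 1 ≤ b + X + 5 := by
    intro j hj
    have e1 := natBits_le j
    have e2 := h1 j (by simpa using hj)
    have e3 : Nat.size (f j).natAbs ≤ X + 1 := by
      rw [Nat.size_le]
      exact (h2 j).trans_lt (Nat.pow_lt_pow_right (by norm_num) (by omega))
    have e4 : natBits (f j).natAbs ≤ X + 2 := by unfold natBits; omega
    omega
  calc _ ≤ f.support.card • (b + X + 5) := Finset.sum_le_card_nsmul _ _ _ ht
    _ ≤ (b + 1) * (b + X + 5) := by
      rw [smul_eq_mul]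
      exact Nat.mul_le_mul_right _ (by simpa using Finset.card_le_card hs)
    _ ≤ _ := Nat.mul_le_mul_right _ (by omega)

/-- Bounds the space of a memory with parameters `b` and `X` in terms of `b + X`. -/
def sizePoly : ℕ[X] :=
  C 61 * (X + 1) * (X + X + C 70) + C 6 * (X + 1) * (X + C 10 + ((X + 1) * (X + C 5) + 1))

/-- Only `61` arrays of natural numbers and `6` arrays of real numbers are in use, with positions up
to `b`. -/
theorem Bd.size_le {b X : ℕ} {σ : State} (h : Bd b X σ) : σ.size ≤ sizePoly.eval (b + X) := by
  have h1 : (σ.nat.sum fun p v => natBits p.1 + natBits p.2 + natBits v) ≤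
      61 * (b + 1) * (b + b + 70) := by
    rw [Finsupp.sum]
    have hs : σ.nat.support ⊆ Finset.range 61 ×ˢ Finset.range (b + 1) := by
      rintro ⟨a, i⟩ hp
      have := h.supp a i (by simpa using hp)
      simp; omega
    have ht : ∀ p ∈ σ.nat.support, natBits p.1 + natBits p.2 + natBits (σ.nat p) ≤
        b + b + 70 := by
      rintro ⟨a, i⟩ hp
      have := h.supp a i (by simpa using hp)
      have e1 := natBits_le a
      have e2 := natBits_le i
      have e3 := natBits_le (σ.nat (a, i))
      have e4 := h.val_le a i
      simp only; omega
    refine (Finset.sum_le_card_nsmul _ _ _ ht).trans ?_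
    rw [smul_eq_mul]
    exact Nat.mul_le_mul_right _ (by simpa using Finset.card_le_card hs)
  have h2 : (σ.real.sum fun p f => natBits p.1 + natBits p.2 + formBits f) ≤
      6 * (b + 1) * (b + 10 + ((b + X + 1) * (b + X + 5) + 1)) := by
    rw [Finsupp.sum]
    have hs : σ.real.support ⊆ Finset.range 6 ×ˢ Finset.range (b + 1) := by
      rintro ⟨a, i⟩ hp
      have := h.rsupp a i (by simpa using hp)
      simp; omega
    have ht : ∀ p ∈ σ.real.support, natBits p.1 + natBits p.2 + formBits (σ.real p) ≤
        b + 10 + ((b + X + 1) * (b + X + 5) + 1) := by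
      rintro ⟨a, i⟩ hp
      have := h.rsupp a i (by simpa using hp)
      have e1 := natBits_le a
      have e2 := natBits_le i
      have e3 := formBits_le (h.ind a i) (h.coeff a i)
      simp only; omega
    refine (Finset.sum_le_card_nsmul _ _ _ ht).trans ?_
    rw [smul_eq_mul]
    exact Nat.mul_le_mul_right _ (by simpa using Finset.card_le_card hs)
  simp only [State.size, sizePoly, eval_add, eval_mul, eval_C, eval_X, eval_one]
  refine (Nat.add_le_add h1 h2).trans ?_
  gcongr <;> omega

/-- Values are polynomial in `b`, as multiplication is iterated only inside a fixed expression. -/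
theorem NExp.bound (e : NExp) : ∃ q : ℕ[X], ∀ b X σ, Bd b X σ →
    e.val σ ≤ q.eval b ∧ e.cost σ ≤ q.eval b := by
  induction e with
  | const c =>
    refine ⟨C (c + 1), fun b X σ _ => ?_⟩
    have := natBits_le c
    simp only [val, cost, eval_C]; omega
  | cell a e ih =>
    obtain ⟨q, hq⟩ := ih
    refine ⟨q + (X + C 2), fun b X σ h => ?_⟩
    have h1 := hq b X σ h
    have h2 := natBits_le (σ.nat (a, e.val σ))
    have h3 := h.val_le a (e.val σ)
    simp only [val, cost, eval_add, eval_C, eval_X]; omega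
  | add e₁ e₂ ih₁ ih₂ =>
    obtain ⟨q₁, hq₁⟩ := ih₁
    obtain ⟨q₂, hq₂⟩ := ih₂
    refine ⟨q₁ + q₁ + q₂ + q₂ + 1, fun b X σ h => ?_⟩
    have h1 := hq₁ b X σ h
    have h2 := hq₂ b X σ h
    have h3 := natBits_le (e₁.val σ + e₂.val σ)
    simp only [val, cost, eval_add, eval_one]; omega
  | sub e₁ e₂ ih₁ ih₂ =>
    obtain ⟨q₁, hq₁⟩ := ih₁
    obtain ⟨q₂, hq₂⟩ := ih₂
    refine ⟨q₁ + q₁ + q₂ + q₂ + 1, fun b X σ h => ?_⟩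
    have h1 := hq₁ b X σ h
    have h2 := hq₂ b X σ h
    have h3 := natBits_le (e₁.val σ - e₂.val σ)
    simp only [val, cost, eval_add, eval_one]; omega
  | mul e₁ e₂ ih₁ ih₂ =>
    obtain ⟨q₁, hq₁⟩ := ih₁
    obtain ⟨q₂, hq₂⟩ := ih₂
    refine ⟨q₁ + q₂ + q₁ * q₂ + 1, fun b X σ h => ?_⟩
    have h1 := hq₁ b X σ h
    have h2 := hq₂ b X σ h
    have h3 := natBits_le (e₁.val σ * e₂.val σ)
    have h4 := Nat.mul_le_mul h1.1 h2.1
    simp only [val, cost, eval_add, eval_one, eval_mul]; omega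

/-- Evaluation adds to the lengths of the coefficients a constant that depends only on the
expression. -/
theorem RExp.bound (e : RExp) : ∃ (g : ℕ) (q : ℕ[X]), ∀ b X σ, Bd b X σ →
    (∀ j, e.val σ j ≠ 0 → j ≤ b) ∧ (∀ j, (e.val σ j).natAbs ≤ 2 ^ (X + g)) ∧
    e.cost σ ≤ q.eval (b + X) := by
  induction e with
  | zero => exact ⟨0, 1, fun b X σ h => by simp [val, cost, eval_one]⟩
  | cell a e =>
    obtain ⟨q, hq⟩ := e.bound
    refine ⟨0, q + ((X + 1) * (X + C 5) + 1), fun b X σ h => ?_⟩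
    refine ⟨fun j => h.ind a _ j, fun j => h.coeff a _ j, ?_⟩
    have h1 := (hq b X σ h).2.trans (eval_mono q (Nat.le_add_right b X))
    have h2 := formBits_le (h.ind a (e.val σ)) (h.coeff a (e.val σ))
    simp only [cost, eval_add, eval_mul, eval_X, eval_C, eval_one]
    omega
  | add e₁ e₂ ih₁ ih₂ | sub e₁ e₂ ih₁ ih₂ =>
    obtain ⟨g₁, q₁, hq₁⟩ := ih₁
    obtain ⟨g₂, q₂, hq₂⟩ := ih₂
    refine ⟨g₁ + g₂ + 1, q₁ + q₂ + ((X + C (g₁ + g₂ + 2)) * (X + C (g₁ + g₂ + 6)) + 1),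
      fun b X σ h => ?_⟩
    obtain ⟨a1, a2, a3⟩ := hq₁ b X σ h
    obtain ⟨b1, b2, b3⟩ := hq₂ b X σ h
    have c1 : ∀ j, (e₁.val σ j).natAbs ≤ 2 ^ (X + (g₁ + g₂)) := fun j =>
      (a2 j).trans (Nat.pow_le_pow_right (by norm_num) (by omega))
    have c2 : ∀ j, (e₂.val σ j).natAbs ≤ 2 ^ (X + (g₁ + g₂)) := fun j =>
      (b2 j).trans (Nat.pow_le_pow_right (by norm_num) (by omega))
    simp only [val, cost, eval_add, eval_mul, eval_X, eval_C, eval_one, Finsupp.add_apply,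
      Finsupp.sub_apply]
    have d1 : ∀ j, (e₁.val σ j + e₂.val σ j ≠ 0 ∨ e₁.val σ j - e₂.val σ j ≠ 0) → j ≤ b := by
      intro j hj
      by_contra hlt
      have z1 : e₁.val σ j = 0 := by by_contra h0; exact hlt (a1 j h0)
      have z2 : e₂.val σ j = 0 := by by_contra h0; exact hlt (b1 j h0)
      simp [z1, z2] at hj
    have d2 : ∀ j, (e₁.val σ j + e₂.val σ j).natAbs ≤ 2 ^ (X + (g₁ + g₂ + 1)) ∧
        (e₁.val σ j - e₂.val σ j).natAbs ≤ 2 ^ (X + (g₁ + g₂ + 1)) := by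
      intro j
      have := c1 j
      have := c2 j
      rw [show X + (g₁ + g₂ + 1) = X + (g₁ + g₂) + 1 by ring, pow_succ]
      omega
    first
    | refine ⟨fun j hj => d1 j (.inl hj), fun j => (d2 j).1, ?_⟩
      have e1 := formBits_le (f := e₁.val σ + e₂.val σ) (fun j hj => d1 j (.inl hj))
        (fun j => (d2 j).1)
      have e2 : (b + (X + (g₁ + g₂ + 1)) + 1) * (b + (X + (g₁ + g₂ + 1)) + 5) + 1 =
        (b + X + (g₁ + g₂ + 2)) * (b + X + (g₁ + g₂ + 6)) + 1 := by ring
      omega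
    | refine ⟨fun j hj => d1 j (.inr hj), fun j => (d2 j).2, ?_⟩
      have e1 := formBits_le (f := e₁.val σ - e₂.val σ) (fun j hj => d1 j (.inr hj))
        (fun j => (d2 j).2)
      have e2 : (b + (X + (g₁ + g₂ + 1)) + 1) * (b + (X + (g₁ + g₂ + 1)) + 5) + 1 =
        (b + X + (g₁ + g₂ + 2)) * (b + X + (g₁ + g₂ + 6)) + 1 := by ring
      omega

theorem Test.bound (t : Test) : ∃ q : ℕ[X], ∀ b X σ, Bd b X σ →
    t.cost σ ≤ q.eval (b + X) := by
  induction t with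
  | nle e₁ e₂ =>
    obtain ⟨q₁, hq₁⟩ := e₁.bound
    obtain ⟨q₂, hq₂⟩ := e₂.bound
    refine ⟨q₁ + q₂ + 1, fun b X σ h => ?_⟩
    have h1 := (hq₁ b X σ h).2.trans (eval_mono q₁ (Nat.le_add_right b X))
    have h2 := (hq₂ b X σ h).2.trans (eval_mono q₂ (Nat.le_add_right b X))
    simp only [cost, eval_add, eval_one]; omega
  | rle e₁ e₂ =>
    obtain ⟨g₁, q₁, hq₁⟩ := e₁.bound
    obtain ⟨g₂, q₂, hq₂⟩ := e₂.bound
    refine ⟨q₁ + q₂ + 1, fun b X σ h => ?_⟩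
    have h1 := (hq₁ b X σ h).2.2
    have h2 := (hq₂ b X σ h).2.2
    simp only [cost, eval_add, eval_one]; omega
  | and t₁ t₂ ih₁ ih₂ =>
    obtain ⟨q₁, hq₁⟩ := ih₁
    obtain ⟨q₂, hq₂⟩ := ih₂
    refine ⟨q₁ + q₂ + 1, fun b X σ h => ?_⟩
    have h1 := hq₁ b X σ h
    have h2 := hq₂ b X σ h
    simp only [cost, eval_add, eval_one]; omega
  | not t ih =>
    obtain ⟨q, hq⟩ := ih
    refine ⟨q + 1, fun b X σ h => ?_⟩
    have h1 := hq b X σ h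
    simp only [cost, eval_add, eval_one]; omega

theorem Bd.setNat {b X : ℕ} {σ : State} (h : Bd b X σ) {a i v : ℕ} (ha : a ≤ 60) (hi : i ≤ b)
    (hv : v ≤ b + 1) : Bd b X (σ.setNat a i v) := by
  refine ⟨fun a' i' => ?_, fun a' i' hne => ?_, h.rsupp, h.ind, h.coeff⟩
  · rw [State.setNat_nat]
    split_ifs
    · exact hv
    · exact h.val_le _ _
  · rw [State.setNat_nat] at hne
    split_ifs at hne with hc
    · obtain ⟨rfl, rfl⟩ := hc; exact ⟨ha, hi⟩
    · exact h.supp _ _ hne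

theorem Bd.setReal {b X : ℕ} {σ : State} (h : Bd b X σ) {a i : ℕ} {f : Form} (ha : a ≤ 5)
    (hi : i ≤ b) (h1 : ∀ j, f j ≠ 0 → j ≤ b) (h2 : ∀ j, (f j).natAbs ≤ 2 ^ X) :
    Bd b X (σ.setReal a i f) := by
  refine ⟨h.val_le, h.supp, fun a' i' hne => ?_, fun a' i' j hne => ?_, fun a' i' j => ?_⟩
  · rw [State.setReal_real] at hne
    split_ifs at hne with hc
    · obtain ⟨rfl, rfl⟩ := hc; exact ⟨ha, hi⟩
    · exact h.rsupp _ _ hne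
  · rw [State.setReal_real] at hne
    split_ifs at hne with hc
    · exact h1 _ hne
    · exact h.ind _ _ _ hne
  · rw [State.setReal_real]
    split_ifs
    · exact h2 _
    · exact h.coeff _ _ _

/-- A loop program halts with the memory `exec`, in time and space polynomial in `b + X`, and it
adds to the lengths of the coefficients at most a number polynomial in `b`. -/
theorem LP.exec_run (p : LP) (hwf : p.wf) : ∃ g q : ℕ[X], ∀ x b X σ, Bd b X σ →
    σ.nat (4, 0) = b → Bd b (X + g.eval b) (p.exec x σ) ∧
    ∃ t m, Run x p.compile σ (p.exec x σ) t m ∧ t ≤ q.eval (b + X) ∧ m ≤ q.eval (b + X) := by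
  induction p with
  | skip =>
    refine ⟨0, 1 + sizePoly, fun x b X σ h hb => ⟨by simpa [exec] using h, _, _, .skip σ, ?_, ?_⟩⟩
    · simp only [eval_add, eval_one]; omega
    · have := h.size_le
      simp only [eval_add, eval_one]; omega
  | nset a i e =>
    simp only [wf, Bool.and_eq_true, decide_eq_true_eq] at hwf
    obtain ⟨qi, hqi⟩ := i.bound
    obtain ⟨qe, hqe⟩ := e.bound
    refine ⟨0, qi + qi + qe + qe + X + X + C 100 + sizePoly, fun x b X σ h hb => ?_⟩
    have hi := (hqi b X σ h).2.trans (eval_mono qi (Nat.le_add_right b X))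
    have he := (hqe b X σ h).2.trans (eval_mono qe (Nat.le_add_right b X))
    have hb1 := natBits_le b
    have hb0 : natBits 0 = 1 := rfl
    have hs := h.size_le
    simp only [exec, compile, hb, eval_add, eval_X, eval_C, eval_zero, add_zero]
    split_ifs with hc
    · have h' : Bd b X (σ.setNat a (i.val σ) (e.val σ)) := h.setNat hwf.1.1 hc.1 (by omega)
      have hs' := h'.size_le
      refine ⟨h', _, _, .ite_true ?_ (.nset σ a i e), ?_, ?_⟩
      · simp only [Test.Holds, NExp.val, hb]; exact hc
      · simp only [Test.cost, NExp.cost, NExp.val, hb]; omega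
      · omega
    · refine ⟨h, _, _, .ite_false ?_ (.skip σ), ?_, ?_⟩
      · simp only [Test.Holds, NExp.val, hb]; exact hc
      · simp only [Test.cost, NExp.cost, NExp.val, hb]; omega
      · omega
  | rset a i e =>
    simp only [wf, Bool.and_eq_true, decide_eq_true_eq] at hwf
    obtain ⟨qi, hqi⟩ := i.bound
    obtain ⟨ge, qe, hqe⟩ := e.bound
    refine ⟨C ge, qi + qi + qe + X + C 100 + sizePoly.comp (X + C ge), fun x b X σ h hb => ?_⟩
    have hi := (hqi b X σ h).2.trans (eval_mono qi (Nat.le_add_right b X))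
    obtain ⟨he1, he2, he⟩ := hqe b X σ h
    have hb1 := natBits_le b
    have hb0 : natBits 0 = 1 := rfl
    have hs := h.size_le.trans (eval_mono sizePoly (show b + X ≤ b + X + ge by omega))
    simp only [exec, compile, hb, eval_add, eval_X, eval_C, eval_comp]
    split_ifs with hc
    · have h' : Bd b (X + ge) (σ.setReal a (i.val σ) (e.val σ)) :=
        (h.mono (by omega)).setReal (by omega) hc he1 he2
      have hs' := h'.size_le
      rw [← add_assoc] at hs'
      refine ⟨h', _, _, .ite_true ?_ (.rset σ a i e), ?_, ?_⟩
      · simp only [Test.Holds, NExp.val, hb]; exact hc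
      · simp only [Test.cost, NExp.cost, NExp.val, hb]; omega
      · omega
    · refine ⟨h.mono (by omega), _, _, .ite_false ?_ (.skip σ), ?_, ?_⟩
      · simp only [Test.Holds, NExp.val, hb]; exact hc
      · simp only [Test.cost, NExp.cost, NExp.val, hb]; omega
      · omega
  | seq p q ihp ihq =>
    simp only [wf, Bool.and_eq_true] at hwf
    obtain ⟨g₁, q₁, h₁⟩ := ihp hwf.1
    obtain ⟨g₂, q₂, h₂⟩ := ihq hwf.2
    refine ⟨g₁ + g₂, q₁ + q₂.comp (X + g₁), fun x b X σ h hb => ?_⟩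
    obtain ⟨a1, t1, m1, r1, ht1, hm1⟩ := h₁ x b X σ h hb
    obtain ⟨a2, t2, m2, r2, ht2, hm2⟩ := h₂ x b _ _ a1
      ((p.exec_nat_of_not_mem σ (wf_four hwf.1) 0).trans hb)
    have hz : b + (X + g₁.eval b) ≤ b + X + g₁.eval (b + X) := by
      have := eval_mono g₁ (Nat.le_add_right b X); omega
    have hm := eval_mono q₂ hz
    refine ⟨?_, _, _, .seq r1 r2, ?_, ?_⟩
    · rw [eval_add, ← add_assoc]; exact a2
    · simp only [eval_add, eval_comp, eval_X]; omega
    · simp only [eval_add, eval_comp, eval_X]; omega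
  | ite c p q ihp ihq =>
    simp only [wf, Bool.and_eq_true] at hwf
    obtain ⟨g₁, q₁, h₁⟩ := ihp hwf.1
    obtain ⟨g₂, q₂, h₂⟩ := ihq hwf.2
    obtain ⟨q₀, h₀⟩ := c.bound
    refine ⟨g₁ + g₂, q₀ + q₁ + q₂, fun x b X σ h hb => ?_⟩
    have hc0 := h₀ b X σ h
    simp only [exec, compile, eval_add]
    split_ifs with hc
    · obtain ⟨a1, t1, m1, r1, ht1, hm1⟩ := h₁ x b X σ h hb
      exact ⟨a1.mono (by omega), _, _, .ite_true hc r1, by omega, by omega⟩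
    · obtain ⟨a1, t1, m1, r1, ht1, hm1⟩ := h₂ x b X σ h hb
      exact ⟨a1.mono (by omega), _, _, .ite_false hc r1, by omega, by omega⟩
  | loop c e p ih =>
    simp only [wf, Bool.and_eq_true, decide_eq_true_eq, List.all_eq_true] at hwf
    obtain ⟨⟨⟨⟨⟨hc60, hc4⟩, hc2⟩, hcp⟩, hed⟩, hp⟩ := hwf
    obtain ⟨g, q, hq⟩ := ih hp
    obtain ⟨qt, hqt⟩ := (Test.and (.nle (.add (.cell c (.const 0)) (.const 1)) e)
      (.nle (.cell c (.const 0)) bnd)).bound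
    -- the lengths of the coefficients never exceed those bounded by `G`
    let G : ℕ[X] := X + (X + 1) * g
    let Q : ℕ[X] := qt.comp G + q.comp G + sizePoly.comp G + X + C 100
    refine ⟨(X + 1) * g, X + C 100 + sizePoly.comp G + (X + C 2) * (Q + X + C 100),
      fun x b X σ h hb => ?_⟩
    have hb0 : natBits 0 = 1 := rfl
    have key : ∀ r j τ, j + r ≤ b + 1 → j + r = min (e.val σ) (b + 1) → τ.nat (c, 0) = j →
        e.val τ = e.val σ → τ.nat (4, 0) = b → Bd b (X + j * g.eval b) τ →
        Bd b (X + (j + r) * g.eval b) ((fun τ => incr c (exec x p τ))^[r] τ) ∧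
        ∃ t m, Run x (.while (.and (.nle (.add (.cell c (.const 0)) (.const 1)) e)
          (.nle (.cell c (.const 0)) bnd))
          (.seq p.compile (.nset c (.const 0) (.add (.cell c (.const 0)) (.const 1)))))
          τ ((fun τ => incr c (exec x p τ))^[r] τ) t m ∧
          t ≤ (r + 1) * (Q.eval (b + X) + (b + X) + 100) ∧ m ≤ Q.eval (b + X) := by
      intro r
      induction r with
      | zero =>
        intro j τ hj hjr hτc hτe hτ4 hBd
        have hz : b + (X + j * g.eval b) ≤ G.eval (b + X) := by
          simp only [G, eval_add, eval_mul, eval_X, eval_one]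
          have := Nat.mul_le_mul (show j ≤ b + X + 1 by omega)
            (eval_mono g (Nat.le_add_right b X))
          omega
        have ht := (hqt _ _ _ hBd).trans (eval_mono qt hz)
        have hs := hBd.size_le.trans (eval_mono sizePoly hz)
        refine ⟨by simpa using hBd, _, _, .while_false ?_, ?_, ?_⟩
        · simp only [Test.Holds, NExp.val, hτc, hτe, hτ4]
          rcases le_total (e.val σ) (b + 1) with h1 | h1
          · rw [min_eq_left h1] at hjr; omega
          · rw [min_eq_right h1] at hjr; omega
        · simp only [Q, eval_add, eval_comp, eval_X, eval_C]; omega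
        · simp only [Q, eval_add, eval_comp, eval_X, eval_C]; omega
      | succ r ihr =>
        intro j τ hj hjr hτc hτe hτ4 hBd
        have hz : b + (X + j * g.eval b) ≤ G.eval (b + X) := by
          simp only [G, eval_add, eval_mul, eval_X, eval_one]
          have := Nat.mul_le_mul (show j ≤ b + X + 1 by omega)
            (eval_mono g (Nat.le_add_right b X))
          omega
        have hz' : b + (X + (j + 1) * g.eval b) ≤ G.eval (b + X) := by
          simp only [G, eval_add, eval_mul, eval_X, eval_one]
          have := Nat.mul_le_mul (show j + 1 ≤ b + X + 1 by omega)
            (eval_mono g (Nat.le_add_right b X))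
          omega
        have ht := (hqt _ _ _ hBd).trans (eval_mono qt hz)
        obtain ⟨a1, t1, m1, r1, ht1, hm1⟩ := hq x b _ τ hBd hτ4
        have ht1' := ht1.trans (eval_mono q hz)
        have hm1' := hm1.trans (eval_mono q hz)
        have hc1 : (exec x p τ).nat (c, 0) = j := by
          rw [exec_nat_of_not_mem p _ hcp]; exact hτc
        have a1' : Bd b (X + (j + 1) * g.eval b) (exec x p τ) := by
          convert a1 using 1; ring
        have a2 : Bd b (X + (j + 1) * g.eval b) (incr c (exec x p τ)) :=
          a1'.setNat hc60 (Nat.zero_le _) (by omega)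
        obtain ⟨a3, t3, m3, r3, ht3, hm3⟩ := ihr (j + 1) (incr c (exec x p τ)) (by omega)
          (by omega) (by simp [incr, State.setNat_nat, hc1])
          (by
            rw [← hτe]
            refine e.val_congr fun a ha i => ?_
            have := hed a ha
            simp only [List.mem_cons, not_or] at this
            simp [incr, State.setNat_nat, this.1, exec_nat_of_not_mem p _ this.2])
          (by simp [incr, State.setNat_nat, Ne.symm hc4, exec_nat_of_not_mem p _ (wf_four hp), hτ4])
          a2
        refine ⟨by rw [Function.iterate_succ_apply]; convert a3 using 2; ring, _, _,
          .while_true ?_ (.seq r1 (.nset _ _ _ _)) r3, ?_, ?_⟩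
        · simp only [Test.Holds, NExp.val, hτc, hτe, hτ4]
          have := min_le_left (e.val σ) (b + 1)
          omega
        · have e1 := natBits_le j
          have e2 := natBits_le (j + 1)
          have e3 : natBits 1 = 2 := by decide
          rw [show (r + 1 + 1) * (Q.eval (b + X) + (b + X) + 100) =
            (r + 1) * (Q.eval (b + X) + (b + X) + 100) + (Q.eval (b + X) + (b + X) + 100) by ring]
          have e4 : Test.cost τ (.and (.nle (.add (.cell c (.const 0)) (.const 1)) e)
              (.nle (.cell c (.const 0)) bnd)) + t1 + (2 * (b + X) + 50) ≤ Q.eval (b + X) + (b + X) + 100 := by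
            simp only [Q, eval_add, eval_comp, eval_X, eval_C]
            have := Nat.add_le_add ht ht1'
            omega
          simp only [NExp.cost, NExp.val, hc1, hb0, e3] at e4 ⊢
          omega
        · have s1 := a1'.size_le.trans (eval_mono sizePoly hz')
          have s2 := a2.size_le.trans (eval_mono sizePoly hz')
          have s3 : (State.setNat (exec x p τ) c ((NExp.const 0).val (exec x p τ))
            (((NExp.cell c (.const 0)).add (.const 1)).val (exec x p τ))) =
              incr c (exec x p τ) := by simp [NExp.val, incr]
          rw [s3]
          refine max_le (max_le ?_ (max_le ?_ ?_)) hm3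
          all_goals
            simp only [Q, eval_add, eval_comp, eval_X, eval_C]; omega
    have hσ0 : Bd b X (σ.setNat c 0 0) := h.setNat hc60 (Nat.zero_le _) (Nat.zero_le _)
    have hσe : e.val (σ.setNat c 0 0) = e.val σ := by
      refine e.val_congr fun a ha i => ?_
      have := hed a ha
      simp only [List.mem_cons, not_or] at this
      simp [State.setNat_nat, this.1]
    have hmin : min (e.val σ) (b + 1) ≤ b + 1 := min_le_right _ _
    obtain ⟨a3, t3, m3, r3, ht3, hm3⟩ := key (min (e.val σ) (b + 1)) 0 (σ.setNat c 0 0)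
      (by omega) (by omega) (by simp [State.setNat_nat]) hσe
      (by simp [State.setNat_nat, Ne.symm hc4, hb]) (by simpa using hσ0)
    have hz : b + X ≤ G.eval (b + X) := by
      simp only [G, eval_add, eval_mul, eval_X, eval_one]; omega
    have s1 := h.size_le.trans (eval_mono sizePoly hz)
    have s2 := hσ0.size_le.trans (eval_mono sizePoly hz)
    simp only [exec, compile, hb]
    refine ⟨a3.mono ?_, _, _, .seq (.nset _ _ _ _) r3, ?_, ?_⟩
    · simp only [eval_mul, eval_add, eval_X, eval_one]
      have := Nat.mul_le_mul_right (g.eval b) hmin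
      rw [zero_add]
      omega
    · have := Nat.mul_le_mul_right (Q.eval (b + X) + (b + X) + 100)
        (show min (e.val σ) (b + 1) + 1 ≤ b + X + 2 by omega)
      simp only [NExp.cost, hb0, eval_add, eval_mul, eval_X, eval_C] at this ⊢
      omega
    · have h5 : Q.eval (b + X) ≤ (b + X + 2) * (Q.eval (b + X) + (b + X) + 100) := by
        nlinarith [Nat.zero_le (b + X), Nat.zero_le (Q.eval (b + X))]
      simp only [eval_add, eval_mul, eval_X, eval_C, eval_comp, NExp.val] at h5 ⊢
      refine max_le (max_le ?_ ?_) ?_ <;> omega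

/-! ### Search trees and bit strings -/

/-- Binary trees with labelled leaves. -/
inductive Tree (α : Type) where
  | leaf (a : α)
  | node (l r : Tree α)

namespace Tree

variable {α : Type}

/-- The labels of the leaves from left to right. -/
def leaves : Tree α → List α
  | leaf a => [a]
  | node l r => l.leaves ++ r.leaves

/-- The label of the leaf to which the digits `D` lead; the digit `0` means left. -/
def walk : Tree α → (ℕ → ℕ) → α
  | leaf a, _ => a
  | node l r, D => if D 0 = 0 then l.walk (fun j => D (j + 1)) else r.walk (fun j => D (j + 1))

/-- The depth of the leaf to which the digits `D` lead. -/
def depth : Tree α → (ℕ → ℕ) → ℕ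
  | leaf _, _ => 0
  | node l r, D =>
      (if D 0 = 0 then l.depth (fun j => D (j + 1)) else r.depth (fun j => D (j + 1))) + 1

/-- The labels of the leaves from the one to which the digits `D` lead onwards. -/
def rem : Tree α → (ℕ → ℕ) → List α
  | leaf a, _ => [a]
  | node l r, D =>
      if D 0 = 0 then l.rem (fun j => D (j + 1)) ++ r.leaves else r.rem (fun j => D (j + 1))

/-- Changes the digit at position `i` to `1` and all later ones to `0`. -/
def next (D : ℕ → ℕ) (i : ℕ) : ℕ → ℕ := fun j => if j < i then D j else if j = i then 1 else 0

theorem rem_zero (T : Tree α) : T.rem (fun _ => 0) = T.leaves := by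
  induction T with
  | leaf a => rfl
  | node l r ihl ihr => simp [rem, leaves, ihl]

/-- If no used digit is `0`, the leaf is the last one. -/
theorem rem_of_forall_ne (T : Tree α) (D : ℕ → ℕ) (h : ∀ j < T.depth D, D j ≠ 0) :
    T.rem D = [T.walk D] := by
  induction T generalizing D with
  | leaf a => rfl
  | node l r ihl ihr =>
    have h0 : D 0 ≠ 0 := h 0 (by simp [depth])
    simp only [depth, h0, if_false] at h
    simp only [rem, walk, h0, if_false]
    exact ihr _ fun j hj => h (j + 1) (by omega)

/-- Flipping the last digit `0` that is used, and clearing the digits after it, leads to the next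
leaf. -/
theorem rem_next (T : Tree α) (D : ℕ → ℕ) (i : ℕ) (hi : i < T.depth D) (h0 : D i = 0)
    (h : ∀ j, i < j → j < T.depth D → D j ≠ 0) : T.rem D = T.walk D :: T.rem (next D i) := by
  induction T generalizing D i with
  | leaf a => simp [depth] at hi
  | node l r ihl ihr =>
    cases i with
    | zero =>
      simp only [depth, h0, if_true] at h
      have h1 : next D 0 0 = 1 := by simp [next]
      have h2 : (fun j => next D 0 (j + 1)) = fun _ => 0 := by funext j; simp [next]
      simp only [rem, walk, h0, if_true, h1, one_ne_zero, if_false, h2, rem_zero]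
      rw [rem_of_forall_ne]
      · rfl
      · exact fun j hj => h (j + 1) (by omega) (by omega)
    | succ i =>
      have h1 : next D (i + 1) 0 = D 0 := by simp [next]
      have h2 : (fun j => next D (i + 1) (j + 1)) = next (fun j => D (j + 1)) i := by
        funext j; simp [next]
      simp only [rem, walk, h1, h2]
      simp only [depth] at hi h
      split_ifs with hD
      · simp only [hD, if_true] at hi h
        rw [ihl (fun j => D (j + 1)) i (by omega) h0
          fun j h3 h4 => h (j + 1) (by omega) (by omega)]
        rfl
      · simp only [hD, if_false] at hi h
        rw [ihr (fun j => D (j + 1)) i (by omega) h0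
          fun j h3 h4 => h (j + 1) (by omega) (by omega)]

end Tree

/-! ### Counting edges and vertices of degree three -/

/-- The number of neighbours of `p` in `S`, where `adj p q ≠ 0` means adjacency. -/
def degOn (adj : ℕ → ℕ → ℕ) (S : Finset ℕ) (p : ℕ) : ℕ := (S.filter fun q => adj p q ≠ 0).card

/-- The number of vertices in `S` that have degree at least three in `S`. -/
def bigOn (adj : ℕ → ℕ → ℕ) (S : Finset ℕ) : ℕ := (S.filter fun p => 3 ≤ degOn adj S p).card

/-- Twice the total weight of the edges in `S`. -/
def massOn (adj : ℕ → ℕ → ℕ) (S : Finset ℕ) : ℕ := ∑ p ∈ S, ∑ q ∈ S, adj p q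

variable {adj adj' : ℕ → ℕ → ℕ} {S S' : Finset ℕ}

theorem degOn_mono (h : S' ⊆ S) (p : ℕ) : degOn adj S' p ≤ degOn adj S p :=
  Finset.card_le_card (Finset.filter_subset_filter _ h)

theorem massOn_mono (h : S' ⊆ S) : massOn adj S' ≤ massOn adj S :=
  (Finset.sum_le_sum fun _ _ => Finset.sum_le_sum_of_subset h).trans
    (Finset.sum_le_sum_of_subset h)

theorem degOn_le_sum (p : ℕ) : degOn adj S p ≤ ∑ q ∈ S, adj p q := by
  rw [degOn, Finset.card_filter]
  exact Finset.sum_le_sum fun q _ => by split_ifs <;> omega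

theorem massOn_erase (hs : ∀ p ∈ S, ∀ q ∈ S, adj p q = adj q p) {u : ℕ} (hu : u ∈ S)
    (h0 : adj u u = 0) : massOn adj S = massOn adj (S.erase u) + 2 * ∑ q ∈ S, adj u q := by
  have h1 : ∀ g : ℕ → ℕ, ∑ p ∈ S, g p = g u + ∑ p ∈ S.erase u, g p := fun g =>
    (Finset.add_sum_erase S g hu).symm
  have h2 : ∑ p ∈ S.erase u, adj p u = ∑ q ∈ S.erase u, adj u q :=
    Finset.sum_congr rfl fun p hp => hs p (Finset.mem_of_mem_erase hp) u hu
  unfold massOn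
  rw [h1, h1 (fun q => adj u q)]
  simp only [h1 (fun q => adj _ q), Finset.sum_add_distrib, h2, h0]
  ring

theorem degOn_erase_lt (p : ℕ) {u : ℕ} (hu : u ∈ S) (h : adj p u ≠ 0) (h' : S' ⊆ S.erase u) :
    degOn adj S' p < degOn adj S p := by
  refine Finset.card_lt_card ((Finset.ssubset_iff_of_subset
    (Finset.filter_subset_filter _ (h'.trans (Finset.erase_subset _ _)))).2 ⟨u, by simp [hu, h], ?_⟩)
  intro hu'
  simpa using h' (Finset.mem_filter.1 hu').1

theorem three_mul_bigOn_le : 3 * bigOn adj S ≤ massOn adj S := by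
  rw [bigOn, Finset.card_filter, Finset.mul_sum]
  refine Finset.sum_le_sum fun p _ => ?_
  have := degOn_le_sum (adj := adj) (S := S) p
  split_ifs <;> omega

/-- If all edges have weight two, every vertex of degree three contributes six to the mass. -/
theorem six_mul_bigOn_le (h : ∀ p ∈ S, ∀ q ∈ S, adj p q ≠ 1) :
    6 * bigOn adj S ≤ massOn adj S := by
  rw [bigOn, Finset.card_filter, Finset.mul_sum]
  refine Finset.sum_le_sum fun p hp => ?_
  have : 2 * degOn adj S p ≤ ∑ q ∈ S, adj p q := by
    rw [degOn, Finset.card_filter, Finset.mul_sum]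
    refine Finset.sum_le_sum fun q hq => ?_
    have := h p hp q hq
    split_ifs <;> omega
  split_ifs <;> omega

/-- Deleting a vertex of a cubic graph. -/
theorem cubic_erase (hs : ∀ p ∈ S, ∀ q ∈ S, adj p q = adj q p) (h0 : ∀ p ∈ S, adj p p = 0)
    (h3 : ∀ p ∈ S, degOn adj S p = 3) {v : ℕ} (hv : v ∈ S) (h' : S' ⊆ S.erase v) :
    bigOn adj S' + 4 ≤ bigOn adj S ∧ massOn adj S' + 6 ≤ massOn adj S := by
  constructor
  · have e1 : bigOn adj S = S.card := by
      rw [bigOn, Finset.filter_true_of_mem]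
      exact fun p hp => (h3 p hp).ge
    have e2 : insert v (S.filter fun q => adj v q ≠ 0) ⊆ S :=
      Finset.insert_subset hv (Finset.filter_subset _ _)
    have e3 : (insert v (S.filter fun q => adj v q ≠ 0)).card = 4 := by
      rw [Finset.card_insert_of_notMem (by simp [h0 v hv])]
      have := h3 v hv
      rw [degOn] at this; omega
    have e4 : bigOn adj S' ≤ (S \ insert v (S.filter fun q => adj v q ≠ 0)).card := by
      refine Finset.card_le_card fun p hp => ?_
      obtain ⟨hp1, hp2⟩ := Finset.mem_filter.1 hp
      have hpe := h' hp1
      have hpS := Finset.mem_of_mem_erase hpe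
      simp only [Finset.mem_sdiff, Finset.mem_insert, Finset.mem_filter, not_or, not_and, not_not]
      refine ⟨hpS, Finset.ne_of_mem_erase hpe, fun _ => ?_⟩
      by_contra hne
      have := degOn_erase_lt (adj := adj) p hv (by rw [hs p hpS v hv]; exact hne) h'
      have := h3 p hpS
      omega
    rw [Finset.card_sdiff_of_subset e2, e3] at e4
    have := Finset.card_le_card e2
    omega
  · have e1 := massOn_erase hs hv (h0 v hv)
    have e2 := massOn_mono (adj := adj) h'
    have e3 := degOn_le_sum (adj := adj) (S := S) v
    have := h3 v hv
    omega

/-- Deleting two adjacent vertices with at most one common neighbour of a cubic graph. -/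
theorem cubic_erase_two (hs : ∀ p ∈ S, ∀ q ∈ S, adj p q = adj q p) (h0 : ∀ p ∈ S, adj p p = 0)
    (h3 : ∀ p ∈ S, degOn adj S p = 3) {u v : ℕ} (hu : u ∈ S) (hv : v ∈ S) (huv : adj v u ≠ 0)
    (hc : (S.filter fun q => adj u q ≠ 0 ∧ adj v q ≠ 0).card ≤ 1)
    (h' : S' ⊆ (S.erase v).erase u) :
    bigOn adj S' + 5 ≤ bigOn adj S ∧ massOn adj S' + 10 ≤ massOn adj S := by
  have hne : u ≠ v := by rintro rfl; exact huv (h0 u hu)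
  have hu' : u ∈ S.erase v := Finset.mem_erase.2 ⟨hne, hu⟩
  have hsub : S' ⊆ S.erase v := h'.trans (Finset.erase_subset _ _)
  have hsub' : S' ⊆ S.erase u := by
    intro p hp
    have := h' hp
    simp only [Finset.mem_erase] at this ⊢
    exact ⟨this.1, this.2.2⟩
  constructor
  · have e1 : bigOn adj S = S.card := by
      rw [bigOn, Finset.filter_true_of_mem]
      exact fun p hp => (h3 p hp).ge
    set A := S.filter fun q => adj u q ≠ 0
    set B := S.filter fun q => adj v q ≠ 0
    have e2 : A ∪ B ⊆ S := Finset.union_subset (Finset.filter_subset _ _) (Finset.filter_subset _ _)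
    have e3 : 5 ≤ (A ∪ B).card := by
      have h1 := Finset.card_union_add_card_inter A B
      have h2 : A ∩ B = S.filter fun q => adj u q ≠ 0 ∧ adj v q ≠ 0 := by
        ext q; simp [A, B]; tauto
      have h4 : A.card = 3 := h3 u hu
      have h5 : B.card = 3 := h3 v hv
      rw [h2] at h1
      omega
    have e4 : bigOn adj S' ≤ (S \ (A ∪ B)).card := by
      refine Finset.card_le_card fun p hp => ?_
      obtain ⟨hp1, hp2⟩ := Finset.mem_filter.1 hp
      have hpS := Finset.mem_of_mem_erase (hsub hp1)
      simp only [A, B, Finset.mem_sdiff, Finset.mem_union, Finset.mem_filter, not_or, not_and,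
        not_not]
      refine ⟨hpS, fun _ => ?_, fun _ => ?_⟩
      · by_contra hne'
        have := degOn_erase_lt (adj := adj) p hu (by rw [hs p hpS u hu]; exact hne') hsub'
        have := h3 p hpS
        omega
      · by_contra hne'
        have := degOn_erase_lt (adj := adj) p hv (by rw [hs p hpS v hv]; exact hne') hsub
        have := h3 p hpS
        omega
    rw [Finset.card_sdiff_of_subset e2] at e4
    have := Finset.card_le_card e2
    omega
  · have e1 := massOn_erase hs hv (h0 v hv)
    have e2 := massOn_erase (S := S.erase v) (fun p hp q hq => hs p (Finset.mem_of_mem_erase hp) q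
      (Finset.mem_of_mem_erase hq)) hu' (h0 u hu)
    have e3 := massOn_mono (adj := adj) h'
    have e4 := degOn_le_sum (adj := adj) (S := S) v
    have e5 := degOn_le_sum (adj := adj) (S := S.erase v) u
    have e6 : degOn adj S u ≤ degOn adj (S.erase v) u + 1 := by
      unfold degOn
      rw [Finset.filter_erase]
      have := Finset.pred_card_le_card_erase (s := S.filter fun q => adj u q ≠ 0) (a := v)
      omega
    have := h3 v hv
    have := h3 u hu
    omega

/-- Deleting `u`, and adding an edge of weight at most two between two of its neighbours, changes
neither the number of vertices of degree three nor the mass for the worse. -/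
theorem erase_add_edge (hs : ∀ p ∈ S, ∀ q ∈ S, adj p q = adj q p) {u a b : ℕ} (hu : u ∈ S)
    (h0 : adj u u = 0) (h' : S' ⊆ S.erase u) (hab : a ≠ b)
    (ha : a ∈ S' → adj u a ≠ 0) (hb : b ∈ S' → adj u b ≠ 0)
    (hadj : ∀ p ∈ S', ∀ q ∈ S', adj' p q =
      if (p = a ∧ q = b ∨ p = b ∧ q = a) ∧ adj p q = 0 then 2 else adj p q) :
    (∀ p ∈ S', degOn adj' S' p ≤ degOn adj S p) ∧ bigOn adj' S' ≤ bigOn adj S ∧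
      massOn adj' S' ≤ massOn adj S := by
  have hsub : S' ⊆ S := h'.trans (Finset.erase_subset _ _)
  have hdeg : ∀ p ∈ S', degOn adj' S' p ≤ degOn adj S p := by
    intro p hp
    by_cases hpab : (p = a ∧ b ∈ S') ∨ (p = b ∧ a ∈ S')
    · have key : ∀ q, (p = a ∧ q = b ∨ p = b ∧ q = a) → q ∈ S' →
          degOn adj' S' p ≤ degOn adj S p := by
        intro q hpq hq
        have hup : adj p u ≠ 0 := by
          rw [hs p (hsub hp) u hu]
          rcases hpq with ⟨rfl, -⟩ | ⟨rfl, -⟩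
          · exact ha hp
          · exact hb hp
        have e1 := degOn_erase_lt p hu hup h'
        have e2 : (S'.filter fun q => adj' p q ≠ 0) ⊆ insert q (S'.filter fun q => adj p q ≠ 0) := by
          intro r hr
          obtain ⟨hr1, hr2⟩ := Finset.mem_filter.1 hr
          rw [hadj p hp r hr1] at hr2
          simp only [Finset.mem_insert, Finset.mem_filter]
          by_cases hrq : r = q
          · exact .inl hrq
          · right
            refine ⟨hr1, ?_⟩
            rw [if_neg] at hr2
            · exact hr2
            · rintro ⟨h1, -⟩
              rcases hpq with ⟨rfl, rfl⟩ | ⟨rfl, rfl⟩ <;> rcases h1 with ⟨h1, h2⟩ | ⟨h1, h2⟩ <;>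
                first | exact hrq h2 | exact hab h1 | exact hab h1.symm
        have e3 := (Finset.card_le_card e2).trans (Finset.card_insert_le _ _)
        unfold degOn at e1 ⊢
        omega
      rcases hpab with ⟨h1, h2⟩ | ⟨h1, h2⟩
      · exact key b (.inl ⟨h1, rfl⟩) h2
      · exact key a (.inr ⟨h1, rfl⟩) h2
    · refine le_trans (Finset.card_le_card fun q hq => ?_) (degOn_mono hsub p)
      obtain ⟨hq1, hq2⟩ := Finset.mem_filter.1 hq
      rw [hadj p hp q hq1, if_neg] at hq2
      · exact Finset.mem_filter.2 ⟨hq1, hq2⟩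
      · rintro ⟨⟨h1, h2⟩ | ⟨h1, h2⟩, -⟩
        · exact hpab (.inl ⟨h1, h2 ▸ hq1⟩)
        · exact hpab (.inr ⟨h1, h2 ▸ hq1⟩)
  refine ⟨hdeg, ?_, ?_⟩
  · refine Finset.card_le_card fun p hp => ?_
    obtain ⟨hp1, hp2⟩ := Finset.mem_filter.1 hp
    exact Finset.mem_filter.2 ⟨hsub hp1, hp2.trans (hdeg p hp1)⟩
  · have e1 := massOn_erase hs hu h0
    have e2 := massOn_mono (adj := adj) h'
    by_cases hab' : a ∈ S' ∧ b ∈ S'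
    · obtain ⟨ha', hb'⟩ := hab'
      have e3 : massOn adj' S' ≤ massOn adj S' + 4 := by
        have : massOn adj' S' ≤ ∑ p ∈ S', ∑ q ∈ S', (adj p q +
            ((if q = b then if p = a then 2 else 0 else 0) +
              (if q = a then if p = b then 2 else 0 else 0))) := by
          refine Finset.sum_le_sum fun p hp => Finset.sum_le_sum fun q hq => ?_
          rw [hadj p hp q hq]
          split_ifs <;> omega
        refine this.trans ?_
        simp only [Finset.sum_add_distrib, Finset.sum_ite_eq', ha', hb', if_true]
        simp [massOn]
      have e4 : adj u a + adj u b ≤ ∑ q ∈ S, adj u q := by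
        rw [← Finset.sum_pair hab]
        refine Finset.sum_le_sum_of_subset fun p hp => ?_
        simp only [Finset.mem_insert, Finset.mem_singleton] at hp
        rcases hp with rfl | rfl
        · exact hsub ha'
        · exact hsub hb'
      have := ha ha'
      have := hb hb'
      omega
    · have e3 : massOn adj' S' = massOn adj S' := by
        refine Finset.sum_congr rfl fun p hp => Finset.sum_congr rfl fun q hq => ?_
        rw [hadj p hp q hq, if_neg]
        rintro ⟨⟨h1, h2⟩ | ⟨h1, h2⟩, -⟩
        · exact hab' ⟨h1 ▸ hp, h2 ▸ hq⟩
        · exact hab' ⟨h2 ▸ hq, h1 ▸ hp⟩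
      omega

/-! ### Configurations -/

/-- A configuration of the search. There are `n + 3` vertices: the `n` vertices of the graph, two
auxiliary vertices `n` and `n + 1` whose value is always `0`, and `n + 2`, which is always
eliminated. A vertex is free (`st = 0`), fixed to the value `y` (`st = 1`) or eliminated (`st = 2`).
The table `f p q` is the cost of the values of `p` and `q`. Adjacency of free vertices is recorded
by `adj`: `0` stands for no edge, `1` for an edge of which the value `1` is needed at some end, and
`2` for any other edge. The other fields record the eliminations: in the `i`-th one, `eu i` and
`ev i` were eliminated, and when `ea i` and `eb i` have the values `r` and `s`, their best values
are `ru i r s` and `rv i r s`. The phase of the search is `mode`: `0` as long as vertices of degree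
at least four are branched on, `1` after that, and `2` if the first phase has shown that there is no
solution. -/
structure Cfg where
  st : ℕ → ℕ
  y : ℕ → ℕ
  adj : ℕ → ℕ → ℕ
  f : ℕ → ℕ → ℕ → ℕ → ℝ
  mode : ℕ
  cnt : ℕ
  eu : ℕ → ℕ
  ev : ℕ → ℕ
  ea : ℕ → ℕ
  eb : ℕ → ℕ
  ru : ℕ → ℕ → ℕ → ℕ
  rv : ℕ → ℕ → ℕ → ℕ

namespace Cfg

/-- The free vertices. -/
def free (n : ℕ) (c : Cfg) : Finset ℕ := (Finset.range n).filter fun v => c.st v = 0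

/-- The cost of the values `z`. -/
def cost (n : ℕ) (c : Cfg) (z : ℕ → ℕ) : ℝ :=
  ∑ p ∈ Finset.range (n + 3), ∑ q ∈ Finset.range (n + 3),
    if c.st p ≠ 2 ∧ c.st q ≠ 2 then c.f p q (z p) (z q) else 0

/-- The part of the cost of the values `z` that involves `u` or `v`. -/
def touch (n : ℕ) (c : Cfg) (u v : ℕ) (z : ℕ → ℕ) : ℝ :=
  ∑ p ∈ Finset.range (n + 3), ∑ q ∈ Finset.range (n + 3),
    if (c.st p ≠ 2 ∧ c.st q ≠ 2) ∧ (p = u ∨ p = v ∨ q = u ∨ q = v) then c.f p q (z p) (z q) else 0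

/-- The part of the cost of the values `z` that does not involve `u` and `v`. -/
def rest (n : ℕ) (c : Cfg) (u v : ℕ) (z : ℕ → ℕ) : ℝ :=
  ∑ p ∈ Finset.range (n + 3), ∑ q ∈ Finset.range (n + 3),
    if (c.st p ≠ 2 ∧ c.st q ≠ 2) ∧ ¬ (p = u ∨ p = v ∨ q = u ∨ q = v)
      then c.f p q (z p) (z q) else 0

/-- Extends values of the vertices that are not eliminated to the vertices that were eliminated in
the first `i` eliminations. -/
def recon (c : Cfg) : ℕ → (ℕ → ℕ) → ℕ → ℕ
  | 0, z => z
  | i + 1, z => c.recon i (Function.update (Function.update z (c.eu i)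
      (c.ru i (z (c.ea i)) (z (c.eb i)))) (c.ev i) (c.rv i (z (c.ea i)) (z (c.eb i))))

/-- The values `z` are Boolean and extend those of the fixed vertices. -/
def Compat (n : ℕ) (c : Cfg) (z : ℕ → ℕ) : Prop :=
  ∀ v < n + 3, z v ≤ 1 ∧ (c.st v = 1 → z v = c.y v)

/-- The invariant of the search, for the cost function `F₀` of the instance. Values that violate an
edge with `adj p q = 1` cost more than the bound `W`. By `cost_recon`, the cost in the configuration
is the cost in the instance after the values of the eliminated vertices have been filled in. -/
structure Inv (n : ℕ) (W : ℝ) (F₀ : (ℕ → ℕ) → ℝ) (c : Cfg) : Prop where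
  st_n : c.st n = 1
  st_n1 : c.st (n + 1) = 1
  st_n2 : c.st (n + 2) = 2
  st_le : ∀ v < n + 3, c.st v ≤ 2
  y_n : c.y n = 0
  y_n1 : c.y (n + 1) = 0
  y_le : ∀ v < n + 3, c.y v ≤ 1
  adj_symm : ∀ p < n + 3, ∀ q < n + 3, c.adj p q = c.adj q p
  adj_self : ∀ p < n + 3, c.adj p p = 0
  adj_le : ∀ p < n + 3, ∀ q < n + 3, c.adj p q ≤ 2
  adj_n2 : ∀ q < n + 3, c.adj (n + 2) q = 0
  f_nonneg : ∀ p < n + 3, ∀ q < n + 3, ∀ r ≤ 1, ∀ s ≤ 1, 0 ≤ c.f p q r s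
  f_zero : ∀ p < n + 3, ∀ q < n + 3, c.st p = 0 → c.st q = 0 → c.adj p q = 0 →
    ∀ r ≤ 1, ∀ s ≤ 1, c.f p q r s = 0
  f_hard : ∀ p < n + 3, ∀ q < n + 3, c.st p = 0 → c.st q = 0 → c.adj p q = 1 →
    W + 1 ≤ c.f p q 0 0
  elim_lt : ∀ i < c.cnt, c.eu i < n + 3 ∧ c.ev i < n + 3 ∧ c.ea i < n + 3 ∧ c.eb i < n + 3
  elim_le : ∀ i < c.cnt, ∀ r ≤ 1, ∀ s ≤ 1, c.ru i r s ≤ 1 ∧ c.rv i r s ≤ 1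
  cost_recon : ∀ z, Compat n c z → F₀ (c.recon c.cnt z) = c.cost n z
  mode_zero : c.mode = 0 → ∀ p ∈ c.free n, ∀ q ∈ c.free n, c.adj p q ≤ 1
  mode_pos : c.mode ≠ 0 → ∀ p ∈ c.free n, degOn c.adj (c.free n) p ≤ 3

/-- The number of vertices that are fixed to the value `1`. -/
def ones (n : ℕ) (c : Cfg) : ℕ := ((Finset.range n).filter fun v => c.st v = 1 ∧ c.y v = 1).card

/-- Some edge between free vertices needs the value `1` at one end. -/
def Hard (n : ℕ) (c : Cfg) : Prop := ∃ p ∈ c.free n, ∃ q ∈ c.free n, c.adj p q = 1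

open Classical in
/-- The potential: the search tree has at most `base ^ pot` leaves, with `base ^ 78 = 1.381`. In the
first phase it is `78` for each vertex that may still be chosen; with the summand `4`, a branch that
fixes four vertices to `1` counts in full even if it overshoots `k`. -/
def pot (n k : ℕ) (c : Cfg) : ℕ :=
  if c.mode = 0 then 78 * (k + 4 - c.ones n)
  else if c.mode = 1 then
    if c.Hard n then 36 * bigOn c.adj (c.free n) + massOn c.adj (c.free n)
    else 42 * bigOn c.adj (c.free n)
  else 0

/-- The configuration still admits a solution, in the first phase one of size at most `k`. The size
plays no role later, when the number of edges bounds the search. -/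
def Good (n k : ℕ) (W : ℝ) (c : Cfg) : Prop :=
  c.mode ≤ 1 ∧ ∃ z, Compat n c z ∧ c.cost n z ≤ W ∧
    (c.mode = 0 → ((Finset.range n).filter fun v => z v = 1).card ≤ k)

/-- Bounds the number of steps that remain. -/
def todo (n : ℕ) (c : Cfg) : ℕ := (c.free n).card + if c.mode = 0 then 1 else 0

/-- The vertices `u` and `v` may be eliminated at the price of a new table for `a` and `b`. The
value `v = n + 2` serves to eliminate only `u`, and `a` or `b` may be an auxiliary vertex. -/
structure CanElim (n : ℕ) (c : Cfg) (u v a b : ℕ) : Prop where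
  hu : u < n
  hv : v < n + 3
  ha : a < n + 3
  hb : b < n + 3
  st_u : c.st u = 0
  st_v : c.st v = 0 ∨ v = n + 2
  huv : u ≠ v
  hab : a ≠ b
  hau : a ≠ u
  hav : a ≠ v
  hbu : b ≠ u
  hbv : b ≠ v
  st_a : (c.st a = 0 ∧ c.adj u a ≠ 0) ∨ a = n ∨ a = n + 1
  st_b : (c.st b = 0 ∧ c.adj u b ≠ 0) ∨ b = n ∨ b = n + 1
  nbr : ∀ w < n, c.st w = 0 → (c.adj u w ≠ 0 ∨ c.adj v w ≠ 0) → w = u ∨ w = v ∨ w = a ∨ w = b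

/-- The values `y`, changed at `a`, `b`, `u` and `v`. -/
def env (y : ℕ → ℕ) (a b u v p q r s : ℕ) : ℕ → ℕ :=
  Function.update (Function.update (Function.update (Function.update y a p) b q) u r) v s

/-- The configuration `c'` arises from `c` by the elimination of `u` and `v`. -/
structure IsElim (n : ℕ) (c c' : Cfg) (u v a b : ℕ) : Prop where
  st : ∀ p < n + 3, c'.st p = if p = u ∨ p = v then 2 else c.st p
  y_le : ∀ p < n + 3, c'.y p ≤ 1
  y_eq : ∀ p < n + 3, c.st p = 1 → c'.y p = c.y p
  adj : ∀ p < n + 3, ∀ q < n + 3, c'.adj p q =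
    if (p = a ∧ q = b ∨ p = b ∧ q = a) ∧ c.adj p q = 0 then 2 else c.adj p q
  f : ∀ p < n + 3, ∀ q < n + 3, ∀ r ≤ 1, ∀ s ≤ 1, c'.f p q r s = if p = a ∧ q = b then
    c.f p q r s + c.touch n u v (env c.y a b u v r s (c'.ru c.cnt r s) (c'.rv c.cnt r s))
    else c.f p q r s
  mode : c'.mode = c.mode
  cnt : c'.cnt = c.cnt + 1
  eu : c'.eu c.cnt = u
  ev : c'.ev c.cnt = v
  ea : c'.ea c.cnt = a
  eb : c'.eb c.cnt = b
  old : ∀ i < c.cnt, c'.eu i = c.eu i ∧ c'.ev i = c.ev i ∧ c'.ea i = c.ea i ∧ c'.eb i = c.eb i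
  old_r : ∀ i < c.cnt, ∀ r ≤ 1, ∀ s ≤ 1, c'.ru i r s = c.ru i r s ∧ c'.rv i r s = c.rv i r s
  r_le : ∀ r ≤ 1, ∀ s ≤ 1, c'.ru c.cnt r s ≤ 1 ∧ c'.rv c.cnt r s ≤ 1
  opt : ∀ p ≤ 1, ∀ q ≤ 1, ∀ r ≤ 1, ∀ s ≤ 1,
    c.touch n u v (env c.y a b u v p q (c'.ru c.cnt p q) (c'.rv c.cnt p q)) ≤
      c.touch n u v (env c.y a b u v p q r s)

/-- The configuration `c'` arises from `c` by fixing `v` to the value `bit` and, if `bit = 0`, the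
neighbours that `v` needs to the value `1`. -/
structure IsFix (n : ℕ) (c c' : Cfg) (v bit : ℕ) : Prop where
  st : ∀ p < n + 3, c'.st p =
    if p = v ∨ (bit = 0 ∧ p < n ∧ c.st p = 0 ∧ c.adj v p = 1) then 1 else c.st p
  y : ∀ p < n + 3, c'.y p = if p = v then bit else
    if bit = 0 ∧ p < n ∧ c.st p = 0 ∧ c.adj v p = 1 then 1 else c.y p
  adj : c'.adj = c.adj
  f : c'.f = c.f
  mode : c'.mode = c.mode
  cnt : c'.cnt = c.cnt
  eu : c'.eu = c.eu
  ev : c'.ev = c.ev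
  ea : c'.ea = c.ea
  eb : c'.eb = c.eb
  ru : c'.ru = c.ru
  rv : c'.rv = c.rv

variable {n k : ℕ} {W : ℝ} {F₀ : (ℕ → ℕ) → ℝ} {c c' : Cfg} {u v a b : ℕ}

theorem mem_free {p : ℕ} : p ∈ c.free n ↔ p < n ∧ c.st p = 0 := by simp [free]

theorem Inv.lt (h : Inv n W F₀ c) {p : ℕ} (hp : p < n + 3) (h0 : c.st p = 0) : p < n := by
  have h1 := h.st_n
  have h2 := h.st_n1
  have h3 := h.st_n2
  by_contra hlt
  obtain rfl | rfl | rfl : p = n ∨ p = n + 1 ∨ p = n + 2 := by omega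
  all_goals omega

theorem cost_eq (z : ℕ → ℕ) : c.cost n z = c.touch n u v z + c.rest n u v z := by
  unfold cost touch rest
  simp only [← Finset.sum_add_distrib]
  refine Finset.sum_congr rfl fun p _ => Finset.sum_congr rfl fun q _ => ?_
  by_cases h1 : c.st p ≠ 2 ∧ c.st q ≠ 2 <;> by_cases h2 : p = u ∨ p = v ∨ q = u ∨ q = v <;>
    simp [h1, h2]

/-- Since `u` and `v` have no free neighbours except for `a` and `b`, the costs that involve them
depend only on the values of `u`, `v`, `a`, `b` and of the fixed vertices. -/
theorem CanElim.touch_congr (h : Inv n W F₀ c) (he : CanElim n c u v a b) {z z' : ℕ → ℕ}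
    (hz : ∀ p < n + 3, z p ≤ 1) (hz' : ∀ p < n + 3, z' p ≤ 1)
    (hfix : ∀ p < n + 3, c.st p ≠ 0 → c.st p ≠ 2 → z p = z' p)
    (hu : z u = z' u) (hv : z v = z' v) (ha : z a = z' a) (hb : z b = z' b) :
    c.touch n u v z = c.touch n u v z' := by
  unfold touch
  refine Finset.sum_congr rfl fun p hp => Finset.sum_congr rfl fun q hq => ?_
  rw [Finset.mem_range] at hp hq
  split_ifs with hc
  · obtain ⟨⟨h1, h2⟩, h3⟩ := hc
    have hun : u < n + 3 := by have := he.hu; omega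
    have st_v : ∀ w, w = v → c.st w ≠ 2 → c.st w = 0 := by
      rintro w rfl hw
      rcases he.st_v with h' | h'
      · exact h'
      · rw [h'] at hw; exact absurd h.st_n2 hw
    -- values differ only at free vertices that are adjacent neither to `u` nor to `v`
    have key : ∀ w < n + 3, c.st w ≠ 2 → z w = z' w ∨
        (c.st w = 0 ∧ c.adj u w = 0 ∧ c.adj v w = 0) := by
      intro w hw hw2
      by_cases hw0 : c.st w = 0
      · by_cases hadj : c.adj u w ≠ 0 ∨ c.adj v w ≠ 0
        · left
          rcases he.nbr w (h.lt hw hw0) hw0 hadj with rfl | rfl | rfl | rfl <;> assumption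
        · push Not at hadj
          exact .inr ⟨hw0, hadj⟩
      · exact .inl (hfix w hw hw0 hw2)
    have zero : ∀ w w', w < n + 3 → w' < n + 3 → c.st w ≠ 2 → (w = u ∨ w = v) → c.st w' = 0 →
        c.adj u w' = 0 → c.adj v w' = 0 → c.f w w' (z w) (z w') = c.f w w' (z' w) (z' w') ∧
          c.f w' w (z w') (z w) = c.f w' w (z' w') (z' w) := by
      intro w w' hw hw' hw2 huv hw0 hau hav
      have hs : c.st w = 0 := by
        rcases huv with rfl | rfl
        · exact he.st_u
        · exact st_v _ rfl hw2
      have had : c.adj w w' = 0 := by rcases huv with rfl | rfl <;> assumption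
      have had' : c.adj w' w = 0 := by rw [h.adj_symm _ hw' _ hw]; exact had
      constructor
      · rw [h.f_zero w hw w' hw' hs hw0 had _ (hz _ hw) _ (hz _ hw'),
          h.f_zero w hw w' hw' hs hw0 had _ (hz' _ hw) _ (hz' _ hw')]
      · rw [h.f_zero w' hw' w hw hw0 hs had' _ (hz _ hw') _ (hz _ hw),
          h.f_zero w' hw' w hw hw0 hs had' _ (hz' _ hw') _ (hz' _ hw)]
    by_cases hpuv : p = u ∨ p = v
    · have hzp : z p = z' p := by rcases hpuv with rfl | rfl <;> assumption
      rcases key q hq h2 with h4 | ⟨h4, h5, h6⟩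
      · rw [hzp, h4]
      · exact (zero p q hp hq h1 hpuv h4 h5 h6).1
    · have hquv : q = u ∨ q = v := by tauto
      have hzq : z q = z' q := by rcases hquv with rfl | rfl <;> assumption
      rcases key p hp h1 with h4 | ⟨h4, h5, h6⟩
      · rw [hzq, h4]
      · exact (zero q p hq hp h2 hquv h4 h5 h6).2
  · rfl

theorem rest_update {z : ℕ → ℕ} (r s : ℕ) :
    c.rest n u v (Function.update (Function.update z u r) v s) = c.rest n u v z := by
  unfold rest
  refine Finset.sum_congr rfl fun p _ => Finset.sum_congr rfl fun q _ => ?_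
  split_ifs with hc
  · obtain ⟨-, h⟩ := hc
    push Not at h
    simp [h]
  · rfl

theorem touch_nonneg (h : Inv n W F₀ c) {z : ℕ → ℕ} (hz : ∀ p < n + 3, z p ≤ 1) :
    0 ≤ c.touch n u v z := by
  refine Finset.sum_nonneg fun p hp => Finset.sum_nonneg fun q hq => ?_
  rw [Finset.mem_range] at hp hq
  split_ifs
  · exact h.f_nonneg p hp q hq _ (hz p hp) _ (hz q hq)
  · rfl

theorem env_le {y : ℕ → ℕ} {p q r s : ℕ} (hy : ∀ w < n + 3, y w ≤ 1) (hp : p ≤ 1) (hq : q ≤ 1)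
    (hr : r ≤ 1) (hs : s ≤ 1) : ∀ w < n + 3, env y a b u v p q r s w ≤ 1 := by
  intro w hw
  have := hy w hw
  simp only [env, Function.update_apply]
  split_ifs <;> assumption

/-- An elimination does not change the records of earlier ones. -/
theorem recon_congr : ∀ i ≤ c.cnt, Inv n W F₀ c → IsElim n c c' u v a b → ∀ z,
    (∀ w < n + 3, z w ≤ 1) → c'.recon i z = c.recon i z
  | 0, _, _, _, z, _ => rfl
  | i + 1, hi, h, he, z, hz => by
    obtain ⟨h1, h2, h3, h4⟩ := he.old i (by omega)
    obtain ⟨e1, e2, e3, e4⟩ := h.elim_lt i (by omega)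
    obtain ⟨h5, h6⟩ := he.old_r i (by omega) _ (hz _ e3) _ (hz _ e4)
    obtain ⟨h7, h8⟩ := h.elim_le i (by omega) _ (hz _ e3) _ (hz _ e4)
    simp only [recon, h1, h2, h3, h4, h5, h6]
    refine recon_congr i (by omega) h he _ fun w hw => ?_
    have := hz w hw
    simp only [Function.update_apply]
    split_ifs <;> assumption

/-- Elimination replaces the values of `u` and `v` by the best ones. -/
theorem IsElim.cost_eq (h : Inv n W F₀ c) (hc : CanElim n c u v a b)
    (he : IsElim n c c' u v a b) {z : ℕ → ℕ} (hz : Compat n c' z) :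
    c'.cost n z = c.cost n (Function.update (Function.update z u (c'.ru c.cnt (z a) (z b))) v
      (c'.rv c.cnt (z a) (z b))) := by
  obtain ⟨hr1, hr2⟩ := he.r_le _ (hz a hc.ha).1 _ (hz b hc.hb).1
  rw [Cfg.cost_eq (c := c) (u := u) (v := v), rest_update]
  have h1 : c.touch n u v (Function.update (Function.update z u (c'.ru c.cnt (z a) (z b))) v
      (c'.rv c.cnt (z a) (z b))) = c.touch n u v
      (env c.y a b u v (z a) (z b) (c'.ru c.cnt (z a) (z b)) (c'.rv c.cnt (z a) (z b))) := by
    refine hc.touch_congr h ?_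
      (env_le h.y_le (hz a hc.ha).1 (hz b hc.hb).1 hr1 hr2) ?_ ?_ ?_ ?_ ?_
    · intro w hw
      have := (hz w hw).1
      simp only [Function.update_apply]
      split_ifs <;> assumption
    · intro w hw hw0 hw2
      simp only [env, Function.update_apply]
      split_ifs with e1 e2 e3 e4
      · rfl
      · rfl
      · rw [e3]
      · rw [e4]
      · have hst := he.st w hw
        rw [if_neg (by tauto)] at hst
        by_cases hw1 : c.st w = 1
        · rw [(hz w hw).2 (by rw [hst, hw1]), he.y_eq w hw hw1]
        · have := h.st_le w hw
          omega
    · simp [env, hc.huv]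
    · simp [env]
    · simp [env, hc.hau, hc.hav, hc.hab]
    · simp [env, hc.hbu, hc.hbv]
  rw [h1]
  have h2 : c'.cost n z = ∑ p ∈ Finset.range (n + 3), ∑ q ∈ Finset.range (n + 3),
      ((if (c.st p ≠ 2 ∧ c.st q ≠ 2) ∧ ¬ (p = u ∨ p = v ∨ q = u ∨ q = v)
        then c.f p q (z p) (z q) else 0) + if q = b then if p = a then c.touch n u v
      (env c.y a b u v (z a) (z b) (c'.ru c.cnt (z a) (z b)) (c'.rv c.cnt (z a) (z b))) else 0
        else 0) := by
    refine Finset.sum_congr rfl fun p hp => Finset.sum_congr rfl fun q hq => ?_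
    rw [Finset.mem_range] at hp hq
    have sta : ∀ w, ((c.st w = 0 ∧ c.adj u w ≠ 0) ∨ w = n ∨ w = n + 1) → c.st w ≠ 2 := by
      rintro w (hw | rfl | rfl)
      · omega
      · rw [h.st_n]; omega
      · rw [h.st_n1]; omega
    rw [he.st p hp, he.st q hq, he.f p hp q hq _ (hz p hp).1 _ (hz q hq).1]
    by_cases hpa : p = a ∧ q = b
    · obtain ⟨rfl, rfl⟩ := hpa
      have e1 := sta p hc.st_a
      have e2 := sta q hc.st_b
      have e3 := hc.hau
      have e4 := hc.hav
      have e5 := hc.hbu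
      have e6 := hc.hbv
      simp [e1, e2, e3, e4, e5, e6]
    · have e0 : (if q = b then if p = a then c.touch n u v
        (env c.y a b u v (z a) (z b) (c'.ru c.cnt (z a) (z b)) (c'.rv c.cnt (z a) (z b))) else 0
        else 0) = (0 : ℝ) := by
        split_ifs <;> tauto
      rw [e0, if_neg hpa, add_zero]
      by_cases e1 : p = u ∨ p = v <;> by_cases e2 : q = u ∨ q = v <;> simp [e1, e2]
  rw [h2]
  simp only [Finset.sum_add_distrib, Finset.sum_ite_eq', Finset.mem_range, hc.ha, hc.hb, if_true]
  rw [add_comm]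
  rfl

end Cfg

namespace Cfg

variable {n k : ℕ} {W : ℝ} {F₀ : (ℕ → ℕ) → ℝ} {c c' : Cfg} {u v a b : ℕ}

/-! ### Elimination -/

theorem Inv.adj_symm_free (h : Inv n W F₀ c) :
    ∀ p ∈ c.free n, ∀ q ∈ c.free n, c.adj p q = c.adj q p := by
  intro p hp q hq
  rw [mem_free] at hp hq
  exact h.adj_symm p (by omega) q (by omega)

theorem Inv.adj_self_free (h : Inv n W F₀ c) : ∀ p ∈ c.free n, c.adj p p = 0 := by
  intro p hp
  rw [mem_free] at hp
  exact h.adj_self p (by omega)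

theorem IsElim.free_sub (he : IsElim n c c' u v a b) : c'.free n ⊆ (c.free n).erase u := by
  intro p hp
  obtain ⟨h1, h2⟩ := mem_free.1 hp
  rw [he.st p (by omega)] at h2
  split_ifs at h2 with h3
  push Not at h3
  exact Finset.mem_erase.2 ⟨h3.1, mem_free.2 ⟨h1, h2⟩⟩

theorem CanElim.mem_free (hc : CanElim n c u v a b) : u ∈ c.free n :=
  Cfg.mem_free.2 ⟨hc.hu, hc.st_u⟩

/-- An elimination increases no degree, and the mass does not grow: the edges of `u` that disappear
weigh at least as much as the new edge of weight two between `a` and `b`. -/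
theorem IsElim.graph (h : Inv n W F₀ c) (hc : CanElim n c u v a b)
    (he : IsElim n c c' u v a b) :
    (∀ p ∈ c'.free n, degOn c'.adj (c'.free n) p ≤ degOn c.adj (c.free n) p) ∧
      bigOn c'.adj (c'.free n) ≤ bigOn c.adj (c.free n) ∧
      massOn c'.adj (c'.free n) ≤ massOn c.adj (c.free n) := by
  have key : ∀ w, ((c.st w = 0 ∧ c.adj u w ≠ 0) ∨ w = n ∨ w = n + 1) → w ∈ c'.free n →
      c.adj u w ≠ 0 := by
    rintro w (hw | rfl | rfl) hw'
    · exact hw.2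
    · simp [Cfg.mem_free] at hw'
    · simp [Cfg.mem_free] at hw'
  refine erase_add_edge h.adj_symm_free hc.mem_free (h.adj_self_free _ hc.mem_free) he.free_sub
    hc.hab (key a hc.st_a) (key b hc.st_b) fun p hp q hq => ?_
  rw [Cfg.mem_free] at hp hq
  exact he.adj p (by omega) q (by omega)

theorem IsElim.inv (h : Inv n W F₀ c) (hm : c.mode ≠ 0) (hc : CanElim n c u v a b)
    (he : IsElim n c c' u v a b) : Inv n W F₀ c' := by
  have hlt : u < n + 3 := by have := hc.hu; omega
  have hsv : ∀ p, c.st p = 1 → ¬ (p = u ∨ p = v) := by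
    rintro p hp (rfl | rfl)
    · have := hc.st_u; omega
    · rcases hc.st_v with h' | rfl
      · omega
      · have := h.st_n2; omega
  have st0 : ∀ p < n + 3, c'.st p = 0 → c.st p = 0 := by
    intro p hp hp0
    rw [he.st p hp] at hp0
    split_ifs at hp0
    exact hp0
  have hmono : ∀ p < n + 3, ∀ q < n + 3, ∀ r ≤ 1, ∀ s ≤ 1, c.f p q r s ≤ c'.f p q r s := by
    intro p hp q hq r hr s hs
    rw [he.f p hp q hq r hr s hs]
    split_ifs
    · have := touch_nonneg (u := u) (v := v) h (env_le (a := a) (b := b) (u := u) (v := v) h.y_le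
        hr hs (he.r_le r hr s hs).1 (he.r_le r hr s hs).2)
      linarith
    · exact le_rfl
  have hn2a : ∀ w, ((c.st w = 0 ∧ c.adj u w ≠ 0) ∨ w = n ∨ w = n + 1) → n + 2 ≠ w := by
    rintro w (hw | rfl | rfl)
    · rintro rfl
      have := h.st_n2; omega
    · omega
    · omega
  refine
    { st_n := ?_, st_n1 := ?_, st_n2 := ?_, st_le := ?_, y_n := ?_, y_n1 := ?_, y_le := he.y_le
      adj_symm := ?_, adj_self := ?_, adj_le := ?_, adj_n2 := ?_, f_nonneg := ?_, f_zero := ?_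
      f_hard := ?_, elim_lt := ?_, elim_le := ?_, cost_recon := ?_, mode_zero := ?_
      mode_pos := ?_ }
  · rw [he.st n (by omega), if_neg (hsv n h.st_n), h.st_n]
  · rw [he.st (n + 1) (by omega), if_neg (hsv _ h.st_n1), h.st_n1]
  · rw [he.st (n + 2) (by omega)]
    split_ifs
    · rfl
    · exact h.st_n2
  · intro p hp
    rw [he.st p hp]
    split_ifs
    · rfl
    · exact h.st_le p hp
  · rw [he.y_eq n (by omega) h.st_n, h.y_n]
  · rw [he.y_eq (n + 1) (by omega) h.st_n1, h.y_n1]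
  · intro p hp q hq
    rw [he.adj p hp q hq, he.adj q hq p hp, h.adj_symm p hp q hq]
    congr 1
    apply propext
    tauto
  · intro p hp
    rw [he.adj p hp p hp, if_neg, h.adj_self p hp]
    rintro ⟨⟨h1, h2⟩ | ⟨h1, h2⟩, -⟩
    · exact hc.hab (h1.symm.trans h2)
    · exact hc.hab (h2.symm.trans h1)
  · intro p hp q hq
    rw [he.adj p hp q hq]
    split_ifs
    · rfl
    · exact h.adj_le p hp q hq
  · intro q hq
    rw [he.adj _ (by omega) q hq, if_neg, h.adj_n2 q hq]
    rintro ⟨⟨h1, -⟩ | ⟨h1, -⟩, -⟩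
    · exact hn2a a hc.st_a h1
    · exact hn2a b hc.st_b h1
  · intro p hp q hq r hr s hs
    exact (h.f_nonneg p hp q hq r hr s hs).trans (hmono p hp q hq r hr s hs)
  · intro p hp q hq hp0 hq0 hadj r hr s hs
    rw [he.adj p hp q hq] at hadj
    split_ifs at hadj with h1
    rw [he.f p hp q hq r hr s hs, if_neg]
    · exact h.f_zero p hp q hq (st0 p hp hp0) (st0 q hq hq0) hadj r hr s hs
    · intro h2
      exact h1 ⟨.inl h2, hadj⟩
  · intro p hp q hq hp0 hq0 hadj
    rw [he.adj p hp q hq] at hadj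
    split_ifs at hadj
    · omega
    exact (h.f_hard p hp q hq (st0 p hp hp0) (st0 q hq hq0) hadj).trans
      (hmono p hp q hq 0 (by omega) 0 (by omega))
  · intro i hi
    rw [he.cnt] at hi
    rcases Nat.lt_succ_iff_lt_or_eq.1 hi with hi | rfl
    · obtain ⟨h1, h2, h3, h4⟩ := he.old i hi
      rw [h1, h2, h3, h4]
      exact h.elim_lt i hi
    · rw [he.eu, he.ev, he.ea, he.eb]
      exact ⟨hlt, hc.hv, hc.ha, hc.hb⟩
  · intro i hi r hr s hs
    rw [he.cnt] at hi
    rcases Nat.lt_succ_iff_lt_or_eq.1 hi with hi | rfl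
    · obtain ⟨h1, h2⟩ := he.old_r i hi r hr s hs
      rw [h1, h2]
      exact h.elim_le i hi r hr s hs
    · exact he.r_le r hr s hs
  -- undoing this elimination first reduces to the invariant of `c`
  · intro z hz
    obtain ⟨hr1, hr2⟩ := he.r_le _ (hz a hc.ha).1 _ (hz b hc.hb).1
    have hz1 : ∀ w < n + 3, Function.update (Function.update z u (c'.ru c.cnt (z a) (z b))) v
        (c'.rv c.cnt (z a) (z b)) w ≤ 1 := by
      intro w hw
      have := (hz w hw).1
      simp only [Function.update_apply]
      split_ifs <;> assumption
    rw [he.cost_eq h hc hz, he.cnt, recon, he.eu, he.ev, he.ea, he.eb,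
      recon_congr c.cnt le_rfl h he _ hz1]
    refine h.cost_recon _ fun w hw => ⟨hz1 w hw, fun hw1 => ?_⟩
    have h2 := hsv w hw1
    push Not at h2
    have h3 := he.st w hw
    rw [if_neg (by tauto)] at h3
    rw [Function.update_of_ne h2.2, Function.update_of_ne h2.1, (hz w hw).2 (by omega),
      he.y_eq w hw hw1]
  · intro h0
    exact absurd (he.mode ▸ h0) hm
  · intro _ p hp
    have h1 := Finset.mem_of_mem_erase (he.free_sub hp)
    exact ((he.graph h hc).1 p hp).trans (h.mode_pos hm p h1)

/-- The new table holds the minimum over all values of `u` and `v`, so it charges at most what the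
values `z` cost. -/
theorem IsElim.cost_le (h : Inv n W F₀ c) (hc : CanElim n c u v a b)
    (he : IsElim n c c' u v a b) {z : ℕ → ℕ} (hz : Compat n c z) (hz' : Compat n c' z) :
    c'.cost n z ≤ c.cost n z := by
  have hun : u < n + 3 := by have := hc.hu; omega
  rw [he.cost_eq h hc hz', Cfg.cost_eq (c := c) (u := u) (v := v), rest_update,
    Cfg.cost_eq (c := c) (u := u) (v := v) z]
  refine add_le_add_left ?_ _
  have hfix : ∀ w < n + 3, c.st w ≠ 0 → c.st w ≠ 2 → w ≠ u ∧ w ≠ v ∧ z w = c.y w := by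
    intro w hw hw0 hw2
    have := h.st_le w hw
    refine ⟨?_, ?_, (hz w hw).2 (by omega)⟩
    · rintro rfl
      exact hw0 hc.st_u
    · rintro rfl
      rcases hc.st_v with h' | rfl
      · exact hw0 h'
      · exact hw2 h.st_n2
  obtain ⟨hr1, hr2⟩ := he.r_le _ (hz a hc.ha).1 _ (hz b hc.hb).1
  have hfix' : ∀ r s : ℕ, ∀ w < n + 3, c.st w ≠ 0 → c.st w ≠ 2 →
      env c.y a b u v (z a) (z b) r s w = z w := by
    intro r s w hw hw0 hw2
    obtain ⟨h1, h2, h3⟩ := hfix w hw hw0 hw2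
    rw [env, Function.update_of_ne h2, Function.update_of_ne h1]
    simp only [Function.update_apply]
    split_ifs with e1 e2
    · rw [e1]
    · rw [e2]
    · exact h3.symm
  have h1 : c.touch n u v (Function.update (Function.update z u (c'.ru c.cnt (z a) (z b))) v
      (c'.rv c.cnt (z a) (z b))) = c.touch n u v
      (env c.y a b u v (z a) (z b) (c'.ru c.cnt (z a) (z b)) (c'.rv c.cnt (z a) (z b))) := by
    refine hc.touch_congr h ?_
      (env_le h.y_le (hz a hc.ha).1 (hz b hc.hb).1 hr1 hr2) ?_ ?_ ?_ ?_ ?_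
    · intro w hw
      have := (hz w hw).1
      simp only [Function.update_apply]
      split_ifs <;> assumption
    · intro w hw hw0 hw2
      obtain ⟨h1, h2, h3⟩ := hfix w hw hw0 hw2
      rw [hfix' _ _ w hw hw0 hw2, Function.update_of_ne h2, Function.update_of_ne h1]
    · simp [env, hc.huv]
    · simp [env]
    · simp [env, hc.hau, hc.hav, hc.hab]
    · simp [env, hc.hbu, hc.hbv]
  have h2 : c.touch n u v z = c.touch n u v (env c.y a b u v (z a) (z b) (z u) (z v)) := by
    refine hc.touch_congr h (fun w hw => (hz w hw).1) (env_le h.y_le (hz a hc.ha).1 (hz b hc.hb).1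
      (hz u hun).1 (hz v hc.hv).1) ?_ ?_ ?_ ?_ ?_
    · intro w hw hw0 hw2
      exact (hfix' _ _ w hw hw0 hw2).symm
    · simp [env, hc.huv]
    · simp [env]
    · simp [env, hc.hau, hc.hav, hc.hab]
    · simp [env, hc.hbu, hc.hbv]
  rw [h1, h2]
  exact he.opt _ (hz a hc.ha).1 _ (hz b hc.hb).1 _ (hz u hun).1 _ (hz v hc.hv).1

theorem IsElim.good (h : Inv n W F₀ c) (hm : c.mode = 1) (hc : CanElim n c u v a b)
    (he : IsElim n c c' u v a b) (hg : Good n k W c) : Good n k W c' := by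
  obtain ⟨-, z, hz, hW, -⟩ := hg
  have hz' : Compat n c' z := by
    intro w hw
    refine ⟨(hz w hw).1, fun hw1 => ?_⟩
    rw [he.st w hw] at hw1
    split_ifs at hw1
    · omega
    rw [(hz w hw).2 hw1, he.y_eq w hw hw1]
  refine ⟨by rw [he.mode, hm], z, hz', (he.cost_le h hc hz hz').trans hW, fun h0 => ?_⟩
  rw [he.mode, hm] at h0
  exact absurd h0 one_ne_zero

theorem IsElim.todo_lt (hc : CanElim n c u v a b)
    (he : IsElim n c c' u v a b) : c'.todo n < c.todo n := by
  have h1 := Finset.card_le_card he.free_sub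
  rw [Finset.card_erase_of_mem hc.mem_free] at h1
  have h2 := Finset.card_pos.2 ⟨u, hc.mem_free⟩
  unfold todo
  rw [he.mode]
  omega

theorem pot_zero (hm : c.mode = 0) : c.pot n k = 78 * (k + 4 - c.ones n) := by
  rw [pot, if_pos hm]

theorem pot_hard (hm : c.mode = 1) (hh : c.Hard n) :
    c.pot n k = 36 * bigOn c.adj (c.free n) + massOn c.adj (c.free n) := by
  rw [pot, if_neg (by omega), if_pos hm, if_pos hh]

theorem pot_soft (hm : c.mode = 1) (hh : ¬ c.Hard n) :
    c.pot n k = 42 * bigOn c.adj (c.free n) := by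
  rw [pot, if_neg (by omega), if_pos hm, if_neg hh]

theorem pot_le (hm : c.mode = 1) :
    c.pot n k ≤ 36 * bigOn c.adj (c.free n) + massOn c.adj (c.free n) := by
  by_cases hh : c.Hard n
  · exact (pot_hard hm hh).le
  · rw [pot_soft hm hh]
    have := six_mul_bigOn_le (adj := c.adj) (S := c.free n) fun p hp q hq h1 =>
      hh ⟨p, hp, q, hq, h1⟩
    omega

/-- New edges are never hard, so the absence of hard edges persists. -/
theorem IsElim.pot_le (h : Inv n W F₀ c) (hm : c.mode = 1) (hc : CanElim n c u v a b)
    (he : IsElim n c c' u v a b) : c'.pot n k ≤ c.pot n k := by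
  obtain ⟨-, h2, h3⟩ := he.graph h hc
  have hm' : c'.mode = 1 := he.mode.trans hm
  by_cases hh : c.Hard n
  · refine (Cfg.pot_le hm').trans ?_
    rw [pot_hard hm hh]
    omega
  · have hh' : ¬ c'.Hard n := by
      rintro ⟨p, hp, q, hq, hpq⟩
      have hp' := Finset.mem_of_mem_erase (he.free_sub hp)
      have hq' := Finset.mem_of_mem_erase (he.free_sub hq)
      rw [Cfg.mem_free] at hp hq
      rw [he.adj p (by omega) q (by omega)] at hpq
      split_ifs at hpq
      · omega
      exact hh ⟨p, hp', q, hq', hpq⟩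
    rw [pot_soft hm hh, pot_soft hm' hh']
    omega

/-! ### Branching -/

theorem IsFix.free_sub {bit : ℕ} (he : IsFix n c c' v bit) :
    c'.free n ⊆ (c.free n).erase v := by
  intro p hp
  obtain ⟨h1, h2⟩ := Cfg.mem_free.1 hp
  rw [he.st p (by omega)] at h2
  split_ifs at h2 with h3
  push Not at h3
  exact Finset.mem_erase.2 ⟨h3.1, Cfg.mem_free.2 ⟨h1, h2⟩⟩

theorem IsFix.free_sub_zero (he : IsFix n c c' v 0) {w : ℕ} (hw : w ∈ c.free n)
    (hvw : c.adj v w = 1) : c'.free n ⊆ ((c.free n).erase v).erase w := by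
  intro p hp
  refine Finset.mem_erase.2 ⟨?_, he.free_sub hp⟩
  rintro rfl
  obtain ⟨h1, h2⟩ := Cfg.mem_free.1 hp
  rw [he.st p (by omega), if_pos (.inr ⟨rfl, h1, (Cfg.mem_free.1 hw).2, hvw⟩)] at h2
  omega

theorem IsFix.st_one_of {bit : ℕ} (he : IsFix n c c' v bit) {p : ℕ} (hp : p < n + 3)
    (h1 : c.st p = 1) : c'.st p = 1 := by
  rw [he.st p hp]
  split_ifs
  · rfl
  · exact h1

theorem IsFix.inv {bit : ℕ} (h : Inv n W F₀ c) (hv : v ∈ c.free n) (hbit : bit ≤ 1)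
    (he : IsFix n c c' v bit) : Inv n W F₀ c' := by
  obtain ⟨hvn, hv0⟩ := Cfg.mem_free.1 hv
  have st0 : ∀ p < n + 3, c'.st p = 0 → c.st p = 0 := by
    intro p hp hp0
    rw [he.st p hp] at hp0
    split_ifs at hp0
    exact hp0
  have st2 : ∀ p < n + 3, (c'.st p = 2 ↔ c.st p = 2) := by
    intro p hp
    rw [he.st p hp]
    split_ifs with h1
    · rcases h1 with rfl | ⟨-, -, h1, -⟩
      · simp [hv0]
      · simp [h1]
    · rfl
  have hy : ∀ p < n + 3, c.st p = 1 → c'.y p = c.y p := by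
    intro p hp hp1
    rw [he.y p hp, if_neg (by rintro rfl; omega), if_neg (by omega)]
  have hcost : ∀ z, c'.cost n z = c.cost n z := by
    intro z
    unfold cost
    refine Finset.sum_congr rfl fun p hp => Finset.sum_congr rfl fun q hq => ?_
    rw [Finset.mem_range] at hp hq
    rw [he.f]
    simp only [ne_eq, st2 p hp, st2 q hq]
  have hrec : ∀ i z, c'.recon i z = c.recon i z := by
    intro i
    induction i with
    | zero => intro z; rfl
    | succ i ih => intro z; simp only [recon, ih, he.eu, he.ev, he.ea, he.eb, he.ru, he.rv]
  refine
    { st_n := he.st_one_of (by omega) h.st_n, st_n1 := he.st_one_of (by omega) h.st_n1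
      st_n2 := (st2 _ (by omega)).2 h.st_n2, st_le := ?_
      y_n := (hy n (by omega) h.st_n).trans h.y_n
      y_n1 := (hy _ (by omega) h.st_n1).trans h.y_n1, y_le := ?_
      adj_symm := he.adj ▸ h.adj_symm, adj_self := he.adj ▸ h.adj_self
      adj_le := he.adj ▸ h.adj_le, adj_n2 := he.adj ▸ h.adj_n2, f_nonneg := he.f ▸ h.f_nonneg
      f_zero := ?_, f_hard := ?_
      elim_lt := by rw [he.cnt, he.eu, he.ev, he.ea, he.eb]; exact h.elim_lt
      elim_le := by rw [he.cnt, he.ru, he.rv]; exact h.elim_le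
      cost_recon := ?_, mode_zero := ?_, mode_pos := ?_ }
  · intro p hp
    rw [he.st p hp]
    split_ifs
    · omega
    · exact h.st_le p hp
  · intro p hp
    rw [he.y p hp]
    split_ifs
    · exact hbit
    · omega
    · exact h.y_le p hp
  · rw [he.adj, he.f]
    exact fun p hp q hq hp0 hq0 => h.f_zero p hp q hq (st0 p hp hp0) (st0 q hq hq0)
  · rw [he.adj, he.f]
    exact fun p hp q hq hp0 hq0 => h.f_hard p hp q hq (st0 p hp hp0) (st0 q hq hq0)
  · intro z hz
    rw [hcost, he.cnt, hrec]
    refine h.cost_recon z fun w hw => ⟨(hz w hw).1, fun hw1 => ?_⟩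
    rw [(hz w hw).2 (he.st_one_of hw hw1), hy w hw hw1]
  · rw [he.mode, he.adj]
    intro hm p hp q hq
    exact h.mode_zero hm p (Finset.mem_of_mem_erase (he.free_sub hp)) q
      (Finset.mem_of_mem_erase (he.free_sub hq))
  · rw [he.mode, he.adj]
    intro hm p hp
    exact (degOn_mono (he.free_sub.trans (Finset.erase_subset _ _)) p).trans
      (h.mode_pos hm p (Finset.mem_of_mem_erase (he.free_sub hp)))

theorem IsFix.todo_lt {bit : ℕ} (hv : v ∈ c.free n) (he : IsFix n c c' v bit) :
    c'.todo n < c.todo n := by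
  have h1 := Finset.card_le_card he.free_sub
  rw [Finset.card_erase_of_mem hv] at h1
  have h2 := Finset.card_pos.2 ⟨v, hv⟩
  unfold todo
  rw [he.mode]
  omega

/-- In a solution, two free vertices do not both have the value `0` if their edge forbids it. -/
theorem Inv.value_of_hard (h : Inv n W F₀ c) {z : ℕ → ℕ} (hz : Compat n c z)
    (hW : c.cost n z ≤ W) {p q : ℕ} (hp : p ∈ c.free n) (hq : q ∈ c.free n)
    (hpq : c.adj p q = 1) : ¬ (z p = 0 ∧ z q = 0) := by
  rintro ⟨hp0, hq0⟩
  obtain ⟨hpn, hps⟩ := Cfg.mem_free.1 hp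
  obtain ⟨hqn, hqs⟩ := Cfg.mem_free.1 hq
  have h1 := h.f_hard p (by omega) q (by omega) hps hqs hpq
  have hnn : ∀ p < n + 3, ∀ q < n + 3,
      0 ≤ if c.st p ≠ 2 ∧ c.st q ≠ 2 then c.f p q (z p) (z q) else 0 := by
    intro p hp q hq
    split_ifs
    · exact h.f_nonneg p hp q hq _ (hz p hp).1 _ (hz q hq).1
    · rfl
  have h2 : (if c.st p ≠ 2 ∧ c.st q ≠ 2 then c.f p q (z p) (z q) else 0) ≤ c.cost n z := by
    unfold cost
    refine le_trans ?_ (Finset.single_le_sum (f := fun p => ∑ q ∈ Finset.range (n + 3),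
      if c.st p ≠ 2 ∧ c.st q ≠ 2 then c.f p q (z p) (z q) else 0) (fun i hi => ?_)
      (Finset.mem_range.2 (show p < n + 3 by omega)))
    · exact Finset.single_le_sum (f := fun q =>
        if c.st p ≠ 2 ∧ c.st q ≠ 2 then c.f p q (z p) (z q) else 0)
        (fun j hj => hnn p (by omega) j (Finset.mem_range.1 hj))
        (Finset.mem_range.2 (show q < n + 3 by omega))
    · exact Finset.sum_nonneg fun j hj => hnn i (Finset.mem_range.1 hi) j (Finset.mem_range.1 hj)
  rw [if_pos (by omega), hp0, hq0] at h2
  linarith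

/-- A solution gives `v` one of the two values, and the value `0` forces the value `1` on the
neighbours along hard edges. -/
theorem IsFix.good {c₀ c₁ : Cfg} (h : Inv n W F₀ c) (hv : v ∈ c.free n)
    (he₀ : IsFix n c c₀ v 0) (he₁ : IsFix n c c₁ v 1) (hg : Good n k W c) :
    Good n k W c₀ ∨ Good n k W c₁ := by
  obtain ⟨hm, z, hz, hW, hk⟩ := hg
  obtain ⟨hvn, hv0⟩ := Cfg.mem_free.1 hv
  -- fixing a vertex does not change costs, which leave out only the eliminated vertices
  have hcost : ∀ {c' : Cfg} {bit : ℕ}, IsFix n c c' v bit → c'.cost n z = c.cost n z := by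
    intro c' bit he
    unfold cost
    refine Finset.sum_congr rfl fun p hp => Finset.sum_congr rfl fun q hq => ?_
    rw [Finset.mem_range] at hp hq
    have st2 : ∀ p < n + 3, (c'.st p = 2 ↔ c.st p = 2) := by
      intro p hp
      rw [he.st p hp]
      split_ifs with h1
      · rcases h1 with rfl | ⟨-, -, h1, -⟩
        · simp [hv0]
        · simp [h1]
      · rfl
    rw [he.f]
    simp only [ne_eq, st2 p hp, st2 q hq]
  have hle := (hz v (by omega)).1
  have hcase : z v = 0 ∨ z v = 1 := by omega
  rcases hcase with hzv | hzv
  · left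
    refine ⟨he₀.mode ▸ hm, z, fun w hw => ⟨(hz w hw).1, fun hw1 => ?_⟩, by rwa [hcost he₀],
      fun h0 => hk (he₀.mode ▸ h0)⟩
    rw [he₀.st w hw] at hw1
    rw [he₀.y w hw]
    by_cases h1 : w = v
    · rw [if_pos h1, h1, hzv]
    · rw [if_neg h1]
      by_cases h3 : 0 = 0 ∧ w < n ∧ c.st w = 0 ∧ c.adj v w = 1
      · rw [if_pos h3]
        have := h.value_of_hard hz hW hv (Cfg.mem_free.2 ⟨h3.2.1, h3.2.2.1⟩) h3.2.2.2
        have := (hz w hw).1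
        omega
      · rw [if_neg h3]
        rw [if_neg (by tauto)] at hw1
        exact (hz w hw).2 hw1
  · right
    refine ⟨he₁.mode ▸ hm, z, fun w hw => ⟨(hz w hw).1, fun hw1 => ?_⟩, by rwa [hcost he₁],
      fun h0 => hk (he₁.mode ▸ h0)⟩
    rw [he₁.st w hw] at hw1
    rw [he₁.y w hw]
    by_cases h1 : w = v
    · rw [if_pos h1, h1, hzv]
    · rw [if_neg (by omega)] at hw1
      rw [if_neg h1, if_neg (by omega)]
      exact (hz w hw).2 hw1

theorem IsFix.ones_one (hv : v ∈ c.free n) (he : IsFix n c c' v 1) :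
    c.ones n + 1 ≤ c'.ones n := by
  obtain ⟨hvn, hv0⟩ := Cfg.mem_free.1 hv
  have h1 : insert v ((Finset.range n).filter fun v => c.st v = 1 ∧ c.y v = 1) ⊆
      (Finset.range n).filter fun v => c'.st v = 1 ∧ c'.y v = 1 := by
    intro p hp
    simp only [Finset.mem_insert, Finset.mem_filter, Finset.mem_range] at hp ⊢
    have hpn : p < n := by rcases hp with rfl | hp <;> omega
    rw [he.st p (by omega), he.y p (by omega)]
    refine ⟨hpn, ?_⟩
    split_ifs <;> omega
  have h2 := Finset.card_le_card h1
  rwa [Finset.card_insert_of_notMem (by simp [hv0])] at h2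

/-- In the first phase all edges are hard: a vertex of value `0` forces its neighbours to `1`. -/
theorem IsFix.ones_zero (h : Inv n W F₀ c) (hm : c.mode = 0) (hv : v ∈ c.free n)
    (he : IsFix n c c' v 0) : c.ones n + degOn c.adj (c.free n) v ≤ c'.ones n := by
  obtain ⟨hvn, hv0⟩ := Cfg.mem_free.1 hv
  have h1 : ((Finset.range n).filter fun v => c.st v = 1 ∧ c.y v = 1) ∪
      ((c.free n).filter fun q => c.adj v q ≠ 0) ⊆
      (Finset.range n).filter fun v => c'.st v = 1 ∧ c'.y v = 1 := by
    intro p hp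
    simp only [Finset.mem_union, Finset.mem_filter, Finset.mem_range, Cfg.mem_free] at hp ⊢
    have hpn : p < n := by rcases hp with hp | hp <;> omega
    refine ⟨hpn, ?_⟩
    rw [he.st p (by omega), he.y p (by omega)]
    rcases hp with ⟨-, h1, h2⟩ | ⟨⟨-, h1⟩, h2⟩
    · rw [if_neg (by rintro (rfl | h') <;> omega), if_neg (by rintro rfl; omega),
        if_neg (by omega)]
      exact ⟨h1, h2⟩
    · have h3 := h.mode_zero hm v hv p (Cfg.mem_free.2 ⟨hpn, h1⟩)
      have h4 : c.adj v p = 1 := by omega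
      have h5 : p ≠ v := by
        rintro rfl
        rw [h.adj_self p (by omega)] at h4
        omega
      rw [if_pos (.inr ⟨rfl, hpn, h1, h4⟩), if_neg h5, if_pos ⟨rfl, hpn, h1, h4⟩]
      exact ⟨rfl, rfl⟩
  have h2 := Finset.card_le_card h1
  rw [Finset.card_union_of_disjoint] at h2
  · exact h2
  · rw [Finset.disjoint_left]
    intro p hp hp'
    simp only [Finset.mem_filter, Finset.mem_range, Cfg.mem_free] at hp hp'
    omega

/-! ### The branching factors -/

/-- The base of the potential: its `78`-th power is `1.381`. -/
def base : ℝ := (1.381 : ℝ) ^ (1 / 78 : ℝ)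

theorem base_pos : 0 < base := Real.rpow_pos_of_pos (by norm_num) _

theorem one_le_base : 1 ≤ base := Real.one_le_rpow (by norm_num) (by norm_num)

theorem base_pow : base ^ 78 = 1.381 := by
  rw [base, ← Real.rpow_natCast, ← Real.rpow_mul (by norm_num)]
  norm_num

/-- Two branches in which the potential drops by `d` and `e`. -/
theorem base_branch {x y : ℝ} {d e m p q : ℕ} (hd : x ≤ base ^ d) (he : y ≤ base ^ e)
    (hx : 0 < x) (hy : 0 < y) (hxy : 1 / x + 1 / y ≤ 1) (hp : p + d ≤ m) (hq : q + e ≤ m) :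
    base ^ p + base ^ q ≤ base ^ m := by
  have key : ∀ {x : ℝ} {d p : ℕ}, 0 < x → x ≤ base ^ d → p + d ≤ m →
      base ^ p ≤ base ^ m * (1 / x) := by
    intro x d p hx hd hp
    rw [mul_one_div, le_div_iff₀ hx]
    calc base ^ p * x ≤ base ^ p * base ^ d :=
          mul_le_mul_of_nonneg_left hd (pow_nonneg base_pos.le _)
      _ = base ^ (p + d) := (pow_add _ _ _).symm
      _ ≤ base ^ m := pow_le_pow_right₀ one_le_base hp
  calc base ^ p + base ^ q ≤ base ^ m * (1 / x) + base ^ m * (1 / y) :=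
        add_le_add (key hx hd hp) (key hy he hq)
    _ = base ^ m * (1 / x + 1 / y) := by ring
    _ ≤ base ^ m * 1 := by gcongr; exact pow_nonneg base_pos.le _
    _ = _ := mul_one _

/-- Compares `x` with a power of `base` by raising both to the `i`-th power, which makes the
right-hand side an integral power of `1.381`. -/
theorem le_base_pow {x : ℝ} {d i j : ℕ} (hi : i ≠ 0) (hij : d * i = 78 * j)
    (h : x ^ i ≤ 1.381 ^ j) : x ≤ base ^ d := by
  refine le_of_pow_le_pow_left₀ hi (pow_nonneg base_pos.le _) ?_
  rw [← pow_mul, hij, pow_mul, base_pow]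
  exact h

/-- Branching on a vertex of degree four: `k` drops by `1` or by at least `4`. -/
theorem branch_degree_four {m p q : ℕ} (hp : p + 78 ≤ m) (hq : q + 312 ≤ m) :
    base ^ p + base ^ q ≤ base ^ m :=
  base_branch (x := 1.381) (y := 1.381 ^ 4) (le_base_pow (i := 1) (j := 1) (by norm_num) (by norm_num)
    (by norm_num)) (le_base_pow (i := 1) (j := 4) (by norm_num) (by norm_num) (by norm_num))
    (by norm_num) (by norm_num) (by norm_num) hp hq

/-- Branching in a cubic graph on a vertex with a hard edge. The vertex and its neighbours lose
degree three, and three edges disappear: `36 * 4 + 2 * 3 = 150`. If the value is `0`, a neighbour is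
fixed as well, and at least five vertices and five edges are concerned: `36 * 5 + 2 * 5 = 190`. -/
theorem branch_hard {m p q : ℕ} (hp : p + 150 ≤ m) (hq : q + 190 ≤ m) :
    base ^ p + base ^ q ≤ base ^ m :=
  base_branch (x := 1.86) (y := 2.19)
    (le_base_pow (i := 13) (j := 25) (by norm_num) (by norm_num) (by norm_num))
    (le_base_pow (i := 39) (j := 95) (by norm_num) (by norm_num) (by norm_num))
    (by norm_num) (by norm_num) (by norm_num) hp hq

/-- Branching in a cubic graph without hard edges: `42 * 4 = 168` on either side. -/
theorem branch_soft {m p q : ℕ} (hp : p + 168 ≤ m) (hq : q + 168 ≤ m) :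
    base ^ p + base ^ q ≤ base ^ m :=
  base_branch (x := 2) (y := 2)
    (le_base_pow (i := 13) (j := 28) (by norm_num) (by norm_num) (by norm_num))
    (le_base_pow (i := 13) (j := 28) (by norm_num) (by norm_num) (by norm_num))
    (by norm_num) (by norm_num) (by norm_num) hp hq

/-- In the first phase, the two subtrees together have no more leaves than the potential allows. -/
theorem IsFix.pot_mode_zero {c₀ c₁ : Cfg} (h : Inv n W F₀ c) (hm : c.mode = 0)
    (hv : v ∈ c.free n) (hd : 4 ≤ degOn c.adj (c.free n) v) (hk : c.ones n ≤ k)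
    (he₀ : IsFix n c c₀ v 0) (he₁ : IsFix n c c₁ v 1) :
    base ^ c₁.pot n k + base ^ c₀.pot n k ≤ base ^ c.pot n k := by
  have h1 := he₁.ones_one hv
  have h0 := he₀.ones_zero h hm hv
  refine branch_degree_four ?_ ?_
  · rw [pot_zero hm, pot_zero (he₁.mode.trans hm)]
    omega
  · rw [pot_zero hm, pot_zero (he₀.mode.trans hm)]
    omega

/-- Without an elimination, the free vertices form a cubic graph in which adjacent vertices have
at most one common neighbour. -/
theorem Inv.cubic (h : Inv n W F₀ c) (hm : c.mode ≠ 0) (hn : ∀ u v a b, ¬ CanElim n c u v a b) :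
    (∀ p ∈ c.free n, degOn c.adj (c.free n) p = 3) ∧
    ∀ p ∈ c.free n, ∀ q ∈ c.free n, c.adj q p ≠ 0 →
      ((c.free n).filter fun w => c.adj p w ≠ 0 ∧ c.adj q w ≠ 0).card ≤ 1 := by
  have hdeg : ∀ p ∈ c.free n, degOn c.adj (c.free n) p = 3 := by
    intro p hp
    have h1 := h.mode_pos hm p hp
    obtain ⟨hpn, hp0⟩ := Cfg.mem_free.1 hp
    by_contra hne
    -- the neighbours of `p` are `a` and `b`, where auxiliary vertices may serve as either
    have key : ∀ a b, a ≠ b → ((a ∈ c.free n ∧ c.adj p a ≠ 0) ∨ a = n ∨ a = n + 1) →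
        ((b ∈ c.free n ∧ c.adj p b ≠ 0) ∨ b = n ∨ b = n + 1) →
        (∀ w ∈ c.free n, c.adj p w ≠ 0 → w = a ∨ w = b) → False := by
      intro a b hab ha hb hw
      have aux : ∀ t, ((t ∈ c.free n ∧ c.adj p t ≠ 0) ∨ t = n ∨ t = n + 1) →
          t < n + 3 ∧ t ≠ p ∧ t ≠ n + 2 ∧
          ((c.st t = 0 ∧ c.adj p t ≠ 0) ∨ t = n ∨ t = n + 1) := by
        rintro t (⟨ht, ht'⟩ | rfl | rfl)
        · obtain ⟨e1, e2⟩ := Cfg.mem_free.1 ht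
          refine ⟨by omega, fun e3 => ht' ?_, by omega, .inl ⟨e2, ht'⟩⟩
          rw [e3]
          exact h.adj_self_free _ hp
        · exact ⟨by omega, by omega, by omega, .inr (.inl rfl)⟩
        · exact ⟨by omega, by omega, by omega, .inr (.inr rfl)⟩
      obtain ⟨a1, a2, a3, a4⟩ := aux a ha
      obtain ⟨b1, b2, b3, b4⟩ := aux b hb
      -- `p` may be eliminated alone
      refine hn p (n + 2) a b ⟨hpn, by omega, a1, b1, hp0, .inr rfl, by omega, hab, a2, a3, b2, b3,
        a4, b4, fun w hwn hw0 hadj => ?_⟩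
      rcases hadj with hadj | hadj
      · exact .inr (.inr (hw w (Cfg.mem_free.2 ⟨hwn, hw0⟩) hadj))
      · exact absurd (h.adj_n2 w (by omega)) hadj
    have hmem : ∀ w, w ∈ ((c.free n).filter fun q => c.adj p q ≠ 0) ↔
        w ∈ c.free n ∧ c.adj p w ≠ 0 := fun w => Finset.mem_filter
    unfold degOn at h1 hne
    generalize ((c.free n).filter fun q => c.adj p q ≠ 0) = N at h1 hne hmem
    have hcard : N.card = 0 ∨ N.card = 1 ∨ N.card = 2 := by omega
    rcases hcard with h2 | h2 | h2
    · rw [Finset.card_eq_zero] at h2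
      refine key n (n + 1) (by omega) (.inr (.inl rfl)) (.inr (.inr rfl)) fun w hw hw' => ?_
      have := (hmem w).2 ⟨hw, hw'⟩
      simp [h2] at this
    · obtain ⟨a, rfl⟩ := Finset.card_eq_one.1 h2
      have ha := (hmem a).1 (by simp)
      refine key a n ?_ (.inl ha) (.inr (.inl rfl)) fun w hw hw' => ?_
      · have := Cfg.mem_free.1 ha.1
        omega
      · have := (hmem w).2 ⟨hw, hw'⟩
        simp only [Finset.mem_singleton] at this
        exact .inl this
    · obtain ⟨a, b, hab, rfl⟩ := Finset.card_eq_two.1 h2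
      refine key a b hab (.inl ((hmem a).1 (by simp))) (.inl ((hmem b).1 (by simp)))
        fun w hw hw' => ?_
      have := (hmem w).2 ⟨hw, hw'⟩
      simpa using this
  refine ⟨hdeg, fun p hp q hq hqp => ?_⟩
  by_contra hlt
  push Not at hlt
  obtain ⟨a, ha, b, hb, hab⟩ := Finset.one_lt_card.1 hlt
  simp only [Finset.mem_filter] at ha hb
  obtain ⟨hpn, hp0⟩ := Cfg.mem_free.1 hp
  obtain ⟨hqn, hq0⟩ := Cfg.mem_free.1 hq
  obtain ⟨han, ha0⟩ := Cfg.mem_free.1 ha.1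
  obtain ⟨hbn, hb0⟩ := Cfg.mem_free.1 hb.1
  have hself := h.adj_self_free
  have hpq : c.adj p q ≠ 0 := by rwa [h.adj_symm_free p hp q hq]
  have ne : ∀ {x y}, x ∈ c.free n → c.adj x y ≠ 0 → y ≠ x := by
    rintro x y hx hxy rfl
    exact hxy (hself _ hx)
  have hset : ∀ x y, x ∈ c.free n → y ∈ c.free n → c.adj x y ≠ 0 → c.adj x a ≠ 0 →
      c.adj x b ≠ 0 → a ≠ y → b ≠ y → ∀ w ∈ c.free n, c.adj x w ≠ 0 → w = y ∨ w = a ∨ w = b := by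
    intro x y hx hy hxy hxa hxb hay hby w hw hxw
    have e1 : ({y, a, b} : Finset ℕ) ⊆ (c.free n).filter fun q => c.adj x q ≠ 0 := by
      intro t ht
      simp only [Finset.mem_insert, Finset.mem_singleton] at ht
      rw [Finset.mem_filter]
      rcases ht with rfl | rfl | rfl
      · exact ⟨hy, hxy⟩
      · exact ⟨ha.1, hxa⟩
      · exact ⟨hb.1, hxb⟩
    have e2 := Finset.eq_of_subset_of_card_le e1 (by
      rw [Finset.card_eq_three.2 ⟨y, a, b, hay.symm, hby.symm, hab, rfl⟩]
      exact (hdeg x hx).le)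
    have e3 : w ∈ (c.free n).filter fun q => c.adj x q ≠ 0 := Finset.mem_filter.2 ⟨hw, hxw⟩
    rw [← e2] at e3
    simpa using e3
  -- `p` and `q` are adjacent, and their only other neighbours are `a` and `b`
  refine hn p q a b ⟨hpn, by omega, by omega, by omega, hp0, .inl hq0, (ne hp hpq).symm, hab,
    ne hp ha.2.1, ne hq ha.2.2, ne hp hb.2.1, ne hq hb.2.2, .inl ⟨ha0, ha.2.1⟩, .inl ⟨hb0, hb.2.1⟩,
    fun w hwn hw0 hadj => ?_⟩
  have hw := Cfg.mem_free.2 ⟨hwn, hw0⟩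
  rcases hadj with hadj | hadj
  · have := hset p q hp hq hpq ha.2.1 hb.2.1 (ne hq ha.2.2) (ne hq hb.2.2) w hw hadj
    exact .inr this
  · have := hset q p hq hp hqp ha.2.2 hb.2.2 (ne hp ha.2.1) (ne hp hb.2.1) w hw hadj
    rcases this with h2 | h2 | h2
    · exact .inl h2
    · exact .inr (.inr (.inl h2))
    · exact .inr (.inr (.inr h2))

/-- In the second phase, the two subtrees together have no more leaves than the potential allows. -/
theorem IsFix.pot_mode_one {c₀ c₁ : Cfg} (h : Inv n W F₀ c) (hm : c.mode = 1)
    (hv : v ∈ c.free n) (hn : ∀ u v a b, ¬ CanElim n c u v a b)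
    (hh : c.Hard n → ∃ w ∈ c.free n, c.adj v w = 1)
    (he₀ : IsFix n c c₀ v 0) (he₁ : IsFix n c c₁ v 1) :
    base ^ c₁.pot n k + base ^ c₀.pot n k ≤ base ^ c.pot n k := by
  obtain ⟨h3, hcom⟩ := h.cubic (by omega) hn
  obtain ⟨b1, m1⟩ := cubic_erase h.adj_symm_free h.adj_self_free h3 hv he₁.free_sub
  obtain ⟨b0, m0⟩ := cubic_erase h.adj_symm_free h.adj_self_free h3 hv he₀.free_sub
  have hm1 : c₁.mode = 1 := he₁.mode.trans hm
  have hm0 : c₀.mode = 1 := he₀.mode.trans hm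
  by_cases hhard : c.Hard n
  · obtain ⟨w, hw, hvw⟩ := hh hhard
    obtain ⟨b0', m0'⟩ := cubic_erase_two h.adj_symm_free h.adj_self_free h3 hw hv
      (by omega) (hcom w hw v hv (by omega)) (he₀.free_sub_zero hw hvw)
    have p1 := Cfg.pot_le (n := n) (k := k) hm1
    have p0 := Cfg.pot_le (n := n) (k := k) hm0
    rw [he₁.adj] at p1
    rw [he₀.adj] at p0
    have p := pot_hard (k := k) hm hhard
    exact branch_hard (by omega) (by omega)
  · have key : ∀ {c' : Cfg} {bit : ℕ}, IsFix n c c' v bit → ¬ c'.Hard n := by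
      rintro c' bit he ⟨p, hp, q, hq, hpq⟩
      rw [he.adj] at hpq
      exact hhard ⟨p, Finset.mem_of_mem_erase (he.free_sub hp), q,
        Finset.mem_of_mem_erase (he.free_sub hq), hpq⟩
    refine branch_soft ?_ ?_
    · rw [pot_soft hm hhard, pot_soft hm1 (key he₁), he₁.adj]
      omega
    · rw [pot_soft hm hhard, pot_soft hm0 (key he₀), he₀.adj]
      omega

/-! ### The end of the first phase -/

theorem Inv.set_mode (h : Inv n W F₀ c) {m : ℕ} (hm : m ≠ 0)
    (hd : ∀ p ∈ c.free n, degOn c.adj (c.free n) p ≤ 3) : Inv n W F₀ { c with mode := m } :=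
  { h with
    cost_recon := fun z hz => by
      have e1 : ∀ i z, recon { c with mode := m } i z = c.recon i z := by
        intro i
        induction i with
        | zero => intro z; rfl
        | succ i ih => intro z; simp only [recon, ih]
      exact (congrArg F₀ (e1 _ _)).trans (h.cost_recon z hz)
    mode_zero := fun h0 => absurd h0 hm
    mode_pos := fun _ => hd }

/-- Each vertex of degree three contributes at least `3` to the mass, so the new potential is at
most `36 / 3 + 1 = 13` times the mass, and `13 * 6 = 78`. -/
theorem pot_set_mode (hm : c.mode = 0) (h6 : massOn c.adj (c.free n) ≤ 6 * (k - c.ones n)) :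
    pot n k { c with mode := 1 } ≤ c.pot n k := by
  refine (Cfg.pot_le (c := { c with mode := 1 }) rfl).trans ?_
  have h1 : bigOn c.adj (c.free n) * 3 ≤ massOn c.adj (c.free n) := by
    have := three_mul_bigOn_le (adj := c.adj) (S := c.free n); omega
  rw [pot_zero hm]
  change 36 * bigOn c.adj (c.free n) + massOn c.adj (c.free n) ≤ _
  omega

theorem Good.ones_le (hg : Good n k W c) (hm : c.mode = 0) : c.ones n ≤ k := by
  obtain ⟨-, z, hz, -, hk⟩ := hg
  refine le_trans (Finset.card_le_card fun p hp => ?_) (hk hm)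
  simp only [Finset.mem_filter, Finset.mem_range] at hp ⊢
  exact ⟨hp.1, by rw [(hz p (by omega)).2 hp.2.1, hp.2.2]⟩

/-- With maximum degree three, a solution of size `k` covers only `3` edges per vertex. -/
theorem Good.mass_le (h : Inv n W F₀ c) (hg : Good n k W c) (hm : c.mode = 0)
    (hd : ∀ p ∈ c.free n, degOn c.adj (c.free n) p ≤ 3) :
    massOn c.adj (c.free n) ≤ 6 * (k - c.ones n) := by
  obtain ⟨-, z, hz, hW, hk⟩ := hg
  have hk := hk hm
  set A := (c.free n).filter fun p => z p = 1
  have h1 : massOn c.adj (c.free n) ≤ ∑ p ∈ c.free n, ∑ q ∈ c.free n,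
      ((if z p = 1 then c.adj p q else 0) + if z q = 1 then c.adj p q else 0) := by
    refine Finset.sum_le_sum fun p hp => Finset.sum_le_sum fun q hq => ?_
    have e1 := h.mode_zero hm p hp q hq
    rcases Nat.eq_zero_or_pos (c.adj p q) with e2 | e2
    · omega
    · have e3 := h.value_of_hard hz hW hp hq (by omega)
      rw [Cfg.mem_free] at hp hq
      have e4 := (hz p (by omega)).1
      have e5 := (hz q (by omega)).1
      split_ifs <;> omega
  have h2 : ∀ p ∈ c.free n, ∑ q ∈ c.free n, c.adj p q ≤ 3 := by
    intro p hp
    refine le_trans ?_ (hd p hp)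
    rw [degOn, Finset.card_filter]
    refine Finset.sum_le_sum fun q hq => ?_
    have := h.mode_zero hm p hp q hq
    split_ifs <;> omega
  have h3 : ∑ p ∈ c.free n, ∑ q ∈ c.free n, (if z p = 1 then c.adj p q else 0) ≤ 3 * A.card := by
    rw [mul_comm, ← smul_eq_mul, ← Finset.sum_const, Finset.sum_filter]
    refine Finset.sum_le_sum fun p hp => ?_
    split_ifs
    · exact h2 p hp
    · simp
  have h4 : ∑ p ∈ c.free n, ∑ q ∈ c.free n, (if z q = 1 then c.adj p q else 0) =
      ∑ p ∈ c.free n, ∑ q ∈ c.free n, (if z p = 1 then c.adj p q else 0) := by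
    rw [Finset.sum_comm]
    refine Finset.sum_congr rfl fun p hp => Finset.sum_congr rfl fun q hq => ?_
    rw [h.adj_symm_free p hp q hq]
  have h5 : A.card + c.ones n ≤ k := by
    refine le_trans ?_ hk
    rw [ones, ← Finset.card_union_of_disjoint]
    · refine Finset.card_le_card fun p hp => ?_
      simp only [A, Finset.mem_union, Finset.mem_filter, Finset.mem_range, Cfg.mem_free] at hp ⊢
      rcases hp with hp | hp
      · exact ⟨hp.1.1, hp.2⟩
      · exact ⟨hp.1, by rw [(hz p (by omega)).2 hp.2.1, hp.2.2]⟩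
    · rw [Finset.disjoint_left]
      intro p hp hp'
      simp only [A, Finset.mem_filter, Finset.mem_range, Cfg.mem_free] at hp hp'
      omega
  simp only [Finset.sum_add_distrib] at h1
  omega

/-- If no vertex is free any more, the values of the fixed vertices extend to a solution. -/
theorem Good.cost_recon_le (h : Inv n W F₀ c) (hg : Good n k W c) (hf : c.free n = ∅) :
    F₀ (c.recon c.cnt c.y) ≤ W := by
  obtain ⟨-, z, hz, hW, -⟩ := hg
  rw [h.cost_recon c.y fun v hv => ⟨h.y_le v hv, fun _ => rfl⟩]
  refine le_trans (le_of_eq ?_) hW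
  unfold cost
  refine Finset.sum_congr rfl fun p hp => Finset.sum_congr rfl fun q hq => ?_
  rw [Finset.mem_range] at hp hq
  have key : ∀ w < n + 3, c.st w ≠ 2 → c.y w = z w := by
    intro w hw hw2
    have h1 := h.st_le w hw
    have h2 : c.st w ≠ 0 := by
      intro h0
      have : w ∈ c.free n := Cfg.mem_free.2 ⟨h.lt hw h0, h0⟩
      rw [hf] at this
      simp at this
    exact ((hz w hw).2 (by omega)).symm
  split_ifs with h1
  · rw [key p hp h1.1, key q hq h1.2]
  · rfl

end Cfg

/-! ### The program

Cell `0` of an array serves as a variable. The arrays of natural numbers are used as follows: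

* `0`, `1`: the input, and `2`, `3`: the output
* `4`: the bound for values and positions
* `5`: the digits that describe a path in the search tree, and `6`: how many have been used
* `7`: whether the search goes on
* `8`, `9`: counters for the steps of a path and for clearing the memory
* `10`, `11`, `12`: states, adjacency and values of the vertices
* `13` to `18`: the records of the eliminations, and `19`: their number
* `20`: the phase of the search
* `21`: whether to branch, `22`: on which vertex, and `23`: to which value
* `24`, `25`, `26`, `27`: number of vertices of value `1`, mass, existence of a vertex of degree at
  least four, and the degree of the current vertex
* `28` to `33`: the search for vertices to eliminate
* `34`, `35`: an elimination and the position of an entry of its record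
* `36`: whether a solution has been found
* `37`: the digit to change next
* `40` to `46`: counters

The arrays of real numbers hold the input (`0` and `1`), the tables (`2`), a sum (`3`), the least
sum so far (`4`), and the parameter `k` as a real number (`5`).
-/

section Prog

/-- The variable `a`: cell `0` of the array `a`. -/
def vr (a : ℕ) : NExp := .cell a (.const 0)

/-- Assigns `e` to the variable `a`. -/
def setv (a : ℕ) (e : NExp) : LP := .nset a (.const 0) e

/-- The number of vertices of the instance. -/
def nE : NExp := vr 0

/-- The number of vertices of a configuration. -/
def mE : NExp := .add (vr 0) (.const 3)

/-- The position of the pair `p`, `q` of vertices of a configuration. -/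
def at2 (p q : NExp) : NExp := .add (.mul p mE) q

/-- The position of the entry `r`, `s` of the table for `p` and `q`. -/
def at4 (p q r s : NExp) : NExp := .add (.mul (.add (.mul (at2 p q) (.const 2)) r) (.const 2)) s

/-- The position of the entry `r`, `s` of the record of the elimination `i`. -/
def atR (i r s : NExp) : NExp := .add (.add (.mul i (.const 4)) (.mul r (.const 2))) s

/-- The test for equality. -/
def eqT (e₁ e₂ : NExp) : Test := .and (.nle e₁ e₂) (.nle e₂ e₁)

/-- The test for inequality. -/
def neT (e₁ e₂ : NExp) : Test := .not (eqT e₁ e₂)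

/-- The disjunction of two tests. -/
def orT (b₁ b₂ : Test) : Test := .not (.and (.not b₁) (.not b₂))

/-- Adds to the variable `25` the entries of the row of the free vertex in variable `40` of the
adjacency matrix, and counts its free neighbours in variable `27`. -/
def statsLoop : LP :=
  .loop 41 nE (.ite (eqT (.cell 10 (vr 41)) (.const 0))
    (.seq (setv 25 (.add (vr 25) (.cell 11 (at2 (vr 40) (vr 41)))))
      (.ite (.nle (.const 1) (.cell 11 (at2 (vr 40) (vr 41)))) (setv 27 (.add (vr 27) (.const 1)))
        .skip)) .skip)

/-- Sets the variables `24`, `25` and `26` to the number of vertices fixed to `1`, to the mass of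
the free vertices, and to `1` if some free vertex has degree at least four; variable `22` is then
such a vertex. -/
def stats : LP :=
  .seq (setv 24 (.const 0)) (.seq (setv 25 (.const 0)) (.seq (setv 26 (.const 0))
    (.loop 40 nE (.seq
      (.ite (.and (eqT (.cell 10 (vr 40)) (.const 1)) (eqT (.cell 12 (vr 40)) (.const 1)))
        (setv 24 (.add (vr 24) (.const 1))) .skip)
      (.ite (eqT (.cell 10 (vr 40)) (.const 0))
        (.seq (setv 27 (.const 0)) (.seq statsLoop
          (.ite (.nle (.const 4) (vr 27)) (.seq (setv 26 (.const 1)) (setv 22 (vr 40))) .skip)))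
        .skip)))))

/-- Sets variable `28` to `1` if a free neighbour of one of the vertices in the variables `42` and
`43` is not among those in the variables `42` to `45`. -/
def nbrCheck : LP :=
  .seq (setv 28 (.const 0)) (.loop 46 nE (.ite
    (.and (.and (eqT (.cell 10 (vr 46)) (.const 0))
      (orT (neT (.cell 11 (at2 (vr 42) (vr 46))) (.const 0))
        (neT (.cell 11 (at2 (vr 43) (vr 46))) (.const 0))))
      (.and (.and (neT (vr 46) (vr 42)) (neT (vr 46) (vr 43)))
        (.and (neT (vr 46) (vr 44)) (neT (vr 46) (vr 45)))))
    (setv 28 (.const 1)) .skip))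

/-- Tests whether variable `a` holds an auxiliary vertex or a free neighbour of variable `42`. -/
def bdryT (a : ℕ) : Test :=
  orT (.and (eqT (.cell 10 (vr a)) (.const 0)) (neT (.cell 11 (at2 (vr 42) (vr a))) (.const 0)))
    (orT (eqT (vr a) nE) (eqT (vr a) (.add nE (.const 1))))

/-- Tests whether the variables `42` to `45` hold vertices that allow an elimination. -/
def elimT : Test :=
  .and (.and (.and (eqT (.cell 10 (vr 42)) (.const 0))
    (orT (eqT (.cell 10 (vr 43)) (.const 0)) (eqT (vr 43) (.add nE (.const 2)))))
    (.and (neT (vr 42) (vr 43)) (neT (vr 44) (vr 45))))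
  (.and (.and (.and (neT (vr 44) (vr 42)) (neT (vr 44) (vr 43)))
    (.and (neT (vr 45) (vr 42)) (neT (vr 45) (vr 43))))
    (.and (.and (bdryT 44) (bdryT 45)) (eqT (vr 28) (.const 0))))

/-- Copies the variables `42` to `45` to the variables `30` to `33` if they allow an elimination. -/
def tryElim : LP :=
  .seq nbrCheck (.ite elimT (.seq (setv 30 (vr 42)) (.seq (setv 31 (vr 43)) (.seq (setv 32 (vr 44))
    (.seq (setv 33 (vr 45)) (setv 29 (.const 1)))))) .skip)

/-- Searches for vertices that allow an elimination; variable `29` tells whether there are any, and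
the variables `30` to `33` hold them. -/
def search : LP :=
  .seq (setv 29 (.const 0)) (.loop 42 nE (.loop 43 mE (.loop 44 mE (.loop 45 mE tryElim))))

/-- The entry of the table for the variables `40` and `41` at their values. -/
def entry : RExp :=
  .cell 2 (at4 (vr 40) (vr 41) (.cell 12 (vr 40)) (.cell 12 (vr 41)))

/-- Adds up the costs that involve the vertices in the variables `30` and `31`. -/
def touchSum : LP :=
  .seq (.rset 3 (.const 0) .zero) (.loop 40 mE (.loop 41 mE (.ite
    (.and (.and (neT (.cell 10 (vr 40)) (.const 2)) (neT (.cell 10 (vr 41)) (.const 2)))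
      (orT (orT (eqT (vr 40) (vr 30)) (eqT (vr 40) (vr 31)))
        (orT (eqT (vr 41) (vr 30)) (eqT (vr 41) (vr 31)))))
    (.rset 3 (.const 0) (.add (.cell 3 (.const 0)) entry)) .skip)))

/-- Records that `r` and `s` are the best values known for the boundary values `p` and `q`. -/
def record (p q r s : ℕ) : LP :=
  .seq (.rset 4 (.const 0) (.cell 3 (.const 0)))
    (.seq (.nset 17 (atR (vr 19) (.const p) (.const q)) (.const r))
      (.nset 18 (atR (vr 19) (.const p) (.const q)) (.const s)))

/-- Computes the cost of the values `r` and `s` of the vertices to be eliminated. -/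
def evalAt (r s : ℕ) : LP :=
  .seq (.nset 12 (vr 30) (.const r)) (.seq (.nset 12 (vr 31) (.const s)) touchSum)

/-- Computes the cost of the values `r` and `s`, and records them if they are the best so far. -/
def improve (p q r s : ℕ) : LP :=
  .seq (evalAt r s) (.ite (.rle (.cell 4 (.const 0)) (.cell 3 (.const 0))) .skip (record p q r s))

/-- Computes the entry `p`, `q` of the new table. -/
def elimEntry (p q : ℕ) : LP :=
  .seq (.seq (.nset 12 (vr 32) (.const p)) (.nset 12 (vr 33) (.const q)))
  (.seq (.seq (evalAt 0 0) (record p q 0 0))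
  (.seq (improve p q 0 1) (.seq (improve p q 1 0) (.seq (improve p q 1 1)
  (.rset 2 (at4 (vr 32) (vr 33) (.const p) (.const q))
    (.add (.cell 2 (at4 (vr 32) (vr 33) (.const p) (.const q))) (.cell 4 (.const 0))))))))

/-- Updates everything but the tables in an elimination. -/
def elimFinish : LP :=
  .seq (.seq (.nset 12 (vr 32) (.const 0)) (.nset 12 (vr 33) (.const 0)))
  (.seq (.seq (.seq (.nset 13 (vr 19) (vr 30)) (.nset 14 (vr 19) (vr 31)))
    (.seq (.nset 15 (vr 19) (vr 32)) (.nset 16 (vr 19) (vr 33))))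
  (.seq (.seq (.nset 10 (vr 30) (.const 2)) (.nset 10 (vr 31) (.const 2)))
  (.seq (.ite (eqT (.cell 11 (at2 (vr 32) (vr 33))) (.const 0))
    (.seq (.nset 11 (at2 (vr 32) (vr 33)) (.const 2)) (.nset 11 (at2 (vr 33) (vr 32)) (.const 2)))
    .skip)
  (setv 19 (.add (vr 19) (.const 1))))))

/-- Eliminates the vertices in the variables `30` and `31`. -/
def elim : LP :=
  .seq (.seq (elimEntry 0 0) (elimEntry 0 1))
    (.seq (.seq (elimEntry 1 0) (elimEntry 1 1)) elimFinish)

/-- Puts a free vertex into variable `22`, one with a neighbour that it needs if there is any, and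
tells in variable `21` whether some vertex is free. -/
def pickVertex : LP :=
  .seq (.loop 40 nE (.ite (eqT (.cell 10 (vr 40)) (.const 0))
    (.seq (setv 22 (vr 40)) (setv 21 (.const 1))) .skip))
  (.loop 40 nE (.loop 41 nE (.ite
    (.and (.and (eqT (.cell 10 (vr 40)) (.const 0)) (eqT (.cell 10 (vr 41)) (.const 0)))
      (eqT (.cell 11 (at2 (vr 40) (vr 41))) (.const 1)))
    (setv 22 (vr 40)) .skip)))

/-- The parameter `k`. -/
def kE : NExp := .cell 0 (.const 1)

/-- Ends the first phase, successfully if the remaining graph has few enough edges. -/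
def endPhase : LP :=
  .ite (.and (.nle (vr 24) kE) (.nle (vr 25) (.mul (.const 6) (.sub kE (vr 24)))))
    (setv 20 (.const 1)) (setv 20 (.const 2))

/-- A step of the search up to branching; variable `21` tells whether to branch on variable `22`. -/
def prep : LP :=
  .seq (setv 21 (.const 0)) (.seq stats (.ite (eqT (vr 20) (.const 0))
    (.ite (eqT (vr 26) (.const 1)) (.ite (.nle (vr 24) kE) (setv 21 (.const 1)) .skip) endPhase)
    (.ite (eqT (vr 20) (.const 1))
      (.seq search (.ite (eqT (vr 29) (.const 1)) elim pickVertex)) .skip)))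

/-- Fixes the vertex in variable `22` to the value in variable `23`. -/
def branch : LP :=
  .seq (.seq (.nset 10 (vr 22) (.const 1)) (.nset 12 (vr 22) (vr 23)))
  (.ite (eqT (vr 23) (.const 0)) (.loop 40 nE (.ite
    (.and (eqT (.cell 10 (vr 40)) (.const 0)) (eqT (.cell 11 (at2 (vr 22) (vr 40))) (.const 1)))
    (.seq (.nset 10 (vr 40) (.const 1)) (.nset 12 (vr 40) (.const 1))) .skip)) .skip)

/-- A step of the search; the value for branching is the next digit. -/
def body : LP :=
  .seq prep (.ite (eqT (vr 21) (.const 0)) .skip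
    (.seq (setv 23 (.cell 5 (vr 6))) (.seq (setv 6 (.add (vr 6) (.const 1))) branch)))

/-- Extends the values of the fixed vertices to the eliminated vertices. -/
def backSubst : LP :=
  .loop 40 (vr 19) (.seq (setv 34 (.sub (.sub (vr 19) (.const 1)) (vr 40)))
    (.seq (setv 35 (atR (vr 34) (.cell 12 (.cell 15 (vr 34))) (.cell 12 (.cell 16 (vr 34)))))
    (.seq (.nset 12 (.cell 13 (vr 34)) (.cell 17 (vr 35)))
      (.nset 12 (.cell 14 (vr 34)) (.cell 18 (vr 35))))))

/-- Sets variable `36` to `1` if the values are those of a solution, and to `0` otherwise. -/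
def check : LP :=
  .seq (.seq (setv 36 (.const 1)) (.rset 3 (.const 0) .zero))
  (.seq (.loop 40 nE (.seq
    (.ite (eqT (.cell 12 (vr 40)) (.const 0)) .skip
      (.rset 3 (.const 0) (.add (.cell 3 (.const 0)) (.cell 1 (vr 40)))))
    (.loop 41 nE (.ite
      (.and (eqT (.cell 1 (.add (.mul (vr 40) nE) (vr 41))) (.const 1))
        (.and (eqT (.cell 12 (vr 40)) (.const 0)) (eqT (.cell 12 (vr 41)) (.const 0))))
      (setv 36 (.const 0)) .skip))))
  (.ite (.rle (.cell 3 (.const 0)) (.cell 0 (.const 1))) .skip (setv 36 (.const 0))))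

/-- Tests whether the leaf gives a solution; variable `36` is `1` if so, and `0` otherwise. -/
def verify : LP := .seq backSubst check

/-- Writes the solution to the output and ends the search. -/
def output : LP :=
  .seq (.seq (setv 2 (.const 1)) (setv 7 (.const 0)))
    (.loop 40 nE (.nset 3 (vr 40) (.cell 12 (vr 40))))

/-- Moves on to the digits of the next leaf, or ends the search if there is none. Variable `37` is
one more than the last position of a digit `0`. -/
def advance : LP :=
  .seq (.seq (setv 37 (.const 0)) (.loop 40 (vr 6)
    (.ite (eqT (.cell 5 (vr 40)) (.const 0)) (setv 37 (.add (vr 40) (.const 1))) .skip)))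
  (.ite (eqT (vr 37) (.const 0)) (setv 7 (.const 0))
    (.seq (.nset 5 (.sub (vr 37) (.const 1)) (.const 1))
      (.loop 40 mE (.ite (.nle (vr 37) (vr 40)) (.nset 5 (vr 40) (.const 0)) .skip))))

/-- Sets the positions in variable `9` of arrays to zero. -/
def clearAll (l : List ℕ) (m : List ℕ) : LP :=
  m.foldr (fun a p => .seq (.rset a (vr 9) .zero) p)
    (l.foldr (fun a p => .seq (.nset a (vr 9) (.const 0)) p) .skip)

/-- Clears the arrays `10` to `60` of natural numbers and `2` to `4` of real numbers. -/
def clear : LP := .loop 9 (.add (vr 4) (.const 1)) (clearAll (List.range' 10 51) [2, 3, 4])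

/-- Sets up the initial configuration in cleared memory. All edges are hard: an edge that is not
covered costs `W + 1`. The weight of a vertex is stored in its table with the auxiliary vertex `n`,
which always has the value `0`. -/
def initCfg : LP :=
  .seq (.loop 40 nE (.seq
    (.loop 41 nE (.ite (eqT (.cell 1 (.add (.mul (vr 40) nE) (vr 41))) (.const 1))
      (.seq (.nset 11 (at2 (vr 40) (vr 41)) (.const 1))
        (.rset 2 (at4 (vr 40) (vr 41) (.const 0) (.const 0))
          (.add (.cell 0 (.const 1)) (.cell 0 (.const 0))))) .skip))
    (.rset 2 (at4 (vr 40) nE (.const 1) (.const 0)) (.cell 1 (vr 40)))))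
  (.seq (.nset 10 nE (.const 1)) (.seq (.nset 10 (.add nE (.const 1)) (.const 1))
    (.nset 10 (.add nE (.const 2)) (.const 2))))

/-- The search along one path of the search tree. -/
def path : LP :=
  .seq (.seq initCfg (.seq (setv 6 (.const 0)) (.loop 8 (.add nE (.const 1)) body)))
    (.seq verify (.ite (eqT (vr 36) (.const 1)) output advance))

end Prog

/-! ### Symbolic evaluation -/

section Eval

variable (x : ℕ → ℝ) (σ : State)

@[simp] theorem val_vr (a : ℕ) : (vr a).val σ = σ.nat (a, 0) := (rfl)
@[simp] theorem val_const (a : ℕ) : (NExp.const a).val σ = a := (rfl)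
@[simp] theorem val_cell (a : ℕ) (e : NExp) : (NExp.cell a e).val σ = σ.nat (a, e.val σ) := (rfl)
@[simp] theorem val_add (e₁ e₂ : NExp) : (e₁.add e₂).val σ = e₁.val σ + e₂.val σ := (rfl)
@[simp] theorem val_sub (e₁ e₂ : NExp) : (e₁.sub e₂).val σ = e₁.val σ - e₂.val σ := (rfl)
@[simp] theorem val_mul (e₁ e₂ : NExp) : (e₁.mul e₂).val σ = e₁.val σ * e₂.val σ := (rfl)
@[simp] theorem val_nE : nE.val σ = σ.nat (0, 0) := (rfl)
@[simp] theorem val_kE : kE.val σ = σ.nat (0, 1) := (rfl)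
@[simp] theorem val_mE : mE.val σ = σ.nat (0, 0) + 3 := (rfl)
@[simp] theorem val_at2 (p q : NExp) :
    (at2 p q).val σ = p.val σ * (σ.nat (0, 0) + 3) + q.val σ := (rfl)
@[simp] theorem val_at4 (p q r s : NExp) : (at4 p q r s).val σ =
    ((p.val σ * (σ.nat (0, 0) + 3) + q.val σ) * 2 + r.val σ) * 2 + s.val σ := (rfl)
@[simp] theorem val_atR (i r s : NExp) :
    (atR i r s).val σ = i.val σ * 4 + r.val σ * 2 + s.val σ := (rfl)

@[simp] theorem holds_eqT (e₁ e₂ : NExp) : (eqT e₁ e₂).Holds x σ ↔ e₁.val σ = e₂.val σ := by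
  simp [eqT, Test.Holds]; omega
@[simp] theorem holds_neT (e₁ e₂ : NExp) : (neT e₁ e₂).Holds x σ ↔ e₁.val σ ≠ e₂.val σ := by
  simp [neT, Test.Holds]
@[simp] theorem holds_orT (b₁ b₂ : Test) :
    (orT b₁ b₂).Holds x σ ↔ b₁.Holds x σ ∨ b₂.Holds x σ := by
  simp [orT, Test.Holds]; tauto
@[simp] theorem holds_and (b₁ b₂ : Test) :
    (Test.and b₁ b₂).Holds x σ ↔ b₁.Holds x σ ∧ b₂.Holds x σ := Iff.rfl
@[simp] theorem holds_nle (e₁ e₂ : NExp) : (Test.nle e₁ e₂).Holds x σ ↔ e₁.val σ ≤ e₂.val σ :=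
  Iff.rfl

@[simp] theorem exec_skip : LP.exec x .skip σ = σ := (rfl)
@[simp] theorem exec_seq (p q : LP) : LP.exec x (.seq p q) σ = q.exec x (p.exec x σ) := (rfl)

theorem exec_ite_pos {b : Test} (h : b.Holds x σ) (p q : LP) :
    LP.exec x (.ite b p q) σ = p.exec x σ := if_pos h

theorem exec_ite_neg {b : Test} (h : ¬ b.Holds x σ) (p q : LP) :
    LP.exec x (.ite b p q) σ = q.exec x σ := if_neg h

variable {σ}

theorem exec_nset {a : ℕ} {i e : NExp} (hi : i.val σ ≤ σ.nat (4, 0)) (he : e.val σ ≤ σ.nat (4, 0)) :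
    LP.exec x (.nset a i e) σ = σ.setNat a (i.val σ) (e.val σ) := by
  simp [LP.exec, hi, he]

theorem exec_setv {a : ℕ} {e : NExp} (he : e.val σ ≤ σ.nat (4, 0)) :
    LP.exec x (setv a e) σ = σ.setNat a 0 (e.val σ) := by
  simp [setv, LP.exec, he]

theorem exec_rset {a : ℕ} {i : NExp} {e : RExp} (hi : i.val σ ≤ σ.nat (4, 0)) :
    LP.exec x (.rset a i e) σ = σ.setReal a (i.val σ) (e.val σ) := by
  simp [LP.exec, hi]

end Eval

theorem Form.val_zero (x : ℕ → ℝ) : Form.val x 0 = 0 := by simp [Form.val]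

theorem Form.val_add (x : ℕ → ℝ) (f g : Form) :
    Form.val x (f + g) = Form.val x f + Form.val x g := by
  unfold Form.val
  exact Finsupp.sum_add_index' (by simp) (by intros; push_cast; ring)

/-! ### The memory of the search -/

/-- The vertices `p` and `q` are adjacent. -/
def Instance.Edge (I : Instance) (p q : ℕ) : Prop :=
  ∃ (hp : p < I.n) (hq : q < I.n), I.G.Adj ⟨p, hp⟩ ⟨q, hq⟩

theorem Instance.Edge.symm {I : Instance} {p q : ℕ} (h : I.Edge p q) : I.Edge q p := by
  obtain ⟨hp, hq, h⟩ := h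
  exact ⟨hq, hp, h.symm⟩

theorem Instance.not_edge_self {I : Instance} {p : ℕ} : ¬ I.Edge p p := by
  rintro ⟨_, _, h⟩
  exact I.G.irrefl h

open Classical in
/-- The memory holds the instance and the bound for values and positions. -/
structure Env (I : Instance) (k : ℕ) (σ : State) : Prop where
  n : σ.nat (0, 0) = I.n
  k : σ.nat (0, 1) = k
  b : σ.nat (4, 0) = 8 * (I.n + 3) ^ 2
  edge : ∀ p < I.n, ∀ q < I.n, σ.nat (1, p * I.n + q) = if I.Edge p q then 1 else 0
  one : (σ.real (0, 0)).val I.reals = 1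
  bound : (σ.real (0, 1)).val I.reals = I.W
  weight : ∀ p < I.n, (σ.real (1, p)).val I.reals = I.reals (p + 2)

theorem Env.exec {I : Instance} {k : ℕ} {σ : State} (h : Env I k σ) (p : LP)
    (h0 : 0 ∉ p.wr := by decide) (h1 : 1 ∉ p.wr := by decide) (h4 : 4 ∉ p.wr := by decide)
    (hr0 : 0 ∉ p.wrR := by decide) (hr1 : 1 ∉ p.wrR := by decide) :
    Env I k (p.exec I.reals σ) := by
  constructor
  · rw [p.exec_nat_of_not_mem _ h0, h.n]
  · rw [p.exec_nat_of_not_mem _ h0, h.k]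
  · rw [p.exec_nat_of_not_mem _ h4, h.b]
  · intro q hq r hr
    rw [p.exec_nat_of_not_mem _ h1, h.edge q hq r hr]
  · rw [p.exec_real_of_not_mem _ hr0, h.one]
  · rw [p.exec_real_of_not_mem _ hr0, h.bound]
  · intro q hq
    rw [p.exec_real_of_not_mem _ hr1, h.weight q hq]

theorem Env.congr {I : Instance} {k : ℕ} {σ τ : State} (h : Env I k σ)
    (hn : ∀ a, a = 0 ∨ a = 1 ∨ a = 4 → ∀ i, τ.nat (a, i) = σ.nat (a, i))
    (hr : ∀ a, a = 0 ∨ a = 1 → ∀ i, τ.real (a, i) = σ.real (a, i)) : Env I k τ := by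
  constructor
  · rw [hn 0 (by simp), h.n]
  · rw [hn 0 (by simp), h.k]
  · rw [hn 4 (by simp), h.b]
  · intro q hq r hr
    rw [hn 1 (by simp), h.edge q hq r hr]
  · rw [hr 0 (by simp), h.one]
  · rw [hr 0 (by simp), h.bound]
  · intro q hq
    rw [hr 1 (by simp), h.weight q hq]

theorem Env.setNat {I : Instance} {k : ℕ} {σ : State} (h : Env I k σ) {a : ℕ}
    (ha : ¬ (a = 0 ∨ a = 1 ∨ a = 4)) (i v : ℕ) : Env I k (σ.setNat a i v) := by
  refine h.congr (fun b hb i => ?_) fun _ _ _ => rfl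
  rw [State.setNat_nat, if_neg (by rintro ⟨rfl, -⟩; exact ha hb)]

/-- Induction along a loop that preserves the input and the bound. -/
theorem Env.exec_loop {I : Instance} {k c : ℕ} {e : NExp} {p : LP} {σ : State} (he : Env I k σ)
    (Inv : ℕ → State → Prop) (N : ℕ) (hN : e.val σ = N) (hb : N ≤ σ.nat (4, 0) + 1)
    (h0 : Inv 0 (σ.setNat c 0 0))
    (hs : ∀ j τ, j < N → Env I k τ → Inv j τ → τ.nat (c, 0) = j →
      (∀ a, a ∉ c :: p.wr → ∀ i, τ.nat (a, i) = σ.nat (a, i)) →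
      (∀ a, a ∉ p.wrR → ∀ i, τ.real (a, i) = σ.real (a, i)) →
      Inv (j + 1) ((p.exec I.reals τ).setNat c 0 (j + 1)))
    (hwf : (LP.loop c e p).wf := by decide)
    (hw : 0 ∉ c :: p.wr ∧ 1 ∉ c :: p.wr ∧ 4 ∉ c :: p.wr := by decide)
    (hwr : 0 ∉ p.wrR ∧ 1 ∉ p.wrR := by decide) :
    Inv N ((LP.loop c e p).exec I.reals σ) := by
  rw [← hN]
  refine LP.exec_loop hwf Inv (by omega) h0 fun j τ hj hinv hc hf hfr => ?_
  refine hs j τ (by omega) (he.congr ?_ ?_) hinv hc hf hfr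
  · rintro a (rfl | rfl | rfl)
    · exact hf _ hw.1
    · exact hf _ hw.2.1
    · exact hf _ hw.2.2
  · rintro a (rfl | rfl)
    · exact hfr _ hwr.1
    · exact hfr _ hwr.2

/-- The bound exceeds all positions and values that the search uses. -/
theorem Env.lt_bnd {I : Instance} {k : ℕ} {σ : State} (h : Env I k σ) :
    8 ≤ σ.nat (4, 0) ∧ 8 * (I.n + 3) ≤ σ.nat (4, 0) ∧ 8 * (I.n * I.n) ≤ σ.nat (4, 0) := by
  rw [h.b, show (I.n + 3) ^ 2 = I.n * I.n + 6 * I.n + 9 by ring]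
  exact ⟨by omega, by omega, by omega⟩

/-- The configuration in memory. -/
def cfg (I : Instance) (σ : State) : Cfg where
  st v := σ.nat (10, v)
  y v := σ.nat (12, v)
  adj p q := σ.nat (11, p * (I.n + 3) + q)
  f p q r s := (σ.real (2, ((p * (I.n + 3) + q) * 2 + r) * 2 + s)).val I.reals
  mode := σ.nat (20, 0)
  cnt := σ.nat (19, 0)
  eu i := σ.nat (13, i)
  ev i := σ.nat (14, i)
  ea i := σ.nat (15, i)
  eb i := σ.nat (16, i)
  ru i r s := σ.nat (17, i * 4 + r * 2 + s)
  rv i r s := σ.nat (18, i * 4 + r * 2 + s)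

/-- Memories that agree on the arrays of the configuration hold the same configuration. -/
theorem cfg_congr {I : Instance} {σ τ : State}
    (h : ∀ a ∈ List.range' 10 11, ∀ i, τ.nat (a, i) = σ.nat (a, i))
    (hr : ∀ i, τ.real (2, i) = σ.real (2, i)) : cfg I τ = cfg I σ := by
  simp only [cfg, hr, h 10 (by decide), h 11 (by decide), h 12 (by decide), h 13 (by decide),
    h 14 (by decide), h 15 (by decide), h 16 (by decide), h 17 (by decide), h 18 (by decide),
    h 19 (by decide), h 20 (by decide)]

theorem cfg_exec_congr {I : Instance} {x : ℕ → ℝ} {σ : State} (p : LP)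
    (h : ∀ a ∈ List.range' 10 11, a ∉ p.wr) (hr : 2 ∉ p.wrR) :
    cfg I (p.exec x σ) = cfg I σ :=
  cfg_congr (fun a ha i => p.exec_nat_of_not_mem _ (h a ha) i)
    fun i => p.exec_real_of_not_mem _ hr i

theorem idx_lt {n p q : ℕ} (hp : p < n + 3) (hq : q < n + 3) :
    p * (n + 3) + q < (n + 3) ^ 2 := by nlinarith

theorem idx_inj {n p q p' q' : ℕ} (hq : q < n + 3) (hq' : q' < n + 3) :
    p * (n + 3) + q = p' * (n + 3) + q' ↔ p = p' ∧ q = q' := by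
  constructor
  · intro h
    have h1 : p = p' := by
      have e1 := congrArg (· / (n + 3)) h
      simp only [mul_comm _ (n + 3)] at e1
      rwa [Nat.mul_add_div (by omega), Nat.mul_add_div (by omega), Nat.div_eq_of_lt hq,
        Nat.div_eq_of_lt hq', add_zero, add_zero] at e1
    subst h1
    exact ⟨rfl, by omega⟩
  · rintro ⟨rfl, rfl⟩; rfl

theorem idx4_inj {n p q p' q' r s r' s' : ℕ} (hq : q < n + 3) (hq' : q' < n + 3) (hr : r ≤ 1)
    (hs : s ≤ 1) (hr' : r' ≤ 1) (hs' : s' ≤ 1) :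
    ((p * (n + 3) + q) * 2 + r) * 2 + s = ((p' * (n + 3) + q') * 2 + r') * 2 + s' ↔
      (p = p' ∧ q = q') ∧ r = r' ∧ s = s' := by
  rw [← idx_inj hq hq']
  omega

theorem sq_ge (n : ℕ) : 9 ≤ (n + 3) ^ 2 ∧ 3 * (n + 3) ≤ (n + 3) ^ 2 ∧ n + 3 ≤ (n + 3) ^ 2 := by
  have h := Nat.mul_le_mul_right (n + 3) (show 3 ≤ n + 3 by omega)
  rw [pow_two]
  exact ⟨by omega, h, by omega⟩

/-! ### Branching and vertex degrees -/

section Branch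

variable {I : Instance} {k : ℕ}

theorem branch_spec {σ : State} (he : Env I k σ) {v bit : ℕ} (hv : v < I.n)
    (h22 : σ.nat (22, 0) = v) (h23 : σ.nat (23, 0) = bit) (hbit : bit ≤ 1) :
    (cfg I σ).IsFix I.n (cfg I (branch.exec I.reals σ)) v bit := by
  have hsq := sq_ge I.n
  have hb := he.b
  have hn := he.n
  have hvb : v ≤ σ.nat (4, 0) := by omega
  have h1b : σ.nat (4, 0) ≠ 0 := by omega
  have hbb : bit ≤ σ.nat (4, 0) := by omega
  have fr : ∀ a, a ∉ branch.wr → ∀ i, (branch.exec I.reals σ).nat (a, i) = σ.nat (a, i) :=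
    fun a ha i => branch.exec_nat_of_not_mem _ ha i
  have frr : ∀ a i, (branch.exec I.reals σ).real (a, i) = σ.real (a, i) :=
    fun a i => branch.exec_real_of_not_mem _ (by simp [branch, LP.wrR]) i
  have e1 : LP.exec I.reals (.seq (.nset 10 (vr 22) (.const 1)) (.nset 12 (vr 22) (vr 23))) σ =
      (σ.setNat 10 v 1).setNat 12 v bit := by
    simp [exec_nset, Nat.one_le_iff_ne_zero, State.setNat_nat, h22, h23, hvb, h1b, hbb]
  have key : ∀ p < I.n + 3, (branch.exec I.reals σ).nat (10, p) =
      (if p = v ∨ (bit = 0 ∧ p < I.n ∧ σ.nat (10, p) = 0 ∧ σ.nat (11, v * (I.n + 3) + p) = 1)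
        then 1 else σ.nat (10, p)) ∧
      (branch.exec I.reals σ).nat (12, p) = if p = v then bit else
        if bit = 0 ∧ p < I.n ∧ σ.nat (10, p) = 0 ∧ σ.nat (11, v * (I.n + 3) + p) = 1 then 1
        else σ.nat (12, p) := by
    rw [branch, exec_seq, e1]
    set σ₁ := (σ.setNat 10 v 1).setNat 12 v bit with hσ₁
    by_cases hb0 : bit = 0
    · rw [exec_ite_pos _ _ (by simp [σ₁, State.setNat_nat, h23, hb0])]
      have hI : σ₁.nat (0, 0) = I.n := by simp [σ₁, State.setNat_nat, hn]
      have := LP.exec_loop (x := I.reals) (c := 40) (e := nE) (σ := σ₁) (p := .ite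
        (.and (eqT (.cell 10 (vr 40)) (.const 0)) (eqT (.cell 11 (at2 (vr 22) (vr 40))) (.const 1)))
        (.seq (.nset 10 (vr 40) (.const 1)) (.nset 12 (vr 40) (.const 1))) .skip) (by decide)
        (fun j τ => ∀ p, τ.nat (10, p) = (if p = v ∨ (p < j ∧ σ.nat (10, p) = 0 ∧
            σ.nat (11, v * (I.n + 3) + p) = 1) then 1 else σ.nat (10, p)) ∧
          τ.nat (12, p) = if p = v then 0 else if p < j ∧ σ.nat (10, p) = 0 ∧
            σ.nat (11, v * (I.n + 3) + p) = 1 then 1 else σ.nat (12, p))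
        (by simp [σ₁, State.setNat_nat, he.n]; omega)
        (by
          intro p
          simp only [σ₁, State.setNat_nat]
          constructor <;> simp <;> split_ifs <;> simp_all)
        (by
          intro j τ hj hinv hc hfr _ p
          simp only [val_nE, hI] at hj
          have r22 : τ.nat (22, 0) = v := by
            rw [hfr 22 (by decide)]; simp [σ₁, State.setNat_nat, h22]
          have rn : τ.nat (0, 0) = I.n := by rw [hfr 0 (by decide), hI]
          have r4 : τ.nat (4, 0) = σ.nat (4, 0) := by
            rw [hfr 4 (by decide)]; simp [σ₁, State.setNat_nat]
          have r11 : ∀ i, τ.nat (11, i) = σ.nat (11, i) := fun i => by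
            rw [hfr 11 (by decide)]; simp [σ₁, State.setNat_nat]
          have hjb : j ≤ σ.nat (4, 0) := by omega
          by_cases hcond : τ.nat (10, j) = 0 ∧ σ.nat (11, v * (I.n + 3) + j) = 1
          · rw [exec_ite_pos _ _ (by simp [hc, r22, rn, r11, hcond])]
            simp [exec_nset, Nat.one_le_iff_ne_zero, State.setNat_nat, r4, hc, hjb, h1b]
            clear hfr; grind
          · rw [exec_ite_neg _ _ (by simpa [hc, r22, rn, r11] using hcond)]
            simp [State.setNat_nat]
            grind)
      intro p hp
      rw [val_nE, hI] at this
      simpa [hb0] using this p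
    · rw [exec_ite_neg _ _ (by simp [σ₁, State.setNat_nat, h23, hb0])]
      intro p hp
      simp [σ₁, State.setNat_nat, hb0]
  constructor
  · exact fun p hp => (key p hp).1
  · exact fun p hp => (key p hp).2
  · simp [cfg, fr 11 (by decide)]
  · simp [cfg, frr]
  · simp [cfg, fr 20 (by decide)]
  · simp [cfg, fr 19 (by decide)]
  · simp [cfg, fr 13 (by decide)]
  · simp [cfg, fr 14 (by decide)]
  · simp [cfg, fr 15 (by decide)]
  · simp [cfg, fr 16 (by decide)]
  · simp [cfg, fr 17 (by decide)]
  · simp [cfg, fr 18 (by decide)]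


theorem statsLoop_spec {σ : State} (he : Env I k σ) {p m : ℕ}
    (h40 : σ.nat (40, 0) = p) (h25 : σ.nat (25, 0) = m) (hm : m + 2 * I.n ≤ σ.nat (4, 0))
    (h27 : σ.nat (27, 0) = 0) (hadj : ∀ q < I.n, (cfg I σ).adj p q ≤ 2) :
    (statsLoop.exec I.reals σ).nat (25, 0) =
      m + ∑ q ∈ (cfg I σ).free I.n, (cfg I σ).adj p q ∧
    (statsLoop.exec I.reals σ).nat (27, 0) = degOn (cfg I σ).adj ((cfg I σ).free I.n) p := by
  have hb := he.lt_bnd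
  have := he.exec_loop (c := 41) (e := nE) (p := .ite (eqT (.cell 10 (vr 41)) (.const 0))
    (.seq (setv 25 (.add (vr 25) (.cell 11 (at2 (vr 40) (vr 41)))))
      (.ite (.nle (.const 1) (.cell 11 (at2 (vr 40) (vr 41)))) (setv 27 (.add (vr 27) (.const 1)))
        .skip)) .skip)
    (fun j τ => τ.nat (25, 0) = m + ∑ q ∈ Finset.range j,
        (if (cfg I σ).st q = 0 then (cfg I σ).adj p q else 0) ∧
      τ.nat (27, 0) = ∑ q ∈ Finset.range j,
        (if (cfg I σ).st q = 0 ∧ (cfg I σ).adj p q ≠ 0 then 1 else 0)) I.n (by simp [he.n])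
    (by omega) (by simp [State.setNat_nat, h25, h27])
    (by
      intro j τ hj heτ hinv hc hfr _
      have r40 : τ.nat (40, 0) = p := by rw [hfr 40 (by decide), h40]
      have r4 : τ.nat (4, 0) = σ.nat (4, 0) := by rw [hfr 4 (by decide)]
      have r10 : τ.nat (10, j) = (cfg I σ).st j := hfr 10 (by decide) _
      have r11 : τ.nat (11, p * (I.n + 3) + j) = (cfg I σ).adj p j := hfr 11 (by decide) _
      have hs1 : ∑ q ∈ Finset.range j, (if (cfg I σ).st q = 0 then (cfg I σ).adj p q else 0) ≤
          2 * j := by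
        refine (Finset.sum_le_card_nsmul _ _ 2 fun q hq => ?_).trans (by simp; omega)
        have := hadj q (by simp at hq; omega)
        split_ifs <;> omega
      have hs2 : ∑ q ∈ Finset.range j,
          (if (cfg I σ).st q = 0 ∧ (cfg I σ).adj p q ≠ 0 then 1 else 0) ≤ j := by
        refine (Finset.sum_le_card_nsmul _ _ 1 fun q hq => ?_).trans (by simp)
        split_ifs <;> omega
      have ha := hadj j hj
      obtain ⟨h1, h2⟩ := hinv
      rw [Finset.sum_range_succ, Finset.sum_range_succ]
      have g1 : τ.nat (25, 0) + (cfg I σ).adj p j ≤ σ.nat (4, 0) := by omega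
      have g2 : τ.nat (27, 0) + 1 ≤ σ.nat (4, 0) := by omega
      by_cases h0 : (cfg I σ).st j = 0
      · rw [exec_ite_pos _ _ (by simp [hc, r10, h0]), exec_seq,
          exec_setv _ (by simp [hc, r40, heτ.n, r11, r4, g1])]
        by_cases h3 : (cfg I σ).adj p j = 0
        · rw [exec_ite_neg _ _ (by simp [State.setNat_nat, hc, r40, heτ.n, r11, h3])]
          simp [State.setNat_nat, hc, r40, heτ.n, r11, h3, h1, h2, h0]
        · rw [exec_ite_pos _ _ (by
              simp [State.setNat_nat, hc, r40, heτ.n, r11]; omega),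
            exec_setv _ (by simp [State.setNat_nat, r4, g2])]
          simp [State.setNat_nat, hc, r40, heτ.n, r11, h3, h1, h2, h0]
          omega
      · rw [exec_ite_neg _ _ (by simp [hc, r10, h0])]
        simp [State.setNat_nat, h1, h2, h0])
  rw [statsLoop, this.1, this.2, Cfg.free, Finset.sum_filter, degOn, Finset.filter_filter,
    Finset.card_filter]
  exact ⟨rfl, rfl⟩

theorem stats_spec {σ : State} (he : Env I k σ)
    (hadj : ∀ p < I.n, ∀ q < I.n, (cfg I σ).adj p q ≤ 2) :
    (stats.exec I.reals σ).nat (24, 0) = (cfg I σ).ones I.n ∧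
    (stats.exec I.reals σ).nat (25, 0) = massOn (cfg I σ).adj ((cfg I σ).free I.n) ∧
    (((stats.exec I.reals σ).nat (26, 0) = 0 ∧
        ∀ p ∈ (cfg I σ).free I.n, degOn (cfg I σ).adj ((cfg I σ).free I.n) p ≤ 3) ∨
      ((stats.exec I.reals σ).nat (26, 0) = 1 ∧
        (stats.exec I.reals σ).nat (22, 0) ∈ (cfg I σ).free I.n ∧
        4 ≤ degOn (cfg I σ).adj ((cfg I σ).free I.n) ((stats.exec I.reals σ).nat (22, 0)))) := by
  set c := cfg I σ with hcdef
  have hb := he.lt_bnd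
  set σ₁ := ((σ.setNat 24 0 0).setNat 25 0 0).setNat 26 0 0 with hσ₁
  have e1 : stats.exec I.reals σ = LP.exec I.reals (.loop 40 nE (.seq
      (.ite (.and (eqT (.cell 10 (vr 40)) (.const 1)) (eqT (.cell 12 (vr 40)) (.const 1)))
        (setv 24 (.add (vr 24) (.const 1))) .skip)
      (.ite (eqT (.cell 10 (vr 40)) (.const 0))
        (.seq (setv 27 (.const 0)) (.seq statsLoop
          (.ite (.nle (.const 4) (vr 27)) (.seq (setv 26 (.const 1)) (setv 22 (vr 40))) .skip)))
        .skip))) σ₁ := by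
    simp [stats, exec_setv, State.setNat_nat, σ₁]
  rw [e1]
  have he₁ : Env I k σ₁ := ((he.setNat (by omega) _ _).setNat (by omega) _ _).setNat (by omega) _ _
  have rd : ∀ a i, a ≠ 24 → a ≠ 25 → a ≠ 26 → σ₁.nat (a, i) = σ.nat (a, i) := by
    intro a i h1 h2 h3
    simp [σ₁, State.setNat_nat, h1, h2, h3]
  have hle : ∀ p < I.n, ∑ q ∈ c.free I.n, c.adj p q ≤ 2 * I.n := by
    intro p hp
    refine (Finset.sum_le_card_nsmul _ _ 2 fun q hq => ?_).trans ?_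
    · exact hadj p hp q (Cfg.mem_free.1 hq).1
    · have := Finset.card_filter_le (Finset.range I.n) fun v => c.st v = 0
      simp only [Finset.card_range] at this
      simp only [Cfg.free, smul_eq_mul]
      omega
  have := he₁.exec_loop (c := 40) (e := nE) (p := .seq
      (.ite (.and (eqT (.cell 10 (vr 40)) (.const 1)) (eqT (.cell 12 (vr 40)) (.const 1)))
        (setv 24 (.add (vr 24) (.const 1))) .skip)
      (.ite (eqT (.cell 10 (vr 40)) (.const 0))
        (.seq (setv 27 (.const 0)) (.seq statsLoop
          (.ite (.nle (.const 4) (vr 27)) (.seq (setv 26 (.const 1)) (setv 22 (vr 40))) .skip)))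
        .skip))
    (fun j τ => τ.nat (24, 0) = ∑ q ∈ Finset.range j, (if c.st q = 1 ∧ c.y q = 1 then 1 else 0) ∧
      τ.nat (25, 0) = ∑ p ∈ Finset.range j,
        (if c.st p = 0 then ∑ q ∈ c.free I.n, c.adj p q else 0) ∧
      ((τ.nat (26, 0) = 0 ∧ ∀ p < j, c.st p = 0 → degOn c.adj (c.free I.n) p ≤ 3) ∨
      (τ.nat (26, 0) = 1 ∧ τ.nat (22, 0) ∈ c.free I.n ∧
        4 ≤ degOn c.adj (c.free I.n) (τ.nat (22, 0))))) I.n (by simp [he₁.n])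
    (by rw [rd 4 0 (by omega) (by omega) (by omega)]; omega)
    (by simp [State.setNat_nat, σ₁])
    (by
      intro j τ hj heτ hinv hc hfr _
      have r4 : τ.nat (4, 0) = σ.nat (4, 0) := by
        rw [hfr 4 (by decide), rd _ _ (by omega) (by omega) (by omega)]
      have r10 : ∀ i, τ.nat (10, i) = c.st i := fun i => by
        rw [hfr 10 (by decide), rd _ _ (by omega) (by omega) (by omega)]; rfl
      have r12 : ∀ i, τ.nat (12, i) = c.y i := fun i => by
        rw [hfr 12 (by decide), rd _ _ (by omega) (by omega) (by omega)]; rfl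
      have r11 : ∀ i, τ.nat (11, i) = σ.nat (11, i) := fun i => by
        rw [hfr 11 (by decide), rd _ _ (by omega) (by omega) (by omega)]
      have hs2 : ∑ q ∈ Finset.range j, (if c.st q = 1 ∧ c.y q = 1 then 1 else 0) ≤ j := by
        refine (Finset.sum_le_card_nsmul _ _ 1 fun q hq => ?_).trans (by simp)
        split_ifs <;> omega
      have hs1 : ∑ p ∈ Finset.range j, (if c.st p = 0 then ∑ q ∈ c.free I.n, c.adj p q else 0) ≤
          j * (2 * I.n) := by
        refine (Finset.sum_le_card_nsmul _ _ (2 * I.n) fun q hq => ?_).trans (by simp)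
        have := hle q (by simp at hq; omega)
        split_ifs <;> omega
      have hmul : j * (2 * I.n) + 2 * I.n ≤ 2 * (I.n * I.n) := by nlinarith
      obtain ⟨h1, h2, h3⟩ := hinv
      rw [Finset.sum_range_succ, Finset.sum_range_succ]
      set τ₁ := LP.exec I.reals (.ite (.and (eqT (.cell 10 (vr 40)) (.const 1))
        (eqT (.cell 12 (vr 40)) (.const 1))) (setv 24 (.add (vr 24) (.const 1))) .skip) τ with hτ₁
      have t24 : τ₁.nat (24, 0) = ∑ q ∈ Finset.range j, (if c.st q = 1 ∧ c.y q = 1 then 1 else 0) +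
          if c.st j = 1 ∧ c.y j = 1 then 1 else 0 := by
        by_cases h0 : c.st j = 1 ∧ c.y j = 1
        · rw [hτ₁, exec_ite_pos _ _ (by simp [hc, r10, r12, h0]), exec_setv _ (by simp; omega)]
          simp [State.setNat_nat, h1, h0]
        · rw [hτ₁, exec_ite_neg _ _ (by simpa [hc, r10, r12] using h0)]
          simp [h1, h0]
      have t : ∀ a, a ≠ 24 → ∀ i, τ₁.nat (a, i) = τ.nat (a, i) := fun a ha i =>
        LP.exec_nat_of_not_mem _ _ (by simpa [LP.wr, setv] using ha) i
      have heτ₁ : Env I k τ₁ := heτ.congr (fun a ha i => t a (by omega) i)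
        fun a _ i => LP.exec_real_of_not_mem _ _ (by simp [LP.wrR, setv]) i
      rw [exec_seq, ← hτ₁]
      by_cases h0 : c.st j = 0
      · rw [exec_ite_pos _ _ (by simp [t 40, t 10, hc, r10, h0])]
        set τ₂ := τ₁.setNat 27 0 0 with hτ₂
        have t2 : ∀ a, a ≠ 24 → a ≠ 27 → ∀ i, τ₂.nat (a, i) = τ.nat (a, i) := fun a ha hb i => by
          simp [τ₂, State.setNat_nat, hb, t a ha]
        have hcfg : ∀ q, (cfg I τ₂).adj j q = c.adj j q := fun q =>
          (t2 11 (by omega) (by omega) _).trans (r11 _)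
        have hfree : (cfg I τ₂).free I.n = c.free I.n := by
          refine Finset.filter_congr fun v _ => ?_
          rw [← r10 v, ← t2 10 (by omega) (by omega)]
          rfl
        have hspec := statsLoop_spec (σ := τ₂) (heτ₁.setNat (by omega) _ _) (p := j)
          (m := τ.nat (25, 0)) (by rw [t2 40 (by omega) (by omega), hc])
          (by rw [t2 25 (by omega) (by omega)])
          (by rw [t2 4 (by omega) (by omega), r4]; omega) (by simp [τ₂, State.setNat_nat])
          (fun q hq => by rw [hcfg]; exact hadj j hj q hq)
        set τ₃ := statsLoop.exec I.reals τ₂ with hτ₃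
        have t3 : ∀ a, a ∉ statsLoop.wr → ∀ i, τ₃.nat (a, i) = τ₂.nat (a, i) := fun a ha i =>
          LP.exec_nat_of_not_mem _ _ ha i
        rw [exec_seq, exec_setv _ (by simp), exec_seq, val_const, ← hτ₂, ← hτ₃]
        have d0 : degOn (cfg I τ₂).adj ((cfg I τ₂).free I.n) j = degOn c.adj (c.free I.n) j := by
          rw [hfree]; unfold degOn; simp only [hcfg]
        rw [d0, hfree] at hspec
        simp only [hcfg] at hspec
        have u24 : τ₃.nat (24, 0) = τ₁.nat (24, 0) := by
          rw [t3 24 (by decide)]; simp [τ₂, State.setNat_nat]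
        have u26 : τ₃.nat (26, 0) = τ.nat (26, 0) := by
          rw [t3 26 (by decide), t2 _ (by omega) (by omega)]
        have u22 : τ₃.nat (22, 0) = τ.nat (22, 0) := by
          rw [t3 22 (by decide), t2 _ (by omega) (by omega)]
        have u40 : τ₃.nat (40, 0) = j := by
          rw [t3 40 (by decide), t2 _ (by omega) (by omega), hc]
        have u4 : τ₃.nat (4, 0) = σ.nat (4, 0) := by
          rw [t3 4 (by decide), t2 _ (by omega) (by omega), r4]
        by_cases h4 : 4 ≤ degOn c.adj (c.free I.n) j
        · rw [exec_ite_pos _ _ (by simpa [hspec.2] using h4), exec_seq,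
            exec_setv (a := 26) _ (by simp; omega),
            exec_setv (a := 22) _ (by simp [State.setNat_nat, u40]; omega)]
          refine ⟨by simp [State.setNat_nat, u24, t24], ?_, .inr ?_⟩
          · simp [State.setNat_nat, hspec.1, h2, h0]
          · simp [State.setNat_nat, u40, h4, Cfg.mem_free, h0, hj]
        · rw [exec_ite_neg _ _ (by simpa [hspec.2] using h4)]
          refine ⟨by simp [State.setNat_nat, u24, t24], ?_, ?_⟩
          · simp [State.setNat_nat, hspec.1, h2, h0]
          · simp only [exec_skip, State.setNat_nat, u26, u22]
            refine h3.imp (fun h => ⟨h.1, fun p hp hp0 => ?_⟩) id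
            rcases Nat.lt_succ_iff_lt_or_eq.1 hp with hp | rfl
            · exact h.2 p hp hp0
            · omega
      · rw [exec_ite_neg _ _ (by simp [t 40, t 10, hc, r10, h0])]
        refine ⟨by simp [State.setNat_nat, t24], ?_, ?_⟩
        · simp [State.setNat_nat, t 25, h2, h0]
        · simp only [exec_skip, State.setNat_nat, t 26 (by omega), t 22 (by omega)]
          refine h3.imp (fun h => ⟨h.1, fun p hp hp0 => ?_⟩) id
          rcases Nat.lt_succ_iff_lt_or_eq.1 hp with hp | rfl
          · exact h.2 p hp hp0
          · exact absurd hp0 h0)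
  obtain ⟨h1, h2, h3⟩ := this
  refine ⟨?_, ?_, ?_⟩
  · rw [h1, Cfg.ones, Finset.card_filter]
  · rw [h2, massOn, Cfg.free, Finset.sum_filter]
  · refine h3.imp (fun h => ⟨h.1, fun p hp => ?_⟩) id
    exact h.2 p (Cfg.mem_free.1 hp).1 (Cfg.mem_free.1 hp).2

end Branch

/-! ### The search for an elimination and for a branching vertex -/

section Search

variable {I : Instance} {k : ℕ}

theorem nbrCheck_spec {σ : State} (he : Env I k σ) {u v a b : ℕ} (h42 : σ.nat (42, 0) = u)
    (h43 : σ.nat (43, 0) = v) (h44 : σ.nat (44, 0) = a) (h45 : σ.nat (45, 0) = b) :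
    (nbrCheck.exec I.reals σ).nat (28, 0) = 0 ↔ ∀ w < I.n, (cfg I σ).st w = 0 →
      ((cfg I σ).adj u w ≠ 0 ∨ (cfg I σ).adj v w ≠ 0) → w = u ∨ w = v ∨ w = a ∨ w = b := by
  have hb := he.lt_bnd
  rw [nbrCheck, exec_seq, exec_setv _ (by simp), val_const]
  refine (he.setNat (a := 28) (by omega) 0 0).exec_loop (fun j τ => τ.nat (28, 0) = 0 ↔
    ∀ w < j, (cfg I σ).st w = 0 →
      ((cfg I σ).adj u w ≠ 0 ∨ (cfg I σ).adj v w ≠ 0) → w = u ∨ w = v ∨ w = a ∨ w = b) I.n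
    (by simp [State.setNat_nat, he.n]) (by simp [State.setNat_nat]; omega)
    (by simp [State.setNat_nat]) ?_
  intro j τ hj heτ hinv hc hfr _
  have rd : ∀ a, a ≠ 28 → a ≠ 46 → ∀ i, τ.nat (a, i) = σ.nat (a, i) := by
    intro a h1 h2 i
    rw [hfr a (by simp [LP.wr, setv, h1, h2])]
    simp [State.setNat_nat, h1]
  have r10 : τ.nat (10, j) = (cfg I σ).st j := rd 10 (by omega) (by omega) _
  have r11 : ∀ p, τ.nat (11, p * (I.n + 3) + j) = (cfg I σ).adj p j := fun p =>
    rd 11 (by omega) (by omega) _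
  have r4 : 1 ≤ τ.nat (4, 0) := by rw [rd 4 (by omega) (by omega)]; omega
  have r42 := (rd 42 (by omega) (by omega) 0).trans h42
  have r43 := (rd 43 (by omega) (by omega) 0).trans h43
  have r44 := (rd 44 (by omega) (by omega) 0).trans h44
  have r45 := (rd 45 (by omega) (by omega) 0).trans h45
  simp only [Nat.lt_succ_iff_lt_or_eq, or_imp, forall_and, forall_eq]
  simp only [or_imp, forall_and] at hinv
  by_cases hcond : ((cfg I σ).st j = 0 ∧ ((cfg I σ).adj u j ≠ 0 ∨ (cfg I σ).adj v j ≠ 0)) ∧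
      (j ≠ u ∧ j ≠ v) ∧ j ≠ a ∧ j ≠ b
  · rw [exec_ite_pos _ _ (by
      simpa [hc, r10, r42, r43, r44, r45, r11, heτ.n] using hcond), exec_setv _ (by simpa using r4)]
    simp only [State.setNat_nat]
    tauto
  · rw [exec_ite_neg _ _ (by
      simpa only [hc, r10, r42, r43, r44, r45, r11, heτ.n, holds_and, holds_orT, holds_neT,
        holds_eqT, val_vr, val_cell, val_at2, val_const] using hcond)]
    simp only [State.setNat_nat, exec_skip]
    rw [if_neg (by omega), hinv]
    tauto

/-- What the search for an elimination has to maintain. -/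
structure Found (I : Instance) (k : ℕ) (c : Cfg) (τ : State) : Prop where
  env : Env I k τ
  cfg : cfg I τ = c
  le : τ.nat (29, 0) ≤ 1
  can : τ.nat (29, 0) = 1 →
    Cfg.CanElim I.n c (τ.nat (30, 0)) (τ.nat (31, 0)) (τ.nat (32, 0)) (τ.nat (33, 0))

theorem Found.setNat {c : Cfg} {τ : State} (h : Found I k c τ) {a : ℕ} (ha : 40 ≤ a) (v : ℕ) :
    Found I k c (τ.setNat a 0 v) := by
  have h' : ∀ b < 40, ∀ i, (τ.setNat a 0 v).nat (b, i) = τ.nat (b, i) := by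
    intro b hb i
    rw [State.setNat_nat, if_neg (by omega)]
  refine ⟨h.env.setNat (by omega) _ _, ?_, ?_, ?_⟩
  · rw [← h.cfg]
    refine cfg_congr (fun b hb i => h' b ?_ i) fun i => rfl
    simp only [List.mem_range'_1] at hb
    omega
  · rw [h' _ (by omega)]; exact h.le
  · rw [h' _ (by omega), h' _ (by omega), h' _ (by omega), h' _ (by omega), h' _ (by omega)]
    exact h.can

/-- A test that finds nothing certifies that the four vertices allow no elimination. -/
theorem tryElim_spec {c : Cfg} {τ : State} (h : Found I k c τ) {u v a b : ℕ} (hu : u < I.n)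
    (hv : v < I.n + 3) (ha : a < I.n + 3) (hb : b < I.n + 3)
    (h42 : τ.nat (42, 0) = u) (h43 : τ.nat (43, 0) = v) (h44 : τ.nat (44, 0) = a)
    (h45 : τ.nat (45, 0) = b) :
    Found I k c (tryElim.exec I.reals τ) ∧ ((tryElim.exec I.reals τ).nat (29, 0) = 0 →
      τ.nat (29, 0) = 0 ∧ ¬ c.CanElim I.n u v a b) := by
  have hn := nbrCheck_spec h.env h42 h43 h44 h45
  have hbd := h.env.lt_bnd
  have hcfg' : cfg I (nbrCheck.exec I.reals τ) = c := by
    rw [cfg_exec_congr _ (by decide) (by simp [nbrCheck, LP.wrR, setv]), h.cfg]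
  rw [h.cfg] at hn
  rw [tryElim, exec_seq]
  set σ := nbrCheck.exec I.reals τ with hσ
  have he : Env I k σ := h.env.exec _
  have rd : ∀ a, a ∉ nbrCheck.wr → ∀ i, σ.nat (a, i) = τ.nat (a, i) := fun a ha i =>
    LP.exec_nat_of_not_mem _ _ ha i
  have r42 := (rd 42 (by decide) 0).trans h42
  have r43 := (rd 43 (by decide) 0).trans h43
  have r44 := (rd 44 (by decide) 0).trans h44
  have r45 := (rd 45 (by decide) 0).trans h45
  have r10 : ∀ i, σ.nat (10, i) = c.st i := fun i => by rw [← hcfg']; rfl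
  have r11 : ∀ p q, σ.nat (11, p * (I.n + 3) + q) = c.adj p q := fun p q => by rw [← hcfg']; rfl
  have r4 : σ.nat (4, 0) = τ.nat (4, 0) := rd 4 (by decide) 0
  have key : elimT.Holds I.reals σ ↔ c.CanElim I.n u v a b := by
    simp only [elimT, bdryT, holds_and, holds_orT, holds_neT, holds_eqT, val_vr, val_cell,
      val_at2, val_const, val_nE, val_add, r42, r43, r44, r45, r10, r11, he.n]
    rw [hn]
    constructor
    · rintro ⟨⟨⟨h1, h2⟩, h3, h4⟩, ⟨⟨h5, h6⟩, h7, h8⟩, ⟨h9, h10⟩, h11⟩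
      exact ⟨hu, hv, ha, hb, h1, h2, h3, h4, h5, h6, h7, h8, h9, h10, h11⟩
    · rintro ⟨-, -, -, -, h1, h2, h3, h4, h5, h6, h7, h8, h9, h10, h11⟩
      exact ⟨⟨⟨h1, h2⟩, h3, h4⟩, ⟨⟨h5, h6⟩, h7, h8⟩, ⟨h9, h10⟩, h11⟩
  by_cases hcan : c.CanElim I.n u v a b
  · rw [exec_ite_pos _ _ (key.2 hcan)]
    have e : LP.exec I.reals (.seq (setv 30 (vr 42)) (.seq (setv 31 (vr 43)) (.seq (setv 32 (vr 44))
        (.seq (setv 33 (vr 45)) (setv 29 (.const 1)))))) σ =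
        ((((σ.setNat 30 0 u).setNat 31 0 v).setNat 32 0 a).setNat 33 0 b).setNat 29 0 1 := by
      have b1 : u ≤ τ.nat (4, 0) := by omega
      have b2 : v ≤ τ.nat (4, 0) := by omega
      have b3 : a ≤ τ.nat (4, 0) := by omega
      have b4 : b ≤ τ.nat (4, 0) := by omega
      have b5 : 1 ≤ τ.nat (4, 0) := by omega
      simp [exec_setv, State.setNat_nat, r42, r43, r44, r45, r4, b1, b2, b3, b4, b5]
    rw [e]
    refine ⟨⟨?_, ?_, by simp [State.setNat_nat], fun _ => by simpa [State.setNat_nat] using hcan⟩,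
      by simp [State.setNat_nat]⟩
    · exact ((((he.setNat (by omega) _ _).setNat (by omega) _ _).setNat (by omega) _ _).setNat
        (by omega) _ _).setNat (by omega) _ _
    · rw [← hcfg']
      refine cfg_congr (fun x hx i => ?_) fun i => rfl
      simp only [List.mem_range'_1] at hx
      simp only [State.setNat_nat]
      rw [if_neg (by omega), if_neg (by omega), if_neg (by omega), if_neg (by omega),
        if_neg (by omega)]
  · rw [exec_ite_neg _ _ (fun hh => hcan (key.1 hh)), exec_skip]
    have r29 := rd 29 (by decide) 0
    have r30 := rd 30 (by decide) 0
    have r31 := rd 31 (by decide) 0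
    have r32 := rd 32 (by decide) 0
    have r33 := rd 33 (by decide) 0
    refine ⟨⟨he, hcfg', by rw [r29]; exact h.le, ?_⟩, fun h0 => ⟨by rw [← r29]; exact h0, hcan⟩⟩
    rw [r29, r30, r31, r32, r33]
    exact h.can

/-- A loop of the search: whatever a pass checks has been checked for all values of the counter. -/
theorem Found.loop {c : Cfg} {x : ℕ} {e : NExp} {p : LP} {σ : State} (h : Found I k c σ)
    (R : State → Prop) (P : ℕ → Prop) (N : ℕ) (hN : e.val σ = N) (hNb : N ≤ I.n + 3)
    (hx : 40 ≤ x) (hR : R σ) (hset : ∀ τ v, R τ → R (τ.setNat x 0 v))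
    (hp : ∀ τ, R τ → R (p.exec I.reals τ))
    (hs : ∀ j τ, j < N → Found I k c τ → R τ → τ.nat (x, 0) = j →
      Found I k c (p.exec I.reals τ) ∧
        ((p.exec I.reals τ).nat (29, 0) = 0 → τ.nat (29, 0) = 0 ∧ P j))
    (hwf : (LP.loop x e p).wf := by decide)
    (hw : 0 ∉ x :: p.wr ∧ 1 ∉ x :: p.wr ∧ 4 ∉ x :: p.wr := by decide)
    (hwr : 0 ∉ p.wrR ∧ 1 ∉ p.wrR := by decide) :
    Found I k c ((LP.loop x e p).exec I.reals σ) ∧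
      (((LP.loop x e p).exec I.reals σ).nat (29, 0) = 0 → σ.nat (29, 0) = 0 ∧ ∀ j < N, P j) := by
  have hb := h.env.lt_bnd
  have := h.env.exec_loop (c := x) (e := e) (p := p) (fun j τ => Found I k c τ ∧ R τ ∧
    (τ.nat (29, 0) = 0 → σ.nat (29, 0) = 0 ∧ ∀ i < j, P i)) N hN (by omega)
    ⟨h.setNat hx 0, hset _ _ hR, by
      rw [State.setNat_nat, if_neg (by omega)]
      exact fun h0 => ⟨h0, fun i hi => absurd hi (by omega)⟩⟩
    (by
      rintro j τ hj - ⟨hinv, hRτ, himp⟩ hc - -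
      obtain ⟨h1, h2⟩ := hs j τ hj hinv hRτ hc
      refine ⟨h1.setNat hx _, hset _ _ (hp _ hRτ), ?_⟩
      rw [State.setNat_nat, if_neg (by omega)]
      intro h0
      obtain ⟨h3, h4⟩ := h2 h0
      obtain ⟨h5, h6⟩ := himp h3
      refine ⟨h5, fun i hi => ?_⟩
      rcases Nat.lt_succ_iff_lt_or_eq.1 hi with hi | rfl
      · exact h6 i hi
      · exact h4) hwf hw hwr
  exact ⟨this.1, this.2.2⟩

theorem search_spec {σ : State} (he : Env I k σ) :
    Found I k (cfg I σ) (search.exec I.reals σ) ∧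
      ((search.exec I.reals σ).nat (29, 0) = 0 → ∀ u v a b, ¬ (cfg I σ).CanElim I.n u v a b) := by
  set c := cfg I σ with hc
  rw [search, exec_seq, exec_setv _ (by simp), val_const]
  have h0 : Found I k c (σ.setNat 29 0 0) := by
    refine ⟨he.setNat (by omega) _ _, cfg_congr (fun x hx i => ?_) fun i => rfl,
      by simp [State.setNat_nat], by simp [State.setNat_nat]⟩
    simp only [List.mem_range'_1] at hx
    rw [State.setNat_nat, if_neg (by omega)]
  have hset : ∀ {x y : ℕ} {τ : State} {w : ℕ} (v : ℕ), x ≠ y → τ.nat (x, 0) = w →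
      (τ.setNat y 0 v).nat (x, 0) = w := by
    intro x y τ w v hxy h
    rw [State.setNat_nat, if_neg (by omega), h]
  have hfr : ∀ {x : ℕ} {p : LP} {τ : State} {w : ℕ}, x ∉ p.wr → τ.nat (x, 0) = w →
      (p.exec I.reals τ).nat (x, 0) = w := by
    intro x p τ w hx h
    rw [LP.exec_nat_of_not_mem _ _ hx, h]
  have h1 := h0.loop (x := 42) (e := nE) (p := .loop 43 mE (.loop 44 mE (.loop 45 mE tryElim)))
    (fun _ => True) (fun u => ∀ v < I.n + 3, ∀ a < I.n + 3, ∀ b < I.n + 3, ¬ c.CanElim I.n u v a b)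
    I.n (by rw [val_nE, h0.env.n]) (by omega) (by omega) trivial (fun _ _ _ => trivial)
    (fun _ _ => trivial) fun u τ hu h _ h42 =>
    h.loop (x := 43) (e := mE) (p := .loop 44 mE (.loop 45 mE tryElim))
    (fun τ => τ.nat (42, 0) = u) (fun v => ∀ a < I.n + 3, ∀ b < I.n + 3, ¬ c.CanElim I.n u v a b)
    (I.n + 3) (by rw [val_mE, h.env.n]) le_rfl (by omega) h42 (fun _ _ => hset _ (by omega))
    (fun _ => hfr (by decide)) fun v τ hv h h42 h43 =>
    h.loop (x := 44) (e := mE) (p := .loop 45 mE tryElim)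
    (fun τ => τ.nat (42, 0) = u ∧ τ.nat (43, 0) = v)
    (fun a => ∀ b < I.n + 3, ¬ c.CanElim I.n u v a b)
    (I.n + 3) (by rw [val_mE, h.env.n]) le_rfl (by omega) ⟨h42, h43⟩
    (fun _ _ h => ⟨hset _ (by omega) h.1, hset _ (by omega) h.2⟩)
    (fun _ h => ⟨hfr (by decide) h.1, hfr (by decide) h.2⟩) fun a τ ha h hr h44 =>
    h.loop (x := 45) (e := mE) (p := tryElim)
    (fun τ => τ.nat (42, 0) = u ∧ τ.nat (43, 0) = v ∧ τ.nat (44, 0) = a)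
    (fun b => ¬ c.CanElim I.n u v a b)
    (I.n + 3) (by rw [val_mE, h.env.n]) le_rfl (by omega) ⟨hr.1, hr.2, h44⟩
    (fun _ _ h => ⟨hset _ (by omega) h.1, hset _ (by omega) h.2.1, hset _ (by omega) h.2.2⟩)
    (fun _ h => ⟨hfr (by decide) h.1, hfr (by decide) h.2.1, hfr (by decide) h.2.2⟩)
    fun b τ hb h hr h45 => tryElim_spec h hu hv ha hb hr.1 hr.2.1 hr.2.2 h45
  exact ⟨h1.1, fun h29 u v a b hcan =>
    (h1.2 h29).2 u hcan.hu v hcan.hv a hcan.ha b hcan.hb hcan⟩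

/-- If no vertex is free, variable `21` remains `0`. The second loop prefers a vertex with a hard
edge. -/
theorem pickVertex_spec {σ : State} (he : Env I k σ) (h21 : σ.nat (21, 0) = 0) :
    ((pickVertex.exec I.reals σ).nat (21, 0) = 0 ∧ (cfg I σ).free I.n = ∅) ∨
    ((pickVertex.exec I.reals σ).nat (21, 0) ≠ 0 ∧
      (pickVertex.exec I.reals σ).nat (22, 0) ∈ (cfg I σ).free I.n ∧
      ((cfg I σ).Hard I.n → ∃ w ∈ (cfg I σ).free I.n,
        (cfg I σ).adj ((pickVertex.exec I.reals σ).nat (22, 0)) w = 1)) := by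
  have hb := he.lt_bnd
  set c := cfg I σ with hc
  rw [pickVertex, exec_seq]
  set p₁ : LP := .ite (eqT (.cell 10 (vr 40)) (.const 0))
    (.seq (setv 22 (vr 40)) (setv 21 (.const 1))) .skip with hp₁
  have h1 := he.exec_loop (c := 40) (e := nE) (p := p₁)
    (fun j τ => (τ.nat (21, 0) = 0 ∧ ∀ p < j, c.st p ≠ 0) ∨
      (τ.nat (21, 0) ≠ 0 ∧ τ.nat (22, 0) ∈ c.free I.n)) I.n (by simp [he.n]) (by omega)
    (by simp [State.setNat_nat, h21])
    (by
      intro j τ hj heτ hinv hcτ hfr _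
      have r10 : τ.nat (10, j) = c.st j := hfr 10 (by decide) _
      have r4 : τ.nat (4, 0) = σ.nat (4, 0) := hfr 4 (by decide) _
      by_cases h0 : c.st j = 0
      · right
        rw [hp₁, exec_ite_pos _ _ (by simp [hcτ, r10, h0]), exec_seq,
          exec_setv (a := 22) _ (by simp [hcτ]; omega),
          exec_setv (a := 21) _ (by simp [State.setNat_nat]; omega)]
        simp [State.setNat_nat, hcτ, Cfg.mem_free, h0, hj]
      · rw [hp₁, exec_ite_neg _ _ (by simp [hcτ, r10, h0])]
        simp only [State.setNat_nat, exec_skip]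
        refine hinv.imp (fun h => ⟨h.1, fun p hp => ?_⟩) id
        rcases Nat.lt_succ_iff_lt_or_eq.1 hp with hp | rfl
        · exact h.2 p hp
        · exact h0)
  set σ₁ := LP.exec I.reals (.loop 40 nE p₁) σ with hσ₁
  have he₁ : Env I k σ₁ := he.exec _
  have rd : ∀ a, a ≠ 21 → a ≠ 22 → a ≠ 40 → ∀ i, σ₁.nat (a, i) = σ.nat (a, i) := fun a h1 h2 h3 i =>
    LP.exec_nat_of_not_mem _ _ (by simp [LP.wr, setv, p₁, h1, h2, h3]) i
  set p₂ : LP := .ite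
    (.and (.and (eqT (.cell 10 (vr 40)) (.const 0)) (eqT (.cell 10 (vr 41)) (.const 0)))
      (eqT (.cell 11 (at2 (vr 40) (vr 41))) (.const 1)))
    (setv 22 (vr 40)) .skip with hp₂
  -- the vertex is free if it was free before, and any hard edge that was seen provides one
  have step : ∀ (p : ℕ), p < I.n → ∀ τ, Env I k τ → τ.nat (40, 0) = p →
      (∀ a, a ≠ 21 → a ≠ 22 → a ≠ 40 → a ≠ 41 → ∀ i, τ.nat (a, i) = σ.nat (a, i)) →
      (((LP.loop 41 nE p₂).exec I.reals τ).nat (22, 0) = τ.nat (22, 0) ∧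
        ∀ q < I.n, c.st p = 0 → c.st q = 0 → c.adj p q ≠ 1) ∨
      (((LP.loop 41 nE p₂).exec I.reals τ).nat (22, 0) ∈ c.free I.n ∧ ∃ w ∈ c.free I.n,
        c.adj (((LP.loop 41 nE p₂).exec I.reals τ).nat (22, 0)) w = 1) := by
    intro p hp τ heτ h40 hτ
    refine heτ.exec_loop (c := 41) (e := nE) (p := p₂) (fun j ρ =>
      (ρ.nat (22, 0) = τ.nat (22, 0) ∧ ∀ q < j, c.st p = 0 → c.st q = 0 → c.adj p q ≠ 1) ∨
      (ρ.nat (22, 0) ∈ c.free I.n ∧ ∃ w ∈ c.free I.n, c.adj (ρ.nat (22, 0)) w = 1)) I.n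
      (by simp [heτ.n]) (by rw [hτ 4 (by omega) (by omega) (by omega) (by omega)]; omega)
      (by simp [State.setNat_nat]) ?_
    intro j ρ hj heρ hinv hcρ hfr _
    have r : ∀ a, a ≠ 21 → a ≠ 22 → a ≠ 40 → a ≠ 41 → ∀ i, ρ.nat (a, i) = σ.nat (a, i) := by
      intro a h1 h2 h3 h4 i
      rw [hfr a (by simp [LP.wr, setv, p₂, h2, h4]), hτ a h1 h2 h3 h4]
    have r40 : ρ.nat (40, 0) = p := by rw [hfr 40 (by decide), h40]
    have r10 : ∀ i, ρ.nat (10, i) = c.st i := r 10 (by omega) (by omega) (by omega) (by omega)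
    have r11 : ρ.nat (11, p * (I.n + 3) + j) = c.adj p j :=
      r 11 (by omega) (by omega) (by omega) (by omega) _
    have r4 := r 4 (by omega) (by omega) (by omega) (by omega) 0
    by_cases hcond : (c.st p = 0 ∧ c.st j = 0) ∧ c.adj p j = 1
    · right
      rw [hp₂, exec_ite_pos _ _ (by simpa [r40, hcρ, r10, heρ.n, r11] using hcond),
        exec_setv _ (by simp [r40]; omega)]
      simp only [State.setNat_nat, val_vr, r40]
      simp only [and_self, if_true]
      exact ⟨Cfg.mem_free.2 ⟨hp, hcond.1.1⟩, j, Cfg.mem_free.2 ⟨hj, hcond.1.2⟩, hcond.2⟩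
    · rw [hp₂, exec_ite_neg _ _ (by
        simpa only [holds_and, holds_eqT, val_vr, val_cell, val_at2, val_const, r40, hcρ, r10,
          heρ.n, r11] using hcond)]
      simp only [State.setNat_nat, exec_skip]
      refine hinv.imp (fun h => ⟨h.1, fun q hq h1 h2 => ?_⟩) id
      rcases Nat.lt_succ_iff_lt_or_eq.1 hq with hq | rfl
      · exact h.2 q hq h1 h2
      · exact fun h3 => hcond ⟨⟨h1, h2⟩, h3⟩
  have h2 := he₁.exec_loop (c := 40) (e := nE) (p := .loop 41 nE p₂)
    (fun j τ => (τ.nat (22, 0) = σ₁.nat (22, 0) ∧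
        ∀ p < j, ∀ q < I.n, c.st p = 0 → c.st q = 0 → c.adj p q ≠ 1) ∨
      (τ.nat (22, 0) ∈ c.free I.n ∧ ∃ w ∈ c.free I.n, c.adj (τ.nat (22, 0)) w = 1)) I.n
    (by simp [he₁.n]) (by rw [rd 4 (by omega) (by omega) (by omega)]; omega)
    (by simp [State.setNat_nat])
    (by
      intro j τ hj heτ hinv hcτ hfr _
      have := step j hj τ heτ hcτ (fun a h1 h2 h3 h4 i => by
        rw [hfr a (by simp [LP.wr, setv, p₂, h2, h3, h4]), rd a h1 h2 h3])
      simp only [State.setNat_nat]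
      rcases this with ⟨h1, h2⟩ | h1
      · rw [h1]
        refine hinv.imp (fun h => ⟨h.1, fun p hp => ?_⟩) id
        rcases Nat.lt_succ_iff_lt_or_eq.1 hp with hp | rfl
        · exact h.2 p hp
        · exact h2
      · exact .inr h1)
  have h3 : (LP.exec I.reals (.loop 40 nE (.loop 41 nE p₂)) σ₁).nat (21, 0) = σ₁.nat (21, 0) :=
    LP.exec_nat_of_not_mem _ _ (by decide) _
  rw [h3]
  rcases h1 with ⟨h1, h4⟩ | ⟨h1, h4⟩
  · refine .inl ⟨h1, ?_⟩
    ext p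
    simp only [Cfg.mem_free, Finset.notMem_empty, iff_false, not_and]
    exact h4 p
  · refine .inr ⟨h1, ?_⟩
    rcases h2 with ⟨h2, h5⟩ | ⟨h2, h5⟩
    · rw [h2]
      refine ⟨h4, ?_⟩
      rintro ⟨p, hp, q, hq, hpq⟩
      rw [Cfg.mem_free] at hp hq
      exact absurd hpq (h5 p hp.1 q hq.1 hp.2 hq.2)
    · exact ⟨h2, fun _ => h5⟩

end Search

/-! ### Costs of values in memory -/

section Elim

variable {I : Instance} {k : ℕ}

/-- The real number at position `i` of the array `a`. -/
abbrev realAt (I : Instance) (σ : State) (a i : ℕ) : ℝ := (σ.real (a, i)).val I.reals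

theorem touchSum_spec {σ : State} (he : Env I k σ) {u v : ℕ} (h30 : σ.nat (30, 0) = u)
    (h31 : σ.nat (31, 0) = v) :
    realAt I (touchSum.exec I.reals σ) 3 0 = (cfg I σ).touch I.n u v (cfg I σ).y := by
  have hb := he.lt_bnd
  set c := cfg I σ with hc
  rw [touchSum, exec_seq, exec_rset _ (by simp)]
  set p₁ : LP := .ite
    (.and (.and (neT (.cell 10 (vr 40)) (.const 2)) (neT (.cell 10 (vr 41)) (.const 2)))
      (orT (orT (eqT (vr 40) (vr 30)) (eqT (vr 40) (vr 31)))
        (orT (eqT (vr 41) (vr 30)) (eqT (vr 41) (vr 31)))))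
    (.rset 3 (.const 0) (.add (.cell 3 (.const 0)) entry)) .skip with hp₁
  set T : ℕ → ℕ → ℝ := fun p q => if (c.st p ≠ 2 ∧ c.st q ≠ 2) ∧ (p = u ∨ p = v ∨ q = u ∨ q = v)
    then c.f p q (c.y p) (c.y q) else 0 with hT
  set σ₁ := σ.setReal 3 0 0 with hσ₁
  have he₁ : Env I k σ₁ := he.congr (fun _ _ _ => rfl) fun a ha i => by
    rw [hσ₁, State.setReal_real, if_neg (by omega)]
  have step : ∀ (p : ℕ), p < I.n + 3 → ∀ τ, Env I k τ → τ.nat (40, 0) = p →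
      (∀ a, a ≠ 40 → a ≠ 41 → ∀ i, τ.nat (a, i) = σ.nat (a, i)) →
      (∀ a, a ≠ 3 → ∀ i, τ.real (a, i) = σ.real (a, i)) →
      realAt I ((LP.loop 41 mE p₁).exec I.reals τ) 3 0 =
        realAt I τ 3 0 + ∑ q ∈ Finset.range (I.n + 3), T p q := by
    intro p hp τ heτ h40 hτ hτr
    refine heτ.exec_loop (c := 41) (e := mE) (p := p₁) (fun j ρ => realAt I ρ 3 0 =
      realAt I τ 3 0 + ∑ q ∈ Finset.range j, T p q) (I.n + 3) (by simp [heτ.n])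
      (by rw [hτ 4 (by omega) (by omega)]; omega) (by simp [realAt]) ?_
    intro j ρ hj heρ hinv hcρ hfr hfrr
    have r : ∀ a, a ≠ 40 → a ≠ 41 → ∀ i, ρ.nat (a, i) = σ.nat (a, i) := by
      intro a h1 h2 i
      rw [hfr a (by simp [LP.wr, p₁, h2]), hτ a h1 h2]
    have rr : ∀ i, ρ.real (2, i) = σ.real (2, i) := fun i => by
      rw [hfrr 2 (by simp [LP.wrR, p₁]), hτr 2 (by omega)]
    have r40 : ρ.nat (40, 0) = p := by rw [hfr 40 (by decide), h40]
    have r10 : ∀ i, ρ.nat (10, i) = c.st i := r 10 (by omega) (by omega)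
    have r12 : ∀ i, ρ.nat (12, i) = c.y i := r 12 (by omega) (by omega)
    have r30 := (r 30 (by omega) (by omega) 0).trans h30
    have r31 := (r 31 (by omega) (by omega) 0).trans h31
    have hiff : ((c.st p ≠ 2 ∧ c.st j ≠ 2) ∧ ((p = u ∨ p = v) ∨ j = u ∨ j = v)) ↔
      ((c.st p ≠ 2 ∧ c.st j ≠ 2) ∧ (p = u ∨ p = v ∨ j = u ∨ j = v)) := by tauto
    rw [Finset.sum_range_succ]
    by_cases hcond : (c.st p ≠ 2 ∧ c.st j ≠ 2) ∧ (p = u ∨ p = v ∨ j = u ∨ j = v)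
    · rw [hp₁, exec_ite_pos _ _ (by
        simpa only [holds_and, holds_orT, holds_neT, holds_eqT, val_vr, val_cell, val_const, r40,
          hcρ, r10, r30, r31] using hiff.2 hcond), exec_rset _ (by simp)]
      have hTe : T p j = c.f p j (c.y p) (c.y j) := if_pos hcond
      simp only [realAt, State.setNat_real, State.setReal_real, val_const, and_self, if_true, entry,
        RExp.val, Form.val_add, val_at4, val_vr, val_cell, r40, hcρ, r12, rr, heρ.n]
      simp only [realAt] at hinv
      rw [hinv, hTe, add_assoc]
      rfl
    · rw [hp₁, exec_ite_neg _ _ (by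
        simpa only [holds_and, holds_orT, holds_neT, holds_eqT, val_vr, val_cell, val_const, r40,
          hcρ, r10, r30, r31] using fun h => hcond (hiff.1 h))]
      have hTe : T p j = 0 := if_neg hcond
      simp only [realAt, State.setNat_real, exec_skip]
      simp only [realAt] at hinv
      rw [hinv, hTe, add_zero]
  refine he₁.exec_loop (c := 40) (e := mE) (p := .loop 41 mE p₁) (fun j τ => realAt I τ 3 0 =
    ∑ p ∈ Finset.range j, ∑ q ∈ Finset.range (I.n + 3), T p q) (I.n + 3) (by simp [he₁.n])
    (by simp [σ₁]; omega) (by simp [realAt, σ₁, State.setReal_real, Form.val_zero]) ?_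
  intro j τ hj heτ hinv hcτ hfr hfrr
  have := step j hj τ heτ hcτ (fun a h1 h2 i => hfr a (by simp [LP.wr, p₁, h1, h2]) i)
    (fun a ha i => by
      rw [hfrr a (by simpa [LP.wrR, p₁] using ha), hσ₁, State.setReal_real, if_neg (by omega)])
  rw [Finset.sum_range_succ, ← hinv, ← this]
  rfl

/-- The memory `τ` arises from `σ` in the course of an elimination of `u` and `v` with boundary
`a`, `b`. The entries `p`, `q` of the table with `D p q` are done. -/
structure Elim (I : Instance) (k : ℕ) (σ : State) (u v a b : ℕ) (D : ℕ → ℕ → Prop) (τ : State) :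
    Prop where
  env : Env I k τ
  frame : ∀ x, x ∉ [12, 17, 18, 40, 41] → ∀ i, τ.nat (x, i) = σ.nat (x, i)
  y : ∀ w, w ≠ a → w ≠ b → w ≠ u → w ≠ v → τ.nat (12, w) = σ.nat (12, w)
  y_le : ∀ w < I.n + 3, τ.nat (12, w) ≤ 1
  old : ∀ i < σ.nat (19, 0), ∀ r ≤ 1, ∀ s ≤ 1, τ.nat (17, i * 4 + r * 2 + s) =
    σ.nat (17, i * 4 + r * 2 + s) ∧ τ.nat (18, i * 4 + r * 2 + s) = σ.nat (18, i * 4 + r * 2 + s)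
  r_le : ∀ p ≤ 1, ∀ q ≤ 1, D p q → (cfg I τ).ru (σ.nat (19, 0)) p q ≤ 1 ∧
    (cfg I τ).rv (σ.nat (19, 0)) p q ≤ 1
  opt : ∀ p ≤ 1, ∀ q ≤ 1, D p q → ∀ r ≤ 1, ∀ s ≤ 1,
    (cfg I σ).touch I.n u v (Cfg.env (cfg I σ).y a b u v p q ((cfg I τ).ru (σ.nat (19, 0)) p q)
      ((cfg I τ).rv (σ.nat (19, 0)) p q)) ≤
    (cfg I σ).touch I.n u v (Cfg.env (cfg I σ).y a b u v p q r s)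
  todo : ∀ p ≤ 1, ∀ q ≤ 1, ¬ D p q → (cfg I τ).f a b p q = (cfg I σ).f a b p q
  done : ∀ p ≤ 1, ∀ q ≤ 1, D p q → (cfg I τ).f a b p q = (cfg I σ).f a b p q +
    (cfg I σ).touch I.n u v (Cfg.env (cfg I σ).y a b u v p q ((cfg I τ).ru (σ.nat (19, 0)) p q)
      ((cfg I τ).rv (σ.nat (19, 0)) p q))
  f : ∀ p < I.n + 3, ∀ q < I.n + 3, ¬ (p = a ∧ q = b) → ∀ r ≤ 1, ∀ s ≤ 1,
    (cfg I τ).f p q r s = (cfg I σ).f p q r s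

/-- The part that involves `u` or `v` depends only on the tables of `u` and `v`. The entries for `a`
and `b`, which change in the course of an elimination, are not among them. -/
theorem Cfg.touch_congr' {n : ℕ} {c c' : Cfg} {u v : ℕ} {z z' : ℕ → ℕ}
    (hst : ∀ p < n + 3, c.st p = c'.st p) (hz : ∀ p < n + 3, z p = z' p)
    (hf : ∀ p < n + 3, ∀ q < n + 3, (p = u ∨ p = v ∨ q = u ∨ q = v) →
      c.f p q (z p) (z q) = c'.f p q (z p) (z q)) : c.touch n u v z = c'.touch n u v z' := by
  unfold Cfg.touch
  refine Finset.sum_congr rfl fun p hp => Finset.sum_congr rfl fun q hq => ?_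
  rw [Finset.mem_range] at hp hq
  rw [hst p hp, hst q hq, ← hz p hp, ← hz q hq]
  split_ifs with h
  · exact hf p hp q hq h.2
  · rfl

/-- Trying the values `r` and `s` leaves their cost in the accumulator. -/
theorem evalAt_spec {τ : State} (he : Env I k τ) {u v r s : ℕ} (hu : u < I.n + 3)
    (hv : v < I.n + 3) (hr : r ≤ 1) (hs : s ≤ 1)
    (h30 : τ.nat (30, 0) = u) (h31 : τ.nat (31, 0) = v) :
    realAt I ((evalAt r s).exec I.reals τ) 3 0 = (cfg I τ).touch I.n u v
      (Function.update (Function.update (cfg I τ).y u r) v s) ∧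
    (∀ w, ((evalAt r s).exec I.reals τ).nat (12, w) =
      Function.update (Function.update (cfg I τ).y u r) v s w) ∧
    (∀ x, x ∉ [12, 40, 41] → ∀ i, ((evalAt r s).exec I.reals τ).nat (x, i) = τ.nat (x, i)) ∧
    (∀ x, x ≠ 3 → ∀ i, ((evalAt r s).exec I.reals τ).real (x, i) = τ.real (x, i)) := by
  have hb := he.lt_bnd
  have e1 : (evalAt r s).exec I.reals τ =
      touchSum.exec I.reals ((τ.setNat 12 u r).setNat 12 v s) := by
    have b1 : u ≤ τ.nat (4, 0) := by omega
    have b2 : v ≤ τ.nat (4, 0) := by omega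
    have b3 : r ≤ τ.nat (4, 0) := by omega
    have b4 : s ≤ τ.nat (4, 0) := by omega
    simp [evalAt, exec_nset, State.setNat_nat, h30, h31, b1, b2, b3, b4]
  rw [e1]
  set ρ := (τ.setNat 12 u r).setNat 12 v s with hρ
  have h12 : ∀ w, ρ.nat (12, w) = Function.update (Function.update (cfg I τ).y u r) v s w := by
    intro w
    simp only [ρ, State.setNat_nat, Function.update_apply, true_and]
    rfl
  have hfr : ∀ x, x ≠ 12 → ∀ i, ρ.nat (x, i) = τ.nat (x, i) := by
    intro x hx i
    simp [ρ, State.setNat_nat, hx]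
  refine ⟨?_, fun w => ?_, fun x hx i => ?_, fun x hx i => ?_⟩
  · rw [touchSum_spec ((he.setNat (by omega) _ _).setNat (by omega) _ _)
      (by rw [hfr 30 (by omega), h30]) (by rw [hfr 31 (by omega), h31])]
    exact Cfg.touch_congr' (fun p _ => hfr 10 (by omega) p) (fun p _ => h12 p) fun _ _ _ _ _ => rfl
  · rw [LP.exec_nat_of_not_mem _ _ (by decide), h12]
  · simp only [List.mem_cons, List.not_mem_nil, or_false, not_or] at hx
    rw [LP.exec_nat_of_not_mem _ _ (by simp [touchSum, LP.wr, hx]), hfr x hx.1]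
  · rw [LP.exec_real_of_not_mem _ _ (by simpa [touchSum, LP.wrR] using hx)]
    rfl

/-- The memory `ρ` agrees with `τ` up to what changes when the entry at position `m` of the records
for the elimination of `u` and `v` is computed. -/
structure Near (I : Instance) (k : ℕ) (τ : State) (u v m : ℕ) (ρ : State) : Prop where
  env : Env I k ρ
  frame : ∀ x, x ∉ [12, 17, 18, 40, 41] → ∀ i, ρ.nat (x, i) = τ.nat (x, i)
  y : ∀ w, w ≠ u → w ≠ v → ρ.nat (12, w) = τ.nat (12, w)
  y_le : ∀ w < I.n + 3, ρ.nat (12, w) ≤ 1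
  r : ∀ i, i ≠ m → ρ.nat (17, i) = τ.nat (17, i) ∧ ρ.nat (18, i) = τ.nat (18, i)
  real : ∀ x, x ≠ 3 → x ≠ 4 → ∀ i, ρ.real (x, i) = τ.real (x, i)

theorem Near.evalAt {τ ρ : State} {u v m r s : ℕ} (h : Near I k τ u v m ρ) (hu : u < I.n + 3)
    (hv : v < I.n + 3) (hr : r ≤ 1) (hs : s ≤ 1)
    (h30 : τ.nat (30, 0) = u) (h31 : τ.nat (31, 0) = v) :
    Near I k τ u v m ((WVC.evalAt r s).exec I.reals ρ) ∧
    realAt I ((WVC.evalAt r s).exec I.reals ρ) 3 0 = (cfg I τ).touch I.n u v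
      (Function.update (Function.update (cfg I τ).y u r) v s) ∧
    (∀ x, x ∉ [12, 40, 41] → ∀ i, ((WVC.evalAt r s).exec I.reals ρ).nat (x, i) = ρ.nat (x, i)) ∧
    (∀ x, x ≠ 3 → ∀ i, ((WVC.evalAt r s).exec I.reals ρ).real (x, i) = ρ.real (x, i)) := by
  obtain ⟨h1, h2, h3, h4⟩ := evalAt_spec h.env hu hv hr hs
    ((h.frame 30 (by decide) 0).trans h30) ((h.frame 31 (by decide) 0).trans h31)
  refine ⟨⟨?_, ?_, ?_, ?_, ?_, ?_⟩, ?_, h3, h4⟩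
  · exact h.env.congr (fun x hx i => h3 x (by simp; omega) i) fun x hx i => h4 x (by omega) i
  · intro x hx i
    rw [h3 x (by simp at hx ⊢; tauto), h.frame x hx]
  · intro w hwu hwv
    rw [h2, Function.update_of_ne hwv, Function.update_of_ne hwu]
    exact h.y w hwu hwv
  · intro w hw
    rw [h2]
    have := h.y_le w hw
    simp only [Function.update_apply]
    split_ifs
    · exact hs
    · exact hr
    · exact this
  · intro i hi
    rw [h3 17 (by decide), h3 18 (by decide)]
    exact h.r i hi
  · intro x hx3 hx4 i
    rw [h4 x hx3, h.real x hx3 hx4]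
  · rw [h1]
    refine Cfg.touch_congr' (fun p _ => h.frame 10 (by decide) p) (fun p _ => ?_)
      fun p _ q _ _ => ?_
    · simp only [Function.update_apply]
      split_ifs with e1 e2
      · rfl
      · rfl
      · exact h.y p e2 e1
    · simp only [cfg, h.real 2 (by omega) (by omega)]

theorem Near.record {τ ρ : State} {u v p q r s : ℕ} (hp : p ≤ 1) (hq : q ≤ 1) (hr : r ≤ 1)
    (hs : s ≤ 1) (hcnt : τ.nat (19, 0) ≤ I.n)
    (h : Near I k τ u v (τ.nat (19, 0) * 4 + p * 2 + q) ρ) :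
    Near I k τ u v (τ.nat (19, 0) * 4 + p * 2 + q) ((WVC.record p q r s).exec I.reals ρ) ∧
    realAt I ((WVC.record p q r s).exec I.reals ρ) 4 0 = realAt I ρ 3 0 ∧
    ((WVC.record p q r s).exec I.reals ρ).nat (17, τ.nat (19, 0) * 4 + p * 2 + q) = r ∧
    ((WVC.record p q r s).exec I.reals ρ).nat (18, τ.nat (19, 0) * 4 + p * 2 + q) = s := by
  set m := τ.nat (19, 0) * 4 + p * 2 + q with hm
  have hb := h.env.lt_bnd
  have r19 : ρ.nat (19, 0) = τ.nat (19, 0) := h.frame 19 (by decide) 0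
  have e : (WVC.record p q r s).exec I.reals ρ =
      ((ρ.setReal 4 0 (ρ.real (3, 0))).setNat 17 m r).setNat 18 m s := by
    have b1 : m ≤ ρ.nat (4, 0) := by omega
    have b2 : r ≤ ρ.nat (4, 0) := by omega
    have b3 : s ≤ ρ.nat (4, 0) := by omega
    rw [WVC.record, exec_seq, exec_seq, exec_rset _ (by simp),
      exec_nset (a := 17) _ (by simp [r19, ← hm, b1]) (by simp [b2]),
      exec_nset (a := 18) _ (by simp [State.setNat_nat, r19, ← hm, b1])
        (by simp [State.setNat_nat, b3])]
    simp [State.setNat_nat, r19, ← hm, RExp.val]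
  rw [e]
  refine ⟨⟨?_, ?_, ?_, ?_, ?_, ?_⟩, ?_, ?_, ?_⟩
  · refine h.env.congr (fun x hx i => ?_) fun x hx i => ?_
    · simp only [State.setNat_nat, State.setReal_nat]
      rw [if_neg (by omega), if_neg (by omega)]
    · simp only [State.setNat_real, State.setReal_real]
      rw [if_neg (by omega)]
  · intro x hx i
    rw [← h.frame x hx]
    simp only [List.mem_cons, List.not_mem_nil, or_false, not_or] at hx
    simp [State.setNat_nat, hx]
  · intro w hwu hwv
    rw [← h.y w hwu hwv]
    simp [State.setNat_nat]
  · intro w hw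
    simpa [State.setNat_nat] using h.y_le w hw
  · intro i hi
    rw [← (h.r i hi).1, ← (h.r i hi).2]
    simp [State.setNat_nat, hi]
  · intro x hx3 hx4 i
    rw [← h.real x hx3 hx4]
    simp [State.setReal_real, hx4]
  · simp [realAt, State.setReal_real]
  · simp [State.setNat_nat]
  · simp [State.setNat_nat]

/-- The values `r` and `s` are recorded, and their cost is stored in cell `0` of the array `4` of
real numbers. -/
structure Best (I : Instance) (k : ℕ) (τ : State) (u v m : ℕ) (ρ : State) (r s : ℕ) : Prop where
  near : Near I k τ u v m ρ
  cost : realAt I ρ 4 0 = (cfg I τ).touch I.n u v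
    (Function.update (Function.update (cfg I τ).y u r) v s)
  ru : ρ.nat (17, m) = r
  rv : ρ.nat (18, m) = s
  r_le : r ≤ 1
  s_le : s ≤ 1

/-- After the attempt, the recorded values are as good as the old ones and as the new ones. -/
theorem Best.improve {τ ρ : State} {u v p q r s r₀ s₀ : ℕ} (hp : p ≤ 1) (hq : q ≤ 1) (hr : r ≤ 1)
    (hs : s ≤ 1) (hcnt : τ.nat (19, 0) ≤ I.n) (hu : u < I.n + 3)
    (hv : v < I.n + 3) (h30 : τ.nat (30, 0) = u) (h31 : τ.nat (31, 0) = v)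
    (h : Best I k τ u v (τ.nat (19, 0) * 4 + p * 2 + q) ρ r₀ s₀) :
    ∃ r₁ s₁, Best I k τ u v (τ.nat (19, 0) * 4 + p * 2 + q)
        ((WVC.improve p q r s).exec I.reals ρ) r₁ s₁ ∧
      (cfg I τ).touch I.n u v (Function.update (Function.update (cfg I τ).y u r₁) v s₁) ≤
        (cfg I τ).touch I.n u v (Function.update (Function.update (cfg I τ).y u r₀) v s₀) ∧
      (cfg I τ).touch I.n u v (Function.update (Function.update (cfg I τ).y u r₁) v s₁) ≤
        (cfg I τ).touch I.n u v (Function.update (Function.update (cfg I τ).y u r) v s) := by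
  obtain ⟨h1, h2, h3, h4⟩ := h.near.evalAt hu hv hr hs h30 h31
  rw [WVC.improve, exec_seq]
  set ρ₁ := (WVC.evalAt r s).exec I.reals ρ with hρ₁
  have hc4 : realAt I ρ₁ 4 0 = realAt I ρ 4 0 := by rw [realAt, h4 4 (by omega)]
  have hiff : Test.Holds I.reals ρ₁ (.rle (.cell 4 (.const 0)) (.cell 3 (.const 0))) ↔
    realAt I ρ₁ 4 0 ≤ realAt I ρ₁ 3 0 := Iff.rfl
  by_cases hle : realAt I ρ₁ 4 0 ≤ realAt I ρ₁ 3 0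
  · rw [exec_ite_pos _ _ (hiff.2 hle), exec_skip]
    refine ⟨r₀, s₀, ⟨h1, by rw [hc4, h.cost], by rw [h3 17 (by decide), h.ru],
      by rw [h3 18 (by decide), h.rv], h.r_le, h.s_le⟩, le_rfl, ?_⟩
    rwa [hc4, h.cost, h2] at hle
  · rw [exec_ite_neg _ _ (fun hh => hle (hiff.1 hh))]
    obtain ⟨g1, g2, g3, g4⟩ := h1.record hp hq hr hs hcnt
    refine ⟨r, s, ⟨g1, by rw [g2, h2], g3, g4, hr, hs⟩, ?_, le_rfl⟩
    rw [hc4, h.cost, h2] at hle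
    exact le_of_not_ge hle

end Elim

/-! ### Elimination in memory -/

section Elim

variable {I : Instance} {k : ℕ}

/-- The entry is computed from values tried one after the other: `0, 0` first, and then the other
three. -/
theorem elimEntry_spec {σ τ : State} {u v a b p q : ℕ} {D : ℕ → ℕ → Prop} (hp : p ≤ 1) (hq : q ≤ 1)
    (hc : (cfg I σ).CanElim I.n u v a b) (hcnt : σ.nat (19, 0) ≤ I.n)
    (h30 : σ.nat (30, 0) = u) (h31 : σ.nat (31, 0) = v) (h32 : σ.nat (32, 0) = a)
    (h33 : σ.nat (33, 0) = b) (h : Elim I k σ u v a b D τ) (hD : ¬ D p q) :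
    Elim I k σ u v a b (fun r s => D r s ∨ (r = p ∧ s = q)) ((elimEntry p q).exec I.reals τ) := by
  have hb := h.env.lt_bnd
  have hu : u < I.n + 3 := by have := hc.hu; omega
  have hv := hc.hv
  have ha := hc.ha
  have hb' := hc.hb
  have hau := hc.hau
  have hav := hc.hav
  have hbu := hc.hbu
  have hbv := hc.hbv
  have hab := hc.hab
  set τ₁ := (τ.setNat 12 a p).setNat 12 b q with hτ₁
  have he₁ : Env I k τ₁ := (h.env.setNat (by omega) _ _).setNat (by omega) _ _
  have r30 := (h.frame 30 (by decide) 0).trans h30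
  have r31 := (h.frame 31 (by decide) 0).trans h31
  have r32 := (h.frame 32 (by decide) 0).trans h32
  have r33 := (h.frame 33 (by decide) 0).trans h33
  have r19 := h.frame 19 (by decide) 0
  have fr₁ : ∀ x, x ≠ 12 → ∀ i, τ₁.nat (x, i) = τ.nat (x, i) := by
    intro x hx i
    simp [τ₁, State.setNat_nat, hx]
  have y₁ : ∀ w, τ₁.nat (12, w) = if w = b then q else if w = a then p else τ.nat (12, w) := by
    intro w
    simp [τ₁, State.setNat_nat]
  have e1 : LP.exec I.reals (.seq (.nset 12 (vr 32) (.const p)) (.nset 12 (vr 33) (.const q))) τ =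
      τ₁ := by
    have b1 : a ≤ τ.nat (4, 0) := by omega
    have b2 : b ≤ τ.nat (4, 0) := by omega
    have b3 : p ≤ τ.nat (4, 0) := by omega
    have b4 : q ≤ τ.nat (4, 0) := by omega
    simp [exec_nset, State.setNat_nat, r32, r33, b1, b2, b3, b4, τ₁]
  have hy₁ : ∀ w < I.n + 3, τ₁.nat (12, w) ≤ 1 := by
    intro w hw
    have := h.y_le w hw
    rw [y₁]
    split_ifs <;> assumption
  -- the costs that are computed are those of the values that extend the boundary values
  have hG : ∀ r ≤ 1, ∀ s ≤ 1, (cfg I τ₁).touch I.n u v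
      (Function.update (Function.update (cfg I τ₁).y u r) v s) =
      (cfg I σ).touch I.n u v (Cfg.env (cfg I σ).y a b u v p q r s) := by
    intro r hr s hs
    refine Cfg.touch_congr' (fun w _ => ?_) (fun w _ => ?_) fun w hw w' hw' huv => ?_
    · exact (fr₁ 10 (by omega) w).trans (h.frame 10 (by decide) w)
    · simp only [Cfg.env, Function.update_apply]
      split_ifs with e1 e2 e3 e4
      · rfl
      · rfl
      · rw [e3]; exact (y₁ b).trans (by simp)
      · rw [e4]; exact (y₁ a).trans (by simp [hab])
      · exact (y₁ w).trans (by rw [if_neg e3, if_neg e4]; exact h.y w e4 e3 e2 e1)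
    · have hz : ∀ x < I.n + 3,
          Function.update (Function.update (cfg I τ₁).y u r) v s x ≤ 1 := by
        intro x hx
        have := hy₁ x hx
        simp only [Function.update_apply]
        split_ifs
        · exact hs
        · exact hr
        · exact this
      refine h.f w hw w' hw' ?_ _ (hz w hw) _ (hz w' hw')
      rintro ⟨rfl, rfl⟩
      omega
  have hn₁ : Near I k τ₁ u v (τ₁.nat (19, 0) * 4 + p * 2 + q) τ₁ :=
    ⟨he₁, fun _ _ _ => rfl, fun _ _ _ => rfl, hy₁, fun _ _ => ⟨rfl, rfl⟩, fun _ _ _ _ => rfl⟩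
  have q30 : τ₁.nat (30, 0) = u := (fr₁ 30 (by omega) 0).trans r30
  have q31 : τ₁.nat (31, 0) = v := (fr₁ 31 (by omega) 0).trans r31
  have q32 : τ₁.nat (32, 0) = a := (fr₁ 32 (by omega) 0).trans r32
  have q33 : τ₁.nat (33, 0) = b := (fr₁ 33 (by omega) 0).trans r33
  have q19 : τ₁.nat (19, 0) = σ.nat (19, 0) := (fr₁ 19 (by omega) 0).trans r19
  have q4 : τ₁.nat (4, 0) = τ.nat (4, 0) := fr₁ 4 (by omega) 0
  obtain ⟨g1, g2, -, -⟩ := hn₁.evalAt hu hv (Nat.zero_le 1) (Nat.zero_le 1) q30 q31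
  obtain ⟨g3, g4, g5, g6⟩ := g1.record hp hq (Nat.zero_le 1) (Nat.zero_le 1) (by omega)
  have B₀ : Best I k τ₁ u v (τ₁.nat (19, 0) * 4 + p * 2 + q) _ 0 0 :=
    ⟨g3, by rw [g4, g2], g5, g6, by omega, by omega⟩
  obtain ⟨r₁, s₁, B₁, l₁, m₁⟩ := B₀.improve hp hq (Nat.zero_le 1) le_rfl (by omega) hu hv q30 q31
  obtain ⟨r₂, s₂, B₂, l₂, m₂⟩ := B₁.improve hp hq le_rfl (Nat.zero_le 1) (by omega) hu hv q30 q31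
  obtain ⟨r₃, s₃, B₃, l₃, m₃⟩ := B₂.improve hp hq le_rfl le_rfl (by omega) hu hv q30 q31
  rw [elimEntry, exec_seq, e1, exec_seq, exec_seq, exec_seq, exec_seq, exec_seq]
  revert B₃
  generalize (improve p q 1 1).exec I.reals _ = ρ
  intro B
  have hopt : ∀ r ≤ 1, ∀ s ≤ 1,
      (cfg I σ).touch I.n u v (Cfg.env (cfg I σ).y a b u v p q r₃ s₃) ≤
      (cfg I σ).touch I.n u v (Cfg.env (cfg I σ).y a b u v p q r s) := by
    intro r hr s hs
    rw [← hG r₃ B.r_le s₃ B.s_le, ← hG r hr s hs]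
    interval_cases r <;> interval_cases s
    · exact (l₃.trans l₂).trans l₁
    · exact (l₃.trans l₂).trans m₁
    · exact l₃.trans m₂
    · exact m₃
  have hcost := B.cost
  rw [hG _ B.r_le _ B.s_le] at hcost
  have n32 := (B.near.frame 32 (by decide) 0).trans q32
  have n33 := (B.near.frame 33 (by decide) 0).trans q33
  have n4 := (B.near.frame 4 (by decide) 0).trans q4
  have hidx : ((a * (I.n + 3) + b) * 2 + p) * 2 + q ≤ ρ.nat (4, 0) := by
    have := idx_lt ha hb'
    rw [B.near.env.b]
    omega
  rw [exec_rset _ (by simpa [n32, n33, B.near.env.n] using hidx)]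
  simp only [val_at4, val_vr, val_const, n32, n33, B.near.env.n, RExp.val]
  set m := ((a * (I.n + 3) + b) * 2 + p) * 2 + q with hm
  set ρ' := ρ.setReal 2 m (ρ.real (2, m) + ρ.real (4, 0)) with hρ'
  have hru : ∀ p' ≤ 1, ∀ q' ≤ 1, ((cfg I ρ').ru (σ.nat (19, 0)) p' q' =
      if p' = p ∧ q' = q then r₃ else (cfg I τ).ru (σ.nat (19, 0)) p' q') ∧
      (cfg I ρ').rv (σ.nat (19, 0)) p' q' =
      if p' = p ∧ q' = q then s₃ else (cfg I τ).rv (σ.nat (19, 0)) p' q' := by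
    intro p' hp' q' hq'
    by_cases hpq : p' = p ∧ q' = q
    · rw [if_pos hpq, if_pos hpq, hpq.1, hpq.2]
      exact ⟨by rw [← q19]; exact B.ru, by rw [← q19]; exact B.rv⟩
    · rw [if_neg hpq, if_neg hpq]
      obtain ⟨x1, x2⟩ := B.near.r (σ.nat (19, 0) * 4 + p' * 2 + q') (by rw [q19]; omega)
      exact ⟨x1.trans (fr₁ 17 (by omega) _), x2.trans (fr₁ 18 (by omega) _)⟩
  have hf : ∀ p' q' r s, q' < I.n + 3 → r ≤ 1 → s ≤ 1 →
      (cfg I ρ').f p' q' r s = if (p' = a ∧ q' = b) ∧ r = p ∧ s = q then (cfg I τ).f a b p q +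
        (cfg I σ).touch I.n u v (Cfg.env (cfg I σ).y a b u v p q r₃ s₃)
        else (cfg I τ).f p' q' r s := by
    intro p' q' r s hq' hr hs
    have hreal : ∀ i, ρ.real (2, i) = τ.real (2, i) := fun i =>
      B.near.real 2 (by omega) (by omega) i
    have hiff := idx4_inj (p := p') (p' := a) (q := q') (q' := b) (r := r) (s := s) (r' := p)
      (s' := q) hq' hb' hr hs hp hq
    simp only [cfg, ρ', State.setReal_real, true_and, hm, hiff]
    split_ifs
    · rw [Form.val_add, hreal]
      exact congrArg _ hcost
    · rw [hreal]
  have hfrn : ∀ x i, ρ'.nat (x, i) = ρ.nat (x, i) := fun _ _ => rfl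
  constructor
  · exact B.near.env.congr (fun _ _ _ => rfl) fun x hx i => by
      rw [hρ', State.setReal_real, if_neg (by omega)]
  · intro x hx i
    rw [hfrn, B.near.frame x hx, fr₁ x (by rintro rfl; simp at hx), h.frame x hx]
  · intro w h1 h2 h3 h4
    rw [hfrn, B.near.y w h3 h4, y₁, if_neg h2, if_neg h1, h.y w h1 h2 h3 h4]
  · exact B.near.y_le
  · intro i hi r hr s hs
    obtain ⟨x1, x2⟩ := B.near.r (i * 4 + r * 2 + s) (by rw [q19]; omega)
    rw [hfrn, hfrn, x1, x2, fr₁ 17 (by omega), fr₁ 18 (by omega)]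
    exact h.old i hi r hr s hs
  · intro p' hp' q' hq' hd
    rw [(hru p' hp' q' hq').1, (hru p' hp' q' hq').2]
    split_ifs with hpq
    · exact ⟨B.r_le, B.s_le⟩
    · exact h.r_le p' hp' q' hq' (hd.resolve_right hpq)
  · intro p' hp' q' hq' hd
    rw [(hru p' hp' q' hq').1, (hru p' hp' q' hq').2]
    split_ifs with hpq
    · rw [hpq.1, hpq.2]
      exact hopt
    · exact h.opt p' hp' q' hq' (hd.resolve_right hpq)
  · intro p' hp' q' hq' hd
    push Not at hd
    rw [hf a b p' q' hb' hp' hq', if_neg (by tauto)]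
    exact h.todo p' hp' q' hq' hd.1
  · intro p' hp' q' hq' hd
    rw [hf a b p' q' hb' hp' hq', (hru p' hp' q' hq').1, (hru p' hp' q' hq').2]
    by_cases hpq : p' = p ∧ q' = q
    · rw [if_pos ⟨⟨rfl, rfl⟩, hpq⟩, if_pos hpq, if_pos hpq, hpq.1, hpq.2, h.todo p hp q hq hD]
    · rw [if_neg (fun hh => hpq hh.2), if_neg hpq, if_neg hpq]
      exact h.done p' hp' q' hq' (hd.resolve_right hpq)
  · intro p' hp' q' hq' hne r hr s hs
    rw [hf p' q' r s hq' hr hs, if_neg (fun hh => hne hh.1)]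
    exact h.f p' hp' q' hq' hne r hr s hs

theorem elim_spec {σ : State} {u v a b : ℕ} {W : ℝ} {F₀ : (ℕ → ℕ) → ℝ} (he : Env I k σ)
    (hi : (cfg I σ).Inv I.n W F₀)
    (hc : (cfg I σ).CanElim I.n u v a b) (hcnt : σ.nat (19, 0) ≤ I.n)
    (h30 : σ.nat (30, 0) = u) (h31 : σ.nat (31, 0) = v) (h32 : σ.nat (32, 0) = a)
    (h33 : σ.nat (33, 0) = b) :
    (cfg I σ).IsElim I.n (cfg I (elim.exec I.reals σ)) u v a b := by
  have h0 : Elim I k σ u v a b (fun _ _ => False) σ :=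
    ⟨he, fun _ _ _ => rfl, fun _ _ _ _ _ => rfl, hi.y_le, fun _ _ _ _ _ _ => ⟨rfl, rfl⟩,
      fun _ _ _ _ h => h.elim, fun _ _ _ _ h => h.elim, fun _ _ _ _ _ => rfl,
      fun _ _ _ _ h => h.elim, fun _ _ _ _ _ _ _ _ _ => rfl⟩
  have h1 := elimEntry_spec (Nat.zero_le 1) (Nat.zero_le 1) hc hcnt h30 h31 h32 h33 h0 (by simp)
  have h2 := elimEntry_spec (Nat.zero_le 1) le_rfl hc hcnt h30 h31 h32 h33 h1 (by simp)
  have h3 := elimEntry_spec le_rfl (Nat.zero_le 1) hc hcnt h30 h31 h32 h33 h2 (by simp)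
  have h4 := elimEntry_spec le_rfl le_rfl hc hcnt h30 h31 h32 h33 h3 (by simp)
  rw [elim, exec_seq, exec_seq, exec_seq, exec_seq]
  revert h4
  generalize (elimEntry 1 1).exec I.reals _ = τ
  intro h
  have hD : ∀ p ≤ 1, ∀ q ≤ 1, (((False ∨ p = 0 ∧ q = 0) ∨ p = 0 ∧ q = 1) ∨ p = 1 ∧ q = 0) ∨
      p = 1 ∧ q = 1 := by omega
  have hb := h.env.lt_bnd
  have hu : u < I.n + 3 := by have := hc.hu; omega
  have hv := hc.hv
  have ha := hc.ha
  have hb' := hc.hb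
  have hab := hc.hab
  set t := σ.nat (19, 0) with ht
  have r30 := (h.frame 30 (by decide) 0).trans h30
  have r31 := (h.frame 31 (by decide) 0).trans h31
  have r32 := (h.frame 32 (by decide) 0).trans h32
  have r33 := (h.frame 33 (by decide) 0).trans h33
  have r19 := (h.frame 19 (by decide) 0).trans ht.symm
  have r11 : ∀ i, τ.nat (11, i) = σ.nat (11, i) := h.frame 11 (by decide)
  have iab := idx_lt ha hb'
  have iba := idx_lt hb' ha
  have hbd := h.env.b
  have b1 : u ≤ τ.nat (4, 0) := by omega
  have b2 : v ≤ τ.nat (4, 0) := by omega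
  have b3 : a ≤ τ.nat (4, 0) := by omega
  have b4 : b ≤ τ.nat (4, 0) := by omega
  have b5 : t ≤ τ.nat (4, 0) := by omega
  have b6 : 2 ≤ τ.nat (4, 0) := by omega
  have b7 : a * (I.n + 3) + b ≤ τ.nat (4, 0) := by omega
  have b8 : b * (I.n + 3) + a ≤ τ.nat (4, 0) := by omega
  have b9 : t + 1 ≤ τ.nat (4, 0) := by omega
  set τ₁ := (τ.setNat 12 a 0).setNat 12 b 0 with hτ₁
  set τ₂ := (((τ₁.setNat 13 t u).setNat 14 t v).setNat 15 t a).setNat 16 t b with hτ₂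
  set τ₃ := (τ₂.setNat 10 u 2).setNat 10 v 2 with hτ₃
  set τ₄ := if σ.nat (11, a * (I.n + 3) + b) = 0 then
    (τ₃.setNat 11 (a * (I.n + 3) + b) 2).setNat 11 (b * (I.n + 3) + a) 2 else τ₃ with hτ₄
  set τ₅ := τ₄.setNat 19 0 (t + 1) with hτ₅
  have e1 : LP.exec I.reals (.seq (.nset 12 (vr 32) (.const 0)) (.nset 12 (vr 33) (.const 0))) τ =
      τ₁ := by
    simp [exec_nset, State.setNat_nat, r32, r33, b3, b4, τ₁]
  have e2 : LP.exec I.reals (.seq (.seq (.nset 13 (vr 19) (vr 30)) (.nset 14 (vr 19) (vr 31)))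
    (.seq (.nset 15 (vr 19) (vr 32)) (.nset 16 (vr 19) (vr 33)))) τ₁ = τ₂ := by
    simp [exec_nset, State.setNat_nat, r30, r31, r32, r33, r19, b1, b2, b3, b4, b5, τ₁, τ₂]
  have e3 : LP.exec I.reals (.seq (.nset 10 (vr 30) (.const 2)) (.nset 10 (vr 31) (.const 2))) τ₂ =
      τ₃ := by
    simp [exec_nset, State.setNat_nat, r30, r31, b1, b2, b6, τ₁, τ₂, τ₃]
  have f3 : ∀ x i, x ∉ [10, 12, 13, 14, 15, 16] → τ₃.nat (x, i) = τ.nat (x, i) := by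
    intro x i hx
    simp only [List.mem_cons, List.not_mem_nil, or_false, not_or] at hx
    simp [τ₁, τ₂, τ₃, State.setNat_nat, hx]
  have e4 : LP.exec I.reals (.ite (eqT (.cell 11 (at2 (vr 32) (vr 33))) (.const 0))
    (.seq (.nset 11 (at2 (vr 32) (vr 33)) (.const 2)) (.nset 11 (at2 (vr 33) (vr 32)) (.const 2)))
    .skip) τ₃ = τ₄ := by
    have x32 := (f3 32 0 (by decide)).trans r32
    have x33 := (f3 33 0 (by decide)).trans r33
    have x0 := (f3 0 0 (by decide)).trans h.env.n
    have x4 := f3 4 0 (by decide)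
    have x11 := fun i => (f3 11 i (by decide)).trans (r11 i)
    by_cases h11 : σ.nat (11, a * (I.n + 3) + b) = 0
    · rw [exec_ite_pos _ _ (by simp [x32, x33, x0, x11, h11]), hτ₄, if_pos h11]
      simp [exec_nset, State.setNat_nat, x32, x33, x0, x4, b6, b7, b8]
    · rw [exec_ite_neg _ _ (by simp [x32, x33, x0, x11, h11]), hτ₄, if_neg h11, exec_skip]
  have f4 : ∀ x i, x ≠ 11 → τ₄.nat (x, i) = τ₃.nat (x, i) := by
    intro x i hx
    rw [hτ₄]
    split_ifs
    · simp [State.setNat_nat, hx]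
    · rfl
  have e5 : LP.exec I.reals (setv 19 (.add (vr 19) (.const 1))) τ₄ = τ₅ := by
    have x19 := ((f4 19 0 (by omega)).trans (f3 19 0 (by decide))).trans r19
    have x4 := (f4 4 0 (by omega)).trans (f3 4 0 (by decide))
    rw [exec_setv _ (by simpa [x19, x4] using b9)]
    simp [x19, hτ₅]
  have efin : elimFinish.exec I.reals τ = τ₅ := by
    rw [elimFinish, exec_seq, e1, exec_seq, e2, exec_seq, e3, exec_seq, e4, e5]
  rw [efin]
  have f5 : ∀ x i, x ≠ 11 → x ≠ 19 → τ₅.nat (x, i) = τ₃.nat (x, i) := by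
    intro x i h1 h2
    rw [hτ₅, State.setNat_nat, if_neg (by omega), f4 x i h1]
  have real5 : τ₅.real = τ.real := by
    rw [hτ₅, State.setNat_real, hτ₄]
    split_ifs <;> rfl
  have hst : ∀ w, (cfg I τ₅).st w = if w = u ∨ w = v then 2 else (cfg I σ).st w := by
    intro w
    change τ₅.nat (10, w) = if w = u ∨ w = v then 2 else σ.nat (10, w)
    rw [f5 10 w (by omega) (by omega), ← h.frame 10 (by decide)]
    simp only [τ₁, τ₂, τ₃, State.setNat_nat]
    grind
  have hy : ∀ w, (cfg I τ₅).y w = if w = a ∨ w = b then 0 else τ.nat (12, w) := by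
    intro w
    change τ₅.nat (12, w) = if w = a ∨ w = b then 0 else τ.nat (12, w)
    rw [f5 12 w (by omega) (by omega)]
    simp only [τ₁, τ₂, τ₃, State.setNat_nat]
    grind
  have hru : ∀ i r s, (cfg I τ₅).ru i r s = (cfg I τ).ru i r s := fun i r s =>
    (f5 17 _ (by omega) (by omega)).trans (f3 17 _ (by decide))
  have hrv : ∀ i r s, (cfg I τ₅).rv i r s = (cfg I τ).rv i r s := fun i r s =>
    (f5 18 _ (by omega) (by omega)).trans (f3 18 _ (by decide))
  have hf : ∀ p q r s, (cfg I τ₅).f p q r s = (cfg I τ).f p q r s := fun p q r s => by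
    simp only [cfg, real5]
  have h13 : ∀ x, 13 ≤ x → x ≤ 16 → ∀ i, i ≠ t → τ₅.nat (x, i) = σ.nat (x, i) := by
    intro x h1 h2 i hit
    rw [f5 x i (by omega) (by omega), ← h.frame x (by simp; omega)]
    simp only [τ₁, τ₂, τ₃, State.setNat_nat]
    rw [if_neg (by omega), if_neg (by omega), if_neg (by omega), if_neg (by omega),
      if_neg (by omega), if_neg (by omega), if_neg (by omega), if_neg (by omega)]
  constructor
  · exact fun p _ => hst p
  · intro p hp
    rw [hy]
    have := h.y_le p hp
    split_ifs
    · omega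
    · exact this
  · intro p hp hp1
    have aux : ∀ w, ((cfg I σ).st w = 0 ∧ (cfg I σ).adj u w ≠ 0) ∨ w = I.n ∨ w = I.n + 1 →
        (cfg I σ).st w = 1 → 0 = (cfg I σ).y w := by
      rintro w (hw | rfl | rfl) hw1
      · omega
      · rw [hi.y_n]
      · rw [hi.y_n1]
    rw [hy]
    split_ifs with hpab
    · rcases hpab with rfl | rfl
      · exact aux _ hc.st_a hp1
      · exact aux _ hc.st_b hp1
    · push Not at hpab
      refine h.y p hpab.1 hpab.2 ?_ ?_
      · rintro rfl
        have := hc.st_u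
        omega
      · rintro rfl
        rcases hc.st_v with h5 | rfl
        · omega
        · have := hi.st_n2
          omega
  · intro p hp q hq
    have hsym := hi.adj_symm a ha b hb'
    have i1 := idx_inj (p := p) (p' := a) hq hb'
    have i2 := idx_inj (p := p) (p' := b) hq ha
    change τ₅.nat (11, p * (I.n + 3) + q) = _
    rw [hτ₅, State.setNat_nat, if_neg (by omega), hτ₄]
    have x11 : τ₃.nat (11, p * (I.n + 3) + q) = (cfg I σ).adj p q :=
      (f3 11 _ (by decide)).trans (r11 _)
    have hab0 : σ.nat (11, a * (I.n + 3) + b) = (cfg I σ).adj a b := rfl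
    rw [hab0]
    split_ifs with c1 c2 c2
    · simp only [State.setNat_nat, true_and]
      rcases c2.1 with hh | hh
      · rw [← i1] at hh
        simp [hh]
      · rw [← i2] at hh
        simp [hh]
    · simp only [State.setNat_nat, true_and, i1, i2, x11]
      rw [if_neg, if_neg]
      · rintro ⟨rfl, rfl⟩; exact c2 ⟨.inl ⟨rfl, rfl⟩, c1⟩
      · rintro ⟨rfl, rfl⟩; exact c2 ⟨.inr ⟨rfl, rfl⟩, by rw [← hsym]; exact c1⟩
    · rcases c2 with ⟨⟨rfl, rfl⟩ | ⟨rfl, rfl⟩, c3⟩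
      · exact absurd c3 c1
      · exact absurd (hsym.trans c3) c1
    · exact x11
  · intro p hp q hq r hr s hs
    rw [hf, hru, hrv]
    split_ifs with hpab
    · rw [hpab.1, hpab.2]
      exact h.done r hr s hs (hD r hr s hs)
    · exact h.f p hp q hq hpab r hr s hs
  · exact (f5 20 0 (by omega) (by omega)).trans ((f3 20 0 (by decide)).trans
      (h.frame 20 (by decide) 0))
  · simp [cfg, hτ₅, State.setNat_nat, ht]
  · change τ₅.nat (13, t) = u
    rw [f5 13 t (by omega) (by omega)]
    simp [τ₂, τ₃, State.setNat_nat]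
  · change τ₅.nat (14, t) = v
    rw [f5 14 t (by omega) (by omega)]
    simp [τ₂, τ₃, State.setNat_nat]
  · change τ₅.nat (15, t) = a
    rw [f5 15 t (by omega) (by omega)]
    simp [τ₂, τ₃, State.setNat_nat]
  · change τ₅.nat (16, t) = b
    rw [f5 16 t (by omega) (by omega)]
    simp [τ₂, τ₃, State.setNat_nat]
  · intro i hit
    have hit' : i ≠ t := (Nat.lt_of_lt_of_le hit le_rfl).ne
    exact ⟨h13 13 (by omega) (by omega) i hit', h13 14 (by omega) (by omega) i hit',
      h13 15 (by omega) (by omega) i hit', h13 16 (by omega) (by omega) i hit'⟩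
  · intro i hit r hr s hs
    rw [hru, hrv]
    exact h.old i hit r hr s hs
  · intro r hr s hs
    rw [hru, hrv]
    exact h.r_le r hr s hs (hD r hr s hs)
  · intro p hp q hq r hr s hs
    rw [hru, hrv]
    exact h.opt p hp q hq (hD p hp q hq) r hr s hs

end Elim

/-! ### The search tree -/

section Step

variable {I : Instance} {k : ℕ} {F₀ : (ℕ → ℕ) → ℝ}

/-- The invariant of the memory during the search. -/
structure Ok (I : Instance) (k : ℕ) (F₀ : (ℕ → ℕ) → ℝ) (σ : State) : Prop where
  env : Env I k σ
  inv : (cfg I σ).Inv I.n I.W F₀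
  cnt : (cfg I σ).cnt + ((cfg I σ).free I.n).card ≤ I.n

/-- The memory allows a branching on the vertex in variable `22`. -/
structure CanBranch (I : Instance) (k : ℕ) (σ : State) : Prop where
  mem : σ.nat (22, 0) ∈ (cfg I σ).free I.n
  or : ((cfg I σ).mode = 0 ∧ (cfg I σ).ones I.n ≤ k ∧
      4 ≤ degOn (cfg I σ).adj ((cfg I σ).free I.n) (σ.nat (22, 0))) ∨
    ((cfg I σ).mode = 1 ∧ (∀ u v a b, ¬ (cfg I σ).CanElim I.n u v a b) ∧
      ((cfg I σ).Hard I.n → ∃ w ∈ (cfg I σ).free I.n, (cfg I σ).adj (σ.nat (22, 0)) w = 1))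

/-- A step either branches, without any change of the configuration, or it does not increase the
potential. In the latter case, if there is a solution, it is not lost, and fewer steps remain unless
nothing is left to do. -/
theorem prep_spec {σ : State} (h : Ok I k F₀ σ) :
    Ok I k F₀ (prep.exec I.reals σ) ∧
    (((prep.exec I.reals σ).nat (21, 0) = 0 ∧
      (cfg I (prep.exec I.reals σ)).pot I.n k ≤ (cfg I σ).pot I.n k ∧
      ((cfg I σ).Good I.n k I.W → (cfg I (prep.exec I.reals σ)).Good I.n k I.W ∧
        ((cfg I (prep.exec I.reals σ)).todo I.n < (cfg I σ).todo I.n ∨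
          (cfg I (prep.exec I.reals σ)).todo I.n = 0))) ∨
    ((prep.exec I.reals σ).nat (21, 0) ≠ 0 ∧ cfg I (prep.exec I.reals σ) = cfg I σ ∧
      CanBranch I k (prep.exec I.reals σ))) := by
  have hb := h.env.lt_bnd
  set σ₀ := σ.setNat 21 0 0 with hσ₀
  have he₀ : Env I k σ₀ := h.env.setNat (by omega) _ _
  have hc₀ : cfg I σ₀ = cfg I σ := by
    refine cfg_congr (fun x hx i => ?_) fun i => rfl
    simp only [List.mem_range'_1] at hx
    rw [hσ₀, State.setNat_nat, if_neg (by omega)]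
  obtain ⟨h24, h25, h26⟩ := stats_spec he₀ (by
    rw [hc₀]
    exact fun p hp q hq => h.inv.adj_le p (by omega) q (by omega))
  rw [prep, exec_seq, exec_setv _ (by simp), exec_seq, val_const, ← hσ₀]
  set σ₁ := stats.exec I.reals σ₀ with hσ₁
  have he : Env I k σ₁ := he₀.exec _
  have hc₁ : cfg I σ₁ = cfg I σ := by
    rw [← hc₀]
    exact cfg_exec_congr _ (by decide) (by decide)
  rw [hc₀] at h24 h25 h26
  have h21 : σ₁.nat (21, 0) = 0 := by
    rw [LP.exec_nat_of_not_mem _ _ (by decide)]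
    simp [hσ₀, State.setNat_nat]
  have hok : Ok I k F₀ σ₁ := ⟨he, by rw [hc₁]; exact h.inv, by rw [hc₁]; exact h.cnt⟩
  have hb₁ := he.lt_bnd
  have h20 : σ₁.nat (20, 0) = (cfg I σ).mode := by rw [← hc₁]; rfl
  by_cases hm : (cfg I σ).mode = 0
  · rw [exec_ite_pos _ _ (by simp [h20, hm])]
    rcases h26 with ⟨h26, hd⟩ | ⟨h26, h22, hd⟩
    · -- the first phase ends
      rw [exec_ite_neg _ _ (by simp [h26]), endPhase]
      have hset : ∀ m, m ≠ 0 → Ok I k F₀ (σ₁.setNat 20 0 m) ∧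
          cfg I (σ₁.setNat 20 0 m) = {cfg I σ with mode := m} := by
        intro m hm0
        have : cfg I (σ₁.setNat 20 0 m) = {cfg I σ with mode := m} := by
          rw [← hc₁]
          simp [cfg, State.setNat_nat]
        refine ⟨⟨he.setNat (by omega) _ _, ?_, ?_⟩, this⟩
        · rw [this]
          exact h.inv.set_mode hm0 hd
        · rw [this]
          exact h.cnt
      by_cases hg : (cfg I σ).ones I.n ≤ k ∧
          massOn (cfg I σ).adj ((cfg I σ).free I.n) ≤ 6 * (k - (cfg I σ).ones I.n)
      · rw [exec_ite_pos _ _ (by simpa [h24, h25, he.k] using hg), exec_setv _ (by simp; omega),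
          val_const]
        obtain ⟨g1, g2⟩ := hset 1 (by omega)
        refine ⟨g1, .inl ⟨by simp [State.setNat_nat, h21], ?_, ?_⟩⟩
        · rw [g2]
          exact Cfg.pot_set_mode hm hg.2
        · rw [g2]
          rintro ⟨-, z, hz, hw, -⟩
          refine ⟨⟨le_rfl, z, hz, hw, fun h => absurd h (by simp)⟩, .inl ?_⟩
          have e1 : Cfg.free I.n {cfg I σ with mode := 1} = (cfg I σ).free I.n := rfl
          simp [Cfg.todo, hm, e1]
      · rw [exec_ite_neg _ _ (by
          simpa only [holds_and, holds_nle, val_vr, val_kE, val_mul, val_sub, val_const, h24, h25,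
            he.k] using hg), exec_setv _ (by simp; omega), val_const]
        obtain ⟨g1, g2⟩ := hset 2 (by omega)
        refine ⟨g1, .inl ⟨by simp [State.setNat_nat, h21], ?_, ?_⟩⟩
        · rw [g2]
          simp [Cfg.pot]
        -- a solution of size `k` would satisfy the condition that failed
        · intro hgood
          exact absurd ⟨hgood.ones_le hm, hgood.mass_le h.inv hm hd⟩ hg
    · rw [exec_ite_pos _ _ (by simp [h26])]
      by_cases hk : (cfg I σ).ones I.n ≤ k
      · rw [exec_ite_pos _ _ (by simpa [h24, he.k] using hk), exec_setv _ (by simp; omega),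
          val_const]
        have hc₂ : cfg I (σ₁.setNat 21 0 1) = cfg I σ := by
          rw [← hc₁]
          refine cfg_congr (fun x hx i => ?_) fun i => rfl
          simp only [List.mem_range'_1] at hx
          rw [State.setNat_nat, if_neg (by omega)]
        have h22' : (σ₁.setNat 21 0 1).nat (22, 0) = σ₁.nat (22, 0) := by
          simp [State.setNat_nat]
        refine ⟨⟨he.setNat (by omega) _ _, by rw [hc₂]; exact h.inv, by rw [hc₂]; exact h.cnt⟩,
          .inr ⟨by simp [State.setNat_nat], hc₂, ?_, .inl ?_⟩⟩
        · rw [h22', hc₂]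
          exact h22
        · rw [h22', hc₂]
          exact ⟨hm, hk, hd⟩
      · rw [exec_ite_neg _ _ (by simpa [h24, he.k] using hk), exec_skip]
        refine ⟨hok, .inl ⟨h21, by rw [hc₁], fun hgood => absurd (hgood.ones_le hm) hk⟩⟩
  · rw [exec_ite_neg _ _ (by simp [h20, hm])]
    by_cases hm1 : (cfg I σ).mode = 1
    · rw [exec_ite_pos _ _ (by simp [h20, hm1]), exec_seq]
      obtain ⟨hf, hno⟩ := search_spec he
      have h21' : (search.exec I.reals σ₁).nat (21, 0) = 0 := by
        rw [LP.exec_nat_of_not_mem _ _ (by decide), h21]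
      set σ₂ := search.exec I.reals σ₁ with hσ₂
      rw [hc₁] at hf hno
      have hok₂ : Ok I k F₀ σ₂ :=
        ⟨hf.env, by rw [hf.cfg]; exact h.inv, by rw [hf.cfg]; exact h.cnt⟩
      by_cases h29 : σ₂.nat (29, 0) = 1
      · rw [exec_ite_pos _ _ (by simp [h29])]
        have hcan := hf.can h29
        have hi₂ := hok₂.inv
        have hsp := elim_spec hf.env hi₂ (by rw [hf.cfg]; exact hcan)
          (by have := hok₂.cnt; exact (Nat.le_add_right _ _).trans this) rfl rfl rfl rfl
        have h21e : (elim.exec I.reals σ₂).nat (21, 0) = 0 := by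
          rw [LP.exec_nat_of_not_mem _ _ (by decide), h21']
        rw [hf.cfg] at hsp
        set σ₃ := elim.exec I.reals σ₂ with hσ₃
        have hlt := Finset.card_lt_card (hsp.free_sub.trans_ssubset
          (Finset.erase_ssubset hcan.mem_free))
        refine ⟨⟨hf.env.exec _, hsp.inv h.inv hm hcan, ?_⟩, .inl ⟨h21e, ?_, ?_⟩⟩
        · rw [hsp.cnt]
          have := h.cnt
          omega
        · exact hsp.pot_le h.inv hm1 hcan
        · exact fun hgood => ⟨hsp.good h.inv hm1 hcan hgood, .inl (hsp.todo_lt hcan)⟩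
      · rw [exec_ite_neg _ _ (by simpa using h29)]
        have h0 := hno (by have := hf.le; omega)
        have hpick := pickVertex_spec hf.env h21'
        have hc₃ : cfg I (pickVertex.exec I.reals σ₂) = cfg I σ := by
          rw [← hf.cfg]
          exact cfg_exec_congr _ (by decide) (by decide)
        rw [hf.cfg] at hpick
        refine ⟨⟨hf.env.exec _, by rw [hc₃]; exact h.inv, by rw [hc₃]; exact h.cnt⟩, ?_⟩
        rcases hpick with ⟨h3, h4⟩ | ⟨h3, h4, h5⟩
        · refine .inl ⟨h3, by rw [hc₃], ?_⟩
          rw [hc₃]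
          exact fun hgood => ⟨hgood, .inr (by simp [Cfg.todo, hm, h4])⟩
        · refine .inr ⟨h3, hc₃, ?_, .inr ?_⟩
          · rw [hc₃]
            exact h4
          · rw [hc₃]
            exact ⟨hm1, h0, h5⟩
    · rw [exec_ite_neg _ _ (by simp [h20, hm1]), exec_skip]
      refine ⟨hok, .inl ⟨h21, by rw [hc₁], fun hgood => ?_⟩⟩
      have := hgood.1
      omega

/-- The memory after branching on variable `22`. -/
def child (I : Instance) (σ : State) (bit : ℕ) : State :=
  branch.exec I.reals (σ.setNat 23 0 bit)

theorem child_spec {σ : State} (h : Ok I k F₀ σ) (hbr : CanBranch I k σ) {bit : ℕ}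
    (hbit : bit ≤ 1) :
    Ok I k F₀ (child I σ bit) ∧
    (cfg I σ).IsFix I.n (cfg I (child I σ bit)) (σ.nat (22, 0)) bit := by
  have he : Env I k (σ.setNat 23 0 bit) := h.env.setNat (by omega) _ _
  have hc : cfg I (σ.setNat 23 0 bit) = cfg I σ := by
    refine cfg_congr (fun x hx i => ?_) fun i => rfl
    simp only [List.mem_range'_1] at hx
    rw [State.setNat_nat, if_neg (by omega)]
  have hfix := branch_spec he (v := σ.nat (22, 0)) (Cfg.mem_free.1 hbr.mem).1
    (by simp [State.setNat_nat]) (by simp [State.setNat_nat]) hbit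
  rw [hc] at hfix
  refine ⟨⟨he.exec _, hfix.inv h.inv hbr.mem hbit, ?_⟩, hfix⟩
  have h1 := Finset.card_le_card hfix.free_sub
  have h2 := Finset.card_erase_le (s := (cfg I σ).free I.n) (a := σ.nat (22, 0))
  have h3 := h.cnt
  change (cfg I (child I σ bit)).cnt + ((cfg I (child I σ bit)).free I.n).card ≤ I.n
  rw [show (cfg I (child I σ bit)).cnt = (cfg I σ).cnt from hfix.cnt]
  exact (Nat.add_le_add_left (h1.trans (by simpa using h2)) _).trans h3

/-- The search tree of depth at most `t` from the memory `σ`. -/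
def tree (I : Instance) : ℕ → State → Tree State
  | 0, σ => .leaf σ
  | t + 1, σ =>
      if (prep.exec I.reals σ).nat (21, 0) = 0 then tree I t (prep.exec I.reals σ)
      else .node (tree I t (child I (prep.exec I.reals σ) 0))
        (tree I t (child I (prep.exec I.reals σ) 1))

/-- The potential drops in each branching by enough to pay for both subtrees. -/
theorem Ok.length_leaves_le {t : ℕ} {σ : State} (h : Ok I k F₀ σ) :
    ((tree I t σ).leaves.length : ℝ) ≤ Cfg.base ^ (cfg I σ).pot I.n k := by
  induction t generalizing σ with
  | zero => simpa [tree, Tree.leaves] using one_le_pow₀ Cfg.one_le_base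
  | succ t ih =>
    obtain ⟨h1, h2⟩ := prep_spec h
    rw [tree]
    rcases h2 with ⟨h2, h3, -⟩ | ⟨h2, h3, h4⟩
    · rw [if_pos h2]
      exact (ih h1).trans (pow_le_pow_right₀ Cfg.one_le_base h3)
    · rw [if_neg h2, Tree.leaves, List.length_append, Nat.cast_add, ← h3, add_comm]
      obtain ⟨g1, g2⟩ := child_spec h1 h4 (Nat.zero_le 1)
      obtain ⟨g3, g4⟩ := child_spec h1 h4 le_rfl
      refine (add_le_add (ih g3) (ih g1)).trans ?_
      rcases h4.or with ⟨f1, f2, f3⟩ | ⟨f1, f2, f3⟩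
      · exact Cfg.IsFix.pot_mode_zero h1.inv f1 h4.mem f3 f2 g2 g4
      · exact Cfg.IsFix.pot_mode_one h1.inv f1 h4.mem f2 f3 g2 g4

theorem Ok.of_mem_leaves {t : ℕ} {σ : State} (h : Ok I k F₀ σ) :
    ∀ ρ ∈ (tree I t σ).leaves, Ok I k F₀ ρ := by
  induction t generalizing σ with
  | zero => simpa [tree, Tree.leaves] using h
  | succ t ih =>
    obtain ⟨h1, h2⟩ := prep_spec h
    rw [tree]
    rcases h2 with ⟨h2, -⟩ | ⟨h2, -, h4⟩
    · rw [if_pos h2]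
      exact ih h1
    · rw [if_neg h2, Tree.leaves]
      intro ρ hρ
      rcases List.mem_append.1 hρ with hρ | hρ
      · exact ih (child_spec h1 h4 (Nat.zero_le 1)).1 ρ hρ
      · exact ih (child_spec h1 h4 le_rfl).1 ρ hρ

/-- If there is a solution, some leaf has fixed all vertices in accordance with one. -/
theorem Ok.exists_leaf {t : ℕ} {σ : State} (h : Ok I k F₀ σ) (hg : (cfg I σ).Good I.n k I.W)
    (ht : (cfg I σ).todo I.n ≤ t) :
    ∃ ρ ∈ (tree I t σ).leaves, (cfg I ρ).Good I.n k I.W ∧ (cfg I ρ).free I.n = ∅ := by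
  induction t generalizing σ with
  | zero =>
    refine ⟨σ, by simp [tree, Tree.leaves], hg, ?_⟩
    rw [← Finset.card_eq_zero]
    have := ht
    simp only [Cfg.todo] at this
    omega
  | succ t ih =>
    obtain ⟨h1, h2⟩ := prep_spec h
    rw [tree]
    rcases h2 with ⟨h2, -, h3⟩ | ⟨h2, h3, h4⟩
    · rw [if_pos h2]
      obtain ⟨g1, g2⟩ := h3 hg
      exact ih h1 g1 (by omega)
    · rw [if_neg h2, Tree.leaves]
      obtain ⟨g1, g2⟩ := child_spec h1 h4 (Nat.zero_le 1)
      obtain ⟨g3, g4⟩ := child_spec h1 h4 le_rfl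
      have t0 := g2.todo_lt h4.mem
      have t1 := g4.todo_lt h4.mem
      rw [h3] at t0 t1
      rw [← h3] at hg
      rcases Cfg.IsFix.good h1.inv h4.mem g2 g4 hg with hg | hg
      · obtain ⟨ρ, hρ, hh⟩ := ih g1 hg (by omega)
        exact ⟨ρ, List.mem_append_left _ hρ, hh⟩
      · obtain ⟨ρ, hρ, hh⟩ := ih g3 hg (by omega)
        exact ⟨ρ, List.mem_append_right _ hρ, hh⟩

end Step

/-! ### Recovering and verifying a solution -/

section Verify

variable {I : Instance} {k : ℕ}

open Classical in
/-- The cost of the values `z`: the weight of the chosen vertices and a penalty that exceeds the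
bound for each edge that is not covered. -/
def Instance.cost (I : Instance) (z : ℕ → ℕ) : ℝ :=
  ∑ p ∈ Finset.range (I.n + 3), ∑ q ∈ Finset.range (I.n + 3),
    ((if I.Edge p q ∧ z p = 0 ∧ z q = 0 then I.W + 1 else 0) +
      if p < I.n ∧ q = I.n ∧ z p = 1 then I.reals (p + 2) else 0)

/-- The set of vertices with a nonzero value. -/
def Instance.chosen (I : Instance) (z : ℕ → ℕ) : Finset (Fin I.n) :=
  Finset.univ.filter fun v => z v ≠ 0

theorem Instance.reals_add_two (I : Instance) (v : Fin I.n) : I.reals (v + 2) = I.w v := by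
  simp [Instance.reals]

theorem Instance.reals_nonneg (I : Instance) (p : ℕ) : 0 ≤ I.reals (p + 2) := by
  by_cases hp : p < I.n
  · simpa [Instance.reals, hp] using zero_le_one.trans (I.one_le_w ⟨p, hp⟩)
  · simp [Instance.reals, hp]

theorem Instance.isSolution_chosen (I : Instance) (z : ℕ → ℕ) : I.IsSolution (I.chosen z) ↔
    (∀ p < I.n, ∀ q < I.n, I.Edge p q → ¬ (z p = 0 ∧ z q = 0)) ∧
      ∑ p ∈ Finset.range I.n, (if z p ≠ 0 then I.reals (p + 2) else 0) ≤ I.W := by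
  unfold Instance.IsSolution
  refine and_congr ?_ ?_
  · constructor
    · rintro h p hp q hq ⟨_, _, hadj⟩ ⟨h1, h2⟩
      rcases h hadj with h | h
      · simp [Instance.chosen, h1] at h
      · simp [Instance.chosen, h2] at h
    · intro h u v hadj
      have := h u u.2 v v.2 ⟨u.2, v.2, hadj⟩
      simp only [Instance.chosen, Finset.coe_filter, Finset.mem_univ, true_and, Set.mem_ofPred_eq]
      tauto
  · rw [Instance.chosen, Finset.sum_filter, Finset.sum_range]
    simp only [I.reals_add_two]

theorem Instance.weight_eq (I : Instance) (z : ℕ → ℕ) :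
    ∑ p ∈ Finset.range (I.n + 3), ∑ q ∈ Finset.range (I.n + 3),
      (if p < I.n ∧ q = I.n ∧ z p = 1 then I.reals (p + 2) else 0) =
    ∑ p ∈ Finset.range I.n, if z p = 1 then I.reals (p + 2) else 0 := by
  have h1 : ∀ p ∈ Finset.range (I.n + 3), ∑ q ∈ Finset.range (I.n + 3),
      (if p < I.n ∧ q = I.n ∧ z p = 1 then I.reals (p + 2) else 0) =
      if p < I.n ∧ z p = 1 then I.reals (p + 2) else 0 := by
    intro p _
    rw [Finset.sum_eq_single I.n]
    · simp
    · intro q _ hq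
      simp [hq]
    · simp
  rw [Finset.sum_congr rfl h1]
  have h2 : Finset.range I.n ⊆ Finset.range (I.n + 3) := Finset.range_subset_range.2 (by omega)
  rw [← Finset.sum_subset h2]
  · refine Finset.sum_congr rfl fun p hp => ?_
    simp [Finset.mem_range.1 hp]
  · intro p _ hp
    rw [if_neg]
    rintro ⟨h, -⟩
    exact hp (Finset.mem_range.2 h)

/-- A single edge that is not covered already costs `W + 1`. -/
theorem Instance.isSolution_of_cost_le (I : Instance) {z : ℕ → ℕ} (hz : ∀ p < I.n + 3, z p ≤ 1)
    (h : I.cost z ≤ I.W) : I.IsSolution (I.chosen z) := by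
  classical
  have hW := I.one_le_W
  have hsplit : I.cost z = ∑ p ∈ Finset.range (I.n + 3), ∑ q ∈ Finset.range (I.n + 3),
      (if I.Edge p q ∧ z p = 0 ∧ z q = 0 then I.W + 1 else 0) +
      ∑ p ∈ Finset.range I.n, if z p = 1 then I.reals (p + 2) else 0 := by
    rw [← I.weight_eq]
    simp only [Instance.cost, Finset.sum_add_distrib]
  have hnn : 0 ≤ ∑ p ∈ Finset.range I.n, if z p = 1 then I.reals (p + 2) else 0 := by
    refine Finset.sum_nonneg fun p _ => ?_
    split_ifs
    · exact I.reals_nonneg p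
    · rfl
  have hE : ∀ p q, 0 ≤ if I.Edge p q ∧ z p = 0 ∧ z q = 0 then I.W + 1 else 0 := by
    intro p q
    split_ifs
    · linarith
    · rfl
  rw [I.isSolution_chosen]
  constructor
  · intro p hp q hq hedge h0
    have h1 : I.W + 1 ≤ ∑ p ∈ Finset.range (I.n + 3), ∑ q ∈ Finset.range (I.n + 3),
        (if I.Edge p q ∧ z p = 0 ∧ z q = 0 then I.W + 1 else 0) := by
      refine le_trans ?_ (Finset.single_le_sum (f := fun p => ∑ q ∈ Finset.range (I.n + 3),
        (if I.Edge p q ∧ z p = 0 ∧ z q = 0 then I.W + 1 else 0))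
        (fun p _ => Finset.sum_nonneg fun q _ => hE p q) (Finset.mem_range.2 (by omega : p < _)))
      refine le_trans ?_ (Finset.single_le_sum (f := fun q =>
        (if I.Edge p q ∧ z p = 0 ∧ z q = 0 then I.W + 1 else 0))
        (fun q _ => hE p q) (Finset.mem_range.2 (by omega : q < _)))
      rw [if_pos ⟨hedge, h0⟩]
    linarith
  · have h2 : ∑ p ∈ Finset.range I.n, (if z p ≠ 0 then I.reals (p + 2) else 0) =
        ∑ p ∈ Finset.range I.n, if z p = 1 then I.reals (p + 2) else 0 := by
      refine Finset.sum_congr rfl fun p hp => ?_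
      have := hz p (by rw [Finset.mem_range] at hp; omega)
      refine if_congr (by omega) rfl rfl
    have h3 : 0 ≤ ∑ p ∈ Finset.range (I.n + 3), ∑ q ∈ Finset.range (I.n + 3),
        (if I.Edge p q ∧ z p = 0 ∧ z q = 0 then I.W + 1 else 0) :=
      Finset.sum_nonneg fun p _ => Finset.sum_nonneg fun q _ => hE p q
    rw [h2]
    linarith

theorem Instance.cost_le_of_isSolution (I : Instance) {z : ℕ → ℕ}
    (h : I.IsSolution (I.chosen z)) : I.cost z ≤ I.W := by
  classical
  rw [I.isSolution_chosen] at h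
  simp only [Instance.cost, Finset.sum_add_distrib]
  rw [I.weight_eq, Finset.sum_eq_zero, zero_add]
  · refine le_trans (Finset.sum_le_sum fun p _ => ?_) h.2
    by_cases hp : z p = 1
    · simp [hp]
    · rw [if_neg hp]
      split_ifs
      · exact I.reals_nonneg p
      · rfl
  · refine fun p _ => Finset.sum_eq_zero fun q _ => if_neg ?_
    rintro ⟨h1, h2⟩
    obtain ⟨hp, hq, _⟩ := id h1
    exact h.1 p hp q hq h1 h2

/-- The eliminations are undone from the last to the first, as in `Cfg.recon`. -/
theorem backSubst_spec {σ : State} {F₀ : (ℕ → ℕ) → ℝ} (h : Ok I k F₀ σ) :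
    (∀ w, (backSubst.exec I.reals σ).nat (12, w) =
      (cfg I σ).recon (cfg I σ).cnt (cfg I σ).y w) ∧
    ∀ w < I.n + 3, (backSubst.exec I.reals σ).nat (12, w) ≤ 1 := by
  have hb := h.env.lt_bnd
  set c := cfg I σ with hc
  have hcnt : c.cnt ≤ I.n := (Nat.le_add_right _ _).trans h.cnt
  have := h.env.exec_loop (c := 40) (e := vr 19) (p := .seq
    (setv 34 (.sub (.sub (vr 19) (.const 1)) (vr 40)))
    (.seq (setv 35 (atR (vr 34) (.cell 12 (.cell 15 (vr 34))) (.cell 12 (.cell 16 (vr 34)))))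
    (.seq (.nset 12 (.cell 13 (vr 34)) (.cell 17 (vr 35)))
      (.nset 12 (.cell 14 (vr 34)) (.cell 18 (vr 35))))))
    (fun j τ => (∀ w, c.recon (c.cnt - j) (fun w => τ.nat (12, w)) w = c.recon c.cnt c.y w) ∧
      ∀ w < I.n + 3, τ.nat (12, w) ≤ 1) c.cnt rfl (by omega)
    (by
      refine ⟨fun w => ?_, fun w hw => ?_⟩
      · simp only [State.setNat_nat]
        simp
        rfl
      · rw [State.setNat_nat, if_neg (by omega)]
        exact h.inv.y_le w hw)
    (by
      intro j τ hj heτ hinv hcτ hfr _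
      have rd : ∀ a, a ≠ 12 → a ≠ 34 → a ≠ 35 → a ≠ 40 → ∀ i, τ.nat (a, i) = σ.nat (a, i) :=
        fun a h1 h2 h3 h4 i => hfr a (by simp [LP.wr, setv, h1, h2, h3, h4]) i
      obtain ⟨i, hi⟩ : ∃ i, c.cnt = j + i + 1 := ⟨c.cnt - j - 1, by omega⟩
      have r19 : τ.nat (19, 0) = c.cnt := rd 19 (by omega) (by omega) (by omega) (by omega) 0
      have r4 := rd 4 (by omega) (by omega) (by omega) (by omega) 0
      have r13 : τ.nat (13, i) = c.eu i := rd 13 (by omega) (by omega) (by omega) (by omega) i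
      have r14 : τ.nat (14, i) = c.ev i := rd 14 (by omega) (by omega) (by omega) (by omega) i
      have r15 : τ.nat (15, i) = c.ea i := rd 15 (by omega) (by omega) (by omega) (by omega) i
      have r16 : τ.nat (16, i) = c.eb i := rd 16 (by omega) (by omega) (by omega) (by omega) i
      obtain ⟨l1, l2, l3, l4⟩ := h.inv.elim_lt i (show i < c.cnt by omega)
      have y3 := hinv.2 _ l3
      have y4 := hinv.2 _ l4
      change c.eu i < I.n + 3 at l1
      change c.ev i < I.n + 3 at l2
      change τ.nat (12, c.ea i) ≤ 1 at y3
      change τ.nat (12, c.eb i) ≤ 1 at y4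
      obtain ⟨m1, m2⟩ := h.inv.elim_le i (show i < c.cnt by omega) _ y3 _ y4
      set r := τ.nat (12, c.ea i) with hr
      set s := τ.nat (12, c.eb i) with hs
      have r17 : τ.nat (17, i * 4 + r * 2 + s) = c.ru i r s :=
        rd 17 (by omega) (by omega) (by omega) (by omega) _
      have r18 : τ.nat (18, i * 4 + r * 2 + s) = c.rv i r s :=
        rd 18 (by omega) (by omega) (by omega) (by omega) _
      change c.ru i r s ≤ 1 at m1
      change c.rv i r s ≤ 1 at m2
      have e1 : LP.exec I.reals (setv 34 (.sub (.sub (vr 19) (.const 1)) (vr 40))) τ =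
          τ.setNat 34 0 i := by
        have : c.cnt - 1 - j = i := by omega
        rw [exec_setv _ (by simp [r19, hcτ, this, r4]; omega)]
        simp [r19, hcτ, this]
      set τ₁ := τ.setNat 34 0 i with hτ₁
      have e2 : LP.exec I.reals
          (setv 35 (atR (vr 34) (.cell 12 (.cell 15 (vr 34))) (.cell 12 (.cell 16 (vr 34))))) τ₁ =
          τ₁.setNat 35 0 (i * 4 + r * 2 + s) := by
        rw [exec_setv _ (by simp [τ₁, State.setNat_nat, r15, r16, ← hr, ← hs, r4]; omega)]
        simp [τ₁, State.setNat_nat, r15, r16, ← hr, ← hs]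
      set τ₂ := τ₁.setNat 35 0 (i * 4 + r * 2 + s) with hτ₂
      have e3 : LP.exec I.reals (.nset 12 (.cell 13 (vr 34)) (.cell 17 (vr 35))) τ₂ =
          τ₂.setNat 12 (c.eu i) (c.ru i r s) := by
        rw [exec_nset _ (by simp [τ₁, τ₂, State.setNat_nat, r13, r4]; omega)
          (by simp [τ₁, τ₂, State.setNat_nat, r17, r4]; omega)]
        simp [τ₁, τ₂, State.setNat_nat, r13, r17]
      set τ₃ := τ₂.setNat 12 (c.eu i) (c.ru i r s) with hτ₃
      have e4 : LP.exec I.reals (.nset 12 (.cell 14 (vr 34)) (.cell 18 (vr 35))) τ₃ =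
          τ₃.setNat 12 (c.ev i) (c.rv i r s) := by
        rw [exec_nset _ (by simp [τ₁, τ₂, τ₃, State.setNat_nat, r14, r4]; omega)
          (by simp [τ₁, τ₂, τ₃, State.setNat_nat, r18, r4]; omega)]
        simp [τ₁, τ₂, τ₃, State.setNat_nat, r14, r18]
      rw [exec_seq, e1, exec_seq, e2, exec_seq, e3, e4]
      have hy : ∀ w, ((τ₃.setNat 12 (c.ev i) (c.rv i r s)).setNat 40 0 (j + 1)).nat (12, w) =
          Function.update (Function.update (fun w => τ.nat (12, w)) (c.eu i) (c.ru i r s))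
            (c.ev i) (c.rv i r s) w := by
        intro w
        simp [τ₁, τ₂, τ₃, State.setNat_nat, Function.update_apply]
      refine ⟨fun w => ?_, fun w hw => ?_⟩
      · rw [← hinv.1 w, funext hy, show c.cnt - j = (c.cnt - (j + 1)) + 1 by omega,
          show c.cnt - (j + 1) = i by omega]
        rfl
      · rw [hy]
        have := hinv.2 w hw
        simp only [Function.update_apply]
        split_ifs
        · exact m2
        · exact m1
        · exact this)
  rw [Nat.sub_self] at this
  exact ⟨this.1, this.2⟩

theorem check_spec {σ : State} (he : Env I k σ) : (check.exec I.reals σ).nat (36, 0) = 1 ↔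
    I.IsSolution (I.chosen fun w => σ.nat (12, w)) := by
  classical
  have hb := he.lt_bnd
  rw [I.isSolution_chosen, check, exec_seq, exec_seq, exec_seq, exec_setv _ (by simp; omega),
    exec_rset _ (by simp), val_const, val_const]
  set y : ℕ → ℕ := fun w => σ.nat (12, w) with hy
  set σ₁ := (σ.setNat 36 0 1).setReal 3 0 (RExp.zero.val (σ.setNat 36 0 1)) with hσ₁
  have he₁ : Env I k σ₁ := he.congr
    (fun a ha i => by
      rw [hσ₁, State.setReal_nat, State.setNat_nat, if_neg (by omega)])
    fun a ha i => by rw [hσ₁, State.setReal_real, if_neg (by omega), State.setNat_real]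
  have f₁ : ∀ a, a ≠ 36 → ∀ i, σ₁.nat (a, i) = σ.nat (a, i) := fun a ha i => by
    rw [hσ₁, State.setReal_nat, State.setNat_nat, if_neg (by omega)]
  set p₁ : LP := .ite (eqT (.cell 12 (vr 40)) (.const 0)) .skip
    (.rset 3 (.const 0) (.add (.cell 3 (.const 0)) (.cell 1 (vr 40)))) with hp₁
  set p₂ : LP := .ite
      (.and (eqT (.cell 1 (.add (.mul (vr 40) nE) (vr 41))) (.const 1))
        (.and (eqT (.cell 12 (vr 40)) (.const 0)) (eqT (.cell 12 (vr 41)) (.const 0))))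
      (setv 36 (.const 0)) .skip with hp₂
  have step : ∀ p < I.n, ∀ τ, Env I k τ → τ.nat (40, 0) = p → (∀ w, τ.nat (12, w) = y w) →
      (((LP.loop 41 nE p₂).exec I.reals τ).nat (36, 0) = 1 ↔ τ.nat (36, 0) = 1 ∧
        ∀ q < I.n, I.Edge p q → ¬ (y p = 0 ∧ y q = 0)) := by
    intro p hp τ heτ h40 h12
    have hbτ := heτ.lt_bnd
    refine heτ.exec_loop (c := 41) (e := nE) (p := p₂) (fun j ρ => ρ.nat (36, 0) = 1 ↔
      τ.nat (36, 0) = 1 ∧ ∀ q < j, I.Edge p q → ¬ (y p = 0 ∧ y q = 0)) I.n (by simp [heτ.n])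
      (by omega) (by simp [State.setNat_nat]) ?_
    intro j ρ hj heρ hinv hcρ hfr _
    have r40 : ρ.nat (40, 0) = p := by rw [hfr 40 (by decide), h40]
    have r12 : ∀ w, ρ.nat (12, w) = y w := fun w => by rw [hfr 12 (by decide), h12]
    have r1 := heρ.edge p hp j hj
    by_cases hcond : I.Edge p j ∧ y p = 0 ∧ y j = 0
    · rw [hp₂, exec_ite_pos _ _ (by simp [r40, hcρ, heρ.n, r1, r12, hcond]),
        exec_setv _ (by simp)]
      simp only [State.setNat_nat, val_const]
      simp only [and_self, if_true]
      constructor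
      · intro h
        simp at h
      · rintro ⟨-, h⟩
        exact absurd hcond.2 (h j (by omega) hcond.1)
    · rw [hp₂, exec_ite_neg _ _ (by
        simp only [holds_and, holds_eqT, val_cell, val_add, val_mul, val_vr, val_nE, val_const, r40,
          hcρ, heρ.n, r1, r12]
        rintro ⟨h1, h2⟩
        refine hcond ⟨?_, h2⟩
        by_contra h3
        rw [if_neg h3] at h1
        omega)]
      simp only [State.setNat_nat, exec_skip]
      rw [if_neg (by omega), hinv]
      refine and_congr_right fun _ => ⟨fun h q hq => ?_, fun h q hq => h q (by omega)⟩
      rcases Nat.lt_succ_iff_lt_or_eq.1 hq with hq | rfl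
      · exact h q hq
      · exact fun h1 h2 => hcond ⟨h1, h2⟩
  have hloop := he₁.exec_loop (c := 40) (e := nE) (p := .seq p₁ (.loop 41 nE p₂))
    (fun j τ => (τ.nat (36, 0) = 1 ↔ ∀ p < j, ∀ q < I.n, I.Edge p q → ¬ (y p = 0 ∧ y q = 0)) ∧
      realAt I τ 3 0 = ∑ p ∈ Finset.range j, if y p ≠ 0 then I.reals (p + 2) else 0) I.n
    (by simp [he₁.n]) (by rw [f₁ 4 (by omega)]; omega)
    (by simp [State.setNat_nat, σ₁, realAt, State.setReal_real, RExp.val, Form.val_zero])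
    (by
      intro j τ hj heτ hinv hcτ hfr _
      have hbτ := heτ.lt_bnd
      have r12 : ∀ w, τ.nat (12, w) = y w := fun w => by
        rw [hfr 12 (by decide), f₁ 12 (by omega)]
      set τ₁ := p₁.exec I.reals τ with hτ₁
      have fτ : ∀ a i, τ₁.nat (a, i) = τ.nat (a, i) := fun a i =>
        LP.exec_nat_of_not_mem _ _ (by simp [p₁, LP.wr]) i
      have heτ₁ : Env I k τ₁ := heτ.congr (fun a _ i => fτ a i) fun a ha i =>
        LP.exec_real_of_not_mem _ _ (by simp [p₁, LP.wrR]; omega) i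
      have hr : realAt I τ₁ 3 0 = realAt I τ 3 0 + if y j ≠ 0 then I.reals (j + 2) else 0 := by
        rw [hτ₁, hp₁]
        by_cases h0 : y j = 0
        · rw [exec_ite_pos _ _ (by simp [hcτ, r12, h0])]
          simp [h0]
        · rw [exec_ite_neg _ _ (by simp [hcτ, r12, h0]), exec_rset _ (by simp)]
          simp [realAt, State.setReal_real, RExp.val, Form.val_add, hcτ, heτ.weight j hj, h0]
      have hs := step j hj τ₁ heτ₁ (by rw [fτ, hcτ]) fun w => by rw [fτ, r12]
      have hr2 : ∀ i, ((LP.loop 41 nE p₂).exec I.reals τ₁).real (3, i) = τ₁.real (3, i) :=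
        fun i => LP.exec_real_of_not_mem _ _ (by simp [p₂, LP.wrR, setv]) i
      rw [exec_seq, ← hτ₁]
      constructor
      · rw [State.setNat_nat, if_neg (by omega), hs, fτ, hinv.1]
        constructor
        · rintro ⟨h1, h2⟩ p hp
          rcases Nat.lt_succ_iff_lt_or_eq.1 hp with hp | rfl
          · exact h1 p hp
          · exact h2
        · exact fun h => ⟨fun p hp => h p (by omega), h j (by omega)⟩
      · simp only [realAt, State.setNat_real, hr2]
        rw [Finset.sum_range_succ, ← hinv.2]
        exact hr)
  set σ₂ := LP.exec I.reals (.loop 40 nE (.seq p₁ (.loop 41 nE p₂))) σ₁ with hσ₂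
  have he₂ : Env I k σ₂ := he₁.exec _
  have hbd₂ := he₂.bound
  have hiff : Test.Holds I.reals σ₂ (.rle (.cell 3 (.const 0)) (.cell 0 (.const 1))) ↔
      ∑ p ∈ Finset.range I.n, (if y p ≠ 0 then I.reals (p + 2) else 0) ≤ I.W := by
    rw [← hloop.2, ← hbd₂]
    exact Iff.rfl
  by_cases hle : ∑ p ∈ Finset.range I.n, (if y p ≠ 0 then I.reals (p + 2) else 0) ≤ I.W
  · rw [exec_ite_pos _ _ (hiff.2 hle), exec_skip, hloop.1]
    exact ⟨fun h => ⟨h, hle⟩, fun h => h.1⟩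
  · rw [exec_ite_neg _ _ (fun h => hle (hiff.1 h)), exec_setv _ (by simp)]
    simp only [State.setNat_nat, val_const]
    simp only [and_self, if_true]
    constructor
    · intro h
      simp at h
    · exact fun h => absurd h.2 hle

end Verify

/-! ### The initial configuration -/

section Setup

variable {I : Instance} {k : ℕ}

theorem exec_foldr_nset (x : ℕ → ℝ) (l : List ℕ) (h9 : 9 ∉ l) (h4 : 4 ∉ l) (σ : State) {j : ℕ}
    (hj : σ.nat (9, 0) = j) (hb : j ≤ σ.nat (4, 0)) :
    (∀ a i, (LP.exec x (l.foldr (fun a p => .seq (.nset a (vr 9) (.const 0)) p) .skip) σ).nat (a, i) =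
      if a ∈ l ∧ i = j then 0 else σ.nat (a, i)) ∧
    (LP.exec x (l.foldr (fun a p => .seq (.nset a (vr 9) (.const 0)) p) .skip) σ).real = σ.real := by
  induction l generalizing σ with
  | nil => simp
  | cons a l ih =>
    simp only [List.mem_cons, not_or] at h9 h4
    have e : LP.exec x (.nset a (vr 9) (.const 0)) σ = σ.setNat a j 0 := by
      rw [exec_nset _ (by simpa [hj] using hb) (by simp)]
      simp [hj]
    rw [List.foldr_cons, exec_seq, e]
    obtain ⟨h1, h2⟩ := ih h9.2 h4.2 (σ.setNat a j 0) (by simp [State.setNat_nat, h9.1, hj])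
      (by simpa [State.setNat_nat, h4.1] using hb)
    refine ⟨fun b i => ?_, h2⟩
    rw [h1, State.setNat_nat]
    simp only [List.mem_cons]
    grind

theorem exec_clearAll (x : ℕ → ℝ) (l m : List ℕ) (h9 : 9 ∉ l) (h4 : 4 ∉ l) (σ : State) {j : ℕ}
    (hj : σ.nat (9, 0) = j) (hb : j ≤ σ.nat (4, 0)) :
    (∀ a i, ((clearAll l m).exec x σ).nat (a, i) = if a ∈ l ∧ i = j then 0 else σ.nat (a, i)) ∧
    (∀ a i, ((clearAll l m).exec x σ).real (a, i) =
      if a ∈ m ∧ i = j then 0 else σ.real (a, i)) := by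
  induction m generalizing σ with
  | nil =>
    obtain ⟨h1, h2⟩ := exec_foldr_nset x l h9 h4 σ hj hb
    exact ⟨h1, fun a i => by simp [clearAll, h2]⟩
  | cons a m ih =>
    have e : LP.exec x (.rset a (vr 9) .zero) σ = σ.setReal a j 0 := by
      rw [exec_rset _ (by simpa [hj] using hb)]
      simp [hj, RExp.val]
    rw [clearAll, List.foldr_cons, exec_seq, e]
    obtain ⟨h1, h2⟩ := ih (σ.setReal a j 0) hj hb
    refine ⟨fun b i => h1 b i, fun b i => (h2 b i).trans ?_⟩
    rw [State.setReal_real]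
    simp only [List.mem_cons]
    grind

/-- Besides what is cleared, this lists what remains, and that nothing that was zero becomes
nonzero. -/
theorem clear_spec (σ : State) :
    (∀ a, 10 ≤ a → a ≤ 60 → ∀ i ≤ σ.nat (4, 0), (clear.exec I.reals σ).nat (a, i) = 0) ∧
    (∀ a, 2 ≤ a → a ≤ 4 → ∀ i ≤ σ.nat (4, 0), (clear.exec I.reals σ).real (a, i) = 0) ∧
    (∀ a, a ≠ 9 → a < 10 ∨ 60 < a → ∀ i, (clear.exec I.reals σ).nat (a, i) = σ.nat (a, i)) ∧
    (∀ a i, σ.real (a, i) = 0 → (clear.exec I.reals σ).real (a, i) = 0) ∧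
    (∀ a, a < 2 ∨ 4 < a → ∀ i, (clear.exec I.reals σ).real (a, i) = σ.real (a, i)) ∧
    (∀ a, a ≠ 9 → ∀ i, σ.nat (a, i) = 0 → (clear.exec I.reals σ).nat (a, i) = 0) := by
  have hmem : ∀ a, a ∈ List.range' 10 51 ↔ 10 ≤ a ∧ a ≤ 60 := by
    intro a
    rw [List.mem_range'_1]
    omega
  have hmem3 : ∀ a, a ∈ [2, 3, 4] ↔ 2 ≤ a ∧ a ≤ 4 := by
    intro a
    simp only [List.mem_cons, List.not_mem_nil, or_false]
    omega
  have h := LP.exec_loop (x := I.reals) (c := 9) (e := .add (vr 4) (.const 1))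
    (p := clearAll (List.range' 10 51) [2, 3, 4]) (σ := σ) (by decide)
    (fun j τ => (∀ a, a ≠ 9 → ∀ i, τ.nat (a, i) =
        if (10 ≤ a ∧ a ≤ 60) ∧ i < j then 0 else σ.nat (a, i)) ∧
      ∀ a i, τ.real (a, i) = if (2 ≤ a ∧ a ≤ 4) ∧ i < j then 0 else σ.real (a, i))
    (by simp) (by constructor <;> intros <;> simp_all [State.setNat_nat])
    (by
      intro j τ hj hinv hc hfr _
      simp only [val_add, val_vr, val_const] at hj
      have h4 : τ.nat (4, 0) = σ.nat (4, 0) := by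
        rw [hinv.1 4 (by omega), if_neg (by omega)]
      obtain ⟨h1, h2⟩ := exec_clearAll I.reals (List.range' 10 51) [2, 3, 4] (by decide)
        (by decide) τ hc (by omega)
      constructor
      · intro a ha i
        rw [State.setNat_nat, if_neg (by tauto), h1, hinv.1 a ha]
        simp only [hmem]
        grind
      · intro a i
        rw [State.setNat_real, h2, hinv.2]
        simp only [hmem3]
        grind)
  rw [val_add, val_vr, val_const] at h
  change (∀ a, a ≠ 9 → ∀ i, (clear.exec I.reals σ).nat (a, i) = _) ∧
    ∀ a i, (clear.exec I.reals σ).real (a, i) = _ at h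
  refine ⟨fun a h1 h2 i hi => ?_, fun a h1 h2 i hi => ?_, fun a h1 h2 i => ?_, fun a i h1 => ?_,
    fun a h1 i => ?_, fun a h1 i h2 => ?_⟩
  · rw [h.1 a (by omega), if_pos (by omega)]
  · rw [h.2, if_pos (by omega)]
  · rw [h.1 a h1, if_neg (by omega)]
  · rw [h.2, h1, ite_self]
  · rw [h.2, if_neg (by omega)]
  · rw [h.1 a h1, h2, ite_self]

/-- Unlike `if_congr`, this applies whatever the instances of decidability are. -/
theorem ite_congr_prop {α : Sort*} {P Q : Prop} {_ : Decidable P} {_ : Decidable Q} (h : P ↔ Q)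
    (a b : α) : (if P then a else b) = if Q then a else b := by
  by_cases hP : P
  · rw [if_pos hP, if_pos (h.1 hP)]
  · rw [if_neg hP, if_neg (mt h.2 hP)]

open Classical in
theorem initCfg_memory {σ : State} (he : Env I k σ)
    (h10 : ∀ a, 10 ≤ a → a ≤ 20 → ∀ i, σ.nat (a, i) = 0)
    (hr : ∀ i, σ.real (2, i) = 0) :
    (∀ a, 12 ≤ a → a ≤ 20 → ∀ i, (initCfg.exec I.reals σ).nat (a, i) = 0) ∧
    (∀ p, (initCfg.exec I.reals σ).nat (10, p) =
      if p = I.n ∨ p = I.n + 1 then 1 else if p = I.n + 2 then 2 else 0) ∧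
    (∀ p < I.n + 3, ∀ q < I.n + 3, (cfg I (initCfg.exec I.reals σ)).adj p q =
      if I.Edge p q then 1 else 0) ∧
    (∀ p < I.n + 3, ∀ q < I.n + 3, ∀ r ≤ 1, ∀ s ≤ 1, (cfg I (initCfg.exec I.reals σ)).f p q r s =
      (if I.Edge p q ∧ r = 0 ∧ s = 0 then I.W + 1 else 0) +
      if p < I.n ∧ q = I.n ∧ r = 1 ∧ s = 0 then I.reals (p + 2) else 0) := by
  have hb := he.lt_bnd
  set p₁ : LP := .ite (eqT (.cell 1 (.add (.mul (vr 40) nE) (vr 41))) (.const 1))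
      (.seq (.nset 11 (at2 (vr 40) (vr 41)) (.const 1))
        (.rset 2 (at4 (vr 40) (vr 41) (.const 0) (.const 0))
          (.add (.cell 0 (.const 1)) (.cell 0 (.const 0))))) .skip with hp₁
  set p₂ : LP := .rset 2 (at4 (vr 40) nE (.const 1) (.const 0)) (.cell 1 (vr 40)) with hp₂
  -- the edges `(p, q)` with `R p q` and the weights of the vertices `p` with `S p` are stored
  set M : (ℕ → ℕ → Prop) → (ℕ → Prop) → State → Prop := fun R S τ =>
    (∀ p < I.n + 3, ∀ q < I.n + 3, τ.nat (11, p * (I.n + 3) + q) =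
      if R p q ∧ I.Edge p q then 1 else 0) ∧
    (∀ p < I.n + 3, ∀ q < I.n + 3, ∀ r ≤ 1, ∀ s ≤ 1,
      realAt I τ 2 (((p * (I.n + 3) + q) * 2 + r) * 2 + s) =
      (if R p q ∧ I.Edge p q ∧ r = 0 ∧ s = 0 then I.W + 1 else 0) +
      if S p ∧ q = I.n ∧ r = 1 ∧ s = 0 then I.reals (p + 2) else 0) with hM
  have edge_lt : ∀ {p q}, I.Edge p q → p < I.n ∧ q < I.n := fun ⟨h1, h2, _⟩ => ⟨h1, h2⟩
  have hidx : ∀ p < I.n + 3, ∀ q < I.n + 3, ∀ r ≤ 1, ∀ s ≤ 1,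
      p * (I.n + 3) + q ≤ σ.nat (4, 0) ∧
        ((p * (I.n + 3) + q) * 2 + r) * 2 + s ≤ σ.nat (4, 0) := by
    intro p hp q hq r hr s hs
    have := idx_lt hp hq
    rw [he.b]
    omega
  have inner : ∀ j < I.n, ∀ τ, Env I k τ → τ.nat (40, 0) = j →
      M (fun p _ => p < j) (fun p => p < j) τ →
      M (fun p _ => p < j + 1) (fun p => p < j) ((LP.loop 41 nE p₁).exec I.reals τ) := by
    intro j hj τ heτ h40 hMτ
    have hbτ := heτ.lt_bnd
    have := heτ.exec_loop (c := 41) (e := nE) (p := p₁)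
      (fun i ρ => M (fun p q => p < j ∨ (p = j ∧ q < i)) (fun p => p < j) ρ) I.n (by simp [heτ.n])
      (by omega) (by simpa [hM, State.setNat_nat, realAt] using hMτ)
      (by
        intro i ρ hi heρ hinv hcρ hfr _
        have r40 : ρ.nat (40, 0) = j := by rw [hfr 40 (by decide), h40]
        have r1 := heρ.edge j hj i hi
        have r4 : ρ.nat (4, 0) = σ.nat (4, 0) := by rw [heρ.b, he.b]
        by_cases hed : I.Edge j i
        · rw [if_pos hed] at r1
          have hx := hidx j (by omega) i (by omega) 0 (by omega) 0 (by omega)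
          have e : p₁.exec I.reals ρ = (ρ.setNat 11 (j * (I.n + 3) + i) 1).setReal 2
              (((j * (I.n + 3) + i) * 2 + 0) * 2 + 0) (ρ.real (0, 1) + ρ.real (0, 0)) := by
            rw [hp₁, exec_ite_pos _ _ (by simp [r40, hcρ, heρ.n, r1]), exec_seq,
              exec_nset _ (by simp [r40, hcρ, heρ.n, r4, hx.1]) (by simp; omega),
              exec_rset _ (by simpa [State.setNat_nat, r40, hcρ, heρ.n, r4] using hx.2)]
            simp [State.setNat_nat, r40, hcρ, heρ.n, RExp.val]
          rw [e]
          refine ⟨fun p hp q hq => ?_, fun p hp q hq r hr s hs => ?_⟩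
          · have hi1 := idx_inj (p := p) (p' := j) hq (show i < I.n + 3 by omega)
            rw [State.setNat_nat, if_neg (by omega), State.setReal_nat, State.setNat_nat,
              hinv.1 p hp q hq]
            simp only [hi1, true_and]
            grind
          · have hi4 := idx4_inj (p := p) (p' := j) hq (show i < I.n + 3 by omega) hr hs
              (Nat.zero_le 1) (Nat.zero_le 1)
            have hv : Form.val I.reals (ρ.real (0, 1) + ρ.real (0, 0)) = I.W + 1 := by
              rw [Form.val_add, heρ.bound, heρ.one]
            simp only [realAt, State.setNat_real, State.setReal_real, hi4, true_and]
            by_cases hc : (p = j ∧ q = i) ∧ r = 0 ∧ s = 0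
            · rw [if_pos hc, hv]
              obtain ⟨⟨rfl, rfl⟩, rfl, rfl⟩ := hc
              rw [if_pos (by simp [hed]), if_neg (by omega), add_zero]
            · rw [if_neg hc]
              refine (hinv.2 p hp q hq r hr s hs).trans ?_
              congr 1
              refine ite_congr_prop ?_ _ _
              constructor
              · rintro ⟨h1, h2⟩
                exact ⟨by omega, h2⟩
              · rintro ⟨h1, h2, h3⟩
                exact ⟨by omega, h2, h3⟩
        · rw [if_neg hed] at r1
          rw [hp₁, exec_ite_neg _ _ (by simp [r40, hcρ, heρ.n, r1]), exec_skip]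
          refine ⟨fun p hp q hq => ?_, fun p hp q hq r hr s hs => ?_⟩
          · rw [State.setNat_nat, if_neg (by omega), hinv.1 p hp q hq]
            grind
          · refine (hinv.2 p hp q hq r hr s hs).trans ?_
            congr 1
            refine ite_congr_prop ?_ _ _
            constructor
            · rintro ⟨h1, h2⟩
              exact ⟨by omega, h2⟩
            · rintro ⟨h1, h2, h3⟩
              refine ⟨?_, h2, h3⟩
              rcases h1 with h1 | ⟨rfl, h1⟩
              · exact .inl h1
              · rcases Nat.lt_succ_iff_lt_or_eq.1 h1 with h1 | rfl
                · exact .inr ⟨rfl, h1⟩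
                · exact absurd h2 hed)
    refine ⟨fun p hp q hq => ?_, fun p hp q hq r hr s hs => ?_⟩
    · rw [this.1 p hp q hq]
      refine ite_congr_prop ⟨fun h => ⟨by omega, h.2⟩, fun h => ⟨?_, h.2⟩⟩ _ _
      have := edge_lt h.2
      omega
    · rw [this.2 p hp q hq r hr s hs]
      congr 1
      refine ite_congr_prop ⟨fun h => ⟨by omega, h.2⟩, fun h => ⟨?_, h.2⟩⟩ _ _
      have := edge_lt h.2.1
      omega
  have outer := he.exec_loop (c := 40) (e := nE) (p := .seq (.loop 41 nE p₁) p₂)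
    (fun j τ => M (fun p _ => p < j) (fun p => p < j) τ) I.n (by simp [he.n]) (by omega)
    (by
      refine ⟨fun p hp q hq => ?_, fun p hp q hq r hr' s hs => ?_⟩
      · simp [State.setNat_nat, h10 11]
      · simp [realAt, hr, Form.val_zero])
    (by
      intro j τ hj heτ hinv hcτ hfr _
      have hMi := inner j hj τ heτ hcτ hinv
      have hei : Env I k ((LP.loop 41 nE p₁).exec I.reals τ) := heτ.exec _
      have r40 : ((LP.loop 41 nE p₁).exec I.reals τ).nat (40, 0) = j := by
        rw [LP.exec_nat_of_not_mem _ _ (by decide), hcτ]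
      rw [exec_seq]
      generalize (LP.loop 41 nE p₁).exec I.reals τ = ρ at hMi hei r40
      have hx := hidx j (by omega) I.n (by omega) 1 (by omega) 0 (by omega)
      have r4 : ρ.nat (4, 0) = σ.nat (4, 0) := by rw [hei.b, he.b]
      have e : p₂.exec I.reals ρ = ρ.setReal 2 (((j * (I.n + 3) + I.n) * 2 + 1) * 2 + 0)
          (ρ.real (1, j)) := by
        rw [hp₂, exec_rset _ (by simpa [r40, hei.n, r4] using hx.2)]
        simp [r40, hei.n, RExp.val]
      rw [e]
      refine ⟨fun p hp q hq => ?_, fun p hp q hq r hr s hs => ?_⟩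
      · rw [State.setNat_nat, if_neg (by omega), State.setReal_nat]
        exact hMi.1 p hp q hq
      · have hi4 := idx4_inj (p := p) (p' := j) hq (show I.n < I.n + 3 by omega) hr hs
          le_rfl (Nat.zero_le 1)
        simp only [realAt, State.setNat_real, State.setReal_real, hi4, true_and]
        by_cases hc : (p = j ∧ q = I.n) ∧ r = 1 ∧ s = 0
        · rw [if_pos hc, hei.weight j hj]
          obtain ⟨⟨rfl, rfl⟩, rfl, rfl⟩ := hc
          rw [if_neg (by omega), if_pos (by omega), zero_add]
        · rw [if_neg hc]
          refine (hMi.2 p hp q hq r hr s hs).trans ?_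
          congr 1
          exact ite_congr_prop (by omega) _ _)
  set σ₁ := LP.exec I.reals (.loop 40 nE (.seq (.loop 41 nE p₁) p₂)) σ with hσ₁
  have he₁ : Env I k σ₁ := he.exec _
  have hb₁ := he₁.lt_bnd
  have e : initCfg.exec I.reals σ =
      ((σ₁.setNat 10 I.n 1).setNat 10 (I.n + 1) 1).setNat 10 (I.n + 2) 2 := by
    have b1 : I.n ≤ σ₁.nat (4, 0) := by omega
    have b2 : I.n + 1 ≤ σ₁.nat (4, 0) := by omega
    have b3 : I.n + 2 ≤ σ₁.nat (4, 0) := by omega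
    have b4 : 1 ≤ σ₁.nat (4, 0) := by omega
    have b5 : 2 ≤ σ₁.nat (4, 0) := by omega
    rw [initCfg, exec_seq, ← hp₁, ← hp₂, ← hσ₁]
    simp [exec_nset, State.setNat_nat, he₁.n, b1, b2, b3, b4, b5]
  have f₁ : ∀ a, 10 ≤ a → a ≤ 20 → a ≠ 11 → ∀ i, σ₁.nat (a, i) = 0 := by
    intro a h1 h2 h3 i
    rw [LP.exec_nat_of_not_mem _ _ (by simp [LP.wr, p₁, p₂]; omega), h10 a h1 h2]
  rw [e]
  refine ⟨fun a h1 h2 i => ?_, fun p => ?_, fun p hp q hq => ?_, fun p hp q hq r hr s hs => ?_⟩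
  · simp only [State.setNat_nat]
    rw [if_neg (by omega), if_neg (by omega), if_neg (by omega), f₁ a (by omega) h2 (by omega)]
  · simp only [State.setNat_nat, true_and, f₁ 10 le_rfl (by omega) (by omega)]
    grind
  · change State.nat _ (11, _) = _
    simp only [State.setNat_nat]
    rw [if_neg (by omega), if_neg (by omega), if_neg (by omega), outer.1 p hp q hq]
    exact ite_congr_prop ⟨fun h => h.2, fun h => ⟨(edge_lt h).1, h⟩⟩ _ _
  · refine (outer.2 p hp q hq r hr s hs).trans (congrArg₂ _ ?_ ?_)
    · exact ite_congr_prop ⟨fun h => h.2, fun h => ⟨(edge_lt h.1).1, h⟩⟩ _ _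
    · exact ite_congr_prop Iff.rfl _ _

/-- The initial configuration satisfies the invariant, and it admits every small solution. -/
theorem initCfg_spec {σ : State} (he : Env I k σ)
    (h10 : ∀ a, 10 ≤ a → a ≤ 20 → ∀ i, σ.nat (a, i) = 0) (hr : ∀ i, σ.real (2, i) = 0) :
    Ok I k I.cost (initCfg.exec I.reals σ) ∧
    (cfg I (initCfg.exec I.reals σ)).pot I.n k = 78 * (k + 4) ∧
    (cfg I (initCfg.exec I.reals σ)).todo I.n ≤ I.n + 1 ∧
    ((∃ U, I.IsSolution U ∧ U.card ≤ k) →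
      (cfg I (initCfg.exec I.reals σ)).Good I.n k I.W) := by
  classical
  obtain ⟨h1, h2, h3, h4⟩ := initCfg_memory he h10 hr
  have heτ : Env I k (initCfg.exec I.reals σ) := he.exec _
  generalize initCfg.exec I.reals σ = τ at h1 h2 h3 h4 heτ
  set c := cfg I τ with hc
  have hW := I.one_le_W
  have hst : ∀ p, c.st p = if p = I.n ∨ p = I.n + 1 then 1 else if p = I.n + 2 then 2 else 0 := h2
  have hy : ∀ p, c.y p = 0 := fun p => h1 12 (by omega) (by omega) p
  have hmode : c.mode = 0 := h1 20 (by omega) (by omega) 0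
  have hcnt : c.cnt = 0 := h1 19 (by omega) (by omega) 0
  have edge_lt : ∀ {p q}, I.Edge p q → p < I.n ∧ q < I.n := fun ⟨h1, h2, _⟩ => ⟨h1, h2⟩
  have hfree : c.free I.n = Finset.range I.n := by
    refine Finset.filter_true_of_mem fun v hv => ?_
    rw [Finset.mem_range] at hv
    rw [hst, if_neg (by omega), if_neg (by omega)]
  have hst2 : ∀ p, c.st p = 2 ↔ p = I.n + 2 := by
    intro p
    rw [hst]
    split_ifs with h h'
    · exact ⟨fun g => by omega, fun g => by omega⟩
    · exact ⟨fun _ => h', fun _ => rfl⟩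
    · exact ⟨fun g => absurd g (by decide), fun g => absurd g h'⟩
  have hcost : ∀ z, (∀ v < I.n + 3, z v ≤ 1) → z I.n = 0 → c.cost I.n z = I.cost z := by
    intro z hz1 hz
    refine Finset.sum_congr rfl fun p hp => Finset.sum_congr rfl fun q hq => ?_
    rw [Finset.mem_range] at hp hq
    by_cases hpq : c.st p ≠ 2 ∧ c.st q ≠ 2
    · rw [if_pos hpq, h4 p hp q hq _ (hz1 p hp) _ (hz1 q hq)]
      congr 1
      refine if_congr ⟨fun h => ⟨h.1, h.2.1, h.2.2.1⟩, fun h => ⟨h.1, h.2.1, h.2.2, ?_⟩⟩ rfl rfl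
      rw [h.2.1, hz]
    · have hpq' := hpq
      rw [ne_eq, ne_eq, hst2, hst2] at hpq'
      rw [if_neg hpq, if_neg, if_neg, add_zero]
      · omega
      · rintro ⟨h, -⟩
        have := edge_lt h
        omega
  have hinv : c.Inv I.n I.W I.cost := by
    constructor
    · rw [hst, if_pos (.inl rfl)]
    · rw [hst, if_pos (.inr rfl)]
    · rw [hst, if_neg (by omega), if_pos rfl]
    · intro v _
      rw [hst]
      split_ifs <;> omega
    · exact hy _
    · exact hy _
    · intro v _
      rw [hy]
      omega
    · intro p hp q hq
      rw [h3 p hp q hq, h3 q hq p hp]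
      exact if_congr ⟨fun h => h.symm, fun h => h.symm⟩ rfl rfl
    · intro p hp
      rw [h3 p hp p hp, if_neg Instance.not_edge_self]
    · intro p hp q hq
      rw [h3 p hp q hq]
      split_ifs <;> omega
    · intro q hq
      rw [h3 _ (by omega) q hq, if_neg]
      intro h
      have := edge_lt h
      omega
    · intro p hp q hq r hr s hs
      rw [h4 p hp q hq r hr s hs]
      have := I.reals_nonneg p
      split_ifs <;> linarith
    · intro p hp q hq _ hq0 hadj r hr s hs
      rw [h3 p hp q hq] at hadj
      have hqn : q ≠ I.n := by
        rintro rfl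
        rw [hst, if_pos (.inl rfl)] at hq0
        omega
      rw [h4 p hp q hq r hr s hs, if_neg (by rintro ⟨h, -⟩; simp [h] at hadj),
        if_neg (by tauto), add_zero]
    · intro p hp q hq _ _ hadj
      rw [h3 p hp q hq] at hadj
      have hed : I.Edge p q := by
        by_contra h
        simp [h] at hadj
      rw [h4 p hp q hq 0 (by omega) 0 (by omega), if_pos ⟨hed, rfl, rfl⟩, if_neg (by omega),
        add_zero]
    · intro i hi
      omega
    · intro i hi
      omega
    · intro z hz
      rw [hcnt]
      refine (hcost z (fun v hv => (hz v hv).1) ?_).symm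
      rw [(hz I.n (by omega)).2 (by rw [hst, if_pos (.inl rfl)]), hy]
    · intro _ p hp q hq
      rw [Cfg.mem_free] at hp hq
      rw [h3 p (by omega) q (by omega)]
      split_ifs <;> omega
    · intro h
      exact absurd hmode h
  have hones : c.ones I.n = 0 := by
    simp [Cfg.ones, hy]
  refine ⟨⟨heτ, hinv, ?_⟩, ?_, ?_, ?_⟩
  · change c.cnt + (c.free I.n).card ≤ I.n
    rw [hcnt, hfree, Finset.card_range, zero_add]
  · rw [Cfg.pot_zero hmode, hones, Nat.sub_zero]
  · rw [Cfg.todo, hfree, Finset.card_range, if_pos hmode]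
  · rintro ⟨U, hU, hUk⟩
    set z : ℕ → ℕ := fun p => if ∃ h : p < I.n, (⟨p, h⟩ : Fin I.n) ∈ U then 1 else 0 with hz
    have hch : I.chosen z = U := by
      ext v
      simp [Instance.chosen, hz]
    have hz1 : ∀ v < I.n + 3, z v ≤ 1 := by
      intro v _
      simp only [hz]
      split_ifs <;> omega
    refine ⟨by omega, z, fun v hv => ⟨hz1 v hv, fun h => ?_⟩, ?_, fun _ => ?_⟩
    · rw [hy]
      simp only [hz]
      rw [if_neg]
      rintro ⟨hlt, -⟩
      rw [hst, if_neg (by omega), if_neg (by omega)] at h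
      omega
    · rw [hcost z hz1 (by simp [hz])]
      exact I.cost_le_of_isSolution (by rw [hch]; exact hU)
    · refine le_trans (le_of_eq ?_) hUk
      rw [← Finset.card_map Fin.valEmbedding]
      congr 1
      ext p
      simp only [Finset.mem_filter, Finset.mem_range, Finset.mem_map, Fin.valEmbedding_apply, hz]
      constructor
      · rintro ⟨h1, h2⟩
        have h3 : ∃ h : p < I.n, (⟨p, h⟩ : Fin I.n) ∈ U := by
          by_contra hn
          rw [if_neg hn] at h2
          omega
        obtain ⟨h, hm⟩ := h3
        exact ⟨_, hm, rfl⟩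
      · rintro ⟨v, hv, rfl⟩
        simp [hv]

end Setup

/-! ### The path to a leaf -/

section Round

variable {I : Instance} {k : ℕ}

/-- The arrays that hold the output and the control variables. The search along a path does not
depend on them, except for the digits. -/
def ctrl : List ℕ := [2, 3, 5, 6, 7, 8, 9]

theorem Tree.walk_mem_leaves {α : Type} (T : Tree α) (D : ℕ → ℕ) : T.walk D ∈ T.leaves := by
  induction T generalizing D with
  | leaf a => simp [walk, leaves]
  | node l r ihl ihr =>
    rw [walk, leaves, List.mem_append]
    split_ifs
    · exact .inl (ihl _)
    · exact .inr (ihr _)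

/-- The memory `ρ` is a node of the search tree; one step of the program leads to the child that the
next digit selects. -/
theorem body_spec {ρ τ : State} (he : Env I k τ) (h : LP.Agree ctrl ρ τ)
    (hD : ∀ i, τ.nat (5, i) ≤ 1) (hpos : τ.nat (6, 0) ≤ I.n) :
    (∀ i, (body.exec I.reals τ).nat (5, i) = τ.nat (5, i)) ∧
    if (prep.exec I.reals ρ).nat (21, 0) = 0 then
      LP.Agree ctrl (prep.exec I.reals ρ) (body.exec I.reals τ) ∧
        (body.exec I.reals τ).nat (6, 0) = τ.nat (6, 0)
    else LP.Agree ctrl (child I (prep.exec I.reals ρ) (τ.nat (5, τ.nat (6, 0))))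
        (body.exec I.reals τ) ∧ (body.exec I.reals τ).nat (6, 0) = τ.nat (6, 0) + 1 := by
  have hp : LP.Agree ctrl (prep.exec I.reals ρ) (prep.exec I.reals τ) :=
    LP.exec_congr (by decide) _ (by decide +kernel) h
  refine ⟨fun i => LP.exec_nat_of_not_mem _ _ (by decide) i, ?_⟩
  have h21 := hp.2 21 (by decide) 0
  have he' : Env I k (prep.exec I.reals τ) := he.exec _
  have hb := he'.lt_bnd
  have h5 : ∀ i, (prep.exec I.reals τ).nat (5, i) = τ.nat (5, i) :=
    fun i => LP.exec_nat_of_not_mem _ _ (by decide) i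
  have h6 : (prep.exec I.reals τ).nat (6, 0) = τ.nat (6, 0) :=
    LP.exec_nat_of_not_mem _ _ (by decide) 0
  rw [body, exec_seq]
  generalize prep.exec I.reals τ = τ' at *
  generalize prep.exec I.reals ρ = ρ' at *
  split_ifs with h0
  · rw [exec_ite_pos _ _ (by simp [← h21, h0]), exec_skip]
    exact ⟨hp, h6⟩
  · rw [exec_ite_neg _ _ (by simpa [← h21] using h0), exec_seq, exec_seq,
      exec_setv (a := 23) _ (by have := hD (τ.nat (6, 0)); simp [h6, h5]; omega),
      exec_setv (a := 6) _ (by simp [State.setNat_nat, h6]; omega)]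
    simp only [val_cell, val_vr, val_add, val_const, h6, h5, State.setNat_nat]
    refine ⟨LP.exec_congr (by decide) _ (by decide +kernel) ?_, ?_⟩
    · exact ((hp.setNat _ _ _).symm.setNat_left (by decide) _ _).symm
    · rw [LP.exec_nat_of_not_mem _ _ (by decide)]
      simp [State.setNat_nat]

/-- The loop of the search leads to the leaf of the search tree that is given by the digits. -/
theorem walk_spec {ρ τ : State} (he : Env I k τ) (h : LP.Agree ctrl ρ τ)
    (hD : ∀ i, τ.nat (5, i) ≤ 1) (hpos : τ.nat (6, 0) = 0) :
    LP.Agree ctrl ((tree I (I.n + 1) ρ).walk fun i => τ.nat (5, i))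
      ((LP.loop 8 (.add nE (.const 1)) body).exec I.reals τ) ∧
    ((LP.loop 8 (.add nE (.const 1)) body).exec I.reals τ).nat (6, 0) =
      (tree I (I.n + 1) ρ).depth (fun i => τ.nat (5, i)) ∧
    ((LP.loop 8 (.add nE (.const 1)) body).exec I.reals τ).nat (6, 0) ≤ I.n + 1 := by
  have hb := he.lt_bnd
  set T := tree I (I.n + 1) ρ with hT
  have := he.exec_loop (c := 8) (e := .add nE (.const 1)) (p := body)
    (fun j υ => (∀ i, υ.nat (5, i) = τ.nat (5, i)) ∧ υ.nat (6, 0) ≤ j ∧ ∃ ρ', LP.Agree ctrl ρ' υ ∧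
      T.walk (fun i => τ.nat (5, i)) =
        (tree I (I.n + 1 - j) ρ').walk (fun i => τ.nat (5, i + υ.nat (6, 0))) ∧
      T.depth (fun i => τ.nat (5, i)) =
        (tree I (I.n + 1 - j) ρ').depth (fun i => τ.nat (5, i + υ.nat (6, 0))) + υ.nat (6, 0))
    (I.n + 1) (by simp [he.n]) (by omega)
    (by
      refine ⟨fun i => by simp [State.setNat_nat], by simp [State.setNat_nat, hpos], ρ,
        (h.symm.setNat_left (by decide) _ _).symm, ?_, ?_⟩ <;>
      simp [State.setNat_nat, hpos, hT])
    (by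
      rintro j υ hj heυ ⟨h1, h2, ρ', h3, h4, h5⟩ hc - -
      obtain ⟨g1, g2⟩ := body_spec heυ h3 (fun i => by rw [h1]; exact hD i) (by omega)
      rw [show I.n + 1 - j = I.n + 1 - (j + 1) + 1 by omega, tree] at h4 h5
      rw [h1] at g2
      generalize body.exec I.reals υ = υ' at g1 g2
      have r5 : ∀ i, (υ'.setNat 8 0 (j + 1)).nat (5, i) = υ'.nat (5, i) := fun i => by
        simp [State.setNat_nat]
      have r6 : (υ'.setNat 8 0 (j + 1)).nat (6, 0) = υ'.nat (6, 0) := by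
        simp [State.setNat_nat]
      simp only [r5, r6]
      refine ⟨fun i => by rw [g1, h1], ?_, ?_⟩
      · split_ifs at g2 <;> omega
      · split_ifs at g2 h4 h5 with h0
        · rw [g2.2]
          exact ⟨_, (g2.1.symm.setNat_left (by decide) _ _).symm, h4, h5⟩
        · refine ⟨_, (g2.1.symm.setNat_left (by decide) _ _).symm, ?_⟩
          rw [Tree.walk, zero_add] at h4
          rw [Tree.depth, zero_add] at h5
          rw [g2.2]
          have e : ∀ i, i + 1 + υ.nat (6, 0) = i + (υ.nat (6, 0) + 1) := fun i => by omega
          simp only [e] at h4 h5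
          have hbit := hD (υ.nat (6, 0))
          split_ifs at h4 h5 with h6
          · rw [h6]
            exact ⟨h4, by omega⟩
          · rw [show τ.nat (5, υ.nat (6, 0)) = 1 by omega]
            exact ⟨h4, by omega⟩)
  obtain ⟨-, h2, ρ', h3, h4, h5⟩ := this
  rw [Nat.sub_self, tree] at h4 h5
  refine ⟨?_, ?_, h2⟩
  · rw [h4]
    exact h3
  · rw [h5, Tree.depth, zero_add]

theorem output_spec {σ : State} (he : Env I k σ) (h12 : ∀ p < I.n, σ.nat (12, p) ≤ 1) :
    (output.exec I.reals σ).nat (2, 0) = 1 ∧ (output.exec I.reals σ).nat (7, 0) = 0 ∧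
    ∀ p < I.n, (output.exec I.reals σ).nat (3, p) = σ.nat (12, p) := by
  have hb := he.lt_bnd
  rw [output, exec_seq, exec_seq, exec_setv (a := 2) _ (by simp; omega), exec_setv (a := 7) _ (by simp)]
  simp only [val_const]
  set σ₁ := (σ.setNat 2 0 1).setNat 7 0 0 with hσ₁
  have he₁ : Env I k σ₁ := (he.setNat (by omega) _ _).setNat (by omega) _ _
  have f : ∀ a, a ≠ 40 ∧ a ≠ 3 → ∀ i, ((LP.loop 40 nE (.nset 3 (vr 40) (.cell 12 (vr 40)))).exec
      I.reals σ₁).nat (a, i) = σ₁.nat (a, i) := by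
    intro a ha i
    exact LP.exec_nat_of_not_mem _ _ (by simpa [LP.wr] using ha) i
  refine ⟨by rw [f _ (by decide)]; simp [hσ₁, State.setNat_nat],
    by rw [f _ (by decide)]; simp [hσ₁, State.setNat_nat], ?_⟩
  have hb₁ := he₁.lt_bnd
  have r12 : ∀ i, σ₁.nat (12, i) = σ.nat (12, i) := fun i => by simp [hσ₁, State.setNat_nat]
  exact he₁.exec_loop (c := 40) (e := nE) (p := .nset 3 (vr 40) (.cell 12 (vr 40)))
    (fun j τ => ∀ p < j, τ.nat (3, p) = σ.nat (12, p)) I.n (by simp [he₁.n]) (by omega)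
    (by simp)
    (by
      intro j τ hj heτ hinv hc hfr _
      have hbτ := heτ.lt_bnd
      have h12τ : τ.nat (12, j) = σ.nat (12, j) := by rw [hfr 12 (by decide), r12]
      have := h12 j hj
      rw [exec_nset _ (by simp [hc]; omega) (by simp [hc, h12τ]; omega)]
      intro p hp
      simp only [val_vr, val_cell, hc, h12τ, State.setNat_nat]
      grind)

/-- The digits of the next leaf, or the end of the search. -/
theorem advance_spec {σ : State} (he : Env I k σ) (h6 : σ.nat (6, 0) ≤ I.n + 1)
    (hD : ∀ i, I.n + 3 ≤ i → σ.nat (5, i) = 0) :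
    ((advance.exec I.reals σ).nat (7, 0) = 0 ∧ ∀ i < σ.nat (6, 0), σ.nat (5, i) ≠ 0) ∨
    ((advance.exec I.reals σ).nat (7, 0) = σ.nat (7, 0) ∧ ∃ i < σ.nat (6, 0), σ.nat (5, i) = 0 ∧
      (∀ j, i < j → j < σ.nat (6, 0) → σ.nat (5, j) ≠ 0) ∧
      ∀ j, (advance.exec I.reals σ).nat (5, j) = Tree.next (fun i => σ.nat (5, i)) i j) := by
  have hb := he.lt_bnd
  rw [advance, exec_seq, exec_seq, exec_setv _ (by simp), val_const]
  set σ₀ := σ.setNat 37 0 0 with hσ₀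
  have he₀ : Env I k σ₀ := he.setNat (by omega) _ _
  have hb₀ := he₀.lt_bnd
  have r6 : σ₀.nat (6, 0) = σ.nat (6, 0) := by simp [hσ₀, State.setNat_nat]
  have r5 : ∀ i, σ₀.nat (5, i) = σ.nat (5, i) := fun i => by simp [hσ₀, State.setNat_nat]
  have hlast := he₀.exec_loop (c := 40) (e := vr 6)
    (p := .ite (eqT (.cell 5 (vr 40)) (.const 0)) (setv 37 (.add (vr 40) (.const 1))) .skip)
    (fun j τ => (τ.nat (37, 0) = 0 ∧ ∀ i < j, σ.nat (5, i) ≠ 0) ∨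
      ∃ i < j, τ.nat (37, 0) = i + 1 ∧ σ.nat (5, i) = 0 ∧ ∀ l, i < l → l < j → σ.nat (5, l) ≠ 0)
    (σ.nat (6, 0)) (by simp [r6]) (by omega)
    (by left; simp [hσ₀, State.setNat_nat])
    (by
      intro j τ hj heτ hinv hc hfr _
      have hbτ := heτ.lt_bnd
      have h5 : τ.nat (5, j) = σ.nat (5, j) := by rw [hfr 5 (by decide), r5]
      by_cases h0 : σ.nat (5, j) = 0
      · rw [exec_ite_pos _ _ (by simp [hc, h5, h0]), exec_setv _ (by simp [hc]; omega)]
        right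
        refine ⟨j, by omega, ?_, h0, fun l h1 h2 => by omega⟩
        simp [State.setNat_nat, hc]
      · rw [exec_ite_neg _ _ (by simp [hc, h5, h0]), exec_skip]
        simp only [State.setNat_nat]
        have key : ∀ i, i < j + 1 → i < j ∨ i = j := fun i hi => by omega
        rcases hinv with ⟨h1, h2⟩ | ⟨i, h1, h2, h3, h4⟩
        · refine .inl ⟨h1, fun i hi => ?_⟩
          rcases key i hi with hi | rfl
          · exact h2 i hi
          · exact h0
        · refine .inr ⟨i, by omega, h2, h3, fun l hl1 hl2 => ?_⟩
          rcases key l hl2 with hl2 | rfl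
          · exact h4 l hl1 hl2
          · exact h0)
  have f : ∀ a, a ≠ 40 ∧ a ≠ 37 → ∀ i, ((LP.loop 40 (vr 6)
      (.ite (eqT (.cell 5 (vr 40)) (.const 0)) (setv 37 (.add (vr 40) (.const 1))) .skip)).exec
      I.reals σ₀).nat (a, i) = σ₀.nat (a, i) := by
    intro a ha i
    exact LP.exec_nat_of_not_mem _ _ (by simpa [LP.wr, setv] using ha) i
  have he₁ : Env I k ((LP.loop 40 (vr 6)
      (.ite (eqT (.cell 5 (vr 40)) (.const 0)) (setv 37 (.add (vr 40) (.const 1))) .skip)).exec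
      I.reals σ₀) := he₀.exec _
  generalize (LP.loop 40 (vr 6) (.ite (eqT (.cell 5 (vr 40)) (.const 0))
    (setv 37 (.add (vr 40) (.const 1))) .skip)).exec I.reals σ₀ = σ₁ at hlast f he₁ ⊢
  have hb₁ := he₁.lt_bnd
  have s5 : ∀ i, σ₁.nat (5, i) = σ.nat (5, i) := fun i => by rw [f 5 (by decide), r5]
  rcases hlast with ⟨h1, h2⟩ | ⟨i, h1, h2, h3, h4⟩
  · left
    rw [exec_ite_pos _ _ (by simp [h1]), exec_setv _ (by simp)]
    exact ⟨by simp [State.setNat_nat], h2⟩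
  · right
    rw [exec_ite_neg _ _ (by simp [h2]), exec_seq,
      exec_nset _ (by simp [h2]; omega) (by simp; omega)]
    simp only [val_sub, val_vr, val_const, h2, Nat.add_sub_cancel]
    set σ₂ := σ₁.setNat 5 i 1 with hσ₂
    have he₂ : Env I k σ₂ := he₁.setNat (by omega) _ _
    have hb₂ := he₂.lt_bnd
    refine ⟨?_, i, h1, h3, h4, ?_⟩
    · rw [LP.exec_nat_of_not_mem _ _ (by decide)]
      simp [hσ₂, State.setNat_nat, f 7 (by decide), hσ₀]
    · have := he₂.exec_loop (c := 40) (e := mE)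
        (p := .ite (.nle (vr 37) (vr 40)) (.nset 5 (vr 40) (.const 0)) .skip)
        (fun j τ => ∀ l, τ.nat (5, l) = if i < l ∧ l < j then 0 else σ₂.nat (5, l))
        (I.n + 3) (by simp [he₂.n]) (by omega)
        (by simp [State.setNat_nat])
        (by
          intro j τ hj heτ hinv hc hfr _
          have hbτ := heτ.lt_bnd
          have h37 : τ.nat (37, 0) = i + 1 := by
            rw [hfr 37 (by decide), hσ₂, State.setNat_nat, if_neg (by omega), h2]
          by_cases hij : i + 1 ≤ j
          · rw [exec_ite_pos _ _ (by simp [h37, hc]; omega), exec_nset _ (by simp [hc]; omega)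
              (by simp)]
            intro l
            simp only [State.setNat_nat, hinv, val_vr, val_const, hc]
            grind
          · rw [exec_ite_neg _ _ (by simp [h37, hc]; omega), exec_skip]
            intro l
            simp only [State.setNat_nat, hinv]
            grind)
      intro j
      rw [this j, Tree.next]
      simp only [hσ₂, State.setNat_nat, s5]
      have := hD j
      grind

end Round

/-! ### A round of the search -/

section Round

variable {I : Instance} {k b X Y : ℕ}

theorem LP.wf_wrR {p : LP} (h : p.wf) : ∀ a ∈ p.wrR, 2 ≤ a ∧ a ≤ 4 := by
  induction p with
  | skip | nset a i e => simp [wrR]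
  | rset a i e =>
    simp only [wf, Bool.and_eq_true, decide_eq_true_eq] at h
    simpa [wrR] using h
  | seq p q ihp ihq | ite b p q ihp ihq =>
    simp only [wf, Bool.and_eq_true] at h
    intro a ha
    rcases List.mem_append.1 ha with ha | ha
    · exact ihp h.1 a ha
    · exact ihq h.2 a ha
  | loop c e p ih =>
    simp only [wf, Bool.and_eq_true] at h
    exact ih h.2

theorem LP.wf_wr {p : LP} (h : p.wf) : ∀ a ∈ p.wr, 2 ≤ a ∧ a ≠ 4 := by
  induction p with
  | skip | rset a i e => simp [wr]
  | nset a i e =>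
    simp only [wf, Bool.and_eq_true, decide_eq_true_eq] at h
    intro b hb
    rw [List.mem_singleton.1 hb]
    exact ⟨h.2, h.1.2⟩
  | seq p q ihp ihq | ite b p q ihp ihq =>
    simp only [wf, Bool.and_eq_true] at h
    intro a ha
    rcases List.mem_append.1 ha with ha | ha
    · exact ihp h.1 a ha
    · exact ihq h.2 a ha
  | loop c e p ih =>
    simp only [wf, Bool.and_eq_true, decide_eq_true_eq] at h
    intro a ha
    rcases List.mem_cons.1 ha with rfl | ha
    · exact ⟨h.1.1.1.2, h.1.1.1.1.2⟩
    · exact ih h.2 a ha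

/-- The memory `τ` arises from `σ` without changes to the input and to the other arrays that the
search only reads. -/
structure Keeps (σ τ : State) : Prop where
  nat : ∀ a, a = 0 ∨ a = 1 ∨ a = 4 → ∀ i, τ.nat (a, i) = σ.nat (a, i)
  real : ∀ a, a < 2 ∨ 4 < a → ∀ i, τ.real (a, i) = σ.real (a, i)

theorem Keeps.refl (σ : State) : Keeps σ σ := ⟨fun _ _ _ => rfl, fun _ _ _ => rfl⟩

theorem Keeps.trans {σ τ υ : State} (h : Keeps σ τ) (h' : Keeps τ υ) : Keeps σ υ :=
  ⟨fun a ha i => (h'.nat a ha i).trans (h.nat a ha i),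
    fun a ha i => (h'.real a ha i).trans (h.real a ha i)⟩

theorem Keeps.exec (x : ℕ → ℝ) (σ : State) (p : LP) (h : p.wf) : Keeps σ (p.exec x σ) := by
  refine ⟨fun a ha i => LP.exec_nat_of_not_mem _ _ (fun hm => ?_) i,
    fun a ha i => LP.exec_real_of_not_mem _ _ (fun hm => ?_) i⟩
  · have := LP.wf_wr h a hm
    omega
  · have := LP.wf_wrR h a hm
    omega

theorem Keeps.env {σ τ : State} (h : Keeps σ τ) (he : Env I k σ) : Env I k τ :=
  he.congr h.nat fun a ha => h.real a (by omega)

theorem clear_wf : clear.wf := by decide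

theorem path_wf : path.wf := by decide

theorem clear_nat_eq_zero {σ : State} (h : Bd b X σ) (hb : σ.nat (4, 0) = b) {a : ℕ} (ha : 10 ≤ a)
    (i : ℕ) : (clear.exec I.reals σ).nat (a, i) = 0 := by
  obtain ⟨h1, -, -, -, -, h6⟩ := clear_spec (I := I) σ
  by_cases hi : a ≤ 60 ∧ i ≤ b
  · exact h1 a ha hi.1 i (by omega)
  · refine h6 a (by omega) i ?_
    by_contra hne
    exact hi (h.supp a i hne)

theorem clear_real_eq_zero {σ : State} (h : Bd b X σ) (hb : σ.nat (4, 0) = b) {a : ℕ} (ha : 2 ≤ a)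
    (ha' : a ≤ 4) (i : ℕ) : (clear.exec I.reals σ).real (a, i) = 0 := by
  obtain ⟨-, h2, -, h4, -, -⟩ := clear_spec (I := I) σ
  by_cases hi : i ≤ b
  · exact h2 a ha ha' i (by omega)
  · refine h4 a i ?_
    by_contra hne
    exact hi (h.rsupp a i hne).2

/-- Cleared memories agree except on the control variables. -/
theorem Keeps.clear {σ τ : State} (h : Keeps σ τ) (hσ : Bd b X σ) (hτ : Bd b Y τ)
    (hb : σ.nat (4, 0) = b) : LP.Agree ctrl (clear.exec I.reals σ) (clear.exec I.reals τ) := by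
  have hbτ : τ.nat (4, 0) = b := by rw [h.nat 4 (by omega), hb]
  obtain ⟨-, -, h3, -, h5, -⟩ := clear_spec (I := I) σ
  obtain ⟨-, -, g3, -, g5, -⟩ := clear_spec (I := I) τ
  constructor
  · ext1 ⟨a, i⟩
    by_cases ha : 2 ≤ a ∧ a ≤ 4
    · rw [clear_real_eq_zero hσ hb ha.1 ha.2, clear_real_eq_zero hτ hbτ ha.1 ha.2]
    · rw [h5 a (by omega), g5 a (by omega), h.real a (by omega)]
  · intro a ha i
    by_cases h10 : 10 ≤ a
    · rw [clear_nat_eq_zero hσ hb h10, clear_nat_eq_zero hτ hbτ h10]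
    · simp only [ctrl, List.mem_cons, List.not_mem_nil, or_false] at ha
      rw [h3 a (by omega) (by omega), g3 a (by omega) (by omega), h.nat a (by omega)]

/-- Clearing the memory restores the bound for the coefficients. -/
theorem Keeps.bd_clear {σ τ : State} (h : Keeps σ τ) (hσ : Bd b X σ) (hτ : Bd b Y τ)
    (hb : σ.nat (4, 0) = b) : Bd b X (WVC.clear.exec I.reals τ) := by
  have hbτ : τ.nat (4, 0) = b := by rw [h.nat 4 (by omega), hb]
  obtain ⟨g, q, hgq⟩ := LP.exec_run WVC.clear clear_wf
  refine { (hgq I.reals b Y τ hτ hbτ).1 with coeff := fun a i j => ?_ }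
  obtain ⟨-, -, -, -, g5, -⟩ := clear_spec (I := I) τ
  by_cases ha : 2 ≤ a ∧ a ≤ 4
  · rw [clear_real_eq_zero hτ hbτ ha.1 ha.2]
    simp
  · rw [g5 a (by omega), h.real a (by omega)]
    exact hσ.coeff a i j

/-- The search tree, where the search starts with the memory `σ`. -/
def searchTree (I : Instance) (σ : State) : Tree State :=
  tree I (I.n + 1) (initCfg.exec I.reals (clear.exec I.reals σ))

/-- The search tree has few enough leaves, and one of them gives a small solution if there is any.
-/
theorem searchTree_spec {σ : State} (he : Env I k σ) (hσ : Bd b X σ) (hb : σ.nat (4, 0) = b) :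
    (∀ ρ ∈ (searchTree I σ).leaves, Ok I k I.cost ρ) ∧
    ((searchTree I σ).leaves.length : ℝ) ≤ 1.381 ^ (k + 4) ∧
    ((∃ U, I.IsSolution U ∧ U.card ≤ k) →
      ∃ ρ ∈ (searchTree I σ).leaves, (cfg I ρ).Good I.n k I.W ∧ (cfg I ρ).free I.n = ∅) := by
  obtain ⟨h1, h2, h3, h4⟩ := initCfg_spec (σ := clear.exec I.reals σ)
    ((Keeps.exec I.reals σ clear clear_wf).env he)
    (fun a ha _ i => clear_nat_eq_zero hσ hb ha i)
    fun i => clear_real_eq_zero hσ hb le_rfl (by omega) i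
  refine ⟨h1.of_mem_leaves, ?_, fun h => h1.exists_leaf (h4 h) h3⟩
  have := h1.length_leaves_le (t := I.n + 1)
  rw [h2, pow_mul, Cfg.base_pow] at this
  exact this

/-- One round of the search either finds a solution, or it moves on to the next leaf. -/
theorem round_spec {σ₀ σ : State} (he : Env I k σ₀) (hb : σ₀.nat (4, 0) = b) (hσ₀ : Bd b X σ₀)
    (hσ : Bd b Y σ) (h : Keeps σ₀ σ) (hD : ∀ i, σ.nat (5, i) ≤ 1)
    (hD0 : ∀ i, I.n + 3 ≤ i → σ.nat (5, i) = 0) :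
    (∃ z, I.IsSolution (I.chosen z) ∧
      (path.exec I.reals (clear.exec I.reals σ)).nat (2, 0) = 1 ∧
      (path.exec I.reals (clear.exec I.reals σ)).nat (7, 0) = 0 ∧
      ∀ p < I.n, (path.exec I.reals (clear.exec I.reals σ)).nat (3, p) = z p) ∨
    ∃ ρ, (path.exec I.reals (clear.exec I.reals σ)).nat (2, 0) = σ.nat (2, 0) ∧
      ¬ ((cfg I ρ).Good I.n k I.W ∧ (cfg I ρ).free I.n = ∅) ∧
      (((path.exec I.reals (clear.exec I.reals σ)).nat (7, 0) = 0 ∧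
        (searchTree I σ₀).rem (fun i => σ.nat (5, i)) = [ρ]) ∨
      ((path.exec I.reals (clear.exec I.reals σ)).nat (7, 0) = σ.nat (7, 0) ∧
        (searchTree I σ₀).rem (fun i => σ.nat (5, i)) = ρ ::
          (searchTree I σ₀).rem
            (fun i => (path.exec I.reals (clear.exec I.reals σ)).nat (5, i)) ∧
        (∀ i, (path.exec I.reals (clear.exec I.reals σ)).nat (5, i) ≤ 1) ∧
        ∀ i, I.n + 3 ≤ i → (path.exec I.reals (clear.exec I.reals σ)).nat (5, i) = 0)) := by
  obtain ⟨hok, -, -⟩ := searchTree_spec he hσ₀ hb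
  have hag := h.clear (I := I) hσ₀ hσ hb
  obtain ⟨-, -, h3, -, -, -⟩ := clear_spec (I := I) σ
  have he₁ : Env I k (clear.exec I.reals σ) :=
    (h.trans (Keeps.exec I.reals σ clear clear_wf)).env he
  rw [path, exec_seq, exec_seq, exec_seq, exec_seq]
  -- the walk to the leaf
  have hag₂ := LP.exec_congr (x := I.reals) (by decide) initCfg (by decide +kernel) hag
  have f₂ : ∀ a, 2 ≤ a → a ≤ 9 → a ≠ 4 → a ≠ 9 → ∀ i,
      (initCfg.exec I.reals (clear.exec I.reals σ)).nat (a, i) = σ.nat (a, i) := by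
    intro a h1 h2 h4 h9 i
    rw [LP.exec_nat_of_not_mem _ _ (by simp [LP.wr, initCfg]; omega), h3 a h9 (by omega)]
  have he₂ : Env I k (initCfg.exec I.reals (clear.exec I.reals σ)) := he₁.exec _
  generalize initCfg.exec I.reals (clear.exec I.reals σ) = σ₂ at hag₂ f₂ he₂ ⊢
  rw [exec_setv _ (by simp), val_const]
  have he₃ : Env I k (σ₂.setNat 6 0 0) := he₂.setNat (by omega) _ _
  have hag₃ := (hag₂.symm.setNat_left (show 6 ∈ ctrl by decide) 0 0).symm
  have f₃ : ∀ a, 2 ≤ a → a ≤ 9 → a ≠ 4 → a ≠ 9 → a ≠ 6 → ∀ i,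
      (σ₂.setNat 6 0 0).nat (a, i) = σ.nat (a, i) := by
    intro a h1 h2 h4 h9 h6 i
    rw [State.setNat_nat, if_neg (by omega), f₂ a h1 h2 h4 h9]
  have h5 : ∀ i, (σ₂.setNat 6 0 0).nat (5, i) = σ.nat (5, i) :=
    f₃ 5 (by omega) (by omega) (by omega) (by omega) (by omega)
  obtain ⟨w1, w2, w3⟩ := walk_spec he₃ hag₃ (fun i => by rw [h5]; exact hD i)
    (by simp [State.setNat_nat])
  have f₄ : ∀ a, a = 2 ∨ a = 5 ∨ a = 7 → ∀ i,
      ((LP.loop 8 (.add nE (.const 1)) body).exec I.reals (σ₂.setNat 6 0 0)).nat (a, i) =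
        σ.nat (a, i) := by
    rintro a (rfl | rfl | rfl) i <;>
      rw [LP.exec_nat_of_not_mem _ _ (by decide), f₃ _ (by omega) (by omega) (by omega) (by omega)
        (by omega)]
  have he₄ : Env I k ((LP.loop 8 (.add nE (.const 1)) body).exec I.reals (σ₂.setNat 6 0 0)) :=
    he₃.exec _
  simp only [h5] at w1 w2
  rw [← searchTree] at w1 w2
  generalize (LP.loop 8 (.add nE (.const 1)) body).exec I.reals (σ₂.setNat 6 0 0) = σ₄
    at w1 w2 w3 f₄ he₄ ⊢
  set D : ℕ → ℕ := fun i => σ.nat (5, i) with hDdef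
  have hokρ := hok _ ((searchTree I σ₀).walk_mem_leaves D)
  set ρ := (searchTree I σ₀).walk D with hρ
  -- the verification
  have hver : LP.Agree ctrl (verify.exec I.reals ρ) (verify.exec I.reals σ₄) :=
    LP.exec_congr (by decide) _ (by decide +kernel) w1
  have hback : LP.Agree ctrl (backSubst.exec I.reals ρ) (backSubst.exec I.reals σ₄) :=
    LP.exec_congr (by decide) _ (by decide +kernel) w1
  obtain ⟨b1, b2⟩ := backSubst_spec hokρ
  have hz : ∀ p, (verify.exec I.reals σ₄).nat (12, p) = (backSubst.exec I.reals ρ).nat (12, p) := by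
    intro p
    rw [verify, exec_seq, LP.exec_nat_of_not_mem _ _ (by decide), hback.2 12 (by decide)]
  have hz' : (fun w => (backSubst.exec I.reals ρ).nat (12, w)) =
      fun w => (cfg I ρ).recon (cfg I ρ).cnt (cfg I ρ).y w := funext b1
  have h36 : (verify.exec I.reals σ₄).nat (36, 0) = 1 ↔
      I.IsSolution (I.chosen fun w => (backSubst.exec I.reals ρ).nat (12, w)) := by
    rw [← hver.2 36 (by decide), verify, exec_seq]
    exact check_spec ((Keeps.exec I.reals ρ backSubst (by decide)).env hokρ.env)
  have f₅ : ∀ a, a = 2 ∨ a = 5 ∨ a = 6 ∨ a = 7 → ∀ i,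
      (verify.exec I.reals σ₄).nat (a, i) = σ₄.nat (a, i) := by
    rintro a (rfl | rfl | rfl | rfl) i <;> exact LP.exec_nat_of_not_mem _ _ (by decide) i
  have he₅ : Env I k (verify.exec I.reals σ₄) := he₄.exec _
  generalize verify.exec I.reals σ₄ = σ₅ at hz h36 f₅ he₅ ⊢
  by_cases hsol : σ₅.nat (36, 0) = 1
  · left
    rw [exec_ite_pos _ _ (by simpa using hsol)]
    obtain ⟨o1, o2, o3⟩ := output_spec he₅ (fun p hp => by rw [hz]; exact b2 p (by omega))
    exact ⟨_, h36.1 hsol, o1, o2, fun p hp => by rw [o3 p hp, hz]⟩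
  · right
    rw [exec_ite_neg _ _ (by simpa using hsol)]
    have g6 : σ₅.nat (6, 0) = (searchTree I σ₀).depth D := by rw [f₅ 6 (by omega), w2]
    have g5 : ∀ i, σ₅.nat (5, i) = D i := fun i => by rw [f₅ 5 (by omega), f₄ 5 (by omega)]
    refine ⟨ρ, ?_, ?_, ?_⟩
    · rw [LP.exec_nat_of_not_mem _ _ (by decide), f₅ 2 (by omega), f₄ 2 (by omega)]
    -- a leaf that has a solution would have passed the verification
    · rintro ⟨hg, hf⟩
      refine hsol (h36.2 (I.isSolution_of_cost_le b2 ?_))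
      rw [hz']
      exact hg.cost_recon_le hokρ.inv hf
    · rcases advance_spec he₅ (by rw [f₅ 6 (by omega)]; exact w3)
        (fun i hi => by rw [g5]; exact hD0 i hi) with ⟨a1, a2⟩ | ⟨a1, i, a2, a3, a4, a5⟩
      · refine .inl ⟨a1, Tree.rem_of_forall_ne _ _ fun j hj => ?_⟩
        rw [← g5]
        exact a2 j (by omega)
      · simp only [g5] at a3 a4 a5
        have hi : i ≤ I.n := by
          rw [f₅ 6 (by omega)] at a2
          omega
        refine .inr ⟨by rw [a1, f₅ 7 (by omega), f₄ 7 (by omega)], ?_, fun j => ?_, fun j hj => ?_⟩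
        · simp only [a5]
          exact Tree.rem_next _ _ i (by omega) a3 fun j h1 h2 => a4 j h1 (by omega)
        · rw [a5, Tree.next]
          have := hD j
          split_ifs <;> omega
        · rw [a5, Tree.next, if_neg (by omega), if_neg (by omega)]

end Round

open Polynomial

/-! ### The search -/

section Search

variable {I : Instance} {k b X : ℕ}

/-- Starts the search at the first leaf. -/
def start : LP :=
  .seq (setv 7 (.const 1)) (.loop 40 (.add (vr 4) (.const 1)) (.nset 5 (vr 40) (.const 0)))

/-- Visits one leaf of the search tree after the other. -/
def rounds : Prog := .while (eqT (vr 7) (.const 1)) (.seq clear.compile path.compile)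

/-- The search for a solution of size at most `k`. -/
def searchProg : Prog := .seq start.compile rounds

theorem output_of_eq_zero {σ : State} {n : ℕ} (h : σ.nat (2, 0) = 0) : σ.output n = none :=
  if_pos h

theorem output_of_ne_zero {σ : State} {n : ℕ} (h : σ.nat (2, 0) ≠ 0) : σ.output n =
    some (Finset.univ.filter fun v : Fin n => σ.nat (3, (v : ℕ)) ≠ 0) :=
  if_neg h

theorem start_spec {σ : State} (h : Bd b X σ) (hb : σ.nat (4, 0) = b) (hb1 : 1 ≤ b) (x : ℕ → ℝ) :
    (start.exec x σ).nat (7, 0) = 1 ∧ ∀ i, (start.exec x σ).nat (5, i) = 0 := by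
  rw [start, exec_seq, exec_setv _ (by simp; omega), val_const]
  constructor
  · rw [LP.exec_nat_of_not_mem _ _ (by decide)]
    simp [State.setNat_nat]
  · have := LP.exec_loop (x := x) (c := 40) (e := .add (vr 4) (.const 1))
      (p := .nset 5 (vr 40) (.const 0)) (σ := σ.setNat 7 0 1) (by decide)
      (fun j τ => ∀ i, i < j ∨ b < i → τ.nat (5, i) = 0) (by simp)
      (by
        intro i hi
        simp only [State.setNat_nat]
        have := h.supp 5 i
        by_contra hne
        simp at hne
        have := this hne
        omega)
      (by
        intro j τ hj hinv hc hfr _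
        have h4 : τ.nat (4, 0) = b := by
          rw [hfr 4 (by decide), State.setNat_nat, if_neg (by decide), hb]
        have hj' : j < b + 1 := by simpa [State.setNat_nat, hb] using hj
        rw [exec_nset _ (by simp [hc]; omega) (by simp)]
        intro i hi
        simp only [State.setNat_nat, val_vr, val_const, hc]
        grind)
    intro i
    refine this i ?_
    simp only [val_add, val_vr, val_const, State.setNat_nat]
    simp [hb]
    omega

/-- The rounds of the search from a memory in which not all leaves have been visited. -/
theorem rounds_run : ∃ g q : ℕ[X], ∀ (I : Instance) (k b X : ℕ) (σ₀ : State), Env I k σ₀ →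
    σ₀.nat (4, 0) = b → Bd b X σ₀ → ∀ (L : ℕ) (σ : State), Keeps σ₀ σ →
    Bd b (X + g.eval b) σ → σ.nat (7, 0) = 1 → σ.nat (2, 0) = 0 → (∀ i, σ.nat (5, i) ≤ 1) →
    (∀ i, I.n + 3 ≤ i → σ.nat (5, i) = 0) →
    ((searchTree I σ₀).rem fun i => σ.nat (5, i)).length ≤ L →
    ((∃ U, I.IsSolution U ∧ U.card ≤ k) → ∃ ρ ∈ (searchTree I σ₀).rem fun i => σ.nat (5, i),
      (cfg I ρ).Good I.n k I.W ∧ (cfg I ρ).free I.n = ∅) →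
    ∃ σ' t m, Run I.reals rounds σ σ' t m ∧ Keeps σ₀ σ' ∧ Bd b (X + g.eval b) σ' ∧
      I.IsAnswerK k (σ'.output I.n) ∧ t ≤ (L + 1) * q.eval (b + (X + g.eval b)) ∧
      m ≤ q.eval (b + (X + g.eval b)) := by
  obtain ⟨g₁, q₁, h₁⟩ := LP.exec_run clear clear_wf
  obtain ⟨g, q₂, h₂⟩ := LP.exec_run path path_wf
  obtain ⟨q₃, h₃⟩ := Test.bound (eqT (vr 7) (.const 1))
  refine ⟨g, q₁ + q₂ + q₃ + sizePoly, fun I k b X σ₀ he hb hσ₀ L => ?_⟩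
  set Z := X + g.eval b with hZ
  set N := (q₁ + q₂ + q₃ + sizePoly).eval (b + Z) with hN
  have hNe : N = q₁.eval (b + Z) + q₂.eval (b + Z) + q₃.eval (b + Z) + sizePoly.eval (b + Z) := by
    simp only [hN, eval_add]
  have hhalt : ∀ σ, Bd b Z σ → σ.nat (7, 0) = 0 →
      ∃ t m, Run I.reals rounds σ σ t m ∧ t ≤ N ∧ m ≤ N := by
    intro σ hσ h7
    refine ⟨_, _, .while_false (by simp [h7]), ?_, ?_⟩
    · have := h₃ _ _ _ hσ
      omega
    · have := hσ.size_le
      omega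
  induction L with
  | zero =>
    intro σ _ _ _ _ _ _ hL
    exfalso
    generalize searchTree I σ₀ = T at hL
    generalize (fun i => σ.nat (5, i)) = D at hL
    -- at least the current leaf remains
    have : T.rem D ≠ [] := by
      clear hL
      induction T generalizing D with
      | leaf a => simp [Tree.rem]
      | node l r ihl ihr =>
        rw [Tree.rem]
        split_ifs
        · exact List.append_ne_nil_of_left_ne_nil (ihl _) _
        · exact ihr _
    exact this (List.length_eq_zero_iff.1 (Nat.le_zero.1 hL))
  | succ L ih =>
    intro σ hk hσ h7 h2 hD hD0 hL hsol
    obtain ⟨c1, t₁, m₁, r₁, ht₁, hm₁⟩ := h₁ I.reals b Z σ hσ (by rw [hk.nat 4 (by omega), hb])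
    have hkc := hk.trans (Keeps.exec I.reals σ clear clear_wf)
    have hc : Bd b X (clear.exec I.reals σ) := hk.bd_clear hσ₀ hσ hb
    obtain ⟨c2, t₂, m₂, r₂, ht₂, hm₂⟩ := h₂ I.reals b X _ hc (by rw [hkc.nat 4 (by omega), hb])
    have hkp := hkc.trans (Keeps.exec I.reals (clear.exec I.reals σ) path path_wf)
    have hround := round_spec he hb hσ₀ hσ hk hD hD0
    generalize path.exec I.reals (clear.exec I.reals σ) = σ' at c2 r₂ hkp hround
    have ht₃ := h₃ _ _ _ hσ
    have hq₂ := eval_mono q₂ (show b + X ≤ b + Z by omega)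
    have hrun : ∀ σ'' t m, Run I.reals rounds σ' σ'' t m →
        Run I.reals rounds σ σ'' ((eqT (vr 7) (.const 1)).cost σ + (t₁ + t₂) + t)
          (max (max m₁ m₂) m) :=
      fun σ'' t m hr => .while_true (by simp [h7]) (.seq r₁ r₂) hr
    have hmax : ∀ m, m ≤ N → max (max m₁ m₂) m ≤ N := fun m hm => by
      refine max_le (max_le ?_ ?_) hm <;> omega
    have htime : ∀ t, t ≤ (L + 1) * N →
        (eqT (vr 7) (.const 1)).cost σ + (t₁ + t₂) + t ≤ (L + 1 + 1) * N := fun t ht => by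
      rw [add_mul (L + 1), one_mul]
      omega
    rcases hround with ⟨z, s1, s2, s3, s4⟩ | ⟨ρ, s1, s2, ⟨s3, s4⟩ | ⟨s3, s4, s5, s6⟩⟩
    -- the round has found a solution
    · obtain ⟨t, m, hr, ht, hm⟩ := hhalt σ' c2 s3
      refine ⟨σ', _, _, hrun _ _ _ hr, hkp, c2, ?_, htime t (ht.trans ?_), hmax m hm⟩
      · rw [output_of_ne_zero (by omega)]
        have e : (Finset.univ.filter fun v : Fin I.n => σ'.nat (3, (v : ℕ)) ≠ 0) = I.chosen z := by
          ext v
          simp [Instance.chosen, s4 v v.2]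
        rw [e]
        exact s1
      · exact Nat.le_mul_of_pos_left _ (by omega)
    -- the last leaf was visited in vain
    · obtain ⟨t, m, hr, ht, hm⟩ := hhalt σ' c2 s3
      refine ⟨σ', _, _, hrun _ _ _ hr, hkp, c2, ?_, htime t (ht.trans ?_), hmax m hm⟩
      · rw [output_of_eq_zero (by omega)]
        intro h
        obtain ⟨ρ', h1, h2⟩ := hsol h
        rw [s4, List.mem_singleton] at h1
        exact s2 (h1 ▸ h2)
      · exact Nat.le_mul_of_pos_left _ (by omega)
    -- the search goes on, and the leaf that was visited is not needed
    · rw [s4] at hL hsol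
      obtain ⟨σ'', t, m, hr, hk', hbd, hans, ht, hm⟩ := ih σ' hkp c2 (by omega) (by omega) s5 s6
        (by simpa using hL) (fun h => by
          obtain ⟨ρ', h1, h2⟩ := hsol h
          rcases List.mem_cons.1 h1 with rfl | h1
          · exact absurd h2 s2
          · exact ⟨ρ', h1, h2⟩)
      exact ⟨σ'', _, _, hrun _ _ _ hr, hk', hbd, hans, htime t ht, hmax m hm⟩

/-- The factor `1.381 ^ 4` that the potential has in excess is less than `8`, and counts as
polynomial. -/
theorem searchProg_run : ∃ g q : ℕ[X], ∀ (I : Instance) (k b X : ℕ) (σ : State), Env I k σ →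
    σ.nat (4, 0) = b → Bd b X σ → σ.nat (2, 0) = 0 →
    ∃ σ' t m, Run I.reals searchProg σ σ' t m ∧ Keeps σ σ' ∧ Bd b (X + g.eval b) σ' ∧
      I.IsAnswerK k (σ'.output I.n) ∧ (t : ℝ) ≤ 1.381 ^ k * q.eval (b + X) ∧
      m ≤ q.eval (b + X) := by
  have hwf : start.wf := by decide
  obtain ⟨g₀, q₀, h₀⟩ := LP.exec_run start hwf
  obtain ⟨g, q, h⟩ := rounds_run
  refine ⟨g₀ + g, q₀ + 8 * q.comp (Polynomial.X + g₀ + g), fun I k b X σ he hb hσ h2 => ?_⟩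
  obtain ⟨c0, t₀, m₀, r₀, ht₀, hm₀⟩ := h₀ I.reals b X σ hσ hb
  have hk₀ := Keeps.exec I.reals σ start hwf
  have he₀ := hk₀.env he
  have hb₀ : (start.exec I.reals σ).nat (4, 0) = b := by rw [hk₀.nat 4 (by omega), hb]
  obtain ⟨s1, s2⟩ := start_spec hσ hb (by have := he.lt_bnd; omega) I.reals
  have s3 : (start.exec I.reals σ).nat (2, 0) = 0 := by
    rw [LP.exec_nat_of_not_mem _ _ (by decide), h2]
  generalize start.exec I.reals σ = σ₀ at c0 r₀ hk₀ he₀ hb₀ s1 s2 s3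
  obtain ⟨-, l2, l3⟩ := searchTree_spec he₀ c0 hb₀
  have hrem : ((searchTree I σ₀).rem fun i => σ₀.nat (5, i)) = (searchTree I σ₀).leaves := by
    simp only [s2]
    exact Tree.rem_zero _
  obtain ⟨σ', t, m, r, hk, hbd, hans, ht, hm⟩ := h I k b _ σ₀ he₀ hb₀ c0
    (searchTree I σ₀).leaves.length σ₀ (Keeps.refl _) (c0.mono (by omega)) s1 s3
    (fun i => by rw [s2]; omega) (fun i _ => s2 i) (by rw [hrem]) (by rw [hrem]; exact l3)
  have hq : q.eval (b + (X + g₀.eval b + g.eval b)) ≤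
      (q.comp (Polynomial.X + g₀ + g)).eval (b + X) := by
    rw [eval_comp]
    refine eval_mono q ?_
    simp only [eval_add, eval_X]
    have := eval_mono g₀ (show b ≤ b + X by omega)
    have := eval_mono g (show b ≤ b + X by omega)
    omega
  generalize (q.comp (Polynomial.X + g₀ + g)) = Q at hq ⊢
  have e8 : (q₀ + 8 * Q).eval (b + X) = q₀.eval (b + X) + 8 * Q.eval (b + X) := by
    simp
  refine ⟨σ', _, _, .seq r₀ r, hk₀.trans hk, ?_, hans, ?_, ?_⟩
  · rw [eval_add, ← add_assoc]
    exact hbd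
  · rw [e8]
    have hp : (1 : ℝ) ≤ 1.381 ^ k := one_le_pow₀ (by norm_num)
    have ht' : (t : ℝ) ≤ ((searchTree I σ₀).leaves.length + 1) * Q.eval (b + X) := by
      exact_mod_cast ht.trans (Nat.mul_le_mul_left _ hq)
    have ht₀' : (t₀ : ℝ) ≤ q₀.eval (b + X) := by exact_mod_cast ht₀
    -- `1.381 ^ 4 + 1 ≤ 8`
    have hl : ((searchTree I σ₀).leaves.length : ℝ) + 1 ≤ 1.381 ^ k * 8 := by
      refine (add_le_add_left l2 1).trans ?_
      rw [pow_add]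
      norm_num at hp ⊢
      linarith
    have hQ : (0 : ℝ) ≤ Q.eval (b + X) := Nat.cast_nonneg _
    have hq₀ : (0 : ℝ) ≤ q₀.eval (b + X) := Nat.cast_nonneg _
    push_cast
    nlinarith [mul_le_mul_of_nonneg_right hl hQ, mul_le_mul_of_nonneg_right hp hq₀]
  · rw [e8]
    refine max_le ?_ ?_ <;> omega

end Search

open Polynomial

/-! ### The input -/

section Input

variable {I : Instance} {k : ℕ}

open Classical in
/-- Position `i` of the adjacency matrix of the instance, stored row by row. -/
def Instance.matrix (I : Instance) (i : ℕ) : ℕ :=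
  ∑ p : Fin I.n, ∑ q : Fin I.n,
    if (p : ℕ) * I.n + (q : ℕ) = i then (if I.G.Adj p q then 1 else 0) else 0

open Classical in
theorem Instance.matrix_apply (I : Instance) {p q : ℕ} (hp : p < I.n) (hq : q < I.n) :
    I.matrix (p * I.n + q) = if I.Edge p q then 1 else 0 := by
  have inj : ∀ a b : Fin I.n, (a : ℕ) * I.n + (b : ℕ) = p * I.n + q → a = ⟨p, hp⟩ ∧ b = ⟨q, hq⟩ := by
    intro a b h
    have h1 : (a : ℕ) = p := by
      have e := congrArg (· / I.n) h
      simp only [mul_comm _ I.n] at e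
      rwa [Nat.mul_add_div (by omega), Nat.mul_add_div (by omega), Nat.div_eq_of_lt b.2,
        Nat.div_eq_of_lt hq, add_zero, add_zero] at e
    rw [h1] at h
    exact ⟨Fin.ext h1, Fin.ext (by simpa using h)⟩
  rw [Instance.matrix, Finset.sum_eq_single ⟨p, hp⟩, Finset.sum_eq_single ⟨q, hq⟩, if_pos rfl]
  · exact ite_congr_prop ⟨fun h => ⟨hp, hq, h⟩, fun ⟨_, _, h⟩ => h⟩ _ _
  · intro b _ hb
    rw [if_neg fun h => hb (inj _ _ h).2]
  · simp
  · intro a _ ha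
    refine Finset.sum_eq_zero fun b _ => ?_
    rw [if_neg fun h => ha (inj _ _ h).1]
  · simp

theorem Instance.exists_of_matrix_ne_zero (I : Instance) {i : ℕ} (h : I.matrix i ≠ 0) :
    ∃ p < I.n, ∃ q < I.n, p * I.n + q = i := by
  obtain ⟨p, -, hp⟩ := Finset.exists_ne_zero_of_sum_ne_zero h
  obtain ⟨q, -, hq⟩ := Finset.exists_ne_zero_of_sum_ne_zero hp
  refine ⟨p, p.2, q, q.2, ?_⟩
  by_contra hne
  exact hq (if_neg hne)

theorem Instance.matrix_le_one (I : Instance) (i : ℕ) : I.matrix i ≤ 1 := by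
  by_cases h : I.matrix i = 0
  · omega
  · obtain ⟨p, hp, q, hq, rfl⟩ := I.exists_of_matrix_ne_zero h
    rw [I.matrix_apply hp hq]
    split_ifs <;> omega

theorem Instance.lt_of_matrix_ne_zero (I : Instance) {i : ℕ} (h : I.matrix i ≠ 0) :
    i < I.n * I.n := by
  obtain ⟨p, hp, q, hq, rfl⟩ := I.exists_of_matrix_ne_zero h
  nlinarith

theorem input_nat (a i : ℕ) : (I.input k).nat (a, i) =
    if a = 0 then (if i = 0 then I.n else if i = 1 then k else 0)
    else if a = 1 then I.matrix i else 0 := by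
  classical
  simp only [Instance.input, Finsupp.add_apply, Finsupp.finsetSum_apply, Finsupp.single_apply,
    Prod.mk.injEq]
  by_cases h0 : a = 0
  · subst h0
    by_cases hi : i = 0
    · simp [hi]
    · by_cases hi1 : i = 1
      · simp [hi1]
      · simp [hi, hi1, Ne.symm hi, Ne.symm hi1]
  · by_cases h1 : a = 1
    · subst h1
      simp [Instance.matrix]
    · simp [h0, h1, Ne.symm h0, Ne.symm h1]

theorem input_real (a i : ℕ) : (I.input k).real (a, i) =
    if a = 0 then (if i = 0 then Finsupp.single 0 1 else if i = 1 then Finsupp.single 1 1 else 0)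
    else if a = 1 ∧ i < I.n then Finsupp.single (i + 2) 1 else 0 := by
  classical
  simp only [Instance.input, Finsupp.add_apply, Finsupp.finsetSum_apply, Finsupp.single_apply,
    Prod.mk.injEq]
  by_cases h0 : a = 0
  · subst h0
    by_cases hi : i = 0
    · simp [hi]
    · by_cases hi1 : i = 1
      · simp [hi1]
      · simp [hi, hi1, Ne.symm hi, Ne.symm hi1]
  · by_cases h1 : a = 1
    · subst h1
      simp only [if_neg one_ne_zero, true_and, zero_ne_one, false_and, if_false, zero_add]
      split_ifs with hi
      · rw [Finset.sum_eq_single ⟨i, hi⟩]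
        · simp
        · intro b _ hb
          rw [if_neg fun h => hb (Fin.ext h)]
        · simp
      · refine Finset.sum_eq_zero fun b _ => if_neg ?_
        rintro rfl
        exact hi b.2
    · simp [h0, h1, Ne.symm h0, Ne.symm h1]

theorem input_setNat (j : ℕ) : (I.input k).setNat 0 1 j = I.input j := by
  have h : ((I.input k).setNat 0 1 j).nat = (I.input j).nat := by
    ext1 ⟨a, i⟩
    rw [State.setNat_nat, input_nat, input_nat]
    grind
  have h' : ((I.input k).setNat 0 1 j).real = (I.input j).real := rfl
  cases hs : (I.input k).setNat 0 1 j
  cases ht : I.input j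
  simp_all

theorem Form.val_single (x : ℕ → ℝ) (j : ℕ) (c : ℤ) :
    Form.val x (Finsupp.single j c) = c * x j := by
  simp [Form.val]

/-- The bound for values and positions. It exceeds the sizes `4 * (n + 3) ^ 2` of the tables and
`n ^ 2` of the adjacency matrix of the input. -/
def bound (n : ℕ) : ℕ := 8 * (n + 3) ^ 2

theorem le_bound (n : ℕ) : n + 3 ≤ bound n ∧ n * n ≤ bound n := by
  unfold bound
  constructor <;> nlinarith

theorem bd_input (hk : k ≤ I.n) : Bd (bound I.n) 0 (I.input k) := by
  obtain ⟨hb, hb'⟩ := le_bound I.n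
  refine ⟨fun a i => ?_, fun a i => ?_, fun a i => ?_, fun a i j => ?_, fun a i j => ?_⟩
  · rw [input_nat]
    have := I.matrix_le_one i
    split_ifs <;> omega
  · rw [input_nat]
    have := I.lt_of_matrix_ne_zero (i := i)
    split_ifs with h1 h2 h3 h4
    · omega
    · omega
    · omega
    · intro h
      have := this h
      omega
    · omega
  · rw [input_real]
    split_ifs <;> first | omega | simp
  · rw [input_real]
    split_ifs with h1 h2 h3 h4 <;> simp only [Finsupp.single_apply, Finsupp.coe_zero, Pi.zero_apply]
      <;> first | (split_ifs <;> omega) | simp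
  · rw [input_real]
    split_ifs with h1 h2 h3 h4 <;> simp only [Finsupp.single_apply, Finsupp.coe_zero, Pi.zero_apply]
      <;> first | (split_ifs <;> simp) | simp

theorem env_input (I : Instance) (k : ℕ) : Env I k ((I.input k).setNat 4 0 (bound I.n)) := by
  classical
  constructor
  · rw [State.setNat_nat, if_neg (by omega), input_nat]
    rfl
  · rw [State.setNat_nat, if_neg (by omega), input_nat]
    rfl
  · rw [State.setNat_nat, if_pos ⟨rfl, rfl⟩]
    rfl
  · intro p hp q hq
    rw [State.setNat_nat, if_neg (by omega), input_nat, if_neg one_ne_zero, if_pos rfl,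
      I.matrix_apply hp hq]
  · rw [State.setNat_real, input_real, if_pos rfl, if_pos rfl, Form.val_single]
    simp [Instance.reals]
  · rw [State.setNat_real, input_real, if_pos rfl, if_neg one_ne_zero, if_pos rfl, Form.val_single]
    simp [Instance.reals]
  · intro p hp
    rw [State.setNat_real, input_real, if_neg one_ne_zero, if_pos ⟨rfl, hp⟩, Form.val_single]
    simp

theorem State.size_setNat_le (σ : State) (a i v : ℕ) :
    (σ.setNat a i v).size ≤ σ.size + (natBits a + natBits i + natBits v) := by
  classical
  have h : ((σ.nat.update (a, i) v).sum fun p v => natBits p.1 + natBits p.2 + natBits v) ≤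
      (σ.nat.sum fun p v => natBits p.1 + natBits p.2 + natBits v) +
        (natBits a + natBits i + natBits v) := by
    have hs : (σ.nat.update (a, i) v).support ⊆ insert (a, i) (σ.nat.support.erase (a, i)) := by
      intro p hp
      rw [Finset.mem_insert, Finset.mem_erase, Finsupp.mem_support_iff]
      rw [Finsupp.mem_support_iff, Finsupp.update_apply] at hp
      split_ifs at hp with h
      · exact .inl h
      · exact .inr ⟨h, hp⟩
    rw [Finsupp.sum, Finsupp.sum]
    refine (Finset.sum_le_sum_of_subset hs).trans ?_
    rw [Finset.sum_insert (by simp), add_comm]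
    refine add_le_add ?_ (by simp [Finsupp.update_apply])
    refine le_trans (Finset.sum_le_sum fun p hp => ?_)
      (Finset.sum_le_sum_of_subset (Finset.erase_subset (a, i) _))
    rw [Finsupp.update_apply, if_neg (Finset.ne_of_mem_erase hp)]
  unfold State.size
  change _ + _ ≤ _
  simp only [State.setNat]
  omega

theorem size_input_le (I : Instance) (k : ℕ) :
    (I.input k).size ≤ sizePoly.eval (bound I.n) + (Nat.size k + 4) := by
  rw [← input_setNat (k := 0)]
  refine (State.size_setNat_le _ _ _ _).trans ?_
  have h1 := (bd_input (I := I) (k := 0) (Nat.zero_le _)).size_le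
  have h2 : natBits 0 = 1 := by simp [natBits]
  have h3 : natBits 1 = 2 := by simp [natBits]
  have h4 : natBits k = Nat.size k + 1 := rfl
  rw [add_zero] at h1
  omega

/-- An assignment runs in polynomial time and space. -/
theorem nset_run (a : ℕ) (i e : NExp) : ∃ q : ℕ[X], ∀ x b X σ, Bd b X σ → a ≤ 60 → i.val σ ≤ b →
    e.val σ ≤ b → Bd b X (σ.setNat a (i.val σ) (e.val σ)) ∧
    ∃ t m, Run x (.nset a i e) σ (σ.setNat a (i.val σ) (e.val σ)) t m ∧ t ≤ q.eval (b + X) ∧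
      m ≤ q.eval (b + X) := by
  obtain ⟨q₁, h₁⟩ := i.bound
  obtain ⟨q₂, h₂⟩ := e.bound
  refine ⟨q₁ + q₂ + 1 + sizePoly, fun x b X σ h ha hi he => ?_⟩
  have hbd := h.setNat ha hi (show e.val σ ≤ b + 1 by omega)
  have g1 := (h₁ b X σ h).2.trans (eval_mono q₁ (Nat.le_add_right b X))
  have g2 := (h₂ b X σ h).2.trans (eval_mono q₂ (Nat.le_add_right b X))
  have s1 := h.size_le
  have s2 := hbd.size_le
  refine ⟨hbd, _, _, .nset _ _ _ _, ?_, max_le ?_ ?_⟩ <;> simp only [eval_add, eval_one] <;> omega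

/-- Stores the bound for values and positions. -/
def setBound : Prog := .nset 4 (.const 0) (.mul (.const 8) (.mul mE mE))

theorem setBound_run : ∃ q : ℕ[X], ∀ (I : Instance) (k : ℕ), k ≤ I.n →
    Bd (bound I.n) 0 ((I.input k).setNat 4 0 (bound I.n)) ∧
    ∃ t m, Run I.reals setBound (I.input k) ((I.input k).setNat 4 0 (bound I.n)) t m ∧
      t ≤ q.eval (bound I.n) ∧ m ≤ q.eval (bound I.n) := by
  obtain ⟨q, h⟩ := nset_run 4 (.const 0) (.mul (.const 8) (.mul mE mE))
  refine ⟨q, fun I k hk => ?_⟩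
  have hn : (I.input k).nat (0, 0) = I.n := by simp [input_nat]
  have hv : (NExp.mul (.const 8) (.mul mE mE)).val (I.input k) = bound I.n := by
    simp [hn, bound, pow_two]
  have := h I.reals (bound I.n) 0 (I.input k) (bd_input hk) (by omega) (by simp) hv.le
  rw [hv] at this
  exact this

/-- A polynomial in the bound is bounded by a power of the number of vertices. -/
theorem exists_eval_bound_le (q : ℕ[X]) : ∃ C d : ℕ, ∀ n, q.eval (bound n) ≤ C * (n + 1) ^ d := by
  refine ⟨q.eval 1 * 72 ^ q.natDegree, 2 * q.natDegree, fun n => ?_⟩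
  have h1 : 1 ≤ bound n := by have := le_bound n; omega
  have h2 : bound n ≤ 72 * (n + 1) ^ 2 := by
    calc 8 * (n + 3) ^ 2 ≤ 8 * (3 * (n + 1)) ^ 2 :=
          Nat.mul_le_mul_left _ (Nat.pow_le_pow_left (by omega) 2)
      _ = _ := by ring
  calc q.eval (bound n) ≤ q.eval 1 * bound n ^ q.natDegree := by
        rw [eval_eq_sum, eval_eq_sum, sum_def, sum_def, Finset.sum_mul]
        refine Finset.sum_le_sum fun i hi => ?_
        rw [one_pow, mul_one]
        exact Nat.mul_le_mul_left _ (Nat.pow_le_pow_right h1 (le_natDegree_of_mem_supp i hi))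
    _ ≤ q.eval 1 * (72 * (n + 1) ^ 2) ^ q.natDegree :=
        Nat.mul_le_mul_left _ (Nat.pow_le_pow_left h2 _)
    _ = _ := by rw [mul_pow, ← pow_mul, mul_assoc]

end Input

open Polynomial

/-! ### The two algorithms -/

section Algorithms

/-- The algorithm for `k`-WVC: it replaces `k` by `k - (k - n) = min k n`, which does not exceed the
bound for values, and searches. -/
def boundedProg : Prog :=
  .seq (.nset 0 (.const 1) (.sub kE (.sub kE nE))) (.seq setBound searchProg)

theorem boundedProg_run : ∃ (c : ℕ) (q : ℕ[X]), ∀ (I : Instance) (k : ℕ), ∃ σ t m,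
    Run I.reals boundedProg (I.input k) σ t m ∧ I.IsAnswerK k (σ.output I.n) ∧
    (t : ℝ) ≤ 1.381 ^ k * ((c * (I.n + Nat.size k + 1) + q.eval (bound I.n) : ℕ) : ℝ) ∧
    m ≤ c * (I.n + Nat.size k + 1) + q.eval (bound I.n) := by
  obtain ⟨q₁, h₁⟩ := setBound_run
  obtain ⟨g, q₂, h₂⟩ := searchProg_run
  refine ⟨30, q₁ + q₂ + sizePoly, fun I k => ?_⟩
  set j := k - (k - I.n) with hj
  have hjn : j ≤ I.n := by omega
  have hjk : j ≤ k := by omega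
  have hn : (I.input k).nat (0, 0) = I.n := by simp [input_nat]
  have hk : (I.input k).nat (0, 1) = k := by simp [input_nat]
  have r₀ := Run.nset (x := I.reals) (I.input k) 0 (.const 1) (.sub kE (.sub kE nE))
  have hv : (NExp.sub kE (.sub kE nE)).val (I.input k) = j := by simp [hn, hk, hj]
  have ht₀ : (NExp.const 1).cost (I.input k) + (NExp.sub kE (.sub kE nE)).cost (I.input k) + 1 ≤
      30 * (I.n + Nat.size k + 1) := by
    have e1 : natBits 1 = 2 := by simp [natBits]
    have e0 : natBits 0 = 1 := by simp [natBits]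
    have s1 : Nat.size (k - I.n) ≤ Nat.size k := Nat.size_le_size (by omega)
    have s2 : Nat.size (k - (k - I.n)) ≤ Nat.size k := Nat.size_le_size (by omega)
    have s3 := natBits_le I.n
    simp only [NExp.cost, kE, nE, vr, NExp.val, hn, hk, e1, e0]
    unfold natBits at s3 ⊢
    omega
  rw [hv, val_const, input_setNat] at r₀
  obtain ⟨c1, t₁, m₁, r₁, ht₁, hm₁⟩ := h₁ I j hjn
  obtain ⟨σ, t₂, m₂, r₂, -, -, hans, ht₂, hm₂⟩ := h₂ I j (bound I.n) 0 _ (env_input I j)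
    (by simp [State.setNat_nat]) c1 (by simp [State.setNat_nat, input_nat])
  rw [add_zero] at ht₂ hm₂
  have hsize := size_input_le I k
  have hsize' := (bd_input (I := I) hjn).size_le
  rw [add_zero] at hsize'
  simp only [eval_add]
  refine ⟨σ, _, _, .seq r₀ (.seq r₁ r₂), ?_, ?_, ?_⟩
  · cases ho : σ.output I.n with
    | none =>
      rw [ho] at hans
      rintro ⟨U, hU, hUk⟩
      have := U.card_le_univ
      rw [Fintype.card_fin] at this
      exact hans ⟨U, hU, by omega⟩
    | some U =>
      rw [ho] at hans
      exact hans
  · have hp : (1 : ℝ) ≤ 1.381 ^ k := one_le_pow₀ (by norm_num)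
    have hjp : (1.381 : ℝ) ^ j ≤ 1.381 ^ k := pow_le_pow_right₀ (by norm_num) hjk
    have a1 : (((NExp.const 1).cost (I.input k) +
        (NExp.sub kE (.sub kE nE)).cost (I.input k) + 1 + t₁ : ℕ) : ℝ) ≤
        ((30 * (I.n + Nat.size k + 1) + (q₁.eval (bound I.n) + sizePoly.eval (bound I.n)) : ℕ) : ℝ) := by
      exact_mod_cast (by omega)
    have a2 := ht₂.trans (mul_le_mul_of_nonneg_right hjp (Nat.cast_nonneg _))
    have a3 := le_mul_of_one_le_left (Nat.cast_nonneg (α := ℝ)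
      (30 * (I.n + Nat.size k + 1) + (q₁.eval (bound I.n) + sizePoly.eval (bound I.n)))) hp
    push_cast at a1 a2 a3 ⊢
    linarith
  · refine max_le (max_le ?_ ?_) (max_le ?_ ?_) <;> omega

/-- Tests whether no solution has been found yet, `k` is at most the number of vertices, and cell
`0` of the array `5` of real numbers, which holds `k` as well, is at most `W`. -/
def guard : Test :=
  .and (eqT (vr 2) (.const 0))
    (.and (.nle kE nE) (.rle (.cell 5 (.const 0)) (.cell 0 (.const 1))))

/-- Increases `k` in both places where it is stored. -/
def increase : Prog :=
  .seq (.nset 0 (.const 1) (.add kE (.const 1)))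
    (.rset 5 (.const 0) (.add (.cell 5 (.const 0)) (.cell 0 (.const 0))))

/-- Iterative deepening: searches for solutions of sizes at most `k`, `k + 1`, …. -/
def deepening : Prog := .while guard (.seq searchProg increase)

/-- The algorithm for WVC. -/
def wvcProg : Prog := .seq setBound deepening

/-- The guard of the iteration keeps `k` at most `s`, even if there is no solution. -/
theorem Instance.le_s (I : Instance) {k : ℕ} (hn : k ≤ I.n) (hW : (k : ℝ) ≤ I.W)
    (h : ∀ U, I.IsSolution U → k ≤ U.card) : (k : ℝ) ≤ I.s := by
  unfold Instance.s
  split_ifs with hU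
  · obtain ⟨U, hU⟩ := hU
    refine Nat.cast_le.2 (le_csInf ⟨_, U, hU, rfl⟩ ?_)
    rintro m ⟨U, hU, rfl⟩
    exact h U hU
  · exact le_min hW (Nat.cast_le.2 hn)

theorem Instance.s_nonneg (I : Instance) : 0 ≤ I.s := by
  simpa using I.le_s (k := 0) (Nat.zero_le _) (by simpa using zero_le_one.trans I.one_le_W)
    (fun _ _ => Nat.zero_le _)

/-- As weights are at least `1`, the iteration may end when `k` exceeds `W`. -/
theorem Instance.IsSolution.card_le {I : Instance} {U : Finset (Fin I.n)} (h : I.IsSolution U) :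
    (U.card : ℝ) ≤ I.W := by
  refine le_trans ?_ h.2
  rw [← nsmul_one]
  exact Finset.card_nsmul_le_sum _ _ _ fun v _ => I.one_le_w v

theorem increase_run : ∃ q : ℕ[X], ∀ (I : Instance) (k b X : ℕ) (σ : State), Env I k σ →
    σ.nat (4, 0) = b → Bd b X σ → k ≤ I.n → σ.real (5, 0) = Finsupp.single 0 (k : ℤ) →
    σ.real (0, 0) = Finsupp.single 0 1 → k + 1 ≤ X →
    ∃ σ' t m, Run I.reals increase σ σ' t m ∧ Env I (k + 1) σ' ∧ Bd b X σ' ∧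
      σ'.real (5, 0) = Finsupp.single 0 ((k + 1 : ℕ) : ℤ) ∧ σ'.real (0, 0) = Finsupp.single 0 1 ∧
      σ'.nat (4, 0) = b ∧ σ'.nat (2, 0) = σ.nat (2, 0) ∧ σ'.output I.n = σ.output I.n ∧
      t ≤ q.eval (b + X) ∧ m ≤ q.eval (b + X) := by
  obtain ⟨q₁, h₁⟩ := nset_run 0 (.const 1) (.add kE (.const 1))
  obtain ⟨q₂, h₂⟩ := (NExp.const 0).bound
  obtain ⟨g, q₃, h₃⟩ := (RExp.add (.cell 5 (.const 0)) (.cell 0 (.const 0))).bound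
  refine ⟨q₁ + q₂ + q₃ + 1 + sizePoly, fun I k b X σ he hb hσ hk h5 h0 hX => ?_⟩
  have hlt := he.lt_bnd
  have hv : (NExp.add kE (.const 1)).val σ = k + 1 := by simp [he.k]
  obtain ⟨c1, t₁, m₁, r₁, ht₁, hm₁⟩ := h₁ I.reals b X σ hσ (by omega) (by simp; omega)
    (by rw [hv]; omega)
  rw [hv, val_const] at c1 r₁
  set σ₁ := σ.setNat 0 1 (k + 1) with hσ₁
  have hr : (RExp.add (.cell 5 (.const 0)) (.cell 0 (.const 0))).val σ₁ =
      Finsupp.single 0 ((k + 1 : ℕ) : ℤ) := by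
    change σ.real (5, 0) + σ.real (0, 0) = _
    rw [h5, h0, ← Finsupp.single_add]
    push_cast
    rfl
  have r₂ := Run.rset (x := I.reals) σ₁ 5 (.const 0)
    (.add (.cell 5 (.const 0)) (.cell 0 (.const 0)))
  have g2 := (h₂ b X σ₁ c1).2.trans (eval_mono q₂ (Nat.le_add_right b X))
  have g3 := (h₃ b X σ₁ c1).2.2
  rw [hr, val_const] at r₂
  have hpow : k + 1 ≤ 2 ^ X := hX.trans Nat.lt_two_pow_self.le
  have c2 : Bd b X (σ₁.setReal 5 0 (Finsupp.single 0 ((k + 1 : ℕ) : ℤ))) := by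
    refine c1.setReal (by omega) (by omega) (fun j hj => ?_) fun j => ?_
    · rw [Finsupp.single_apply] at hj
      split_ifs at hj <;> omega
    · rw [Finsupp.single_apply]
      split_ifs
      · rw [Int.natAbs_natCast]
        exact hpow
      · simp
  have s1 := c1.size_le
  have s2 := c2.size_le
  have f : ∀ a, a ≠ 0 → ∀ i, (σ₁.setReal 5 0 (Finsupp.single 0 ((k + 1 : ℕ) : ℤ))).nat (a, i) =
      σ.nat (a, i) := by
    intro a ha i
    rw [State.setReal_nat, hσ₁, State.setNat_nat, if_neg (by omega)]
  have f' : ∀ a, a ≠ 5 → ∀ i, (σ₁.setReal 5 0 (Finsupp.single 0 ((k + 1 : ℕ) : ℤ))).real (a, i) =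
      σ.real (a, i) := by
    intro a ha i
    rw [State.setReal_real, if_neg (by omega), hσ₁, State.setNat_real]
  refine ⟨_, _, _, .seq r₁ r₂, ?_, c2, ?_, ?_, ?_, ?_, ?_, ?_, ?_⟩
  · constructor
    · rw [State.setReal_nat, hσ₁, State.setNat_nat, if_neg (by omega), he.n]
    · rw [State.setReal_nat, hσ₁, State.setNat_nat, if_pos ⟨rfl, rfl⟩]
    · rw [f 4 (by omega), he.b]
    · intro p hp q hq
      rw [f 1 (by omega), he.edge p hp q hq]
    · rw [f' 0 (by omega), he.one]
    · rw [f' 0 (by omega), he.bound]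
    · intro p hp
      rw [f' 1 (by omega), he.weight p hp]
  · rw [State.setReal_real, if_pos ⟨rfl, rfl⟩]
  · rw [f' 0 (by omega), h0]
  · rw [f 4 (by omega), hb]
  · rw [f 2 (by omega)]
  · simp only [State.output, f 2 (by omega), f 3 (by omega)]
  · simp only [eval_add, eval_one]
    omega
  · simp only [eval_add, eval_one]
    refine max_le ?_ (max_le ?_ ?_) <;> omega

/-- The iteration from `k` onwards, if there is no solution of size less than `k`. Each round runs
with `k ≤ s`, and there are at most `n + 1` of them. -/
theorem deepening_run : ∃ g q : ℕ[X], ∀ (I : Instance) (b Z : ℕ), Z = (I.n + 1) * (g.eval b + 1) →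
    ∀ (d k : ℕ) (σ : State), k + d = I.n + 1 → Env I k σ → σ.nat (4, 0) = b →
    Bd b (k * (g.eval b + 1)) σ → σ.real (5, 0) = Finsupp.single 0 (k : ℤ) →
    σ.real (0, 0) = Finsupp.single 0 1 → σ.nat (2, 0) = 0 →
    (∀ U, I.IsSolution U → k ≤ U.card) →
    ∃ σ' t m, Run I.reals deepening σ σ' t m ∧ I.IsAnswer (σ'.output I.n) ∧
      (t : ℝ) ≤ (d + 1) * (1.381 ^ I.s * q.eval (b + Z)) ∧ m ≤ q.eval (b + Z) := by
  obtain ⟨g, q₁, h₁⟩ := searchProg_run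
  obtain ⟨q₂, h₂⟩ := increase_run
  obtain ⟨q₃, h₃⟩ := guard.bound
  refine ⟨g, q₁ + q₂ + q₃ + sizePoly, fun I b Z hZ d => ?_⟩
  set N := (q₁ + q₂ + q₃ + sizePoly).eval (b + Z) with hN
  have hNe : N = q₁.eval (b + Z) + q₂.eval (b + Z) + q₃.eval (b + Z) + sizePoly.eval (b + Z) := by
    simp only [hN, eval_add]
  have hXZ : ∀ k, k ≤ I.n + 1 → k * (g.eval b + 1) ≤ Z := fun k hk => by
    rw [hZ]
    exact Nat.mul_le_mul_right _ hk
  have hp : (1 : ℝ) ≤ 1.381 ^ I.s := Real.one_le_rpow (by norm_num) I.s_nonneg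
  have hN1 : (N : ℝ) ≤ 1.381 ^ I.s * N := le_mul_of_one_le_left (Nat.cast_nonneg _) hp
  have hguard : ∀ (k : ℕ) (σ : State), Env I k σ → σ.real (5, 0) = Finsupp.single 0 (k : ℤ) →
      (guard.Holds I.reals σ ↔ σ.nat (2, 0) = 0 ∧ k ≤ I.n ∧ (k : ℝ) ≤ I.W) := by
    intro k σ he h5
    have e1 : Form.val I.reals (σ.real (5, 0)) = k := by
      rw [h5, Form.val_single]
      simp [Instance.reals]
    have e2 := he.bound
    rw [guard, holds_and, holds_and, holds_eqT, holds_nle, val_vr, val_const, val_kE, val_nE, he.k,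
      he.n]
    change _ ∧ _ ∧ Form.val I.reals (σ.real (5, 0)) ≤ Form.val I.reals (σ.real (0, 1)) ↔ _
    rw [e1, e2]
  have hhalt : ∀ σ, Bd b Z σ → ¬ guard.Holds I.reals σ →
      ∃ t m, Run I.reals deepening σ σ t m ∧ t ≤ N ∧ m ≤ N := by
    intro σ hσ h
    refine ⟨_, _, .while_false h, ?_, ?_⟩
    · have := h₃ _ _ _ hσ
      omega
    · have := hσ.size_le
      omega
  have hfin : ∀ (d' : ℕ) (t : ℕ), t ≤ N → (t : ℝ) ≤ (d' + 1) * (1.381 ^ I.s * N) := by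
    intro d' t ht
    have h1 : (t : ℝ) ≤ N := Nat.cast_le.2 ht
    have h2 : (0 : ℝ) ≤ d' := Nat.cast_nonneg _
    have h3 : (0 : ℝ) ≤ 1.381 ^ I.s * N := by positivity
    nlinarith
  -- without a solution of size less than `k`, the search ends unsuccessfully only if it has to
  have hnone : ∀ (k : ℕ) (σ : State), Env I k σ → σ.real (5, 0) = Finsupp.single 0 (k : ℤ) →
      σ.nat (2, 0) = 0 → (∀ U, I.IsSolution U → k ≤ U.card) → ¬ guard.Holds I.reals σ →
      I.IsAnswer (σ.output I.n) := by
    intro k σ he h5 h2 hU hg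
    rw [output_of_eq_zero h2]
    rintro ⟨U, hsol⟩
    rw [hguard k σ he h5] at hg
    have h1 := hU U hsol
    have h3 := U.card_le_univ
    rw [Fintype.card_fin] at h3
    exact hg ⟨h2, h1.trans h3, (Nat.cast_le.2 h1).trans hsol.card_le⟩
  induction d with
  | zero =>
    intro k σ hd he hb hσ h5 h0 h2 hU
    -- now `k = n + 1`
    have hg : ¬ guard.Holds I.reals σ := by
      rw [hguard k σ he h5]
      omega
    obtain ⟨t, m, r, ht, hm⟩ := hhalt σ (hσ.mono (hXZ k (by omega))) hg
    exact ⟨σ, t, m, r, hnone k σ he h5 h2 hU hg, hfin _ _ ht, hm⟩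
  | succ d ih =>
    intro k σ hd he hb hσ h5 h0 h2 hU
    have hX := hXZ k (by omega)
    have hX' := hXZ (k + 1) (by omega)
    have hσZ := hσ.mono hX
    by_cases hg : guard.Holds I.reals σ
    · obtain ⟨-, hkn, hkW⟩ := (hguard k σ he h5).1 hg
      have hks := I.le_s hkn hkW hU
      obtain ⟨σ₁, t₁, m₁, r₁, hk₁, c₁, hans, ht₁, hm₁⟩ := h₁ I k b _ σ he hb hσ h2
      have hkk : k * (g.eval b + 1) + g.eval b ≤ (k + 1) * (g.eval b + 1) := by
        rw [add_mul, one_mul]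
        omega
      obtain ⟨σ₂, t₂, m₂, r₂, he₂, c₂, g5, g0, g4, g2, go, ht₂, hm₂⟩ := h₂ I k b
        ((k + 1) * (g.eval b + 1)) σ₁ (hk₁.env he) (by rw [hk₁.nat 4 (by omega), hb])
        (c₁.mono hkk) hkn (by rw [hk₁.real 5 (by omega), h5]) (by rw [hk₁.real 0 (by omega), h0])
        (Nat.le_mul_of_pos_right _ (by omega))
      rw [← go] at hans
      have ht₃ := h₃ _ _ _ hσZ
      have e1 := eval_mono q₁ (show b + k * (g.eval b + 1) ≤ b + Z by omega)
      have e2 := eval_mono q₂ (show b + (k + 1) * (g.eval b + 1) ≤ b + Z by omega)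
      have hrun : ∀ σ' t m, Run I.reals deepening σ₂ σ' t m →
          Run I.reals deepening σ σ' (guard.cost σ + (t₁ + t₂) + t) (max (max m₁ m₂) m) :=
        fun σ' t m hr => .while_true hg (.seq r₁ r₂) hr
      have hmax : ∀ m, m ≤ N → max (max m₁ m₂) m ≤ N := fun m hm => by
        refine max_le (max_le ?_ ?_) hm <;> omega
      -- as `k ≤ s`, this round is cheap enough
      have hround : ((guard.cost σ + (t₁ + t₂) : ℕ) : ℝ) ≤ 1.381 ^ I.s * N := by
        have a1 : (1.381 : ℝ) ^ k ≤ 1.381 ^ I.s := by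
          rw [← Real.rpow_natCast]
          exact Real.rpow_le_rpow_of_exponent_le (by norm_num) hks
        have a2 : (t₁ : ℝ) ≤ 1.381 ^ I.s * q₁.eval (b + Z) :=
          ht₁.trans (mul_le_mul a1 (Nat.cast_le.2 e1) (Nat.cast_nonneg _) (by positivity))
        have a3 : ((guard.cost σ + t₂ : ℕ) : ℝ) ≤
            ((q₂.eval (b + Z) + q₃.eval (b + Z) + sizePoly.eval (b + Z) : ℕ) : ℝ) :=
          Nat.cast_le.2 (by omega)
        have a4 := a3.trans (le_mul_of_one_le_left (Nat.cast_nonneg _) hp)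
        rw [hNe]
        push_cast at a4 ⊢
        linarith
      by_cases hflag : σ₂.nat (2, 0) = 0
      · rw [output_of_eq_zero hflag] at hans
        obtain ⟨σ', t, m, hr, hans', ht, hm⟩ := ih (k + 1) σ₂ (by omega) he₂ g4 c₂ g5 g0 hflag
          (fun U hsol => by
            by_contra hlt
            exact hans ⟨U, hsol, by omega⟩)
        refine ⟨σ', _, _, hrun _ _ _ hr, hans', ?_, hmax m hm⟩
        push_cast at hround ⊢
        linarith
      · obtain ⟨t, m, hr, ht, hm⟩ := hhalt σ₂ (c₂.mono hX') (by
          rw [hguard (k + 1) σ₂ he₂ g5]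
          exact fun h => hflag h.1)
        refine ⟨σ₂, _, _, hrun _ _ _ hr, ?_, ?_, hmax m hm⟩
        · rw [output_of_ne_zero hflag] at hans ⊢
          exact hans
        · have := hfin d t ht
          push_cast at hround ⊢
          linarith
    · obtain ⟨t, m, r, ht, hm⟩ := hhalt σ hσZ hg
      exact ⟨σ, t, m, r, hnone k σ he h5 h2 hU hg, hfin _ _ ht, hm⟩

theorem wvcProg_run : ∃ q : ℕ[X], ∀ I : Instance, ∃ σ t m,
    Run I.reals wvcProg (I.input 0) σ t m ∧ I.IsAnswer (σ.output I.n) ∧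
    (t : ℝ) ≤ 1.381 ^ I.s * q.eval (bound I.n) ∧ m ≤ q.eval (bound I.n) := by
  obtain ⟨q₁, h₁⟩ := setBound_run
  obtain ⟨g, q₂, h₂⟩ := deepening_run
  refine ⟨q₁ + (X + 1) * q₂.comp (X + (X + 1) * (g + 1)), fun I => ?_⟩
  obtain ⟨c1, t₁, m₁, r₁, ht₁, hm₁⟩ := h₁ I 0 (Nat.zero_le _)
  obtain ⟨σ, t₂, m₂, r₂, hans, ht₂, hm₂⟩ := h₂ I (bound I.n) _ rfl (I.n + 1) 0 _ (by omega)
    (env_input I 0) (by simp [State.setNat_nat]) (by simpa using c1)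
    (by simp [input_real]) (by simp [input_real]) (by simp [State.setNat_nat, input_nat])
    (fun _ _ => Nat.zero_le _)
  have hp : (1 : ℝ) ≤ 1.381 ^ I.s := Real.one_le_rpow (by norm_num) I.s_nonneg
  have hle := le_bound I.n
  set Q := (q₂.comp (X + (X + 1) * (g + 1))).eval (bound I.n) with hQ
  have hq : q₂.eval (bound I.n + (I.n + 1) * (g.eval (bound I.n) + 1)) ≤ Q := by
    rw [hQ, eval_comp]
    refine eval_mono q₂ ?_
    simp only [eval_add, eval_mul, eval_X, eval_one]
    exact Nat.add_le_add_left (Nat.mul_le_mul_right _ (by omega)) _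
  have e : (q₁ + (X + 1) * q₂.comp (X + (X + 1) * (g + 1))).eval (bound I.n) =
      q₁.eval (bound I.n) + (bound I.n + 1) * Q := by
    simp only [eval_add, eval_mul, eval_X, eval_one, hQ]
  refine ⟨σ, _, _, .seq r₁ r₂, hans, ?_, ?_⟩
  · rw [e]
    have a1 : (t₁ : ℝ) ≤ 1.381 ^ I.s * q₁.eval (bound I.n) :=
      (Nat.cast_le.2 ht₁).trans (le_mul_of_one_le_left (Nat.cast_nonneg _) hp)
    have a2 : (t₂ : ℝ) ≤ ((bound I.n + 1 : ℕ) : ℝ) * (1.381 ^ I.s * Q) := by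
      refine ht₂.trans (mul_le_mul ?_ ?_ (by positivity) (by positivity))
      · exact_mod_cast (by omega : I.n + 1 + 1 ≤ bound I.n + 1)
      · exact mul_le_mul_of_nonneg_left (Nat.cast_le.2 hq) (by positivity)
    push_cast at a2 ⊢
    linarith
  · rw [e]
    have := Nat.le_mul_of_pos_left Q (show 0 < bound I.n + 1 by omega)
    exact max_le (by omega) (by omega)

end Algorithms

end WVC

end

theorem mainTheorem1 :
    -- `k`-WVC in time `O*(1.381 ^ k)` and polynomial space
    (∃ (p : WVC.Prog) (C d : ℕ), ∀ (I : WVC.Instance) (k : ℕ),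
      ∃ (σ : WVC.State) (t m : ℕ),
        WVC.Run I.reals p (I.input k) σ t m ∧
        I.IsAnswerK k (σ.output I.n) ∧
        (t : ℝ) ≤ (C : ℝ) * ((I.n + Nat.size k + 1 : ℕ) : ℝ) ^ d * (1.381 : ℝ) ^ k ∧
        m ≤ C * (I.n + Nat.size k + 1) ^ d) ∧
    -- WVC in time `O*(1.381 ^ s)` and polynomial space
    (∃ (p : WVC.Prog) (C d : ℕ), ∀ I : WVC.Instance,
      ∃ (σ : WVC.State) (t m : ℕ),
        WVC.Run I.reals p (I.input 0) σ t m ∧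
        I.IsAnswer (σ.output I.n) ∧
        (t : ℝ) ≤ (C : ℝ) * ((I.n + 1 : ℕ) : ℝ) ^ d * (1.381 : ℝ) ^ I.s ∧
        m ≤ C * (I.n + 1) ^ d) := by
  refine ⟨?_, ?_⟩
  · obtain ⟨c, q, h⟩ := WVC.boundedProg_run
    obtain ⟨C, d, hC⟩ := WVC.exists_eval_bound_le q
    refine ⟨WVC.boundedProg, c + C, d + 1, fun I k => ?_⟩
    obtain ⟨σ, t, m, hr, hans, ht, hm⟩ := h I k
    have hle : c * (I.n + Nat.size k + 1) + q.eval (WVC.bound I.n) ≤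
        (c + C) * (I.n + Nat.size k + 1) ^ (d + 1) := by
      have h1 : (I.n + 1) ^ d ≤ (I.n + Nat.size k + 1) ^ (d + 1) :=
        (Nat.pow_le_pow_left (by omega) d).trans (Nat.pow_le_pow_right (by omega) (by omega))
      have h2 : I.n + Nat.size k + 1 ≤ (I.n + Nat.size k + 1) ^ (d + 1) :=
        Nat.le_self_pow (by omega) _
      rw [add_mul]
      exact add_le_add (Nat.mul_le_mul_left _ h2) ((hC I.n).trans (Nat.mul_le_mul_left _ h1))
    refine ⟨σ, t, m, hr, hans, ht.trans ?_, hm.trans hle⟩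
    rw [mul_comm]
    exact mul_le_mul_of_nonneg_right (by exact_mod_cast hle) (by positivity)
  · obtain ⟨q, h⟩ := WVC.wvcProg_run
    obtain ⟨C, d, hC⟩ := WVC.exists_eval_bound_le q
    refine ⟨WVC.wvcProg, C, d, fun I => ?_⟩
    obtain ⟨σ, t, m, hr, hans, ht, hm⟩ := h I
    refine ⟨σ, t, m, hr, hans, ht.trans ?_, hm.trans (hC I.n)⟩
    rw [mul_comm]
    exact mul_le_mul_of_nonneg_right (by exact_mod_cast hC I.n) (by positivity)
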